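/- **Setting.** Strings are indexed from $1$. A period of a string $X$ is an integer $p\in[1,|X|]$ with $X[i]=X[i+p]$ for all $1\le i\le |X|-p$; $\mathrm{per}(X)$ is the smallest period, and $X$ is strongly periodic if $\mathrm{per}(X)\le |X|/4$. For an integer $\ell$, a string $S$ is of type 3 if every length-$\ell$ substring of $S$ is strongly periodic (for $|S|\ge\ell\ge1$ this is equivalent to $\mathrm{per}(S)\le \ell/4$). Active Prefixes (AP) problem. Input: a string $P$ of length $m\ge 1$, a bit vector $U$ of size $m$, and a finite set $\mathcal S$ of strings of total length $N$. Output: the bit vector $V$ of size $m$ with $V[j]=1$ if and only if there are $S\in\mathcal S$ and $i\in[1,m]$ with $U[i]=1$, $P[1..i]\cdot S=P[1..i+|S|]$ and $j=i+|S|$. Running times are worst-case numbers of unit-cost instructions of deterministic, uniform programs on a word RAM (arithmetic, division, bitwise operations, shifts and comparisons on $w$-bit words, and indirect addressing). Letters are arbitrary machine words. Words have at least $c\log_2(\text{size})$ bits, $c$ a constant of the program, where size is $m+N+2$ for AP, and $r+M+2$ for the multiplication of $r\times r$ integer matrices with entries of absolute value at most $M$. All memory outside the input has arbitrary initial contents.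 **Theorem.** Let $\omega$ be a real number such that two $r\times r$ matrices over $\mathbb Z$ can be multiplied in $O(r^{\omega})$ time. Then there are a program and constants $C,c$ such that, for every integer $\ell\le m$, the program solves every instance $(P,U,\mathcal S)$ of the AP problem in which each $S\in\mathcal S$ is of type 3 with respect to $\ell$ and has length $|S|\in[\tfrac98\ell,\tfrac54\ell)$, in time at most $$C\,\bigl(m^{\omega-1}+N\bigr)\,\bigl(1+\log(m+N)\bigr)^{c},$$ that is, in $\tilde O(m^{\omega-1}+N)$ time. -/

import Mathlib

/-! ## Strings, periods and the Active Prefixes problem -/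

/-- `p` is a period of `X`: `1 ≤ p ≤ |X|`, and letters at distance `p` are equal. -/
def IsPeriod {α : Type*} (X : List α) (p : ℕ) : Prop :=
  1 ≤ p ∧ p ≤ X.length ∧ ∀ i : ℕ, i + p < X.length → X[i]? = X[i + p]?

/-- The smallest period of `X` (every non-empty `X` has the period `|X|`). -/
noncomputable def per {α : Type*} (X : List α) : ℕ := sInf {p | IsPeriod X p}

/-- `per X ≤ |X| / 4`. -/
def StronglyPeriodic {α : Type*} (X : List α) : Prop := 4 * per X ≤ X.length

/-- Type 3 with respect to `ℓ`: every substring of length `ℓ` is strongly periodic. -/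
def IsType3 {α : Type*} (ℓ : ℕ) (X : List α) : Prop :=
  ∀ Y : List α, Y <:+: X → Y.length = ℓ → StronglyPeriodic Y

/-- The solution `V` of the Active Prefixes instance `(P, U, S)`. With `m = |P|`, the bit of a
bit vector that belongs to the prefix `P[1..i]`, `1 ≤ i ≤ m`, has the index `i - 1 : Fin m`. -/
def activePrefixes {α : Type*} [DecidableEq α] (P : List α) (U : Fin P.length → Bool)
    (S : List (List α)) (j : Fin P.length) : Bool :=
  decide (∃ X ∈ S, ∃ i : Fin P.length, U i = true ∧
    P.take (i + 1) ++ X = P.take (i + 1 + X.length) ∧ (j : ℕ) + 1 = i + 1 + X.length)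

/-! ## The word RAM

A machine with words of `w` bits. It has variables (registers), each holding one word, and arrays,
each with one cell per word-sized address; a program names finitely many of both. Every
instruction and every test of a condition takes one unit of time. -/

/-- The binary operations on words; arithmetic is modulo `2 ^ w`. -/
inductive WordOp where
  | plus | minus | times | quot | rem | band | bor | bxor | shl | shr | eq | lt

/-- The value of a binary operation (comparisons return `1` or `0` and are unsigned, and so are
quotient and remainder). -/
def WordOp.eval {w : ℕ} : WordOp → BitVec w → BitVec w → BitVec w
  | .plus, a, b => a + b
  | .minus, a, b => a - b
  | .times, a, b => a * b
  | .quot, a, b => a / b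
  | .rem, a, b => a % b
  | .band, a, b => a &&& b
  | .bor, a, b => a ||| b
  | .bxor, a, b => a ^^^ b
  | .shl, a, b => a <<< b
  | .shr, a, b => a >>> b
  | .eq, a, b => if a = b then 1#w else 0#w
  | .lt, a, b => if a.toNat < b.toNat then 1#w else 0#w

/-- Programs. Variables and arrays are named by natural numbers. A program is a finite text that
does not depend on the word length. -/
inductive Prog where
  /-- do nothing -/
  | skip
  /-- `x := n` -/
  | const (x : ℕ) (n : ℕ)
  /-- `x := y o z` -/
  | op (o : WordOp) (x y z : ℕ)
  /-- `x := a[y]` -/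
  | load (x a y : ℕ)
  /-- `a[x] := y` -/
  | store (a x y : ℕ)
  /-- `p; q` -/
  | seq (p q : Prog)
  /-- if `x ≠ 0` then `p` else `q` -/
  | ite (x : ℕ) (p q : Prog)
  /-- while `x ≠ 0` do `p` -/
  | loop (x : ℕ) (p : Prog)

/-- The contents of the variables and of the arrays. -/
structure RAMState (w : ℕ) where
  var : ℕ → BitVec w
  arr : ℕ → BitVec w → BitVec w

/-- Assign `v` to the variable `x`. -/
def RAMState.setVar {w : ℕ} (s : RAMState w) (x : ℕ) (v : BitVec w) : RAMState w :=
  { s with var := Function.update s.var x v }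

/-- Write `v` to the cell with address `k` of the array `a`. -/
def RAMState.setArr {w : ℕ} (s : RAMState w) (a : ℕ) (k v : BitVec w) : RAMState w :=
  { s with arr := Function.update s.arr a (Function.update (s.arr a) k v) }

/-- `Exec p s t s'`: started in the state `s`, the program `p` halts after exactly `t` units of
time in the state `s'`. -/
inductive Exec {w : ℕ} : Prog → RAMState w → ℕ → RAMState w → Prop where
  | skip (s : RAMState w) : Exec .skip s 1 s
  | const (s : RAMState w) (x n : ℕ) :
      Exec (.const x n) s 1 (s.setVar x (BitVec.ofNat w n))
  | op (s : RAMState w) (o : WordOp) (x y z : ℕ) :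
      Exec (.op o x y z) s 1 (s.setVar x (o.eval (s.var y) (s.var z)))
  | load (s : RAMState w) (x a y : ℕ) :
      Exec (.load x a y) s 1 (s.setVar x (s.arr a (s.var y)))
  | store (s : RAMState w) (a x y : ℕ) :
      Exec (.store a x y) s 1 (s.setArr a (s.var x) (s.var y))
  | seq {p q : Prog} {s s₁ s₂ : RAMState w} {t₁ t₂ : ℕ} :
      Exec p s t₁ s₁ → Exec q s₁ t₂ s₂ → Exec (.seq p q) s (t₁ + t₂) s₂
  | iteTrue {x : ℕ} {p q : Prog} {s s₁ : RAMState w} {t : ℕ} :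
      s.var x ≠ 0#w → Exec p s t s₁ → Exec (.ite x p q) s (t + 1) s₁
  | iteFalse {x : ℕ} {p q : Prog} {s s₁ : RAMState w} {t : ℕ} :
      s.var x = 0#w → Exec q s t s₁ → Exec (.ite x p q) s (t + 1) s₁
  | loopDone {x : ℕ} {p : Prog} {s : RAMState w} :
      s.var x = 0#w → Exec (.loop x p) s 1 s
  | loopStep {x : ℕ} {p : Prog} {s s₁ s₂ : RAMState w} {t₁ t₂ : ℕ} :
      s.var x ≠ 0#w → Exec p s t₁ s₁ → Exec (.loop x p) s₁ t₂ s₂ →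
      Exec (.loop x p) s (t₁ + t₂ + 1) s₂

/-- Started in `s`, the program halts within `T` units of time, in a state satisfying `post`. -/
def Prog.RunsWithin {w : ℕ} (p : Prog) (s : RAMState w) (T : ℝ) (post : RAMState w → Prop) :
    Prop :=
  ∃ (t : ℕ) (s' : RAMState w), Exec p s t s' ∧ (t : ℝ) ≤ T ∧ post s'

/-- The array `a` holds the list `l` in its cells `0, 1, …, |l| - 1`. -/
def RAMState.HoldsList {w : ℕ} (s : RAMState w) (a : ℕ) (l : List (BitVec w)) : Prop :=
  ∀ (i : ℕ) (hi : i < l.length), s.arr a (BitVec.ofNat w i) = l[i]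

/-- The array `a` holds the bit vector `U` in its cells `0, 1, …, m - 1`. -/
def RAMState.HoldsBits {w m : ℕ} (s : RAMState w) (a : ℕ) (U : Fin m → Bool) : Prop :=
  ∀ i : Fin m, s.arr a (BitVec.ofNat w i) = if U i then 1#w else 0#w

/-- The array `a` holds the integer matrix `A`, row by row, in two's complement. -/
def RAMState.HoldsMatrix {w r : ℕ} (s : RAMState w) (a : ℕ) (A : Matrix (Fin r) (Fin r) ℤ) :
    Prop :=
  ∀ i j : Fin r, s.arr a (BitVec.ofNat w (i * r + j)) = BitVec.ofInt w (A i j)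

/-! ## The two computational problems

In both, whatever is not part of the input (all other variables and cells) has arbitrary initial
contents. -/

/-- Two `r × r` matrices over `ℤ` can be multiplied in `O(r ^ ω)` time, on a word RAM whose words
have at least `c * log₂ (r + M + 2)` bits when the entries are at most `M` in absolute value.
Input: `r` in variable `0`, the factors in arrays `0` and `1`; output: the product in array `2`. -/
def MatrixMultiplicationInTime (ω : ℝ) : Prop :=
  ∃ (p : Prog) (C : ℝ) (c : ℕ), ∀ (r M w : ℕ) (A B : Matrix (Fin r) (Fin r) ℤ),
    1 ≤ r → (∀ i j, |A i j| ≤ (M : ℤ)) → (∀ i j, |B i j| ≤ (M : ℤ)) →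
    (r + M + 2) ^ c ≤ 2 ^ w →
    ∀ s : RAMState w, s.var 0 = BitVec.ofNat w r → s.HoldsMatrix 0 A → s.HoldsMatrix 1 B →
      p.RunsWithin s (C * (r : ℝ) ^ ω) (fun s' => s'.HoldsMatrix 2 (A * B))

/-- The state `s` contains the Active Prefixes instance `(P, U, S)`: `|P|` and `|S|` in variables
`0` and `1`, the letters of `P` in array `0`, the bits of `U` in array `1`, the concatenation of
the strings of `S` in array `2`, and their lengths in array `3`. -/
def RAMState.HoldsInstance {w : ℕ} (s : RAMState w) (P : List (BitVec w))
    (U : Fin P.length → Bool) (S : List (List (BitVec w))) : Prop :=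
  s.var 0 = BitVec.ofNat w P.length ∧ s.var 1 = BitVec.ofNat w S.length ∧
  s.HoldsList 0 P ∧ s.HoldsBits 1 U ∧
  s.HoldsList 2 S.flatten ∧ s.HoldsList 3 (S.map fun X => BitVec.ofNat w X.length)

/-! ## Variables, arrays, expressions and commands -/

/-! Let L be the least length of a string of the instance and B = L/9 + 1. Every string has a
smallest period p with 9p ≤ 2L and a length k with L ≤ k < 10L/9 (`IsType3.strOk`); after that ℓ
plays no role. Cut the text into blocks of length B. An occurrence that starts in the block at s
contains the window [s + B, s + L), whose length is at least 3p. The window alone therefore reveals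
p and the least rotation of the repeated word, the root (`Primitive.rot`). So strings and blocks
fall into groups by their roots, and inside a group occurrences are pure arithmetic: the start a has
the right phase modulo p, and [a, a + k) lies in the extent of the period around the window
(`occurs_of_phase`, `phase_of_occurs`, `hit_iff`). Roots are compared by a deterministic trie built
on dictionaries that need no initialisation (`dictCm_spec`, `TriePath.inj`).

Take a group with period p, q blocks and n strings, and write positions in a block as row · p +
column, with roots starting in column 0. A string of phase α starts in column α; its end lies in a
fixed column and a fixed number of rows further down. Finding the ends is thus the product of a p ×
p matrix (the strings) with a p × q matrix (the active starts in the blocks), whose entries are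
polynomials of degree O(B/p) in a variable that counts rows. If q ≤ p, trying all n · q · (B/p + 3)
combinations costs O(nB) (`naiveCm_spec`). If p < q, the product is computed by evaluation at points
(`fastCm_spec`).

For the evaluation, a row number is split into two digits in a base d of order √(B/p), which gives
polynomials in two variables of degree below d. Digit sums do not wrap around modulo r when 2d ≤ r,
so r-point transforms in each variable suffice, and these are themselves products with an r × r
matrix. With r² p = O(B), the transforms and the pointwise p × p products both take O(B q Φ) time,
where Φ = O(m^(ω-2)) bounds the time of a product divided by the square of its order.

The points come from a prime ρ in (2d, 4d], with r = ρ - 1, small enough to be found by trial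
division. The arithmetic is modulo M = ρ^e, larger than the number of strings. The powers with
exponent ρ^Λ of 1, …, ρ - 1 are roots of unity of order dividing r modulo M, and their power sums
satisfy the orthogonality relations (`sum_pow_range`). Hence the transposed evaluation returns every
coefficient times the unit r² (`convolution_eq`). A coefficient counts strings, so it is less than M
and is non-zero modulo M exactly if there is a hit (`scaled_count_ne_zero`).

Summed over the groups, B · q is at most m and n · B is at most N, which gives m (Φ + log) + N up to
constants. Replacing r^ω by r² Φ needs ω ≥ 2. This follows because a product must overwrite r² cells
of a memory with adversarial contents (`MatrixMultiplicationInTime.sq_le`).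

On the machine, everything is phrased as commands on natural numbers with timed Hoare triples `Ht`;
compilation is verified once, and absence of overflow becomes side conditions that follow from Z^6 ≤
2^w, where Z = 8(m + N + 2). -/

/-- The variables of the program. -/
inductive Var where
  | vm | vnS | vN | vL | vB | vZ | vR | vt | vf | vrho | vM
  | vh | vst | vn | vi | vj | vk | vz | vlim | vp | vg | vlid | vcl | vcn
  | vb | vnb | vhi | vlo | vs | vq | vng | vbeta | veta | vsl | vsk | vy | vx
  | vD | vd | vr | vI | vu | vu1 | vu2 | vx1 | vx2 | vrr | vdel | val | vlen
  | vO | vC | vio | vix | vic | voo | voy | voc | vo | vch | vnc | vcc | vcol | va | ve | vpp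
  | vLam | vw1
  deriving DecidableEq

/-- The arrays of the program; the last three are those of the matrix multiplication. -/
inductive Arr where
  | aP | aU | aS | aLen | aV
  | aOff | aW | aLA | aLL | aNA | aNL | aQ | aNS | aGp | aBst | aBdel | aBlo | aBhi | aSal | aSlen
  | aX | aY | aVd | aG | aK
  | mA | mB | mC
  deriving DecidableEq

namespace Var
/-- The number of the physical variable. -/
def phys (x : Var) : ℕ := 3 * x.ctorIdx

theorem phys_inj {x y : Var} : x.phys = y.phys ↔ x = y := by
  constructor
  · intro h
    have h' : x.ctorIdx = y.ctorIdx := by unfold phys at h; omega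
    rw [← Var.ofNat_ctorIdx x, h', Var.ofNat_ctorIdx]
  · rintro rfl; rfl
end Var

theorem Arr.ctorIdx_inj {x y : Arr} : x.ctorIdx = y.ctorIdx ↔ x = y := by
  constructor
  · intro h
    rw [← Arr.ofNat_ctorIdx x, h, Arr.ofNat_ctorIdx]
  · rintro rfl; rfl

/-- Expressions over the natural numbers. -/
inductive Ex where
  | v (x : Var)
  | n (k : ℕ)
  | bin (o : WordOp) (a b : Ex)
  | ld (a : Arr) (i : Ex)

instance : Coe Var Ex := ⟨Ex.v⟩
instance (k : ℕ) : OfNat Ex k := ⟨Ex.n k⟩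
instance : Add Ex := ⟨Ex.bin .plus⟩
instance : Sub Ex := ⟨Ex.bin .minus⟩
instance : Mul Ex := ⟨Ex.bin .times⟩
instance : Div Ex := ⟨Ex.bin .quot⟩
instance : Mod Ex := ⟨Ex.bin .rem⟩
/-- The test `a = b`. -/
def Ex.eqv (a b : Ex) : Ex := .bin .eq a b
/-- The test `a < b`. -/
def Ex.ltv (a b : Ex) : Ex := .bin .lt a b

/-- States with natural numbers in variables and cells. -/
structure St where
  var : Var → ℕ
  arr : Arr → ℕ → ℕ

namespace St
/-- Assign `k` to the variable `x`. -/
def set (σ : St) (x : Var) (k : ℕ) : St := { σ with var := fun y => if y = x then k else σ.var y }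
/-- Write `k` to the cell `i` of the array `a`. -/
def put (σ : St) (a : Arr) (i k : ℕ) : St :=
  { σ with arr := fun b j => if b = a ∧ j = i then k else σ.arr b j }

@[simp] theorem set_var (σ : St) (x y : Var) (k : ℕ) :
    (σ.set x k).var y = if y = x then k else σ.var y := rfl
@[simp] theorem set_arr (σ : St) (x : Var) (k : ℕ) : (σ.set x k).arr = σ.arr := rfl
@[simp] theorem put_var (σ : St) (a : Arr) (i k : ℕ) : (σ.put a i k).var = σ.var := rfl
@[simp] theorem put_arr (σ : St) (a b : Arr) (i j k : ℕ) :
    (σ.put a i k).arr b j = if b = a ∧ j = i then k else σ.arr b j := rfl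
theorem put_arr_fun (σ : St) (a b : Arr) (i k : ℕ) :
    (σ.put a i k).arr b = fun j => if b = a ∧ j = i then k else σ.arr b j := rfl
theorem put_arr_ne (σ : St) {a b : Arr} (i k : ℕ) (h : b ≠ a) :
    (σ.put a i k).arr b = σ.arr b := by
  funext j; simp [h]
end St

open Classical in
/-- The number of a truth value. -/
noncomputable def truth (p : Prop) : ℕ := if p then 1 else 0

@[simp] theorem truth_eq_zero {p : Prop} : truth p = 0 ↔ ¬ p := by
  unfold truth; split_ifs with h <;> simp [h]

/-- The value of an operation on natural numbers that does not overflow. -/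
noncomputable def WordOp.nat : WordOp → ℕ → ℕ → ℕ
  | .plus, a, b => a + b
  | .minus, a, b => a - b
  | .times, a, b => a * b
  | .quot, a, b => a / b
  | .rem, a, b => a % b
  | .eq, a, b => truth (a = b)
  | .lt, a, b => truth (a < b)
  -- A dummy value for the bit operations: `WordOp.fits` is false for them, so it is never relied
  -- on.
  | _, _, _ => 0

/-- The condition under which `WordOp.nat` is the operation on words of `w` bits. -/
def WordOp.fits (w : ℕ) : WordOp → ℕ → ℕ → Prop
  | .plus, a, b => a + b < 2 ^ w
  | .minus, a, b => b ≤ a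
  | .times, a, b => a * b < 2 ^ w
  | .quot, _, _ => True
  | .rem, _, _ => True
  | .eq, _, _ => True
  | .lt, _, _ => True
  | _, _, _ => False

namespace Ex
/-- The value of an expression. -/
noncomputable def eval (σ : St) : Ex → ℕ
  | .v x => σ.var x
  | .n k => k
  | .bin o a b => o.nat (a.eval σ) (b.eval σ)
  | .ld a i => σ.arr a (i.eval σ)

/-- No overflow occurs in the evaluation of an expression on words of `w` bits. -/
def ok (w : ℕ) (σ : St) : Ex → Prop
  | .v _ => True
  | .n k => k < 2 ^ w
  | .bin o a b => a.ok w σ ∧ b.ok w σ ∧ o.fits w (a.eval σ) (b.eval σ)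
  | .ld _ i => i.ok w σ ∧ i.eval σ < 2 ^ w

/-- The number of instructions that evaluate an expression. -/
def size : Ex → ℕ
  | .v _ => 1
  | .n _ => 1
  | .bin _ a b => a.size + b.size + 1
  | .ld _ i => i.size + 1

variable (w : ℕ) (σ : St) (a b : Ex) (x : Var) (k : ℕ) (t : Arr)
@[simp] theorem eval_v : (Ex.v x).eval σ = σ.var x := rfl
@[simp] theorem eval_ofNat : (no_index (OfNat.ofNat k : Ex)).eval σ = OfNat.ofNat k := rfl
@[simp] theorem eval_add : (a + b).eval σ = a.eval σ + b.eval σ := rfl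
@[simp] theorem eval_sub : (a - b).eval σ = a.eval σ - b.eval σ := rfl
@[simp] theorem eval_mul : (a * b).eval σ = a.eval σ * b.eval σ := rfl
@[simp] theorem eval_div : (a / b).eval σ = a.eval σ / b.eval σ := rfl
@[simp] theorem eval_mod : (a % b).eval σ = a.eval σ % b.eval σ := rfl
@[simp] theorem eval_eqv : (a.eqv b).eval σ = truth (a.eval σ = b.eval σ) := rfl
@[simp] theorem eval_ltv : (a.ltv b).eval σ = truth (a.eval σ < b.eval σ) := rfl
@[simp] theorem eval_ld : (Ex.ld t a).eval σ = σ.arr t (a.eval σ) := rfl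
@[simp] theorem ok_v : (Ex.v x).ok w σ ↔ True := Iff.rfl
@[simp] theorem ok_ofNat : (no_index (OfNat.ofNat k : Ex)).ok w σ ↔ OfNat.ofNat k < 2 ^ w := Iff.rfl
@[simp] theorem ok_add : (a + b).ok w σ ↔ a.ok w σ ∧ b.ok w σ ∧ a.eval σ + b.eval σ < 2 ^ w := Iff.rfl
@[simp] theorem ok_sub : (a - b).ok w σ ↔ a.ok w σ ∧ b.ok w σ ∧ b.eval σ ≤ a.eval σ := Iff.rfl
@[simp] theorem ok_mul : (a * b).ok w σ ↔ a.ok w σ ∧ b.ok w σ ∧ a.eval σ * b.eval σ < 2 ^ w := Iff.rfl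
@[simp] theorem ok_div : (a / b).ok w σ ↔ a.ok w σ ∧ b.ok w σ :=
  ⟨fun h => ⟨h.1, h.2.1⟩, fun h => ⟨h.1, h.2, trivial⟩⟩
@[simp] theorem ok_mod : (a % b).ok w σ ↔ a.ok w σ ∧ b.ok w σ :=
  ⟨fun h => ⟨h.1, h.2.1⟩, fun h => ⟨h.1, h.2, trivial⟩⟩
@[simp] theorem ok_eqv : (a.eqv b).ok w σ ↔ a.ok w σ ∧ b.ok w σ :=
  ⟨fun h => ⟨h.1, h.2.1⟩, fun h => ⟨h.1, h.2, trivial⟩⟩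
@[simp] theorem ok_ltv : (a.ltv b).ok w σ ↔ a.ok w σ ∧ b.ok w σ :=
  ⟨fun h => ⟨h.1, h.2.1⟩, fun h => ⟨h.1, h.2, trivial⟩⟩
@[simp] theorem ok_ld : (Ex.ld t a).ok w σ ↔ a.ok w σ ∧ a.eval σ < 2 ^ w := Iff.rfl
end Ex

/-- Commands. -/
inductive Cm where
  | skip
  | asg (x : Var) (e : Ex)
  | sto (a : Arr) (i e : Ex)
  | seq (c d : Cm)
  | ite (e : Ex) (c d : Cm)
  /-- for `x := 0, …, y - 1` do `c` -/
  | loop (x y : Var) (c : Cm)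
  /-- `mC := mA * mB`, where the order of the matrices is the value of `x` -/
  | mm (x : Var)

infixr:60 " ;; " => Cm.seq
infix:62 " ≔ " => Cm.asg

/-- Instructions that put the value of an expression into the temporary `k`. -/
def Ex.compile : Ex → ℕ → Prog
  | .v x, k => .op .bor (3 * k + 1) x.phys x.phys
  | .n c, k => .const (3 * k + 1) c
  | .bin o a b, k => .seq (a.compile k) (.seq (b.compile (k + 1))
      (.op o (3 * k + 1) (3 * k + 1) (3 * (k + 1) + 1)))
  | .ld a i, k => .seq (i.compile k) (.load (3 * k + 1) a.ctorIdx (3 * k + 1))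

/-- Rename the variables and the arrays of a program. -/
def Prog.rename (f g : ℕ → ℕ) : Prog → Prog
  | .skip => .skip
  | .const x n => .const (f x) n
  | .op o x y z => .op o (f x) (f y) (f z)
  | .load x a y => .load (f x) (g a) (f y)
  | .store a x y => .store (g a) (f x) (f y)
  | .seq p q => .seq (p.rename f g) (q.rename f g)
  | .ite x p q => .ite (f x) (p.rename f g) (q.rename f g)
  | .loop x p => .loop (f x) (p.rename f g)

/-- The renamed multiplication program uses the variables `3 * x + 2` and the arrays from `mA`. -/
def Prog.shift (p : Prog) : Prog := p.rename (fun x => 3 * x + 2) (fun a => a + Arr.mA.ctorIdx)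

namespace Cm
/-- Compilation with the matrix multiplication program `pm`. -/
def compile (pm : Prog) : Cm → Prog
  | .skip => .skip
  | .asg x e => .seq (e.compile 0) (.op .bor x.phys 1 1)
  | .sto a i e => .seq (i.compile 0) (.seq (e.compile 1) (.store a.ctorIdx 1 4))
  | .seq c d => .seq (c.compile pm) (d.compile pm)
  | .ite e c d => .seq (e.compile 0) (.ite 1 (c.compile pm) (d.compile pm))
  | .loop x y c => .seq (.const x.phys 0) (.seq (.op .lt 1 x.phys y.phys) (.loop 1
      (.seq (c.compile pm) (.seq (.const 1 1) (.seq (.op .plus x.phys x.phys 1)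
        (.op .lt 1 x.phys y.phys))))))
  | .mm x => .seq (.op .bor 2 x.phys x.phys) pm.shift

/-- The variables that a command may change. -/
def wv : Cm → List Var
  | .skip => []
  | .asg x _ => [x]
  | .sto _ _ _ => []
  | .seq c d => c.wv ++ d.wv
  | .ite _ c d => c.wv ++ d.wv
  | .loop x _ c => x :: c.wv
  | .mm _ => []

/-- The arrays that a command may change. -/
def wa : Cm → List Arr
  | .skip => []
  | .asg _ _ => []
  | .sto a _ _ => [a]
  | .seq c d => c.wa ++ d.wa
  | .ite _ c d => c.wa ++ d.wa
  | .loop _ _ c => c.wa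
  | .mm _ => [.mA, .mB, .mC]

/-- A bound for the running time of a command without loops. -/
def cost : Cm → ℕ
  | .skip => 1
  | .asg _ e => e.size + 1
  | .sto _ i e => i.size + e.size + 1
  | .seq c d => c.cost + d.cost
  | .ite e c d => e.size + max c.cost d.cost + 1
  -- The zeros for loops and `mm` are harmless: `wp` is false on both, and they have rules of their
  -- own.
  | .loop _ _ _ => 0
  | .mm _ => 0

/-- The weakest precondition of a command without loops. -/
def wp (w : ℕ) : Cm → (St → Prop) → St → Prop
  | .skip, Q, σ => Q σ
  | .asg x e, Q, σ => e.ok w σ ∧ Q (σ.set x (e.eval σ))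
  | .sto a i e, Q, σ => i.ok w σ ∧ e.ok w σ ∧ i.eval σ < 2 ^ w ∧ Q (σ.put a (i.eval σ) (e.eval σ))
  | .seq c d, Q, σ => c.wp w (fun τ => d.wp w Q τ) σ
  | .ite e c d, Q, σ => e.ok w σ ∧ (e.eval σ ≠ 0 → c.wp w Q σ) ∧ (e.eval σ = 0 → d.wp w Q σ)
  | .loop _ _ _, _, _ => False
  | .mm _, _, _ => False
end Cm

/-! ### Hoare triples with running times -/

/-- The frame of a command: what is outside its reach is unchanged. -/
def Fr (c : Cm) (σ τ : St) : Prop :=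
  (∀ x, x ∉ c.wv → τ.var x = σ.var x) ∧ (∀ a, a ∉ c.wa → τ.arr a = σ.arr a)

theorem Fr.refl (c : Cm) (σ : St) : Fr c σ σ := ⟨fun _ _ => rfl, fun _ _ => rfl⟩

theorem Fr.trans {c : Cm} {σ τ υ : St} (h : Fr c σ τ) (h' : Fr c τ υ) : Fr c σ υ :=
  ⟨fun x hx => (h'.1 x hx).trans (h.1 x hx), fun a ha => (h'.2 a ha).trans (h.2 a ha)⟩

theorem Fr.mono {c d : Cm} {σ τ : St} (h : Fr c σ τ) (hv : ∀ x ∈ c.wv, x ∈ d.wv)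
    (ha : ∀ a ∈ c.wa, a ∈ d.wa) : Fr d σ τ :=
  ⟨fun x hx => h.1 x fun h' => hx (hv x h'), fun a hx => h.2 a fun h' => hx (ha a h')⟩

/-- The state of the machine represents the state `σ`. -/
structure Models {w : ℕ} (s : RAMState w) (σ : St) : Prop where
  var : ∀ x : Var, (s.var x.phys).toNat = σ.var x
  arr : ∀ (a : Arr) (i : ℕ), i < 2 ^ w → (s.arr a.ctorIdx (BitVec.ofNat w i)).toNat = σ.arr a i

/-- Started in a state that represents `σ`, the command `c` halts within `T` units of time in a
state that represents a state satisfying `Q`, and respects its frame. -/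
def Ht (w : ℕ) (pm : Prog) (c : Cm) (σ : St) (T : ℕ) (Q : St → Prop) : Prop :=
  ∀ s : RAMState w, Models s σ →
    ∃ (t : ℕ) (s' : RAMState w) (τ : St), Exec (c.compile pm) s t s' ∧ t ≤ T ∧ Models s' τ ∧
      Fr c σ τ ∧ Q τ

theorem WordOp.toNat_eval {w : ℕ} (hw : 1 ≤ w) (o : WordOp) (x y : BitVec w)
    (h : o.fits w x.toNat y.toNat) : (o.eval x y).toNat = o.nat x.toNat y.toNat := by
  have h1 : 1 < 2 ^ w := Nat.one_lt_two_pow (by omega)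
  cases o <;> simp only [WordOp.fits] at h <;> simp only [WordOp.eval, WordOp.nat]
  · rw [BitVec.toNat_add, Nat.mod_eq_of_lt h]
  · rw [BitVec.toNat_sub_of_le (by rwa [BitVec.le_def])]
  · rw [BitVec.toNat_mul, Nat.mod_eq_of_lt h]
  · exact BitVec.toNat_udiv
  · exact BitVec.toNat_umod
  · by_cases e : x = y
    · simp [e, truth, Nat.mod_eq_of_lt h1]
    · have e' : x.toNat ≠ y.toNat := fun h => e (BitVec.eq_of_toNat_eq h)
      simp [e, e', truth]
  · unfold truth; split_ifs <;> simp [Nat.mod_eq_of_lt h1]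

theorem WordOp.toNat_lt {w : ℕ} (hw : 1 ≤ w) (x y : BitVec w) :
    (WordOp.lt.eval x y).toNat = if x.toNat < y.toNat then 1 else 0 := by
  rw [WordOp.toNat_eval hw .lt x y trivial, WordOp.nat, truth]; congr

/-- Temporaries below `k`, all other variables and all arrays agree. -/
def SameBelow {w : ℕ} (k : ℕ) (s s' : RAMState w) : Prop :=
  s'.arr = s.arr ∧ (∀ y, y % 3 ≠ 1 → s'.var y = s.var y) ∧ ∀ j < k, s'.var (3 * j + 1) = s.var (3 * j + 1)

theorem SameBelow.rep {w k : ℕ} {s s' : RAMState w} {σ : St} (h : SameBelow k s s') (hr : Models s σ) :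
    Models s' σ := by
  refine ⟨fun x => ?_, fun a i hi => ?_⟩
  · rw [h.2.1 _ (by unfold Var.phys; omega), hr.var]
  · rw [h.1, hr.arr a i hi]

theorem SameBelow.setVar {w k : ℕ} {s s' : RAMState w} (h : SameBelow k s s') (b : BitVec w) :
    SameBelow k s (s'.setVar (3 * k + 1) b) := by
  refine ⟨h.1, fun y hy => ?_, fun j hj => ?_⟩
  · simp only [RAMState.setVar]
    rw [Function.update_of_ne (by omega), h.2.1 y hy]
  · simp only [RAMState.setVar]
    rw [Function.update_of_ne (by omega), h.2.2 j hj]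

/-- Machine variables are separated by their residue modulo 3: 0 for the variables of commands, 1
for temporaries, 2 for the matrix multiplication. Evaluation into the temporary k spares the
temporaries below k, so a left operand survives the evaluation of the right one. -/
theorem Ex.exec_compile {w : ℕ} (hw : 1 ≤ w) (e : Ex) : ∀ (k : ℕ) (s : RAMState w) (σ : St),
    Models s σ → e.ok w σ → ∃ s', Exec (e.compile k) s e.size s' ∧
      (s'.var (3 * k + 1)).toNat = e.eval σ ∧ SameBelow k s s' := by
  induction e with
  | v x =>
    intro k s σ hr _
    refine ⟨_, Exec.op _ _ _ _ _, ?_, SameBelow.setVar ⟨rfl, fun _ _ => rfl, fun _ _ => rfl⟩ _⟩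
    simp [RAMState.setVar, WordOp.eval, hr.var]
  | n c =>
    intro k s σ hr hok
    refine ⟨_, Exec.const _ _ _, ?_, SameBelow.setVar ⟨rfl, fun _ _ => rfl, fun _ _ => rfl⟩ _⟩
    simp only [RAMState.setVar, Function.update_self, BitVec.toNat_ofNat]
    exact Nat.mod_eq_of_lt hok
  | bin o a b iha ihb =>
    intro k s σ hr hok
    obtain ⟨s1, h1, e1, f1⟩ := iha k s σ hr hok.1
    obtain ⟨s2, h2, e2, f2⟩ := ihb (k + 1) s1 σ (f1.rep hr) hok.2.1
    have e3 : (s2.var (3 * k + 1)).toNat = a.eval σ := by rw [f2.2.2 k (by omega), e1]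
    have f3 : SameBelow k s s2 := by
      refine ⟨?_, ?_, ?_⟩
      · rw [f2.1, f1.1]
      · intro y hy; rw [f2.2.1 y hy, f1.2.1 y hy]
      · intro j hj; rw [f2.2.2 j (by omega), f1.2.2 j hj]
    refine ⟨_, ?_, ?_, f3.setVar (o.eval (s2.var (3 * k + 1)) (s2.var (3 * (k + 1) + 1)))⟩
    · have := Exec.seq h1 (Exec.seq h2 (Exec.op s2 o (3 * k + 1) (3 * k + 1) (3 * (k + 1) + 1)))
      simpa only [Ex.size, Nat.add_assoc, Ex.compile] using this
    · simp only [RAMState.setVar, Function.update_self]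
      rw [WordOp.toNat_eval hw, e3, e2]; · rfl
      rw [e3, e2]; exact hok.2.2
  | ld a i ih =>
    intro k s σ hr hok
    obtain ⟨s1, h1, e1, f1⟩ := ih k s σ hr hok.1
    refine ⟨_, Exec.seq h1 (Exec.load _ _ _ _), ?_, f1.setVar _⟩
    simp only [RAMState.setVar, Function.update_self]
    have hi : s1.var (3 * k + 1) = BitVec.ofNat w (i.eval σ) := by
      rw [← e1, BitVec.ofNat_toNat, BitVec.setWidth_eq]
    rw [hi, (f1.rep hr).arr a _ hok.2]; rfl

theorem Models.setVar {w : ℕ} {s : RAMState w} {σ : St} (h : Models s σ) (x : Var) (b : BitVec w) :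
    Models (s.setVar x.phys b) (σ.set x b.toNat) := by
  refine ⟨fun y => ?_, fun a i hi => h.arr a i hi⟩
  simp only [RAMState.setVar, St.set_var]
  split_ifs with e
  · rw [e, Function.update_self]
  · rw [Function.update_of_ne (by rwa [Ne, Var.phys_inj]), h.var]

theorem Models.setTemp {w : ℕ} {s : RAMState w} {σ : St} (h : Models s σ) (x : ℕ) (hx : x % 3 ≠ 0)
    (b : BitVec w) : Models (s.setVar x b) σ := by
  refine ⟨fun y => ?_, fun a i hi => h.arr a i hi⟩
  simp only [RAMState.setVar]
  rw [Function.update_of_ne (by unfold Var.phys; omega), h.var]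

theorem Models.setArr {w : ℕ} {s : RAMState w} {σ : St} (h : Models s σ) (a : Arr) (k b : BitVec w) :
    Models (s.setArr a.ctorIdx k b) (σ.put a k.toNat b.toNat) := by
  refine ⟨fun y => h.var y, fun c i hi => ?_⟩
  simp only [RAMState.setArr, St.put_arr]
  by_cases e : c = a
  · subst e
    rw [Function.update_self]
    by_cases e' : i = k.toNat
    · subst e'
      simp
    · rw [Function.update_of_ne, h.arr c i hi]
      · simp [e']
      · intro h'
        apply e'
        rw [← h', BitVec.toNat_ofNat, Nat.mod_eq_of_lt hi]
  · rw [Function.update_of_ne (by rwa [Ne, Arr.ctorIdx_inj]), h.arr c i hi]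
    simp [e]

section
variable {w : ℕ} {pm : Prog} {σ : St}

theorem Ht.mono {c : Cm} {T T' : ℕ} {Q Q' : St → Prop} (h : Ht w pm c σ T Q) (hT : T ≤ T')
    (hQ : ∀ τ, Fr c σ τ → Q τ → Q' τ) : Ht w pm c σ T' Q' := by
  intro s hs
  obtain ⟨t, s', τ, h1, h2, h3, h4, h5⟩ := h s hs
  exact ⟨t, s', τ, h1, h2.trans hT, h3, h4, hQ τ h4 h5⟩

theorem Ht.seq {c d : Cm} {T₁ T₂ : ℕ} {R Q : St → Prop} (h : Ht w pm c σ T₁ R)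
    (h' : ∀ τ, Fr c σ τ → R τ → Ht w pm d τ T₂ Q) : Ht w pm (c ;; d) σ (T₁ + T₂) Q := by
  intro s hs
  obtain ⟨t, s', τ, h1, h2, h3, h4, h5⟩ := h s hs
  obtain ⟨t', s'', υ, g1, g2, g3, g4, g5⟩ := h' τ h4 h5 s' h3
  refine ⟨_, s'', υ, Exec.seq h1 g1, by omega, g3, ?_, g5⟩
  exact (h4.mono (by simp +contextual [Cm.wv]) (by simp +contextual [Cm.wa])).trans
    (g4.mono (by simp +contextual [Cm.wv]) (by simp +contextual [Cm.wa]))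

theorem Ht.ite (hw : 1 ≤ w) {e : Ex} {c d : Cm} {T : ℕ} {Q : St → Prop} (hok : e.ok w σ)
    (h : e.eval σ ≠ 0 → Ht w pm c σ T Q) (h' : e.eval σ = 0 → Ht w pm d σ T Q) :
    Ht w pm (.ite e c d) σ (e.size + T + 1) Q := by
  intro s hs
  obtain ⟨s1, h1, e1, f1⟩ := e.exec_compile hw 0 s σ hs hok
  by_cases h0 : e.eval σ = 0
  · obtain ⟨t', s'', υ, g1, g2, g3, g4, g5⟩ := h' h0 s1 (f1.rep hs)
    refine ⟨_, s'', υ, Exec.seq h1 (Exec.iteFalse ?_ g1), by omega, g3,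
      g4.mono (by simp +contextual [Cm.wv]) (by simp +contextual [Cm.wa]), g5⟩
    exact BitVec.eq_of_toNat_eq (by simpa [h0] using e1)
  · obtain ⟨t', s'', υ, g1, g2, g3, g4, g5⟩ := h h0 s1 (f1.rep hs)
    refine ⟨_, s'', υ, Exec.seq h1 (Exec.iteTrue ?_ g1), by omega, g3,
      g4.mono (by simp +contextual [Cm.wv]) (by simp +contextual [Cm.wa]), g5⟩
    intro h2
    apply h0
    rw [← e1]
    have h3 : s1.var 1 = 0#w := h2
    simp [h3]

theorem Ht.skip {Q : St → Prop} (h : Q σ) : Ht w pm .skip σ 1 Q :=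
  fun s hs => ⟨1, s, σ, Exec.skip s, le_rfl, hs, Fr.refl _ _, h⟩

/-- Code without loops is verified by unfolding its weakest precondition; overflow conditions then
appear as linear goals. Only loops and matrix products need explicit invariants or specifications.
-/
theorem Ht.of_wp (hw : 1 ≤ w) {c : Cm} : ∀ {σ : St} {T : ℕ} {Q : St → Prop}, c.cost ≤ T →
    c.wp w Q σ → Ht w pm c σ T Q := by
  induction c with
  | skip => intro σ T Q hT h; exact (Ht.skip h).mono hT fun _ _ h => h
  | asg x e =>
    intro σ T Q hT h s hs
    obtain ⟨s1, h1, e1, f1⟩ := e.exec_compile hw 0 s σ hs h.1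
    refine ⟨_, _, σ.set x (e.eval σ), Exec.seq h1 (Exec.op _ _ _ _ _), hT, ?_, ?_, h.2⟩
    · have := (f1.rep hs).setVar x (s1.var 1)
      simpa [WordOp.eval, e1] using this
    · exact ⟨fun y hy => by simp [Cm.wv] at hy; simp [hy], fun _ _ => rfl⟩
  | sto a i e =>
    intro σ T Q hT h s hs
    obtain ⟨s1, h1, e1, f1⟩ := i.exec_compile hw 0 s σ hs h.1
    obtain ⟨s2, h2, e2, f2⟩ := e.exec_compile hw 1 s1 σ (f1.rep hs) h.2.1
    refine ⟨_, _, σ.put a (i.eval σ) (e.eval σ), Exec.seq h1 (Exec.seq h2 (Exec.store _ _ _ _)),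
      by simp only [Cm.cost] at hT; omega, ?_, ?_, h.2.2.2⟩
    · have := (f2.rep (f1.rep hs)).setArr a (s2.var 1) (s2.var 4)
      rw [f2.2.2 0 (by omega)] at this ⊢
      simpa [e1, e2] using this
    · refine ⟨fun _ _ => rfl, fun b hb => ?_⟩
      simp only [Cm.wa, List.mem_singleton] at hb
      exact St.put_arr_ne _ _ _ hb
  | seq c d ihc ihd =>
    intro σ T Q hT h
    refine (Ht.seq (ihc le_rfl h) fun τ _ hτ => ihd le_rfl hτ).mono hT fun _ _ h => h
  | ite e c d ihc ihd =>
    intro σ T Q hT h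
    refine (Ht.ite hw h.1 (fun h0 => ihc (le_max_left _ d.cost) (h.2.1 h0))
      (fun h0 => ihd (le_max_right c.cost _) (h.2.2 h0))).mono hT fun _ _ h => h
  | loop x y c => intro σ T Q hT h; exact h.elim
  | mm x => intro σ T Q hT h; exact h.elim

/-- The rule for loops, with an invariant `I`. -/
theorem Ht.loop (hw : 1 ≤ w) {x y : Var} {c : Cm} (I : ℕ → St → Prop) (T : ℕ → ℕ)
    (hxy : y ≠ x) (hx : x ∉ c.wv) (hy : y ∉ c.wv) (h0 : I 0 (σ.set x 0))
    (step : ∀ i < σ.var y, ∀ τ, Fr (.loop x y c) σ τ → τ.var x = i → I i τ →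
      Ht w pm c τ (T i) (fun υ => I (i + 1) (υ.set x (i + 1)))) :
    Ht w pm (.loop x y c) σ (∑ i ∈ Finset.range (σ.var y), (T i + 4) + 3) (I (σ.var y)) := by
  have h1w : 1 < 2 ^ w := Nat.one_lt_two_pow (by omega)
  set n := σ.var y with hn
  -- Induction on the number k of remaining rounds. The last hypothesis records that the temporary
  -- tested by the compiled loop holds the comparison of the counter with the bound.
  have key : ∀ k i, i + k = n → ∀ (τ : St) (s : RAMState w), Models s τ → Fr (.loop x y c) σ τ →
      τ.var x = i → I i τ → (s.var 1).toNat = (if i < n then 1 else 0) →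
      ∃ t s' υ, Exec (.loop 1 (.seq (c.compile pm) (.seq (.const 1 1)
        (.seq (.op .plus x.phys x.phys 1) (.op .lt 1 x.phys y.phys))))) s t s' ∧
        t ≤ ∑ j ∈ Finset.Ico i n, (T j + 4) + 1 ∧ Models s' υ ∧ Fr (.loop x y c) σ υ ∧ I n υ := by
    intro k
    induction k with
    | zero =>
      intro i hi τ s hs hf hv hI h1
      obtain rfl : i = n := by omega
      refine ⟨1, s, τ, Exec.loopDone ?_, by simp, hs, hf, hI⟩
      exact BitVec.eq_of_toNat_eq (by simpa using h1)
    | succ k ih =>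
      intro i hi τ s hs hf hv hI h1
      have hin : i < n := by omega
      obtain ⟨t, s1, υ, g1, g2, g3, g4, g5⟩ := step i hin τ hf hv hI s hs
      have hυx : υ.var x = i := by rw [g4.1 x hx, hv]
      have hyn : υ.var y = n := by
        rw [g4.1 y hy, hf.1 y (by simp [Cm.wv, hxy, hy])]
      have hnw : n < 2 ^ w := by rw [← hyn, ← g3.var]; exact BitVec.isLt _
      have r1 := (g3.setTemp 1 (by decide) (BitVec.ofNat w 1))
      have hp1 : (x.phys : ℕ) ≠ 1 := by unfold Var.phys; omega
      have r2 := r1.setVar x (WordOp.plus.eval (s1.var x.phys) (BitVec.ofNat w 1))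
      have hv2 : (WordOp.plus.eval (s1.var x.phys) (BitVec.ofNat w 1)).toNat = i + 1 := by
        rw [WordOp.toNat_eval hw]
        · simp [WordOp.nat, g3.var, hυx, Nat.mod_eq_of_lt h1w]
        · simp only [WordOp.fits, g3.var, hυx, BitVec.toNat_ofNat, Nat.mod_eq_of_lt h1w]; omega
      rw [hv2] at r2
      set s2 := (s1.setVar 1 (BitVec.ofNat w 1)).setVar x.phys
        (WordOp.plus.eval (s1.var x.phys) (BitVec.ofNat w 1)) with hs2
      have r3 := r2.setTemp 1 (by decide) (WordOp.lt.eval (s2.var x.phys) (s2.var y.phys))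
      have hf' : Fr (.loop x y c) σ (υ.set x (i + 1)) := by
        refine ⟨fun z hz => ?_, fun a ha => ?_⟩
        · simp only [Cm.wv, List.mem_cons, not_or] at hz
          simp only [St.set_var, hz.1, if_false]
          rw [g4.1 z hz.2, hf.1 z (by simp [Cm.wv, hz])]
        · simp only [St.set_arr]
          rw [g4.2 a ha, hf.2 a ha]
      obtain ⟨t', s', υ', k1, k2, k3, k4, k5⟩ := ih (i + 1) (by omega) _ _ r3 hf' (by simp) g5 (by
        simp only [RAMState.setVar, Function.update_self]
        rw [WordOp.toNat_lt hw, r2.var, r2.var]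
        simp [hxy, hyn])
      have e1 : Exec (.seq (c.compile pm) (.seq (.const 1 1)
        (.seq (.op .plus x.phys x.phys 1) (.op .lt 1 x.phys y.phys)))) s (t + (1 + (1 + 1)))
          (s2.setVar 1 (WordOp.lt.eval (s2.var x.phys) (s2.var y.phys))) := by
        refine Exec.seq g1 (Exec.seq (Exec.const _ _ _) (Exec.seq ?_ (Exec.op _ _ _ _ _)))
        have := Exec.op (s1.setVar 1 (BitVec.ofNat w 1)) .plus x.phys x.phys 1
        simpa [RAMState.setVar, hs2, hp1] using this
      refine ⟨_, s', υ', Exec.loopStep ?_ e1 k1, ?_, k3, k4, k5⟩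
      · intro h2
        simp [h2, hin] at h1
      · rw [Finset.sum_eq_sum_Ico_succ_bot hin]
        omega
  intro s hs
  have r1 := hs.setVar x (BitVec.ofNat w 0)
  have e0 : (BitVec.ofNat w 0).toNat = 0 := by simp
  rw [e0] at r1
  set s1 := s.setVar x.phys (BitVec.ofNat w 0) with hs1
  have r2 := r1.setTemp 1 (by decide) (WordOp.lt.eval (s1.var x.phys) (s1.var y.phys))
  obtain ⟨t', s', υ', k1, k2, k3, k4, k5⟩ := key n 0 (by omega) _ _ r2
    ⟨fun z hz => by simp only [Cm.wv, List.mem_cons, not_or] at hz; simp [hz], fun _ _ => rfl⟩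
    (by simp) h0 (by
      simp only [RAMState.setVar, Function.update_self]
      rw [WordOp.toNat_lt hw, r1.var, r1.var]
      simp [hxy, hn])
  refine ⟨_, s', υ', Exec.seq (Exec.const _ _ _) (Exec.seq (Exec.op _ _ _ _ _) k1), ?_, k3, k4, k5⟩
  rw [Finset.range_eq_Ico]
  omega

/-- The rule for loops whose body has a uniform time bound. -/
theorem Ht.loop_const (hw : 1 ≤ w) {x y : Var} {c : Cm} (I : ℕ → St → Prop) (T : ℕ)
    (hxy : y ≠ x) (hx : x ∉ c.wv) (hy : y ∉ c.wv) (h0 : I 0 (σ.set x 0))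
    (step : ∀ i < σ.var y, ∀ τ, Fr (.loop x y c) σ τ → τ.var x = i → I i τ →
      Ht w pm c τ T (fun υ => I (i + 1) (υ.set x (i + 1)))) :
    Ht w pm (.loop x y c) σ (σ.var y * (T + 4) + 3) (I (σ.var y)) :=
  (Ht.loop hw I (fun _ => T) hxy hx hy h0 step).mono (by simp) fun _ _ h => h

end

/-! ## Matrix multiplication as a command -/

/-- Updates commute with injective renamings, and names outside their images are never touched. So
an unknown multiplication program can run inside the compiled code without disturbing anything else.
-/
theorem Exec.rename {w : ℕ} {f g : ℕ → ℕ} (hf : Function.Injective f) (hg : Function.Injective g)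
    {p : Prog} {s s' : RAMState w} {t : ℕ} (h : Exec p s t s') : ∀ S : RAMState w,
    (∀ x, S.var (f x) = s.var x) → (∀ a, S.arr (g a) = s.arr a) →
    ∃ S', Exec (p.rename f g) S t S' ∧ (∀ x, S'.var (f x) = s'.var x) ∧
      (∀ a, S'.arr (g a) = s'.arr a) ∧ (∀ y, (∀ x, y ≠ f x) → S'.var y = S.var y) ∧
      (∀ b, (∀ a, b ≠ g a) → S'.arr b = S.arr b) := by
  have upd : ∀ (S s : RAMState w) (x : ℕ) (v : BitVec w), (∀ x, S.var (f x) = s.var x) →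
      ∀ y, (S.setVar (f x) v).var (f y) = (s.setVar x v).var y := by
    intro S s x v h y
    simp only [RAMState.setVar, Function.update_apply, hf.eq_iff, h]
  have fre : ∀ (S : RAMState w) (x : ℕ) (v : BitVec w) (y : ℕ), (∀ x, y ≠ f x) →
      (S.setVar (f x) v).var y = S.var y := by
    intro S x v y hy
    simp only [RAMState.setVar]
    rw [Function.update_of_ne (hy x)]
  induction h with
  | skip s => intro S hv ha; exact ⟨S, Exec.skip S, hv, ha, fun _ _ => rfl, fun _ _ => rfl⟩
  | const s x n =>
    intro S hv ha
    exact ⟨_, Exec.const _ _ _, upd S s x _ hv, ha, fre S x _, fun _ _ => rfl⟩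
  | op s o x y z =>
    intro S hv ha
    refine ⟨_, Exec.op _ _ _ _ _, ?_, ha, fre S x _, fun _ _ => rfl⟩
    rw [hv y, hv z]
    exact upd S s x _ hv
  | load s x a y =>
    intro S hv ha
    refine ⟨_, Exec.load _ _ _ _, ?_, ha, fre S x _, fun _ _ => rfl⟩
    rw [hv y, ha a]
    exact upd S s x _ hv
  | store s a x y =>
    intro S hv ha
    refine ⟨_, Exec.store _ _ _ _, hv, ?_, fun _ _ => rfl, ?_⟩
    · intro b
      simp only [RAMState.setArr, Function.update_apply, hg.eq_iff, ha, hv]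
    · intro b hb
      simp only [RAMState.setArr]
      rw [Function.update_of_ne (hb a)]
  | seq _ _ ih1 ih2 =>
    intro S hv ha
    obtain ⟨S1, e1, hv1, ha1, fv1, fa1⟩ := ih1 S hv ha
    obtain ⟨S2, e2, hv2, ha2, fv2, fa2⟩ := ih2 S1 hv1 ha1
    exact ⟨S2, Exec.seq e1 e2, hv2, ha2, fun y hy => (fv2 y hy).trans (fv1 y hy),
      fun y hy => (fa2 y hy).trans (fa1 y hy)⟩
  | iteTrue h0 _ ih =>
    intro S hv ha
    obtain ⟨S1, e1, r⟩ := ih S hv ha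
    exact ⟨S1, Exec.iteTrue (by rwa [hv]) e1, r⟩
  | iteFalse h0 _ ih =>
    intro S hv ha
    obtain ⟨S1, e1, r⟩ := ih S hv ha
    exact ⟨S1, Exec.iteFalse (by rwa [hv]) e1, r⟩
  | loopDone h0 =>
    intro S hv ha
    exact ⟨S, Exec.loopDone (by rwa [hv]), hv, ha, fun _ _ => rfl, fun _ _ => rfl⟩
  | loopStep h0 _ _ ih1 ih2 =>
    intro S hv ha
    obtain ⟨S1, e1, hv1, ha1, fv1, fa1⟩ := ih1 S hv ha
    obtain ⟨S2, e2, hv2, ha2, fv2, fa2⟩ := ih2 S1 hv1 ha1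
    exact ⟨S2, Exec.loopStep (by rwa [hv]) e1 e2, hv2, ha2,
      fun y hy => (fv2 y hy).trans (fv1 y hy), fun y hy => (fa2 y hy).trans (fa1 y hy)⟩

/-- On words of `w` bits, `pm` multiplies matrices of order `r ≤ smax` with entries at most `Mx` in
time `r ^ 2 * Φ`. -/
def Multiplies (w : ℕ) (pm : Prog) (Φ smax Mx : ℕ) : Prop :=
  ∀ (r : ℕ) (A B : Matrix (Fin r) (Fin r) ℤ), 1 ≤ r → r ≤ smax →
    (∀ i j, |A i j| ≤ (Mx : ℤ)) → (∀ i j, |B i j| ≤ (Mx : ℤ)) →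
    ∀ s : RAMState w, s.var 0 = BitVec.ofNat w r → s.HoldsMatrix 0 A → s.HoldsMatrix 1 B →
      ∃ t s', Exec pm s t s' ∧ t ≤ r ^ 2 * Φ ∧ s'.HoldsMatrix 2 (A * B)

theorem BitVec.ofInt_natCast' {w : ℕ} (n : ℕ) : BitVec.ofInt w (n : ℤ) = BitVec.ofNat w n := by
  simp

/-- Natural numbers and two's complement agree modulo 2^w, and an entry of the product is at most r
· Mx² < 2^w, so it is read back exactly. The two factors may be destroyed. -/
theorem Ht.mm {w : ℕ} {pm : Prog} {Φ smax Mx : ℕ} (hpm : Multiplies w pm Φ smax Mx) {σ : St}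
    {x : Var} {r : ℕ} (hr : σ.var x = r) (h1 : 1 ≤ r) (h2 : r ≤ smax)
    (hA : ∀ i < r * r, σ.arr .mA i ≤ Mx) (hB : ∀ i < r * r, σ.arr .mB i ≤ Mx)
    (hw : r * r < 2 ^ w) (hw' : r * (Mx * Mx) < 2 ^ w) :
    Ht w pm (.mm x) σ (1 + r ^ 2 * Φ) (fun τ => ∀ y < r, ∀ c < r,
      τ.arr .mC (y * r + c) = ∑ i ∈ Finset.range r, σ.arr .mA (y * r + i) * σ.arr .mB (i * r + c)) := by
  intro s hs
  set S := s.setVar 2 (s.var x.phys) with hS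
  have hS' : Models S σ := hs.setTemp 2 (by decide) _
  have idx : ∀ i j : Fin r, (i : ℕ) * r + j < r * r := fun i j => by
    have := i.2; have := j.2; nlinarith
  let A : Matrix (Fin r) (Fin r) ℤ := fun i j => (σ.arr .mA (i * r + j) : ℤ)
  let B : Matrix (Fin r) (Fin r) ℤ := fun i j => (σ.arr .mB (i * r + j) : ℤ)
  have hfi : Function.Injective (fun x : ℕ => 3 * x + 2) := fun a b h => by simpa using h
  have hgi : Function.Injective (fun a : ℕ => a + Arr.mA.ctorIdx) := fun a b h => by simpa using h
  have holds : ∀ (a : Arr) (b : ℕ), b + Arr.mA.ctorIdx = a.ctorIdx →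
      RAMState.HoldsMatrix (⟨fun x => S.var (3 * x + 2), fun a => S.arr (a + Arr.mA.ctorIdx)⟩ : RAMState w)
        b (fun i j : Fin r => (σ.arr a (i * r + j) : ℤ)) := by
    intro a b hab i j
    simp only [hab]
    rw [BitVec.ofInt_natCast']
    apply BitVec.eq_of_toNat_eq
    rw [hS'.arr a _ ((idx i j).trans hw), BitVec.toNat_ofNat, Nat.mod_eq_of_lt]
    rw [← hS'.arr a _ ((idx i j).trans hw)]
    exact BitVec.isLt _
  obtain ⟨t, s', he, ht, hC⟩ := hpm r A B h1 h2
    (fun i j => by simp only [A, Nat.abs_cast]; exact_mod_cast hA _ (idx i j))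
    (fun i j => by simp only [B, Nat.abs_cast]; exact_mod_cast hB _ (idx i j))
    ⟨fun x => S.var (3 * x + 2), fun a => S.arr (a + Arr.mA.ctorIdx)⟩
    (by
      apply BitVec.eq_of_toNat_eq
      simp only [hS, RAMState.setVar]
      rw [Function.update_self, hs.var, hr, BitVec.toNat_ofNat, Nat.mod_eq_of_lt]
      rw [← hr, ← hs.var]; exact BitVec.isLt _)
    (holds .mA 0 rfl) (holds .mB 1 rfl)
  obtain ⟨S', e, -, ka, kv, kb⟩ := he.rename hfi hgi S (fun _ => rfl) (fun _ => rfl)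
  have hsmall : ∀ a : Arr, a ∉ [Arr.mA, .mB, .mC] → a.ctorIdx < Arr.mA.ctorIdx := by
    intro a ha
    cases a <;> first | decide | simp at ha
  -- The multiplication may leave anything in its three arrays; the new abstract state reads these
  -- off the machine and keeps the rest of the old state.
  refine ⟨1 + t, S', ⟨σ.var, fun a i => if a ∈ [Arr.mA, .mB, .mC] then
      (S'.arr a.ctorIdx (BitVec.ofNat w i)).toNat else σ.arr a i⟩,
    Exec.seq (Exec.op _ .bor 2 x.phys x.phys) ?_, ?_, ⟨fun y => ?_, fun a i hi => ?_⟩, ⟨fun y hy => rfl, fun a ha => ?_⟩, ?_⟩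
  · simpa [WordOp.eval, Prog.shift, hS] using e
  · omega
  · rw [kv _ (fun z => by unfold Var.phys; omega), hS'.var]
  · simp only
    split_ifs with h
    · rfl
    · rw [kb _ (fun z => by have := hsmall a h; omega), hS'.arr a i hi]
  · funext i
    simp only [Cm.wa] at ha
    simp only [if_neg ha]
  · intro y hy c hc
    simp only [List.mem_cons, true_or, or_true, if_true]
    have h3 := hC ⟨y, hy⟩ ⟨c, hc⟩
    have h4 := ka 2
    have h5 : 2 + Arr.mA.ctorIdx = Arr.mC.ctorIdx := rfl
    simp only [h5] at h4
    rw [h4, h3, Matrix.mul_apply]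
    have h6 : (∑ j, A ⟨y, hy⟩ j * B j ⟨c, hc⟩) =
        ((∑ i ∈ Finset.range r, σ.arr .mA (y * r + i) * σ.arr .mB (i * r + c) : ℕ) : ℤ) := by
      rw [Finset.sum_range]; push_cast; rfl
    rw [h6, BitVec.ofInt_natCast', BitVec.toNat_ofNat, Nat.mod_eq_of_lt]
    refine lt_of_le_of_lt ?_ hw'
    refine (Finset.sum_le_card_nsmul _ _ (Mx * Mx) fun i hi => ?_).trans (by simp)
    have hi := Finset.mem_range.1 hi
    exact Nat.mul_le_mul (hA _ (by nlinarith)) (hB _ (by nlinarith))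

/-! ## The exponent of matrix multiplication is at least two -/

/-- A program changes at most one cell per unit of time. -/
theorem Exec.card_changed {w : ℕ} {p : Prog} {s s' : RAMState w} {t : ℕ} (h : Exec p s t s') :
    ∃ F : Finset (ℕ × BitVec w), F.card ≤ t ∧ ∀ a k, s'.arr a k ≠ s.arr a k → (a, k) ∈ F := by
  classical
  induction h with
  | skip | const | op | load | loopDone => exact ⟨∅, by simp, fun a k h => absurd rfl h⟩
  | store s a x y =>
    refine ⟨{(a, s.var x)}, by simp, fun b k h => ?_⟩
    by_contra hn
    apply h
    simp only [Finset.mem_singleton, Prod.mk.injEq, not_and] at hn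
    simp only [RAMState.setArr]
    by_cases e : b = a
    · subst e
      rw [Function.update_self, Function.update_of_ne (hn rfl)]
    · rw [Function.update_of_ne e]
  | seq _ _ ih1 ih2 =>
    obtain ⟨F, hF, h1⟩ := ih1
    obtain ⟨G, hG, h2⟩ := ih2
    refine ⟨F ∪ G, (Finset.card_union_le _ _).trans (by omega), fun a k h => ?_⟩
    by_cases e : (a, k) ∈ G
    · simp [e]
    · have : _ = _ := not_not.1 (mt (h2 a k) e)
      rw [this] at h
      simp [h1 a k h]
  | iteTrue _ _ ih | iteFalse _ _ ih =>
    obtain ⟨F, hF, h1⟩ := ih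
    exact ⟨F, by omega, h1⟩
  | loopStep _ _ _ ih1 ih2 =>
    obtain ⟨F, hF, h1⟩ := ih1
    obtain ⟨G, hG, h2⟩ := ih2
    refine ⟨F ∪ G, (Finset.card_union_le _ _).trans (by omega), fun a k h => ?_⟩
    by_cases e : (a, k) ∈ G
    · simp [e]
    · have : _ = _ := not_not.1 (mt (h2 a k) e)
      rw [this] at h
      simp [h1 a k h]

/-- Multiply two zero matrices when every cell of the output array initially holds 1: all r² entries
must change, and a unit of time changes at most one cell. -/
theorem MatrixMultiplicationInTime.sq_le {p : Prog} {C ω : ℝ} {c : ℕ}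
    (h : ∀ (r M w : ℕ) (A B : Matrix (Fin r) (Fin r) ℤ),
      1 ≤ r → (∀ i j, |A i j| ≤ (M : ℤ)) → (∀ i j, |B i j| ≤ (M : ℤ)) →
      (r + M + 2) ^ c ≤ 2 ^ w →
      ∀ s : RAMState w, s.var 0 = BitVec.ofNat w r → s.HoldsMatrix 0 A → s.HoldsMatrix 1 B →
        p.RunsWithin s (C * (r : ℝ) ^ ω) (fun s' => s'.HoldsMatrix 2 (A * B)))
    (r : ℕ) (hr : 1 ≤ r) : (r : ℝ) ^ 2 ≤ C * (r : ℝ) ^ ω := by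
  classical
  -- Words long enough for the multiplication program and for the r² addresses of the output to be
  -- distinct.
  obtain ⟨w, hw⟩ : ∃ w : ℕ, (r + 0 + 2) ^ c + r * r + 2 < 2 ^ w := ⟨_, Nat.lt_two_pow_self⟩
  have hw1 : 1 < 2 ^ w := by omega
  obtain ⟨t, s', he, ht, hC⟩ := h r 0 w 0 0 hr (by simp) (by simp) (by omega)
    ⟨fun _ => BitVec.ofNat w r, fun a _ => if a = 2 then 1#w else 0#w⟩ rfl
    (fun i j => by simp) (fun i j => by simp)
  obtain ⟨F, hF, h1⟩ := he.card_changed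
  have hinj : (r * r) ≤ F.card := by
    have : (Finset.univ : Finset (Fin r × Fin r)).card ≤ F.card := by
      refine Finset.card_le_card_of_injOn
        (fun q => (2, BitVec.ofNat w ((q.1 : ℕ) * r + q.2))) ?_ ?_
      · intro q _
        apply h1
        rw [hC q.1 q.2]
        simp only [if_true]
        intro h0
        have := congrArg BitVec.toNat h0
        simp [Nat.mod_eq_of_lt hw1] at this
      · intro q _ q' _ hq
        have hlt : ∀ q : Fin r × Fin r, (q.1 : ℕ) * r + q.2 < r * r := fun q => by
          have := q.1.2; have := q.2.2; nlinarith
        have h2 := congrArg BitVec.toNat (Prod.ext_iff.1 hq).2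
        simp only [BitVec.toNat_ofNat] at h2
        rw [Nat.mod_eq_of_lt (by have := hlt q; omega),
          Nat.mod_eq_of_lt (by have := hlt q'; omega)] at h2
        have e1 : (q.1 : ℕ) = q'.1 := by
          have := congrArg (· / r) h2
          simpa [Nat.add_div_of_dvd_right, Nat.mul_add_div, mul_comm _ r, Nat.mul_add_div (show 0 < r by omega),
            Nat.div_eq_of_lt q.2.2, Nat.div_eq_of_lt q'.2.2] using this
        rw [e1] at h2
        exact Prod.ext (Fin.ext e1) (Fin.ext (by omega))
    simpa using this
  have : ((r * r : ℕ) : ℝ) ≤ t := by exact_mod_cast hinj.trans hF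
  push_cast at this
  nlinarith

/-- For ω < 2 the power r^(2 - ω) would be unbounded, whereas C bounds it. -/
theorem two_le_of_sq_le {C ω : ℝ} (h : ∀ r : ℕ, 1 ≤ r → (r : ℝ) ^ 2 ≤ C * (r : ℝ) ^ ω) : 2 ≤ ω := by
  by_contra! hω
  have hlim : Filter.Tendsto (fun r : ℕ => (r : ℝ) ^ (2 - ω)) Filter.atTop Filter.atTop :=
    (tendsto_rpow_atTop (by linarith)).comp tendsto_natCast_atTop_atTop
  obtain ⟨r, hr1, hr⟩ := ((Filter.eventually_ge_atTop 1).and (hlim.eventually_gt_atTop C)).exists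
  have hpos : (0 : ℝ) < r := by exact_mod_cast hr1
  have h1 := h r hr1
  rw [Real.rpow_sub hpos, Real.rpow_two, lt_div_iff₀ (Real.rpow_pos_of_pos hpos ω)] at hr
  linarith

/-! ## Least rotations and periods of strings -/

/-- The letters of `f` on `[0, n)` have the period `p`. -/
def HasPer (f : ℕ → ℕ) (n p : ℕ) : Prop := ∀ i, i + p < n → f i = f (i + p)

theorem HasPer.eq_mod {f : ℕ → ℕ} {n p : ℕ} (h : HasPer f n p) (i : ℕ) (hi : i < n) :
    f i = f (i % p) := by
  induction i using Nat.strong_induction_on with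
  | _ i ih =>
    rcases Nat.lt_or_ge i p with h1 | h1
    · rw [Nat.mod_eq_of_lt h1]
    · rcases Nat.eq_zero_or_pos p with rfl | hp
      · simp
      · have h2 := h (i - p) (by omega)
        rw [Nat.sub_add_cancel h1] at h2
        rw [← h2, ih (i - p) (by omega) (by omega), Nat.mod_eq_sub_mod h1]

/-- The suffix of an infinite word from `s` on, in the lexicographic order. -/
def suffix (e : ℕ → ℕ) (s : ℕ) : Lex (ℕ → ℕ) := toLex fun x => e (s + x)

theorem suffix_lt {e : ℕ → ℕ} {a b k : ℕ} (h : ∀ x < k, e (a + x) = e (b + x))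
    (hk : e (a + k) < e (b + k)) : suffix e a < suffix e b := ⟨k, h, hk⟩

/-- `e` has the period `p`, and no smaller one. -/
structure Primitive (e : ℕ → ℕ) (p : ℕ) : Prop where
  pos : 1 ≤ p
  per : ∀ t, e (t + p) = e t
  prim : ∀ d, 0 < d → d < p → ∃ t, e (t + d) ≠ e t

namespace Primitive
variable {e : ℕ → ℕ} {p : ℕ}

theorem per_mul (h : Primitive e p) (t k : ℕ) : e (t + k * p) = e t := by
  induction k with
  | zero => simp
  | succ k ih => rw [Nat.succ_mul, ← Nat.add_assoc, h.per, ih]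

theorem per_mod (h : Primitive e p) (t : ℕ) : e (t % p) = e t := by
  conv_rhs => rw [← Nat.mod_add_div t p, Nat.mul_comm]
  rw [h.per_mul]

theorem congr (h : Primitive e p) {a b : ℕ} (hab : a % p = b % p) : e a = e b := by
  rw [← h.per_mod a, hab, h.per_mod]

theorem suffix_congr (h : Primitive e p) {a b : ℕ} (hab : a % p = b % p) :
    suffix e a = suffix e b := by
  have : (fun x => e (a + x)) = fun x => e (b + x) :=
    funext fun x => h.congr (Nat.ModEq.add_right x hab)
  exact congrArg toLex this

/-- If the suffixes at a and b are equal but b - a is not a multiple of p, its residue modulo p is a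
smaller period. Multiples of p are added so that the truncated subtraction of a is exact. -/
theorem mod_eq (h : Primitive e p) {a b : ℕ} (hab : ∀ x, e (a + x) = e (b + x)) :
    a % p = b % p := by
  have key : ∀ {a b : ℕ}, a ≤ b → (∀ x, e (a + x) = e (b + x)) → a % p = b % p := by
    intro a b hle hab
    by_contra hne
    have hd : 0 < (b - a) % p := by
      rcases Nat.eq_zero_or_pos ((b - a) % p) with h0 | h0
      · exact absurd ((Nat.modEq_iff_dvd' hle).2 (Nat.dvd_of_mod_eq_zero h0)) hne
      · exact h0
    obtain ⟨t, ht⟩ := h.prim _ hd (Nat.mod_lt _ h.pos)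
    apply ht
    have h1 : a ≤ a * p := Nat.le_mul_of_pos_right a h.pos
    rw [← h.per_mul t a, h.congr (a := t + (b - a) % p) (b := t + (b - a)) (by simp [Nat.add_mod]),
      ← h.per_mul (t + (b - a)) a]
    have h2 := hab (t + a * p - a)
    rw [show a + (t + a * p - a) = t + a * p by omega,
      show b + (t + a * p - a) = t + (b - a) + a * p by omega] at h2
    exact h2.symm
  rcases le_total a b with hle | hle
  · exact key hle hab
  · exact (key hle fun x => (hab x).symm).symm

theorem mod_eq_of_lt (h : Primitive e p) {a b : ℕ} (hab : ∀ x < p, e (a + x) = e (b + x)) :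
    a % p = b % p := by
  refine h.mod_eq fun x => ?_
  rw [h.congr (a := a + x) (b := a + x % p) (by simp), h.congr (a := b + x) (b := b + x % p) (by simp)]
  exact hab _ (Nat.mod_lt _ h.pos)

theorem exists_min (h : Primitive e p) : ∃ m < p, ∀ s, suffix e m ≤ suffix e s := by
  obtain ⟨m, hm, hmin⟩ := Finset.exists_min_image (Finset.range p) (suffix e)
    ⟨0, Finset.mem_range.2 h.pos⟩
  refine ⟨m, Finset.mem_range.1 hm, fun s => ?_⟩
  rw [h.suffix_congr (a := s) (b := s % p) (by simp)]
  exact hmin _ (Finset.mem_range.2 (Nat.mod_lt _ h.pos))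

theorem shift (h : Primitive e p) (a : ℕ) : Primitive (fun x => e (a + x)) p := by
  refine ⟨h.pos, fun t => ?_, fun d h0 hd => ?_⟩
  · simp only [← Nat.add_assoc, h.per]
  · by_contra! hc
    have := h.mod_eq (a := a + d) (b := a) fun x => by rw [← hc x]; congr 1; omega
    have h2 : a + d ≡ a + 0 [MOD p] := this
    have h3 := Nat.ModEq.add_left_cancel' a h2
    rw [Nat.ModEq, Nat.mod_eq_of_lt hd, Nat.zero_mod] at h3
    omega

end Primitive

/-- One step of the search for the least rotation of `f` on `[0, n)`: two candidates `i < j`, which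
agree on `k` letters. -/
def rotStep (f : ℕ → ℕ) (n : ℕ) (q : ℕ × ℕ × ℕ) : ℕ × ℕ × ℕ :=
  if q.2.1 + q.2.2 < n then
    if f (q.1 + q.2.2) = f (q.2.1 + q.2.2) then (q.1, q.2.1, q.2.2 + 1)
    else if f (q.2.1 + q.2.2) < f (q.1 + q.2.2) then
      (max (q.1 + q.2.2 + 1) q.2.1, max (q.1 + q.2.2 + 1) q.2.1 + 1, 0)
    else (q.1, q.2.1 + q.2.2 + 1, 0)
  else q

/-- The state of the search after `z` steps. -/
def rotIter (f : ℕ → ℕ) (n z : ℕ) : ℕ × ℕ × ℕ := (rotStep f n)^[z] (0, 1, 0)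

theorem rotIter_succ (f : ℕ → ℕ) (n z : ℕ) : rotIter f n (z + 1) = rotStep f n (rotIter f n z) :=
  Function.iterate_succ_apply' _ _ _

/-- The sum of the two candidates and the common length grows in every step of a running search. It
stays below 2n, since i < j and j + k < n; hence 2n steps suffice. -/
theorem rotIter_inv {f : ℕ → ℕ} {n : ℕ} (hn : 1 ≤ n) (z : ℕ) :
    (rotIter f n z).1 < (rotIter f n z).2.1 ∧ (rotIter f n z).2.1 + (rotIter f n z).2.2 ≤ n ∧
    (∀ t < (rotIter f n z).2.2, f ((rotIter f n z).1 + t) = f ((rotIter f n z).2.1 + t)) ∧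
    ((rotIter f n z).2.1 + (rotIter f n z).2.2 < n →
      z + 1 ≤ (rotIter f n z).1 + (rotIter f n z).2.1 + (rotIter f n z).2.2) := by
  induction z with
  | zero => simp [rotIter, hn]
  | succ z ih =>
    rw [rotIter_succ]
    generalize rotIter f n z = q at *
    obtain ⟨i, j, k⟩ := q
    simp only at ih
    obtain ⟨h1, h2, h3, h4⟩ := ih
    unfold rotStep
    simp only
    split_ifs with c1 c2 c3
    · refine ⟨h1, by simp only; omega, fun t ht => ?_, by simp only; omega⟩
      simp only at ht ⊢
      rcases Nat.lt_succ_iff_lt_or_eq.1 ht with h | rfl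
      · exact h3 t h
      · exact c2
    · exact ⟨by simp, by simp only; omega, by simp, by simp only; omega⟩
    · exact ⟨by simp only; omega, by simp only; omega, by simp, by simp only; omega⟩
    · exact ⟨h1, h2, h3, fun h => absurd h c1⟩

theorem rotIter_done {f : ℕ → ℕ} {n : ℕ} (hn : 1 ≤ n) :
    (rotIter f n (2 * n)).2.1 + (rotIter f n (2 * n)).2.2 = n := by
  obtain ⟨h1, h2, -, h4⟩ := rotIter_inv (f := f) hn (2 * n)
  by_contra h
  have := h4 (by omega)
  omega

/-- When the candidates part after k common letters, every start among the k + 1 positions from the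
loser on is beaten by the start at the same offset from the winner. So of the starts below j only i
can be least. -/
theorem rotIter_elim {e f : ℕ → ℕ} {n : ℕ} (hn : 1 ≤ n) (hf : ∀ t < n, f t = e t) (z : ℕ) :
    ∀ t < (rotIter f n z).2.1, t ≠ (rotIter f n z).1 → ∃ s, suffix e s < suffix e t := by
  induction z with
  | zero => intro t ht h; simp [rotIter] at ht h; omega
  | succ z ih =>
    have inv := rotIter_inv (f := f) hn z
    rw [rotIter_succ]
    generalize rotIter f n z = q at *
    obtain ⟨i, j, k⟩ := q
    simp only at ih inv
    obtain ⟨h1, h2, h3, -⟩ := inv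
    unfold rotStep
    simp only
    split_ifs with c1 c2 c3
    · exact ih
    · intro t ht hne
      simp only at ht hne
      by_cases h5 : i ≤ t ∧ t ≤ i + k
      · refine ⟨j + (t - i), suffix_lt (k := k - (t - i)) (fun x hx => ?_) ?_⟩
        · have := h3 (t - i + x) (by omega)
          rw [hf _ (by omega), hf _ (by omega)] at this
          rw [show t + x = i + (t - i + x) by omega, this]
          congr 1; omega
        · rw [hf _ (by omega), hf _ (by omega)] at c3
          rw [show j + (t - i) + (k - (t - i)) = j + k by omega, show t + (k - (t - i)) = i + k by omega]
          exact c3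
      · exact ih t (by omega) (by omega)
    · intro t ht hne
      simp only at ht hne
      by_cases h5 : j ≤ t
      · refine ⟨i + (t - j), suffix_lt (k := k - (t - j)) (fun x hx => ?_) ?_⟩
        · have := h3 (t - j + x) (by omega)
          rw [hf _ (by omega), hf _ (by omega)] at this
          rw [show t + x = j + (t - j + x) by omega, ← this]
          congr 1; omega
        · rw [hf _ (by omega), hf _ (by omega)] at c2 c3
          rw [show i + (t - j) + (k - (t - j)) = i + k by omega, show t + (k - (t - j)) = j + k by omega]
          omega
      · exact ih t (by omega) hne
    · exact ih

/-- The start of the least rotation of `f` on `[0, n)`. -/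
def rotStart (f : ℕ → ℕ) (n : ℕ) : ℕ := (rotIter f n (2 * n)).1
/-- The period that the search for the least rotation finds. -/
def rotPer (f : ℕ → ℕ) (n : ℕ) : ℕ := (rotIter f n (2 * n)).2.1 - (rotIter f n (2 * n)).1

theorem rotPer_pos {f : ℕ → ℕ} {n : ℕ} (hn : 1 ≤ n) : 1 ≤ rotPer f n := by
  have := (rotIter_inv (f := f) hn (2 * n)).1
  unfold rotPer; omega

theorem rotStart_add_rotPer_le {f : ℕ → ℕ} {n : ℕ} (hn : 1 ≤ n) : rotStart f n + rotPer f n ≤ n := by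
  obtain ⟨h1, h2, -, -⟩ := rotIter_inv (f := f) hn (2 * n)
  unfold rotPer rotStart; omega

/-- The search ends with j + k = n. Let m < p be a least start; m and m + p can lie below j only if
they equal i. If j < i + p and k ≥ p, agreement on p letters would make i and j congruent modulo p.
With three periods available this leaves only i = m and j = m + p. -/
theorem Primitive.rot {e f : ℕ → ℕ} {n p : ℕ} (h : Primitive e p) (hf : ∀ t < n, f t = e t)
    (hn : 3 * p ≤ n) : rotPer f n = p ∧ rotStart f n < p ∧ ∀ s, suffix e (rotStart f n) ≤ suffix e s := by
  have hp := h.pos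
  have hn1 : 1 ≤ n := by omega
  obtain ⟨m, hm, hmin⟩ := h.exists_min
  obtain ⟨h1, h2, h3, -⟩ := rotIter_inv (f := f) hn1 (2 * n)
  have h5 := rotIter_done (f := f) hn1
  have h6 := rotIter_elim hn1 hf (2 * n)
  unfold rotPer rotStart
  generalize rotIter f n (2 * n) = q at *
  obtain ⟨i, j, k⟩ := q
  simp only at *
  have hm1 : m < j → m = i := fun hj => by
    by_contra hne
    obtain ⟨s, hs⟩ := h6 m hj hne
    exact absurd hs (not_lt.2 (hmin s))
  have hm2 : m + p < j → m + p = i := fun hj => by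
    by_contra hne
    obtain ⟨s, hs⟩ := h6 (m + p) hj hne
    rw [h.suffix_congr (a := m + p) (b := m) (by simp)] at hs
    exact absurd hs (not_lt.2 (hmin s))
  have clash : j < i + p → p ≤ k → False := fun hj hk => by
    have := h.mod_eq_of_lt (a := i) (b := j) fun x hx => by
      have := h3 x (by omega)
      rwa [hf _ (by omega), hf _ (by omega)] at this
    have h7 : i + 0 ≡ i + (j - i) [MOD p] := by
      rw [Nat.add_sub_cancel' h1.le]; exact this
    have h8 := Nat.ModEq.add_left_cancel' i h7
    rw [Nat.ModEq, Nat.mod_eq_of_lt (show j - i < p by omega), Nat.zero_mod] at h8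
    omega
  rcases Nat.lt_or_ge m j with hj | hj
  · obtain rfl := hm1 hj
    have h9 : j = m + p := by
      by_contra hne
      rcases Nat.lt_or_ge j (m + p) with h10 | h10
      · exact clash h10 (by omega)
      · have := hm2 (by omega); omega
    exact ⟨by omega, hm, hmin⟩
  · exact (clash (by omega) (by omega)).elim

/-! ### Occurrences of periodic strings, read off from roots and phases -/

/-- The strings of the instance, as the algorithm uses them: the smallest period `p` of `f` on
`[0, k)` is small. -/
structure StrOk (L : ℕ) (f : ℕ → ℕ) (k p : ℕ) : Prop where
  pos : 1 ≤ p
  per : HasPer f k p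
  min : ∀ d, 1 ≤ d → HasPer f k d → p ≤ d
  small : 9 * p ≤ 2 * L
  le : L ≤ k
  lt : 9 * k < 10 * L
  five : 5 ≤ L

namespace StrOk
variable {L k p : ℕ} {f : ℕ → ℕ}

/-- A period d < p of the infinite repetition would be a period of `f` on [0, k) as well. -/
theorem primitive (h : StrOk L f k p) : Primitive (fun t => f (t % p)) p := by
  refine ⟨h.pos, fun t => by simp, fun d h0 hd => ?_⟩
  by_contra! hc
  have : HasPer f k d := fun i hi => by
    rw [h.per.eq_mod i (by omega), h.per.eq_mod (i + d) hi, hc i]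
  exact absurd (h.min d h0 this) (by omega)

theorem rot (h : StrOk L f k p) : rotPer f k = p ∧ rotStart f k < p ∧
    ∀ s, suffix (fun t => f (t % p)) (rotStart f k) ≤ suffix (fun t => f (t % p)) s :=
  h.primitive.rot (fun t ht => h.per.eq_mod t ht) (by have := h.small; have := h.le; omega)

end StrOk

/-- `[lo, hi)` is the extent of the period `p` of `f` around `[c, c + p)`, as far as `s` on the left
and `lim` on the right. -/
structure Extent (f : ℕ → ℕ) (m s c p lim lo hi : ℕ) : Prop where
  lo_ge : s ≤ lo
  lo_le : lo ≤ c
  lo_per : ∀ y, lo ≤ y → y < c → f y = f (y + p)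
  lo_max : lo = s ∨ f (lo - 1) ≠ f (lo - 1 + p)
  hi_ge : c + p ≤ hi
  hi_le : hi ≤ m
  hi_per : ∀ y, c ≤ y → y + p < hi → f y = f (y + p)
  hi_max : hi = m ∨ lim ≤ hi ∨ f (hi - p) ≠ f hi

theorem Extent.per {f : ℕ → ℕ} {m s c p lim lo hi : ℕ} (h : Extent f m s c p lim lo hi) (y : ℕ)
    (h1 : lo ≤ y) (h2 : y + p < hi) : f y = f (y + p) := by
  rcases Nat.lt_or_ge y c with h3 | h3
  · exact h.lo_per y h1 h3
  · exact h.hi_per y h3 h2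

theorem Extent.congr {f : ℕ → ℕ} {m s c p lim lo hi : ℕ} (h : Extent f m s c p lim lo hi) {y z : ℕ}
    (h1 : lo ≤ y) (h2 : y < hi) (h3 : lo ≤ z) (h4 : z < hi) (h5 : y % p = z % p) : f y = f z := by
  have hper : HasPer (fun t => f (lo + t)) (hi - lo) p := fun i hi => by
    have := h.per (lo + i) (by omega) (by omega)
    simpa [Nat.add_assoc] using this
  have e1 := hper.eq_mod (y - lo) (by omega)
  have e2 := hper.eq_mod (z - lo) (by omega)
  simp only [Nat.add_sub_cancel' h1, Nat.add_sub_cancel' h3] at e1 e2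
  have h6 : (y - lo) % p = (z - lo) % p := by
    have : lo + (y - lo) ≡ lo + (z - lo) [MOD p] := by
      rw [Nat.add_sub_cancel' h1, Nat.add_sub_cancel' h3]; exact h5
    exact Nat.ModEq.add_left_cancel' lo this
  rw [e1, e2, h6]

/-- The string `g` of length `k` occurs in `f` at the position `a`. -/
def Occurs (f : ℕ → ℕ) (m : ℕ) (g : ℕ → ℕ) (k a : ℕ) : Prop := a + k ≤ m ∧ ∀ t < k, f (a + t) = g t

/-- The phase of a position `x` before the start of the root. -/
def phase (p x : ℕ) : ℕ := (p - x % p) % p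

theorem phase_add {p : ℕ} (hp : 1 ≤ p) (x : ℕ) : (phase p x + x) % p = 0 := by
  unfold phase
  rw [Nat.mod_add_mod, ← Nat.add_mod_mod, Nat.sub_add_cancel (Nat.mod_lt x hp).le, Nat.mod_self]

theorem phase_lt {p : ℕ} (hp : 1 ≤ p) (x : ℕ) : phase p x < p := Nat.mod_lt _ hp

section
variable {f g : ℕ → ℕ} {m L k p s a lo hi q : ℕ}

/-- Let α be the phase of the string. The equation of phases puts a + t into the residue class
modulo p of letter number (α + t) mod p of the root in the window. Both positions lie in the extent,
so they carry the same letter, and equality of the roots identifies it with letter t of the string.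
-/
theorem occurs_of_phase (hs : StrOk L g k p) (hp : q = p)
    (hroot : ∀ t < q, f (s + (L / 9 + 1) + rotStart (fun t => f (s + (L / 9 + 1) + t)) (L - (L / 9 + 1)) + t) =
      g (rotStart g k + t))
    (hq : q = rotPer (fun t => f (s + (L / 9 + 1) + t)) (L - (L / 9 + 1)))
    (hx : Extent f m s (s + (L / 9 + 1)) q (s + (L / 9 + 1) + 2 * L) lo hi)
    (hhi : s + L ≤ hi) (hlo : lo ≤ a) (hak : a + k ≤ hi)
    (hph : (phase q (L / 9 + 1 + rotStart (fun t => f (s + (L / 9 + 1) + t)) (L - (L / 9 + 1))) +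
      (a - s)) % q = phase q (rotStart g k)) : Occurs f m g k a := by
  subst hp
  have h5 := hs.five
  have hrs := rotStart_add_rotPer_le (f := fun t => f (s + (L / 9 + 1) + t))
    (n := L - (L / 9 + 1)) (by omega)
  rw [← hq] at hrs
  generalize rotStart (fun t => f (s + (L / 9 + 1) + t)) (L - (L / 9 + 1)) = i at *
  obtain ⟨hr1, hr2, -⟩ := hs.rot
  have hpos := hs.pos
  have hsm := hs.small
  have hk := hs.le
  generalize rotStart g k = j at *
  refine ⟨hak.trans hx.hi_le, fun t ht => ?_⟩
  have e1 := phase_add hpos (L / 9 + 1 + i)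
  have e2 := phase_add hpos j
  have hlos := hx.lo_ge
  have hloc := hx.lo_le
  generalize phase q (L / 9 + 1 + i) = δ at *
  generalize phase q j = α at *
  -- `a + t` and `s + B + i + ((α + t) % q)` are congruent
  have hα : t % q = (j + (α + t) % q) % q := by
    rw [Nat.add_mod_mod, show j + (α + t) = (α + j) + t by omega, Nat.add_mod, e2]; simp
  have h1 : (a + t) % q = (s + (L / 9 + 1) + i + (α + t) % q) % q := by
    rw [Nat.add_mod_mod]
    have h2 : δ + (L / 9 + 1 + i) ≡ 0 [MOD q] := by simpa [Nat.ModEq] using e1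
    have h3 : δ + (a - s) ≡ α [MOD q] := by
      rw [Nat.ModEq, hph, ← hph, Nat.mod_mod]
    have h4 : δ + (a + t) ≡ δ + (s + (L / 9 + 1) + i + (α + t)) [MOD q] := by
      calc δ + (a + t) = (δ + (a - s)) + (s + t) := by omega
        _ ≡ α + (s + t) [MOD q] := h3.add_right _
        _ = 0 + (s + α + t) := by omega
        _ ≡ δ + (L / 9 + 1 + i) + (s + α + t) [MOD q] := (h2.add_right _).symm
        _ = δ + (s + (L / 9 + 1) + i + (α + t)) := by omega
    exact Nat.ModEq.add_left_cancel' δ h4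
  have hm := Nat.mod_lt (α + t) hpos
  rw [hx.congr (by omega) (by omega) (by omega) (by omega) h1, hroot _ hm]
  rw [hs.per.eq_mod t ht, hs.per.eq_mod (j + (α + t) % q) (by omega), hα]

/-- Because k ≥ L, an occurrence that starts in [s, s + B) contains the window [s + B, s + L). The
window is a factor of the repeated root of length at least 3p, so the search for least rotations
finds the same period and root in it as in the string. Inside the occurrence no extension of the
period can stop. -/
theorem phase_of_occurs (hs : StrOk L g k p) (ho : Occurs f m g k a) (h1 : s ≤ a)
    (h2 : a < s + (L / 9 + 1))
    (hq : q = rotPer (fun t => f (s + (L / 9 + 1) + t)) (L - (L / 9 + 1))) :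
    q = p ∧ 3 * q ≤ L - (L / 9 + 1) ∧
    (∀ t < q, f (s + (L / 9 + 1) + rotStart (fun t => f (s + (L / 9 + 1) + t)) (L - (L / 9 + 1)) + t) =
      g (rotStart g k + t)) ∧
    (phase q (L / 9 + 1 + rotStart (fun t => f (s + (L / 9 + 1) + t)) (L - (L / 9 + 1))) +
      (a - s)) % q = phase q (rotStart g k) ∧
    ∀ lo hi, Extent f m s (s + (L / 9 + 1)) q (s + (L / 9 + 1) + 2 * L) lo hi →
      s + L ≤ hi ∧ lo ≤ a ∧ a + k ≤ hi := by
  have h5 := hs.five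
  have hpos := hs.pos
  have hsm := hs.small
  have hkl := hs.le
  have hku := hs.lt
  have h3p : 3 * p ≤ L - (L / 9 + 1) := by omega
  set d := s + (L / 9 + 1) - a with hd
  have hwin : ∀ t < L - (L / 9 + 1), f (s + (L / 9 + 1) + t) = (fun t => g (t % p)) (d + t) := by
    intro t ht
    have := ho.2 (d + t) (by omega)
    rw [show a + (d + t) = s + (L / 9 + 1) + t by omega] at this
    rw [this]
    exact hs.per.eq_mod _ (by omega)
  obtain ⟨r1, r2, r3⟩ := (hs.primitive.shift d).rot hwin h3p
  rw [← hq] at r1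
  obtain ⟨g1, g2, g3⟩ := hs.rot
  -- Both starts are least in the same infinite word. The multiple d * p is added so that the shift
  -- by d can be undone in the natural numbers.
  have hsuf : suffix (fun t => g (t % p)) (rotStart g k) = suffix (fun t => g (t % p))
      (d + rotStart (fun t => f (s + (L / 9 + 1) + t)) (L - (L / 9 + 1))) := by
    apply le_antisymm (g3 _)
    have h := r3 (rotStart g k + d * p - d)
    have hdp : d ≤ d * p := Nat.le_mul_of_pos_right d hpos
    have e : ∀ x, suffix (fun x => (fun t => g (t % p)) (d + x)) x = suffix (fun t => g (t % p)) (d + x) := by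
      intro x; unfold suffix; simp only [Nat.add_assoc]
    rw [e, e] at h
    rw [hs.primitive.suffix_congr (a := d + (rotStart g k + d * p - d)) (b := rotStart g k) (by
      rw [show d + (rotStart g k + d * p - d) = rotStart g k + d * p by omega]; simp)] at h
    exact h
  generalize rotStart (fun t => f (s + (L / 9 + 1) + t)) (L - (L / 9 + 1)) = i at *
  generalize rotStart g k = j at *
  subst r1
  have hlet : ∀ x, g ((j + x) % q) = g ((d + i + x) % q) := fun x => congrFun (toLex_inj.1 hsuf) x
  have hmod : j % q = (d + i) % q := hs.primitive.mod_eq hlet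
  refine ⟨rfl, h3p, fun t ht => ?_, ?_, fun lo hi hx => ?_⟩
  · have h6 := hwin (i + t) (by omega)
    rw [← Nat.add_assoc] at h6
    rw [h6, hs.per.eq_mod (j + t) (by omega), hlet t]
    simp [Nat.add_assoc]
  · have e1 := phase_add hpos (L / 9 + 1 + i)
    have e2 := phase_add hpos j
    have e3 := phase_lt hpos j
    generalize phase q (L / 9 + 1 + i) = δ at *
    generalize phase q j = α at *
    rw [← Nat.mod_eq_of_lt e3]
    have h2 : δ + (L / 9 + 1 + i) ≡ α + j [MOD q] := by rw [Nat.ModEq, e1, e2]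
    have h4 : δ + (a - s) + j ≡ α + j [MOD q] := by
      calc δ + (a - s) + j ≡ δ + (a - s) + (d + i) [MOD q] := Nat.ModEq.add_left _ hmod
        _ = δ + (L / 9 + 1 + i) := by omega
        _ ≡ α + j [MOD q] := h2
    exact Nat.ModEq.add_right_cancel' j h4
  · have hin : ∀ y, a ≤ y → y + q < a + k → f y = f (y + q) := by
      intro y hy1 hy2
      have e1 := ho.2 (y - a) (by omega)
      have e2 := ho.2 (y - a + q) (by omega)
      rw [show a + (y - a) = y by omega] at e1
      rw [show a + (y - a + q) = y + q by omega] at e2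
      rw [e1, e2]
      exact hs.per _ (by omega)
    have hm := ho.1
    have x1 := hx.hi_ge
    have x2 := hx.lo_le
    -- The cap s + B + 2L on the extension does not interfere, since a < s + B and k < 2L.
    have hi1 : a + k ≤ hi := by
      by_contra hc
      rcases hx.hi_max with h | h | h
      · omega
      · omega
      · apply h
        have := hin (hi - q) (by omega) (by omega)
        rwa [Nat.sub_add_cancel (by omega)] at this
    refine ⟨by omega, ?_, hi1⟩
    by_contra hc
    rcases hx.lo_max with h | h
    · omega
    · exact h (hin _ (by omega) (by omega))

end

/-! ### Strings of type 3 have one small period -/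

/-- The letters of a string of words. -/
def letters {w : ℕ} (X : List (BitVec w)) (t : ℕ) : ℕ := (X.getD t 0).toNat

theorem letters_eq_iff {w : ℕ} {X Y : List (BitVec w)} {s t : ℕ} (hs : s < X.length)
    (ht : t < Y.length) : letters X s = letters Y t ↔ X[s]? = Y[t]? := by
  unfold letters
  rw [List.getD_eq_getElem _ _ hs, List.getD_eq_getElem _ _ ht, List.getElem?_eq_getElem hs,
    List.getElem?_eq_getElem ht, Option.some_inj]
  exact ⟨BitVec.eq_of_toNat_eq, fun h => by rw [h]⟩

/-- Windows of length ℓ may come with different periods. The period p of the first one is carried on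
letter by letter: if q is a period of the window that ends with the new letter i + p, then f i = f
(i - q) = f (i - q + p) = f (i + p). As p, q ≤ ℓ/4, all these positions stay within reach. -/
theorem IsType3.hasPer {w ℓ : ℕ} {X : List (BitVec w)} (h : IsType3 ℓ X) (hℓ : 1 ≤ ℓ)
    (hX : ℓ ≤ X.length) : ∃ p, 1 ≤ p ∧ 4 * p ≤ ℓ ∧ HasPer (letters X) X.length p := by
  have win : ∀ t, t + ℓ ≤ X.length → ∃ p, 1 ≤ p ∧ 4 * p ≤ ℓ ∧
      ∀ i, t ≤ i → i + p < t + ℓ → letters X i = letters X (i + p) := by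
    intro t ht
    have hlen : ((X.drop t).take ℓ).length = ℓ := by simp; omega
    have h1 := h ((X.drop t).take ℓ)
      ((List.take_prefix _ _).isInfix.trans (List.drop_suffix _ _).isInfix) hlen
    have hne : {p | IsPeriod ((X.drop t).take ℓ) p}.Nonempty :=
      ⟨ℓ, hℓ, hlen.ge, fun i hi => by omega⟩
    obtain ⟨h2, h3, h4⟩ : IsPeriod ((X.drop t).take ℓ) (per ((X.drop t).take ℓ)) := Nat.sInf_mem hne
    unfold StronglyPeriodic at h1
    rw [hlen] at h1
    refine ⟨_, h2, h1, fun i hi1 hi2 => ?_⟩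
    rw [letters_eq_iff (by omega) (by omega)]
    have h5 := h4 (i - t) (by omega)
    rw [List.getElem?_take_of_lt (by omega), List.getElem?_take_of_lt (by omega),
      List.getElem?_drop, List.getElem?_drop] at h5
    rw [show t + (i - t) = i by omega, show t + (i - t + per ((X.drop t).take ℓ)) = i + per ((X.drop t).take ℓ) by omega] at h5
    exact h5
  obtain ⟨p, hp1, hp2, hp3⟩ := win 0 (by omega)
  refine ⟨p, hp1, hp2, ?_⟩
  have ext : ∀ t, t + ℓ ≤ X.length → ∀ i, i + p < t + ℓ → letters X i = letters X (i + p) := by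
    intro t
    induction t with
    | zero => intro _ i hi; exact hp3 i (by omega) hi
    | succ t ih =>
      intro ht i hi
      rcases Nat.lt_or_ge (i + p) (t + ℓ) with h1 | h1
      · exact ih (by omega) i h1
      · obtain ⟨q, hq1, hq2, hq3⟩ := win (t + 1) ht
        have e1 := hq3 (i - q) (by omega) (by omega)
        have e2 := ih (by omega) (i - q) (by omega)
        have e3 := hq3 (i + p - q) (by omega) (by omega)
        rw [Nat.sub_add_cancel (by omega)] at e1 e3
        rw [← e1, e2, ← e3]
        congr 1; omega
  intro i hi
  exact ext (X.length - ℓ) (by omega) i (by omega)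

/-- Translation from ℓ to L: 4p ≤ ℓ and 9ℓ ≤ 8L give 9p ≤ 2L; 4k < 5ℓ gives 9k < 10L; and p ≥ 1
forces L ≥ 5. -/
theorem IsType3.strOk {w ℓ L : ℕ} {X : List (BitVec w)} (h : IsType3 ℓ X)
    (hX : 4 * X.length < 5 * ℓ) (hL : L ≤ X.length) (hℓL : 9 * ℓ ≤ 8 * L) :
    ∃ p, StrOk L (letters X) X.length p := by
  classical
  obtain ⟨p, p1, p2, p3⟩ := h.hasPer (by omega) (by omega)
  have hex : ∃ p, 1 ≤ p ∧ HasPer (letters X) X.length p := ⟨p, p1, p3⟩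
  obtain ⟨m1, m2⟩ := Nat.find_spec hex
  have m3 : Nat.find hex ≤ p := Nat.find_min' hex ⟨p1, p3⟩
  exact ⟨Nat.find hex, m1, m2, fun d d1 d2 => Nat.find_min' hex ⟨d1, d2⟩, by omega, hL, by omega,
    by omega⟩

open Var Arr

/-! ## Least rotations on the machine -/

/-- One step of the search for the least rotation of the string of length `vn` in `aW`. -/
def rotStepCm : Cm :=
  .ite (.ltv (vj + vk) vn)
    (.ite (.eqv (.ld aW (vi + vk)) (.ld aW (vj + vk))) (vk ≔ vk + 1)
      (.ite (.ltv (.ld aW (vj + vk)) (.ld aW (vi + vk)))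
        (vi ≔ vi + vk + 1 ;; .ite (.ltv vi vj) (vi ≔ vj) .skip ;; vj ≔ vi + 1 ;; vk ≔ 0)
        (vj ≔ vj + vk + 1 ;; vk ≔ 0))) .skip

/-- The search for the least rotation of the string of length `vn` in `aW`. -/
def rotCm : Cm :=
  (vi ≔ 0 ;; vj ≔ 1 ;; vk ≔ 0 ;; vlim ≔ 2 * vn) ;; .loop vz vlim rotStepCm ;; vp ≔ vj - vi

theorem rotCm_spec {w : ℕ} {pm : Prog} (hw : 1 ≤ w) {σ : St} {n : ℕ} (hn : σ.var vn = n)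
    (h1 : 1 ≤ n) (h2 : 2 * n + 100 < 2 ^ w) :
    Ht w pm rotCm σ (200 * n + 100) (fun τ =>
      τ.var vi = rotStart (σ.arr aW) n ∧ τ.var vp = rotPer (σ.arr aW) n) := by
  have hpre : Ht w pm (vi ≔ 0 ;; vj ≔ 1 ;; vk ≔ 0 ;; vlim ≔ 2 * vn) σ 20 (fun τ =>
      τ.var vi = 0 ∧ τ.var vj = 1 ∧ τ.var vk = 0 ∧ τ.var vlim = 2 * n ∧ τ.var vn = n ∧
      τ.arr aW = σ.arr aW) := by
    refine Ht.of_wp hw (by decide) ?_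
    simp [Cm.wp, hn]
    omega
  refine Ht.mono (hpre.seq (T₂ := 2 * n * 64 + 3 + 10) ?_) (by omega) fun _ _ h => h
  rintro τ - ⟨i0, j0, k0, l0, n0, a0⟩
  rw [← l0]
  refine Ht.seq (Ht.loop_const hw
    (fun z υ => (υ.var vi, υ.var vj, υ.var vk) = rotIter (σ.arr aW) n z) 60
    (by decide) (by decide) (by decide) (by simp [i0, j0, k0, rotIter]) ?_) ?_
  · intro z hz υ hF _ hI
    refine Ht.of_wp hw (by decide) ?_
    have ha : υ.arr aW = σ.arr aW := (hF.2 aW (by decide)).trans a0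
    have hn' : υ.var vn = n := (hF.1 vn (by decide)).trans n0
    obtain ⟨i1, i2, -, -⟩ := rotIter_inv (f := σ.arr aW) h1 z
    rw [← hI] at i1 i2
    simp only at i1 i2
    rw [rotIter_succ, ← hI]
    simp only [rotStep]
    simp [Cm.wp, rotStepCm, hn', ha]
    clear hI hF hpre
    generalize υ.var vi = i at *
    generalize υ.var vj = j at *
    generalize υ.var vk = k at *
    generalize 2 ^ w = W at *
    rcases Nat.lt_or_ge (j + k) n with c1 | c1
    · rcases lt_trichotomy (σ.arr aW (i + k)) (σ.arr aW (j + k)) with c2 | c2 | c2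
      · simp [c1, c2.ne, not_lt.2 c2.le]
        omega
      · simp [c1, c2]
        omega
      · rcases Nat.lt_or_ge (i + k + 1) j with c3 | c3
        · simp [c1, c2, c2.ne', c3, c3.le]
          omega
        · simp [c1, c2, c2.ne', c3]
          omega
    · simp only [not_lt.2 c1, if_false]
      grind
  · intro υ hF hI
    refine Ht.of_wp hw (by decide) ?_
    obtain ⟨i1, i2, -, -⟩ := rotIter_inv (f := σ.arr aW) h1 (2 * n)
    rw [l0] at hI
    rw [← hI] at i1
    simp [Cm.wp, rotStart, rotPer, ← hI]
    exact i1.le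

/-! ## Dictionaries and the trie of the roots -/

/-- `L` lists `c` keys, and `A` maps each of them to its index. -/
def DictOk (A L : ℕ → ℕ) (c : ℕ) : Prop := ∀ i < c, A (L i) = i

/-- Look up the key, and insert it if it is new. -/
def dictCm (A L : Arr) (cnt key out : Var) : Cm :=
  .ite (.ltv (.ld A key) cnt)
    (.ite (.eqv (.ld L (.ld A key)) key) (out ≔ .ld A key)
      (out ≔ cnt ;; .sto A key cnt ;; .sto L cnt key ;; cnt ≔ cnt + 1))
    (out ≔ cnt ;; .sto A key cnt ;; .sto L cnt key ;; cnt ≔ cnt + 1)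

/-- A key counts as present only if its index is below the counter and the list of keys points back
to it. Garbage in the index array cannot pass this test, so keys may be arbitrary words and neither
array has to be initialised. -/
theorem dictCm_spec {w : ℕ} {pm : Prog} (hw : 1 ≤ w) {σ : St} {A L : Arr} {cnt key out : Var}
    (hAL : A ≠ L) (h1 : key ≠ out) (h2 : cnt ≠ out)
    (hd : DictOk (σ.arr A) (σ.arr L) (σ.var cnt)) (hk : σ.var key < 2 ^ w)
    (hc : σ.var cnt + 1 < 2 ^ w) :
    Ht w pm (dictCm A L cnt key out) σ 25 (fun τ =>
      DictOk (τ.arr A) (τ.arr L) (τ.var cnt) ∧ τ.var out < τ.var cnt ∧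
      τ.arr L (τ.var out) = σ.var key ∧ σ.var cnt ≤ τ.var cnt ∧ τ.var cnt ≤ σ.var cnt + 1 ∧
      ∀ i < σ.var cnt, τ.arr L i = σ.arr L i) := by
  have hnew : (σ.var cnt ≤ σ.arr A (σ.var key) ∨
      σ.arr L (σ.arr A (σ.var key)) ≠ σ.var key) →
      DictOk (fun j => if j = σ.var key then σ.var cnt else σ.arr A j)
        (fun j => if j = σ.var cnt then σ.var key else σ.arr L j) (σ.var cnt + 1) := by
    intro hn i hi
    by_cases e : i = σ.var cnt
    · simp [e]
    · have hi' : i < σ.var cnt := by omega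
      have : σ.arr L i ≠ σ.var key := by
        intro h
        have := hd i hi'
        rw [h] at this
        rcases hn with hn | hn
        · omega
        · rw [this] at hn; exact hn h
      simp [e, this, hd i hi']
  refine Ht.of_wp hw (Nat.le_of_ble_eq_true rfl) ?_
  simp [dictCm, Cm.wp, h1, h2, h2.symm, hAL, hAL.symm, hk, St.put_arr_fun]
  refine ⟨fun c1 => ⟨by omega, fun c2 => ⟨hd, c1, c2⟩, fun c2 => ⟨by omega, ⟨by omega, hc⟩, hnew (.inr c2), ?_⟩⟩,
    fun c1 => ⟨by omega, ⟨by omega, hc⟩, hnew (.inl c1), ?_⟩⟩ <;>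
  · intro i hi h; omega

/-- The word `f (i + z - 1), …, f i`. -/
def rword (f : ℕ → ℕ) (i : ℕ) : ℕ → List ℕ
  | 0 => []
  | z + 1 => f (i + z) :: rword f i z

theorem rword_length (f : ℕ → ℕ) (i z : ℕ) : (rword f i z).length = z := by
  induction z with
  | zero => rfl
  | succ z ih => simp [rword, ih]

theorem rword_inj {f g : ℕ → ℕ} {i j p q : ℕ} :
    rword f i p = rword g j q ↔ p = q ∧ ∀ t < p, f (i + t) = g (j + t) := by
  constructor
  · intro h
    obtain rfl : p = q := by have := congrArg List.length h; simpa [rword_length] using this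
    refine ⟨rfl, ?_⟩
    induction p with
    | zero => simp
    | succ p ih =>
      simp only [rword, List.cons.injEq] at h
      intro t ht
      rcases Nat.lt_succ_iff_lt_or_eq.1 ht with h1 | rfl
      · exact ih h.2 t h1
      · exact h.1
  · rintro ⟨rfl, h⟩
    induction p with
    | zero => rfl
    | succ p ih =>
      simp only [rword, List.cons.injEq]
      exact ⟨h p (by omega), ih fun t ht => h t (by omega)⟩

/-- The node `v` of the trie represents the word `cs` (its last letter first). -/
inductive TriePath (σ : St) : ℕ → List ℕ → Prop where
  | nil : TriePath σ 0 []
  | cons {v k l : ℕ} {cs : List ℕ} : TriePath σ v cs → k < σ.var vcn →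
      σ.arr aNL k = v * σ.var vZ + l → l < σ.var vcl → l < σ.var vZ →
      TriePath σ (k + 1) (σ.arr aLL l :: cs)

/-- The dictionaries of the trie are correct. -/
structure TrieOk (σ : St) : Prop where
  letters : DictOk (σ.arr aLA) (σ.arr aLL) (σ.var vcl)
  nodes : DictOk (σ.arr aNA) (σ.arr aNL) (σ.var vcn)

/-- The trie of `τ` extends that of `σ`. -/
structure TrieExt (σ τ : St) : Prop where
  Z : τ.var vZ = σ.var vZ
  cl : σ.var vcl ≤ τ.var vcl
  cn : σ.var vcn ≤ τ.var vcn
  LL : ∀ i < σ.var vcl, τ.arr aLL i = σ.arr aLL i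
  NL : ∀ i < σ.var vcn, τ.arr aNL i = σ.arr aNL i

theorem TrieExt.trans {σ τ υ : St} (h : TrieExt σ τ) (h' : TrieExt τ υ) : TrieExt σ υ :=
  ⟨h'.Z.trans h.Z, h.cl.trans h'.cl, h.cn.trans h'.cn,
    fun i hi => (h'.LL i (hi.trans_le h.cl)).trans (h.LL i hi),
    fun i hi => (h'.NL i (hi.trans_le h.cn)).trans (h.NL i hi)⟩

/-- Dictionaries only grow, so a node keeps its word forever. -/
theorem TriePath.ext {σ τ : St} (h : TrieExt σ τ) {v : ℕ} {cs : List ℕ} (hp : TriePath σ v cs) :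
    TriePath τ v cs := by
  induction hp with
  | nil => exact .nil
  | cons _ hk hl h1 h2 ih =>
    rw [← h.LL _ h1]
    exact .cons ih (hk.trans_le h.cn) (by rw [h.NL _ hk, h.Z, hl]) (h1.trans_le h.cl) (by rwa [h.Z])

theorem TriePath.le {σ : St} {v : ℕ} {cs : List ℕ} (h : TriePath σ v cs) : v ≤ σ.var vcn := by
  cases h with
  | nil => omega
  | cons => omega

/-- The key v * Z + l of a node determines its parent v and the number l of its last letter, because
l < Z; conversely, each key and each letter has one index. Hence comparing roots is comparing node
numbers. -/
theorem TriePath.inj {σ : St} (hσ : TrieOk σ) {v : ℕ} {cs : List ℕ} (h : TriePath σ v cs) :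
    ∀ {v' : ℕ} {cs' : List ℕ}, TriePath σ v' cs' → (v = v' ↔ cs = cs') := by
  induction h with
  | nil =>
    intro v' cs' h'
    cases h' <;> simp
  | @cons v k l cs _ hk hl h1 h2 ih =>
    intro v' cs' h'
    cases h' with
    | nil => simp
    | @cons v' k' l' cs' h' hk' hl' h1' h2' =>
      simp only [Nat.add_right_cancel_iff, List.cons.injEq]
      constructor
      · rintro rfl
        rw [hl] at hl'
        have hZ : 0 < σ.var vZ := by omega
        have e1 : v = v' := by
          have := congrArg (· / σ.var vZ) hl'
          simpa [Nat.mul_add_div hZ, mul_comm _ (σ.var vZ), Nat.div_eq_of_lt h2, Nat.div_eq_of_lt h2'] using this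
        subst e1
        obtain rfl : l = l' := by omega
        exact ⟨rfl, (ih h').1 rfl⟩
      · rintro ⟨e1, e2⟩
        have e3 := (ih h').2 e2
        have e4 : l = l' := by rw [← hσ.letters l h1, e1, hσ.letters l' h1']
        rw [← hσ.nodes k hk, hl, e3, e4, ← hl', hσ.nodes k' hk']

/-- One step on the path in the trie. -/
def trieStepCm : Cm :=
  (vt ≔ .ld aW (vi + vz)) ;; dictCm aLA aLL vcl vt vlid ;; (vx ≔ vg * vZ + vlid) ;;
    dictCm aNA aNL vcn vx vsk ;; vg ≔ vsk + 1

/-- Insert the word of length `vp` from the cell `vi` of `aW` on into the trie; `vg` is its node. -/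
def trieCm : Cm := (vg ≔ 0) ;; .loop vz vp trieStepCm

/-- Each letter needs one lookup of its number and one of the pair of node and number, so either
counter grows by at most one per letter. Keeping both below Z is what makes the encoding of pairs
faithful. -/
theorem trieCm_spec {w : ℕ} {pm : Prog} (hw : 1 ≤ w) {σ : St} {i p Z : ℕ} (hi : σ.var vi = i)
    (hp : σ.var vp = p) (hZ : σ.var vZ = Z) (hok : TrieOk σ)
    (hW : ∀ t < p, σ.arr aW (i + t) < 2 ^ w) (hcl : σ.var vcl + p ≤ Z)
    (hcn : σ.var vcn + p ≤ Z) (hip : i + p ≤ Z) (hZw : Z * Z + Z + 100 < 2 ^ w) :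
    Ht w pm trieCm σ (100 * p + 100) (fun τ => TrieOk τ ∧ TrieExt σ τ ∧
      TriePath τ (τ.var vg) (rword (σ.arr aW) i p) ∧ τ.var vcl ≤ σ.var vcl + p ∧
      τ.var vcn ≤ σ.var vcn + p) := by
  refine Ht.mono (Ht.seq (T₁ := 2) (T₂ := p * (80 + 4) + 3) (R := fun τ => τ = σ.set vg 0)
    (Ht.of_wp hw (by decide) (by simp [Cm.wp])) ?_) (by omega) fun _ _ h => h
  rintro τ - rfl
  have hp' : (σ.set vg 0).var vp = p := by simp [hp]
  rw [← hp']
  refine Ht.mono (Ht.loop_const hw (fun z υ => TrieOk υ ∧ TrieExt σ υ ∧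
      TriePath υ (υ.var vg) (rword (σ.arr aW) i z) ∧ υ.var vcl ≤ σ.var vcl + z ∧
      υ.var vcn ≤ σ.var vcn + z) 80 (by decide) (by decide) (by decide) ?_ ?_) le_rfl fun υ _ h => h
  · refine ⟨⟨by simpa using hok.letters, by simpa using hok.nodes⟩, ⟨by simp, by simp, by simp, by simp, by simp⟩, ?_, by simp, by simp⟩
    simp only [rword]
    exact .nil
  · intro z hz υ hF hvz ⟨h1, h2, h3, h4, h5⟩
    rw [hp'] at hz
    have hi' : υ.var vi = i := (hF.1 vi (by decide)).trans (by simp [hi])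
    have hZ' : υ.var vZ = Z := h2.Z.trans hZ
    have hW' : υ.arr aW = σ.arr aW := hF.2 aW (by decide)
    have hgle := h3.le
    have hZZ : υ.var vg * Z ≤ Z * Z := Nat.mul_le_mul_right _ (by omega)
    refine Ht.mono (Ht.seq (T₁ := 5) (T₂ := 70) (R := fun τ => τ = υ.set vt (σ.arr aW (i + z)))
      (Ht.of_wp hw (by decide) (by simp [Cm.wp, hi', hvz, hW']; omega)) ?_) (by omega) fun _ _ h => h
    rintro _ - rfl
    set α := υ.set vt (σ.arr aW (i + z)) with hα
    refine Ht.mono (Ht.seq (T₂ := 45) (dictCm_spec hw (by decide) (by decide) (by decide)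
      ?_ ?_ ?_) ?_) (by omega) fun _ _ h => h
    · simpa [hα] using h1.letters
    · simpa [hα] using hW z hz
    · simp [hα]; omega
    intro β fβ ⟨b1, b2, b3, b4, b5, b6⟩
    have c1 : α.var vcl = υ.var vcl := by simp [hα]
    have c2 : α.arr aLL = υ.arr aLL := by simp [hα]
    have c3 : α.var vt = σ.arr aW (i + z) := by simp [hα]
    have d1 : β.var vg = υ.var vg := (fβ.1 vg (by decide)).trans (by simp [hα])
    have d2 : β.var vZ = Z := (fβ.1 vZ (by decide)).trans (by simp [hα, hZ'])
    have d3 : β.var vcn = υ.var vcn := (fβ.1 vcn (by decide)).trans (by simp [hα])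
    have d4 : β.arr aNL = υ.arr aNL := (fβ.2 aNL (by decide)).trans (by simp [hα])
    have d5 : β.arr aNA = υ.arr aNA := (fβ.2 aNA (by decide)).trans (by simp [hα])
    rw [c1] at b4 b5 b6
    rw [c2] at b6
    rw [c3] at b3
    refine Ht.mono (Ht.seq (T₁ := 6) (T₂ := 35)
      (R := fun τ => τ = β.set vx (υ.var vg * Z + β.var vlid))
      (Ht.of_wp hw (by decide) (by simp [Cm.wp, d1, d2]; omega)) ?_) (by omega) fun _ _ h => h
    rintro _ - rfl
    set γ := β.set vx (υ.var vg * Z + β.var vlid) with hγ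
    refine Ht.mono (Ht.seq (T₂ := 5) (dictCm_spec hw (by decide) (by decide) (by decide)
      ?_ ?_ ?_) ?_) (by omega) fun _ _ h => h
    · simpa [hγ, d3, d4, d5] using h1.nodes
    · simp [hγ]; omega
    · simp [hγ, d3]; omega
    intro δ fδ ⟨e1, e2, e3, e4, e5, e6⟩
    have g1 : γ.var vcn = υ.var vcn := by simp [hγ, d3]
    have g2 : γ.arr aNL = υ.arr aNL := by simp [hγ, d4]
    have g3 : γ.var vx = υ.var vg * Z + β.var vlid := by simp [hγ]
    rw [g1] at e4 e5 e6
    rw [g2] at e6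
    rw [g3] at e3
    have k1 : δ.var vcl = β.var vcl := (fδ.1 vcl (by decide)).trans (by simp [hγ])
    have k2 : δ.arr aLL = β.arr aLL := (fδ.2 aLL (by decide)).trans (by simp [hγ])
    have k3 : δ.arr aLA = β.arr aLA := (fδ.2 aLA (by decide)).trans (by simp [hγ])
    have k4 : δ.var vZ = Z := (fδ.1 vZ (by decide)).trans (by simp [hγ, d2])
    have hext : TrieExt υ δ := ⟨by rw [k4, hZ'], by rw [k1]; exact b4, e4,
      fun i hi => by rw [k2]; exact b6 i hi, e6⟩
    refine Ht.of_wp hw (by decide) ?_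
    simp [Cm.wp]
    refine ⟨by omega, ⟨by simpa [k1, k2, k3] using b1, by simpa using e1⟩,
      ⟨by simp [k4, hZ], by simpa using (h2.trans hext).cl, by simpa using (h2.trans hext).cn,
        fun i hi => by simpa using (h2.trans hext).LL i hi, fun i hi => by simpa using (h2.trans hext).NL i hi⟩,
      ?_, by rw [k1]; omega, by omega⟩
    rw [rword, ← b3, ← k2]
    have hext' : TrieExt υ ((δ.set vg (δ.var vsk + 1)).set vz (z + 1)) :=
      ⟨by simpa using hext.Z, by simpa using hext.cl, by simpa using hext.cn,
        by simpa using hext.LL, by simpa using hext.NL⟩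
    refine TriePath.cons (σ := (δ.set vg (δ.var vsk + 1)).set vz (z + 1)) (h3.ext hext') ?_ ?_ ?_ ?_
    · simpa using e2
    · simpa [k4] using e3
    · simpa [k1] using b2
    · simp [k4]; omega

/-! ## Auxiliary computations -/

theorem Ht.seq_le {w : ℕ} {pm : Prog} {σ : St} {c d : Cm} {R Q : St → Prop} (T₁ T₂ : ℕ) {T : ℕ}
    (h : Ht w pm c σ T₁ R) (hT : T₁ + T₂ ≤ T) (h' : ∀ τ, Fr c σ τ → R τ → Ht w pm d τ T₂ Q) :
    Ht w pm (c ;; d) σ T Q :=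
  (h.seq h').mono hT fun _ _ h => h

theorem Ht.ite_le {w : ℕ} {pm : Prog} {σ : St} (hw : 1 ≤ w) {e : Ex} {c d : Cm} {Q : St → Prop}
    (k T : ℕ) {T' : ℕ} (hk : e.size ≤ k) (hT : k + T + 1 ≤ T') (hok : e.ok w σ)
    (h : e.eval σ ≠ 0 → Ht w pm c σ T Q) (h' : e.eval σ = 0 → Ht w pm d σ T Q) :
    Ht w pm (.ite e c d) σ T' Q :=
  (Ht.ite hw hok h h').mono (by omega) fun _ _ h => h

/-- The rule for loops with a given number of rounds. -/
theorem Ht.loop_le {w : ℕ} {pm : Prog} {σ : St} (hw : 1 ≤ w) {x y : Var} {c : Cm} {n T' : ℕ}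
    (I : ℕ → St → Prop) (T : ℕ) (hn : σ.var y = n) (hT : n * (T + 4) + 3 ≤ T')
    (hxy : y ≠ x) (hx : x ∉ c.wv) (hy : y ∉ c.wv) (h0 : I 0 (σ.set x 0))
    (step : ∀ i < n, ∀ τ, Fr (.loop x y c) σ τ → τ.var x = i → I i τ →
      Ht w pm c τ T (fun υ => I (i + 1) (υ.set x (i + 1)))) :
    Ht w pm (.loop x y c) σ T' (I n) := by
  subst hn
  exact (Ht.loop_const hw I T hxy hx hy h0 step).mono hT fun _ _ h => h

theorem rotIter_congr {f g : ℕ → ℕ} {n : ℕ} (hn : 1 ≤ n) (h : ∀ t < n, f t = g t) (z : ℕ) :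
    rotIter f n z = rotIter g n z := by
  induction z with
  | zero => rfl
  | succ z ih =>
    have inv := rotIter_inv (f := f) hn z
    rw [rotIter_succ, rotIter_succ, ← ih]
    unfold rotStep
    by_cases c : (rotIter f n z).2.1 + (rotIter f n z).2.2 < n
    · rw [h _ c, h _ (by omega)]
    · simp [c]

theorem rotStart_congr {f g : ℕ → ℕ} {n : ℕ} (hn : 1 ≤ n) (h : ∀ t < n, f t = g t) :
    rotStart f n = rotStart g n := by
  unfold rotStart; rw [rotIter_congr hn h]

theorem rotPer_congr {f g : ℕ → ℕ} {n : ℕ} (hn : 1 ≤ n) (h : ∀ t < n, f t = g t) :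
    rotPer f n = rotPer g n := by
  unfold rotPer; rw [rotIter_congr hn h]

/-- Copy the cells from `vst` on of `A` to the `vn` first cells of `aW`. -/
def copyCm (A : Arr) : Cm := .loop vz vn (.sto aW vz (.ld A (vst + vz)))

theorem copyCm_spec {w : ℕ} {pm : Prog} (hw : 1 ≤ w) {σ : St} {A : Arr} (hA : A ≠ aW)
    {n st : ℕ} (hn : σ.var vn = n) (hst : σ.var vst = st) (h : st + n < 2 ^ w) :
    Ht w pm (copyCm A) σ (10 * n + 10) (fun τ => ∀ z < n, τ.arr aW z = σ.arr A (st + z)) := by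
  rw [← hn]
  refine Ht.mono (Ht.loop_const hw (fun z τ => ∀ t < z, τ.arr aW t = σ.arr A (st + t)) 6
    (by simp) (by simp [Cm.wv]) (by simp [Cm.wv]) (by simp) ?_) (by omega) fun τ _ h => h
  intro z hz τ hF hvz hI
  have hst' : τ.var vst = st := (hF.1 vst (by simp [Cm.wv])).trans hst
  have hA' : τ.arr A = σ.arr A := hF.2 A (by simpa [Cm.wa] using hA)
  refine Ht.of_wp hw (Nat.le_of_ble_eq_true rfl) ?_
  simp [Cm.wp, hvz, hst', hA']
  refine ⟨by omega, by omega, fun t ht => ?_⟩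
  split_ifs with e
  · rw [e]
  · exact hI t (by omega)

/-- `vR` becomes the integer part of the square root of `vD`. -/
def sqrtCm : Cm := (vR ≔ 0) ;; .loop vt vD (.ite (.ltv vD (vt * vt)) .skip (vR ≔ vt))

theorem sqrtCm_spec {w : ℕ} {pm : Prog} (hw : 1 ≤ w) {σ : St} {D : ℕ} (hD : σ.var vD = D)
    (h2 : 2 ≤ D) (h : D * D < 2 ^ w) :
    Ht w pm sqrtCm σ (20 * D + 20) (fun τ =>
      τ.var vR * τ.var vR ≤ D ∧ D < (τ.var vR + 1) * (τ.var vR + 1)) := by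
  refine Ht.mono (Ht.seq (T₁ := 2) (T₂ := D * (10 + 4) + 3) (R := fun τ => τ = σ.set vR 0)
    (Ht.of_wp hw (by decide) (by simp [Cm.wp])) ?_) (by omega) fun _ _ h => h
  rintro τ - rfl
  have hD' : (σ.set vR 0).var vD = D := by simp [hD]
  conv in D * (10 + 4) + 3 => rw [← hD']
  refine Ht.mono (Ht.loop_const hw (fun z τ => τ.var vR * τ.var vR ≤ D ∧ τ.var vR ≤ z ∧
    ∀ t < z, t * t ≤ D → t ≤ τ.var vR) 10
    (by decide) (by decide) (by decide) (by simp) ?_) le_rfl fun τ _ ⟨h1, h2', h3⟩ => ⟨h1, ?_⟩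
  · intro z hz τ hF hvz ⟨h1, h2', h3⟩
    have hDt : τ.var vD = D := (hF.1 vD (by decide)).trans hD'
    rw [hD'] at hz
    have hzz : z * z ≤ D * D := Nat.mul_le_mul hz.le hz.le
    refine Ht.of_wp hw (by decide) ?_
    simp [Cm.wp, hvz, hDt]
    refine ⟨by omega, fun c => ⟨h1, by omega, fun t ht htt => ?_⟩, fun c => ⟨c, fun t ht htt => by omega⟩⟩
    rcases Nat.lt_or_eq_of_le ht with h4 | rfl
    · exact h3 t h4 htt
    · omega
  · rw [hD'] at h3
    by_contra hc
    -- D ≥ 2 puts a number whose square is at most D strictly below D, hence among the tested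
    -- candidates.
    have := h3 (τ.var vR + 1) (by nlinarith) (by omega)
    omega

/-- `vf` becomes `0` if `vx` has a divisor `d` with `1 < d < vx`. -/
def divisorCm : Cm := .loop vx2 vx (.ite (.ltv 1 vx2) (.ite (vx % vx2) .skip (vf ≔ 0)) .skip)

theorem divisorCm_spec {w : ℕ} {pm : Prog} (hw : 1 ≤ w) {σ : St} {x : ℕ} (hx : σ.var vx = x)
    (h1 : σ.var vf = 1) :
    Ht w pm divisorCm σ (20 * x + 20) (fun τ => τ.var vf = 0 ↔ ∃ d < x, 1 < d ∧ d ∣ x) := by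
  refine Ht.loop_le hw (fun z τ => τ.var vf = 0 ↔ ∃ d < z, 1 < d ∧ d ∣ x) 12 hx (by omega)
    (by decide) (by decide) (by decide) (by simp [h1]) ?_
  intro z hz τ hF hvz hI
  have hx' : τ.var vx = x := (hF.1 vx (by decide)).trans hx
  have hone : 1 < 2 ^ w := Nat.one_lt_two_pow (by omega)
  refine Ht.of_wp hw (by decide) ?_
  have hsucc : (∃ d < z + 1, 1 < d ∧ d ∣ x) ↔ (∃ d < z, 1 < d ∧ d ∣ x) ∨ (1 < z ∧ z ∣ x) := by
    constructor
    · rintro ⟨d, h1, h2⟩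
      rcases Nat.lt_succ_iff_lt_or_eq.1 h1 with h3 | rfl
      · exact .inl ⟨d, h3, h2⟩
      · exact .inr h2
    · rintro (⟨d, h1, h2⟩ | h)
      · exact ⟨d, by omega, h2⟩
      · exact ⟨z, by omega, h⟩
  simp only [Cm.wp, hsucc]
  simp [hvz, hx', hI]
  refine ⟨by omega, fun c => ⟨fun d => ?_, fun d => .inr ⟨c, Nat.dvd_of_mod_eq_zero d⟩⟩, fun c h => by omega⟩
  exact fun _ h => absurd (Nat.mod_eq_zero_of_dvd h) d

/-- One candidate in the search for a prime. -/
def primeStepCm : Cm := (vx ≔ vR + 1 + vt ;; vf ≔ 1) ;; divisorCm ;; .ite vf (vrho ≔ vx) .skip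

/-- `vrho` becomes a prime above `vR`. -/
def primeCm : Cm := (vrho ≔ 0) ;; .loop vt vR primeStepCm

/-- Bertrand's postulate supplies a prime in (R, 2R]. Trial division of all R candidates takes O(R²)
time, which is affordable because R² will be O(B/p). -/
theorem primeCm_spec {w : ℕ} {pm : Prog} (hw : 1 ≤ w) {σ : St} {R : ℕ} (hR : σ.var vR = R)
    (h1 : 1 ≤ R) (h : 2 * R + 10 < 2 ^ w) :
    Ht w pm primeCm σ (200 * (R * R) + 100) (fun τ =>
      τ.var vrho ≤ 2 * R ∧ R < τ.var vrho ∧ (τ.var vrho).Prime) := by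
  have hRR : R ≤ R * R := Nat.le_mul_of_pos_left R h1
  refine Ht.seq_le 2 (R * ((40 * R + 60) + 4) + 3) (R := fun τ => τ = σ.set vrho 0)
    (Ht.of_wp hw (by decide) (by simp [Cm.wp])) (by ring_nf; nlinarith) ?_
  rintro β - rfl
  refine Ht.mono (Ht.loop_le hw (fun z τ =>
      (τ.var vrho = 0 ∧ ∀ t < z, ¬ (R + 1 + t).Prime) ∨
      (τ.var vrho ≤ 2 * R ∧ R < τ.var vrho ∧ (τ.var vrho).Prime)) (40 * R + 60) (n := R)
      (by simp [hR]) le_rfl (by decide) (by decide) (by decide) (by simp) ?_) le_rfl fun τ _ h => ?_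
  · intro z hz τ hF hvz hI
    have hRt : τ.var vR = R := (hF.1 vR (by decide)).trans (by simp [hR])
    refine Ht.seq_le 10 (40 * R + 50)
      (R := fun υ => υ.var vx = R + 1 + z ∧ υ.var vf = 1 ∧ υ.var vrho = τ.var vrho)
      (Ht.of_wp hw (by decide) (by simp [Cm.wp, hRt, hvz]; omega)) (by omega) ?_
    intro υ fυ ⟨u1, u2, u3⟩
    refine Ht.seq_le _ 10 (divisorCm_spec hw u1 u2) (by omega) ?_
    intro κ fκ k1
    have k2 : κ.var vx = R + 1 + z := (fκ.1 vx (by decide)).trans u1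
    have k3 : κ.var vrho = τ.var vrho := ((fκ.1 vrho (by decide)).trans u3)
    have hpr : (R + 1 + z).Prime ↔ ¬ ∃ d < R + 1 + z, 1 < d ∧ d ∣ R + 1 + z := by
      rw [Nat.prime_def_lt']
      constructor
      · rintro ⟨-, h⟩ ⟨d, d1, d2, d3⟩; exact h d d2 d1 d3
      · intro h; exact ⟨by omega, fun d d1 d2 d3 => h ⟨d, d2, d1, d3⟩⟩
    rw [← k1] at hpr
    refine Ht.of_wp hw (by decide) ?_
    simp [Cm.wp, k2, k3]
    refine ⟨fun c => ⟨by omega, by omega, hpr.2 c⟩, fun c => ?_⟩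
    rcases hI with ⟨h1, h3⟩ | h1
    · refine .inl ⟨h1, fun t ht => ?_⟩
      rcases Nat.lt_or_eq_of_le ht with h4 | rfl
      · exact h3 t h4
      · rw [hpr]; simpa using c
    · exact .inr h1
  · rcases h with ⟨-, h⟩ | h
    · obtain ⟨p, p1, p2, p3⟩ := Nat.exists_prime_lt_and_le_two_mul R (by omega)
      have := h (p - (R + 1)) (by omega)
      rw [Nat.add_sub_cancel' (by omega)] at this
      exact absurd p1 this
    · exact h

/-- Set `vN` to the total length of the strings, `vL` to the smallest length (or to `vm + 1`), and
compute the positions of the strings. -/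
def lengthsCm : Cm :=
  (vN ≔ 0 ;; vL ≔ vm + 1) ;;
  .loop vh vnS (.sto aOff vh vN ;; vlen ≔ .ld aLen vh ;; vN ≔ vN + vlen ;;
    .ite (.ltv vlen vL) (vL ≔ vlen) .skip)

theorem lengthsCm_spec {w : ℕ} {pm : Prog} (hw : 1 ≤ w) {σ : St} {m n N : ℕ} (hm : σ.var vm = m)
    (hn : σ.var vnS = n) (hN : ∑ h ∈ Finset.range n, σ.arr aLen h = N) (hmw : m + 1 < 2 ^ w)
    (hnw : n < 2 ^ w)
    (hNw : N < 2 ^ w) :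
    Ht w pm lengthsCm σ (30 * n + 30) (fun τ => τ.var vN = N ∧
      (∀ h < n, τ.arr aOff h = ∑ i ∈ Finset.range h, σ.arr aLen i) ∧
      (∀ h < n, τ.var vL ≤ σ.arr aLen h) ∧ τ.var vL ≤ m + 1 ∧
      (τ.var vL ≤ m → ∃ h < n, τ.var vL = σ.arr aLen h)) := by
  have hone : 1 < 2 ^ w := Nat.one_lt_two_pow (by omega)
  refine Ht.mono (Ht.seq (T₁ := 10) (T₂ := n * (20 + 4) + 3)
    (R := fun τ => τ.var vN = 0 ∧ τ.var vL = m + 1 ∧ τ.var vnS = n ∧ τ.arr aLen = σ.arr aLen)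
    (Ht.of_wp hw (by decide) (by simp [Cm.wp, hm, hn]; omega)) ?_) (by omega) fun _ _ h => h
  intro τ fτ ⟨t1, t2, t3, t4⟩
  conv in n * (20 + 4) + 3 => rw [← t3]
  refine Ht.mono (Ht.loop_const hw (fun z τ => τ.var vN = ∑ i ∈ Finset.range z, σ.arr aLen i ∧
      (∀ h < z, τ.arr aOff h = ∑ i ∈ Finset.range h, σ.arr aLen i) ∧
      (∀ h < z, τ.var vL ≤ σ.arr aLen h) ∧ τ.var vL ≤ m + 1 ∧
      (τ.var vL ≤ m → ∃ h < z, τ.var vL = σ.arr aLen h)) 20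
    (by decide) (by decide) (by decide) (by simp [t1, t2]) ?_) le_rfl fun υ _ h => ?_
  · intro z hz υ hF hvz ⟨h1, h2, h3, h4, h5⟩
    rw [t3] at hz
    have hlen : υ.arr aLen = σ.arr aLen := (hF.2 aLen (by decide)).trans t4
    have hle : ∑ i ∈ Finset.range z, σ.arr aLen i + σ.arr aLen z ≤ N := by
      rw [← Finset.sum_range_succ, ← hN]
      exact Finset.sum_le_sum_of_subset (by simpa using hz)
    have key : ∀ L' : ℕ, (L' = υ.var vL ∧ υ.var vL ≤ σ.arr aLen z ∨ L' = σ.arr aLen z ∧ σ.arr aLen z < υ.var vL) →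
        (∀ h < z + 1, L' ≤ σ.arr aLen h) ∧ L' ≤ m + 1 ∧
        (L' ≤ m → ∃ h < z + 1, L' = σ.arr aLen h) := by
      intro L' hL'
      refine ⟨fun h hh => ?_, by omega, fun hm' => ?_⟩
      · rcases Nat.lt_succ_iff_lt_or_eq.1 hh with h6 | rfl
        · have := h3 h h6; omega
        · omega
      · rcases hL' with ⟨rfl, -⟩ | ⟨rfl, -⟩
        · obtain ⟨h, h6, h7⟩ := h5 hm'
          exact ⟨h, by omega, h7⟩
        · exact ⟨z, by omega, rfl⟩
    have hoff : ∀ h < z + 1, (if h = z then ∑ i ∈ Finset.range z, σ.arr aLen i else υ.arr aOff h) =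
        ∑ i ∈ Finset.range h, σ.arr aLen i := by
      intro h hh
      split_ifs with e
      · rw [e]
      · exact h2 h (by omega)
    refine Ht.of_wp hw (by decide) ?_
    simp [Cm.wp, hvz, hlen, h1]
    refine ⟨by omega, by omega, fun c => ⟨?_, ?_, ?_⟩, fun c => ⟨?_, ?_, ?_⟩⟩
    · rw [Finset.sum_range_succ]
    · exact fun h hh => hoff h (by omega)
    · simpa using key _ (.inr ⟨rfl, c⟩)
    · rw [Finset.sum_range_succ]
    · exact fun h hh => hoff h (by omega)
    · simpa using key _ (.inl ⟨rfl, c⟩)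
  · rw [t3, hN] at h
    exact h

/-! ## The tables of the strings -/

theorem Finset.sum_range_update (A : ℕ → ℕ) {n v : ℕ} (hv : v < n) :
    ∑ g ∈ Finset.range n, (if g = v then A v + 1 else A g) = ∑ g ∈ Finset.range n, A g + 1 := by
  have : ∀ g ∈ Finset.range n, (if g = v then A v + 1 else A g) = A g + if g = v then 1 else 0 := by
    intro g _; split_ifs with h
    · rw [h]
    · rfl
  rw [Finset.sum_congr rfl this, Finset.sum_add_distrib]
  simp [hv]

theorem rword_congr {f g : ℕ → ℕ} {i p : ℕ} (h : ∀ t < i + p, f t = g t) : rword f i p = rword g i p :=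
  rword_inj.2 ⟨rfl, fun t ht => h _ (by omega)⟩

/-- Copy a string of `A` and find its least rotation. -/
def rootCm (A : Arr) : Cm := copyCm A ;; rotCm

theorem rootCm_spec {w : ℕ} {pm : Prog} (hw : 1 ≤ w) {σ : St} {A : Arr} (hA : A ≠ aW)
    {n st : ℕ} (hn : σ.var vn = n) (hst : σ.var vst = st) (h1 : 1 ≤ n) (h : st + n < 2 ^ w)
    (h2 : 2 * n + 100 < 2 ^ w) :
    Ht w pm (rootCm A) σ (210 * n + 110) (fun τ =>
      τ.var vi = rotStart (fun t => σ.arr A (st + t)) n ∧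
      τ.var vp = rotPer (fun t => σ.arr A (st + t)) n ∧ ∀ z < n, τ.arr aW z = σ.arr A (st + z)) := by
  refine Ht.seq_le _ (200 * n + 100) (copyCm_spec hw hA hn hst h) (by omega) ?_
  intro τ fτ hτ
  have hn' : τ.var vn = n := (fτ.1 vn (by simp [copyCm, Cm.wv])).trans hn
  refine (rotCm_spec hw hn' h1 h2).mono le_rfl fun υ fυ ⟨u1, u2⟩ => ⟨?_, ?_, fun z hz => ?_⟩
  · rw [u1, rotStart_congr h1 hτ]
  · rw [u2, rotPer_congr h1 hτ]
  · rw [fυ.2 aW (by decide), hτ z hz]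

/-- The dictionaries of the trie are correct and have at most `X` entries. -/
structure TrieIs (X : ℕ) (σ : St) : Prop where
  ok : TrieOk σ
  cl : σ.var vcl ≤ X
  cn : σ.var vcn ≤ X

/-- The trie of `τ` is that of `σ`. -/
structure TrieEq (σ τ : St) : Prop where
  Z : τ.var vZ = σ.var vZ
  cl : τ.var vcl = σ.var vcl
  cn : τ.var vcn = σ.var vcn
  LA : τ.arr aLA = σ.arr aLA
  LL : τ.arr aLL = σ.arr aLL
  NA : τ.arr aNA = σ.arr aNA
  NL : τ.arr aNL = σ.arr aNL

theorem TrieEq.trans {σ τ υ : St} (h : TrieEq σ τ) (h' : TrieEq τ υ) : TrieEq σ υ :=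
  ⟨h'.1.trans h.1, h'.2.trans h.2, h'.3.trans h.3, h'.4.trans h.4, h'.5.trans h.5, h'.6.trans h.6,
    h'.7.trans h.7⟩

theorem TrieEq.ext {σ τ : St} (h : TrieEq σ τ) : TrieExt σ τ :=
  ⟨h.Z, h.cl.ge, h.cn.ge, fun _ _ => by rw [h.LL], fun _ _ => by rw [h.NL]⟩

theorem TrieEq.is {X : ℕ} {σ τ : St} (h : TrieEq σ τ) (h' : TrieIs X σ) : TrieIs X τ :=
  ⟨⟨by rw [h.LA, h.LL, h.cl]; exact h'.ok.1, by rw [h.NA, h.NL, h.cn]; exact h'.ok.2⟩,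
    by rw [h.cl]; exact h'.cl, by rw [h.cn]; exact h'.cn⟩

/-- The slot `η` of the group `g` holds the string `i`. -/
structure StrSlot (F : ℕ → ℕ → ℕ) (K : ℕ → ℕ) (τ : St) (g η i : ℕ) : Prop where
  path : TriePath τ g (rword (F i) (rotStart (F i) (K i)) (rotPer (F i) (K i)))
  per : τ.arr aGp g = rotPer (F i) (K i)
  al : τ.arr aSal (g * τ.var vZ + η) = phase (rotPer (F i) (K i)) (rotStart (F i) (K i))
  len : τ.arr aSlen (g * τ.var vZ + η) = K i

/-- The slots hold the strings below `h`. -/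
structure StrInv (F : ℕ → ℕ → ℕ) (K : ℕ → ℕ) (h : ℕ) (τ : St) : Prop where
  sound : ∀ g < τ.var vZ, ∀ η < τ.arr aNS g, ∃ i < h, StrSlot F K τ g η i
  complete : ∀ i < h, ∃ g < τ.var vZ, ∃ η < τ.arr aNS g, StrSlot F K τ g η i
  sum : ∑ g ∈ Finset.range (τ.var vZ), τ.arr aNS g ≤ h

theorem mul_add_inj {Z a b c d : ℕ} (hb : b < Z) (hd : d < Z) (h : a * Z + b = c * Z + d) :
    a = c ∧ b = d := by
  have hZ : 0 < Z := by omega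
  have h1 := congrArg (· / Z) h
  have h2 := congrArg (· % Z) h
  simp only [mul_comm _ Z, Nat.mul_add_div hZ, Nat.mul_add_mod, Nat.div_eq_of_lt hb,
    Nat.div_eq_of_lt hd, Nat.mod_eq_of_lt hb, Nat.mod_eq_of_lt hd] at h1 h2
  exact ⟨by simpa using h1, h2⟩

theorem StrInv.ext {F : ℕ → ℕ → ℕ} {K : ℕ → ℕ} {h : ℕ} {σ τ : St} (hI : StrInv F K h σ)
    (he : TrieExt σ τ) (h1 : τ.arr aNS = σ.arr aNS) (h2 : τ.arr aGp = σ.arr aGp)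
    (h3 : τ.arr aSal = σ.arr aSal) (h4 : τ.arr aSlen = σ.arr aSlen) : StrInv F K h τ := by
  have key : ∀ {g η i}, StrSlot F K σ g η i → StrSlot F K τ g η i := fun h =>
    ⟨h.path.ext he, by rw [h2]; exact h.per, by rw [h3, he.Z]; exact h.al, by rw [h4, he.Z]; exact h.len⟩
  refine ⟨fun g hg η hη => ?_, fun i hi => ?_, ?_⟩
  · rw [he.Z] at hg; rw [h1] at hη
    obtain ⟨i, hi, h⟩ := hI.sound g hg η hη
    exact ⟨i, hi, key h⟩
  · obtain ⟨g, hg, η, hη, h⟩ := hI.complete i hi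
    exact ⟨g, by rwa [he.Z], η, by rwa [h1], key h⟩
  · rw [he.Z, h1]; exact hI.sum

theorem StrInv.le {F : ℕ → ℕ → ℕ} {K : ℕ → ℕ} {h : ℕ} {σ : St} (hI : StrInv F K h σ) {g : ℕ}
    (hg : g < σ.var vZ) : σ.arr aNS g ≤ h :=
  (Finset.single_le_sum (f := fun g => σ.arr aNS g) (fun _ _ => Nat.zero_le _)
    (Finset.mem_range.2 hg)).trans hI.sum

/-- A later string overwrites the period of its group by the same value, since equal nodes carry
words of equal length. Slots of different groups occupy different cells g · Z + η because fewer than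
Z strings are stored. -/
theorem StrInv.push {F : ℕ → ℕ → ℕ} {K : ℕ → ℕ} {h g : ℕ} {σ τ : St} (hI : StrInv F K h σ)
    (he : TrieExt σ τ) (hok : TrieOk τ) (hg : g < σ.var vZ) (hh : h < σ.var vZ)
    (path : TriePath τ g (rword (F h) (rotStart (F h) (K h)) (rotPer (F h) (K h))))
    (h1 : τ.arr aNS = fun j => if j = g then σ.arr aNS g + 1 else σ.arr aNS j)
    (h2 : τ.arr aGp = fun j => if j = g then rotPer (F h) (K h) else σ.arr aGp j)
    (h3 : τ.arr aSal = fun j => if j = g * σ.var vZ + σ.arr aNS g then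
      phase (rotPer (F h) (K h)) (rotStart (F h) (K h)) else σ.arr aSal j)
    (h4 : τ.arr aSlen = fun j => if j = g * σ.var vZ + σ.arr aNS g then K h else σ.arr aSlen j) :
    StrInv F K (h + 1) τ := by
  have hle : ∀ {g}, g < σ.var vZ → σ.arr aNS g < σ.var vZ := fun hg => (hI.le hg).trans_lt hh
  have new : StrSlot F K τ g (σ.arr aNS g) h :=
    ⟨path, by simp [h2], by simp [h3, he.Z], by simp [h4, he.Z]⟩
  have old : ∀ {g' η i}, g' < σ.var vZ → η < σ.arr aNS g' → StrSlot F K σ g' η i →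
      StrSlot F K τ g' η i := by
    intro g' η i hg' hη hs
    have hp := hs.path.ext he
    have hne : g' * σ.var vZ + η ≠ g * σ.var vZ + σ.arr aNS g := by
      intro e
      obtain ⟨e1, e2⟩ := mul_add_inj (hη.trans (hle hg')) (hle hg) e
      subst e1; omega
    refine ⟨hp, ?_, ?_, ?_⟩
    · rw [h2]
      by_cases e : g' = g
      · subst e
        simp only [if_true]
        exact (rword_inj.1 ((path.inj hok hp).1 rfl)).1
      · simp only [e, if_false]; exact hs.per
    · rw [h3, he.Z]; simp only [hne, if_false]; exact hs.al
    · rw [h4, he.Z]; simp only [hne, if_false]; exact hs.len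
  refine ⟨fun g' hg' η hη => ?_, fun i hi => ?_, ?_⟩
  · rw [he.Z] at hg'; rw [h1] at hη
    by_cases c : g' = g ∧ η = σ.arr aNS g
    · exact ⟨h, by omega, by rw [c.1, c.2]; exact new⟩
    · have hη' : η < σ.arr aNS g' := by
        by_cases e : g' = g
        · subst e; simp at hη; simp at c; omega
        · simpa [e] using hη
      obtain ⟨i, hi, hs⟩ := hI.sound g' hg' η hη'
      exact ⟨i, by omega, old hg' hη' hs⟩
  · rcases Nat.lt_succ_iff_lt_or_eq.1 hi with hi | rfl
    · obtain ⟨g', hg', η, hη, hs⟩ := hI.complete i hi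
      exact ⟨g', by rwa [he.Z], η, by rw [h1]; grind, old hg' hη hs⟩
    · exact ⟨g, by rwa [he.Z], σ.arr aNS g, by simp [h1], new⟩
  · rw [he.Z, h1, Finset.sum_range_update _ hg]
    have := hI.sum
    omega

/-- Enter the string `vh` into the tables. -/
def strCm : Cm :=
  (vst ≔ .ld aOff vh ;; vn ≔ .ld aLen vh) ;; rootCm aS ;; trieCm ;;
    vsl ≔ vg * vZ + .ld aNS vg ;; .sto aSal vsl ((vp - vi % vp) % vp) ;; .sto aSlen vsl vn ;;
    .sto aGp vg vp ;; .sto aNS vg (.ld aNS vg + 1)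

theorem strCm_spec {w : ℕ} {pm : Prog} (hw : 1 ≤ w) {σ : St} {F : ℕ → ℕ → ℕ} {K : ℕ → ℕ}
    {h X Z : ℕ} (hh : σ.var vh = h) (hhZ : h < Z) (hZ : σ.var vZ = Z) (hK : σ.arr aLen h = K h)
    (hK1 : 1 ≤ K h) (hF : ∀ t < K h, σ.arr aS (σ.arr aOff h + t) = F h t)
    (hFw : ∀ t < K h, F h t < 2 ^ w)
    (ht : TrieIs X σ) (hXZ : X + K h < Z) (hoff : σ.arr aOff h + K h ≤ Z)
    (hZw : Z * Z + Z + Z + 100 < 2 ^ w) (hI : StrInv F K h σ) :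
    Ht w pm strCm σ (400 * K h + 400) (fun τ => TrieIs (X + K h) τ ∧ StrInv F K (h + 1) τ ∧
      TrieExt σ τ) := by
  refine Ht.seq_le 10 (400 * K h + 390)
    (R := fun τ => τ.var vst = σ.arr aOff h ∧ τ.var vn = K h ∧ TrieEq σ τ)
    (Ht.of_wp hw (by decide) ?_) (by omega) ?_
  · simp [Cm.wp, hh, hK]
    exact ⟨by omega, by constructor <;> simp⟩
  intro α fα ⟨a1, a2, a3⟩
  have aS' : α.arr aS = σ.arr aS := fα.2 aS (by decide)
  refine Ht.seq_le _ (190 * K h + 270) (rootCm_spec hw (by decide) a2 a1 hK1 (by omega) (by omega))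
    (by omega) ?_
  rw [aS', rotStart_congr hK1 hF, rotPer_congr hK1 hF]
  intro β fβ ⟨b1, b2, b3⟩
  have b4 : TrieEq σ β := a3.trans ⟨fβ.1 vZ (by decide), fβ.1 vcl (by decide), fβ.1 vcn (by decide),
    fβ.2 aLA (by decide), fβ.2 aLL (by decide), fβ.2 aNA (by decide), fβ.2 aNL (by decide)⟩
  have b5 : β.var vn = K h := (fβ.1 vn (by decide)).trans a2
  have hle := rotStart_add_rotPer_le (f := F h) hK1
  have hpos := rotPer_pos (f := F h) hK1
  have b6 : ∀ t < rotStart (F h) (K h) + rotPer (F h) (K h), β.arr aW t = F h t := fun t ht => by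
    rw [b3 t (by omega), hF t (by omega)]
  have hcl := (b4.is ht).cl
  have hcn := (b4.is ht).cn
  refine Ht.seq_le _ 100 (trieCm_spec hw b1 b2 (b4.Z.trans hZ) (b4.is ht).ok
    (fun t ht => by rw [b6 _ (by omega)]; exact hFw _ (by omega)) (by omega) (by omega) (by omega)
    (by omega)) (by omega) ?_
  rw [rword_congr b6]
  intro γ fγ ⟨c1, c2, c3, c4, c5⟩
  have c6 := b4.ext.trans c2
  have gn : γ.arr aNS = σ.arr aNS := (fγ.2 aNS (by decide)).trans ((fβ.2 aNS (by decide)).trans (fα.2 aNS (by decide)))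
  have gp : γ.arr aGp = σ.arr aGp := (fγ.2 aGp (by decide)).trans ((fβ.2 aGp (by decide)).trans (fα.2 aGp (by decide)))
  have gs : γ.arr aSal = σ.arr aSal := (fγ.2 aSal (by decide)).trans ((fβ.2 aSal (by decide)).trans (fα.2 aSal (by decide)))
  have gl : γ.arr aSlen = σ.arr aSlen := (fγ.2 aSlen (by decide)).trans ((fβ.2 aSlen (by decide)).trans (fα.2 aSlen (by decide)))
  have gvi : γ.var vi = rotStart (F h) (K h) := (fγ.1 vi (by decide)).trans b1
  have gvp : γ.var vp = rotPer (F h) (K h) := (fγ.1 vp (by decide)).trans b2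
  have gvn : γ.var vn = K h := (fγ.1 vn (by decide)).trans b5
  have gZ : γ.var vZ = Z := c6.Z.trans hZ
  have hg : γ.var vg < Z := by have := c3.le; omega
  have hns : σ.arr aNS (γ.var vg) < Z := (hI.le (by rwa [hZ])).trans_lt hhZ
  have hgZ : γ.var vg * Z ≤ Z * Z := Nat.mul_le_mul_right _ hg.le
  refine Ht.of_wp hw (by decide) ?_
  simp [Cm.wp, gZ, gn, gvi, gvp, gvn]
  have hmod : rotStart (F h) (K h) % rotPer (F h) (K h) ≤ rotPer (F h) (K h) := (Nat.mod_lt _ hpos).le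
  generalize hD : ((((γ.set vsl _).put aSal _ _).put aSlen _ _).put aGp _ _).put aNS _ _ = δ
  have e1 : TrieEq γ δ := by subst hD; constructor <;> simp [St.put_arr_fun]
  have hD1 : TrieIs (X + K h) δ := e1.is ⟨c1, by omega, by omega⟩
  refine ⟨by omega, hmod, by omega, by omega, by omega, by omega, hD1, ?_, c6.trans e1.ext⟩
  · refine hI.push (g := γ.var vg) (c6.trans e1.ext) hD1.ok (by omega) (by omega) (c3.ext e1.ext) ?_ ?_ ?_ ?_
    · subst hD; simp [St.put_arr_fun, gn]
    · subst hD; simp [St.put_arr_fun, gp]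
    · subst hD; simp [St.put_arr_fun, gs, hZ, phase]
    · subst hD; simp [St.put_arr_fun, gl, hZ]

/-! ## The tables of the blocks -/

/-- The window of the block that starts at `s`. -/
def window (f : ℕ → ℕ) (L s : ℕ) : ℕ → ℕ := fun t => f (s + (L / 9 + 1) + t)

/-- The period of the window of the block `b`. -/
def blkPer (f : ℕ → ℕ) (L b : ℕ) : ℕ :=
  rotPer (window f L (b * (L / 9 + 1))) (L - (L / 9 + 1))
/-- The start of the least rotation in the window of the block `b`. -/
def blkStart (f : ℕ → ℕ) (L b : ℕ) : ℕ :=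
  rotStart (window f L (b * (L / 9 + 1))) (L - (L / 9 + 1))

/-- The extent of the period of the window of the block `b`. -/
def BlkExtent (f : ℕ → ℕ) (m L b lo hi : ℕ) : Prop :=
  Extent f m (b * (L / 9 + 1)) (b * (L / 9 + 1) + (L / 9 + 1)) (blkPer f L b)
    (b * (L / 9 + 1) + (L / 9 + 1) + 2 * L) lo hi

/-- The slot `β` of the group `g` holds the block `b`. -/
structure BlkSlot (f : ℕ → ℕ) (m L : ℕ) (τ : St) (g β b : ℕ) : Prop where
  path : TriePath τ g (rword (window f L (b * (L / 9 + 1))) (blkStart f L b) (blkPer f L b))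
  st : τ.arr aBst (g * τ.var vZ + β) = b * (L / 9 + 1)
  del : τ.arr aBdel (g * τ.var vZ + β) = phase (blkPer f L b) (L / 9 + 1 + blkStart f L b)
  ext : BlkExtent f m L b (τ.arr aBlo (g * τ.var vZ + β)) (τ.arr aBhi (g * τ.var vZ + β))
  hi : b * (L / 9 + 1) + L ≤ τ.arr aBhi (g * τ.var vZ + β)
  small : 3 * blkPer f L b ≤ L - (L / 9 + 1)

/-- The slots hold the relevant ones among the blocks below `h`. -/
structure BlkInv (f : ℕ → ℕ) (m L : ℕ) (h : ℕ) (τ : St) : Prop where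
  sound : ∀ g < τ.var vZ, ∀ β < τ.arr aQ g, ∃ b < h, BlkSlot f m L τ g β b
  complete : ∀ b < h, 3 * blkPer f L b ≤ L - (L / 9 + 1) →
    (∀ lo hi, BlkExtent f m L b lo hi → b * (L / 9 + 1) + L ≤ hi) →
    ∃ g < τ.var vZ, ∃ β < τ.arr aQ g, BlkSlot f m L τ g β b
  sum : ∑ g ∈ Finset.range (τ.var vZ), τ.arr aQ g ≤ h

section
variable {f : ℕ → ℕ} {m L h : ℕ} {σ τ : St}

theorem BlkSlot.keep (he : TrieExt σ τ) {g β b : ℕ} (hs : BlkSlot f m L σ g β b)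
    (h1 : τ.arr aBst (g * σ.var vZ + β) = σ.arr aBst (g * σ.var vZ + β))
    (h2 : τ.arr aBdel (g * σ.var vZ + β) = σ.arr aBdel (g * σ.var vZ + β))
    (h3 : τ.arr aBlo (g * σ.var vZ + β) = σ.arr aBlo (g * σ.var vZ + β))
    (h4 : τ.arr aBhi (g * σ.var vZ + β) = σ.arr aBhi (g * σ.var vZ + β)) :
    BlkSlot f m L τ g β b :=
  ⟨hs.path.ext he, by rw [he.Z, h1]; exact hs.st, by rw [he.Z, h2]; exact hs.del,
    by rw [he.Z, h3, h4]; exact hs.ext, by rw [he.Z, h4]; exact hs.hi, hs.small⟩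

theorem BlkInv.ext (hI : BlkInv f m L h σ) (he : TrieExt σ τ) (h0 : τ.arr aQ = σ.arr aQ)
    (h1 : τ.arr aBst = σ.arr aBst) (h2 : τ.arr aBdel = σ.arr aBdel)
    (h3 : τ.arr aBlo = σ.arr aBlo) (h4 : τ.arr aBhi = σ.arr aBhi) : BlkInv f m L h τ := by
  refine ⟨fun g hg η hη => ?_, fun b hb c1 c2 => ?_, ?_⟩
  · rw [he.Z] at hg; rw [h0] at hη
    obtain ⟨i, hi, h⟩ := hI.sound g hg η hη
    exact ⟨i, hi, h.keep he (by rw [h1]) (by rw [h2]) (by rw [h3]) (by rw [h4])⟩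
  · obtain ⟨g, hg, η, hη, h⟩ := hI.complete b hb c1 c2
    exact ⟨g, by rwa [he.Z], η, by rwa [h0], h.keep he (by rw [h1]) (by rw [h2]) (by rw [h3]) (by rw [h4])⟩
  · rw [he.Z, h0]; exact hI.sum

theorem BlkInv.le (hI : BlkInv f m L h σ) {g : ℕ} (hg : g < σ.var vZ) : σ.arr aQ g ≤ h :=
  (Finset.single_le_sum (f := fun g => σ.arr aQ g) (fun _ _ => Nat.zero_le _)
    (Finset.mem_range.2 hg)).trans hI.sum

/-- A block that is not relevant need not be entered. -/
theorem BlkInv.pass (hI : BlkInv f m L h σ) (hn : ¬ (3 * blkPer f L h ≤ L - (L / 9 + 1) ∧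
    ∀ lo hi, BlkExtent f m L h lo hi → h * (L / 9 + 1) + L ≤ hi)) : BlkInv f m L (h + 1) σ := by
  refine ⟨fun g hg η hη => ?_, fun b hb c1 c2 => ?_, hI.sum.trans (Nat.le_succ _)⟩
  · obtain ⟨i, hi, h⟩ := hI.sound g hg η hη
    exact ⟨i, by omega, h⟩
  · rcases Nat.lt_succ_iff_lt_or_eq.1 hb with hb | rfl
    · exact hI.complete b hb c1 c2
    · exact absurd ⟨c1, c2⟩ hn

theorem BlkInv.push {g lo hi : ℕ} (hI : BlkInv f m L h σ)
    (he : TrieExt σ τ) (hg : g < σ.var vZ) (hh : h < σ.var vZ)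
    (path : TriePath τ g (rword (window f L (h * (L / 9 + 1))) (blkStart f L h) (blkPer f L h)))
    (hext : BlkExtent f m L h lo hi) (hhi : h * (L / 9 + 1) + L ≤ hi)
    (small : 3 * blkPer f L h ≤ L - (L / 9 + 1))
    (h0 : τ.arr aQ = fun j => if j = g then σ.arr aQ g + 1 else σ.arr aQ j)
    (h1 : τ.arr aBst = fun j => if j = g * σ.var vZ + σ.arr aQ g then h * (L / 9 + 1) else σ.arr aBst j)
    (h2 : τ.arr aBdel = fun j => if j = g * σ.var vZ + σ.arr aQ g then
      phase (blkPer f L h) (L / 9 + 1 + blkStart f L h) else σ.arr aBdel j)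
    (h3 : τ.arr aBlo = fun j => if j = g * σ.var vZ + σ.arr aQ g then lo else σ.arr aBlo j)
    (h4 : τ.arr aBhi = fun j => if j = g * σ.var vZ + σ.arr aQ g then hi else σ.arr aBhi j) :
    BlkInv f m L (h + 1) τ := by
  have hle : ∀ {g}, g < σ.var vZ → σ.arr aQ g < σ.var vZ := fun hg => (hI.le hg).trans_lt hh
  have new : BlkSlot f m L τ g (σ.arr aQ g) h :=
    ⟨path, by simp [h1, he.Z], by simp [h2, he.Z], by simpa [h3, h4, he.Z] using hext,
      by simpa [h4, he.Z] using hhi, small⟩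
  have old : ∀ {g' η i}, g' < σ.var vZ → η < σ.arr aQ g' → BlkSlot f m L σ g' η i →
      BlkSlot f m L τ g' η i := by
    intro g' η i hg' hη hs
    have hne : g' * σ.var vZ + η ≠ g * σ.var vZ + σ.arr aQ g := by
      intro e
      obtain ⟨e1, e2⟩ := mul_add_inj (hη.trans (hle hg')) (hle hg) e
      subst e1; omega
    exact hs.keep he (by simp [h1, hne]) (by simp [h2, hne]) (by simp [h3, hne]) (by simp [h4, hne])
  refine ⟨fun g' hg' η hη => ?_, fun i hi c1 c2 => ?_, ?_⟩
  · rw [he.Z] at hg'; rw [h0] at hη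
    by_cases c : g' = g ∧ η = σ.arr aQ g
    · exact ⟨h, by omega, by rw [c.1, c.2]; exact new⟩
    · have hη' : η < σ.arr aQ g' := by
        by_cases e : g' = g
        · subst e; simp at hη; simp at c; omega
        · simpa [e] using hη
      obtain ⟨i, hi, hs⟩ := hI.sound g' hg' η hη'
      exact ⟨i, by omega, old hg' hη' hs⟩
  · rcases Nat.lt_succ_iff_lt_or_eq.1 hi with hi | rfl
    · obtain ⟨g', hg', η, hη, hs⟩ := hI.complete i hi c1 c2
      exact ⟨g', by rwa [he.Z], η, by rw [h0]; grind, old hg' hη hs⟩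
    · exact ⟨g, by rwa [he.Z], σ.arr aQ g, by simp [h0], new⟩
  · rw [he.Z, h0, Finset.sum_range_update _ hg]
    have := hI.sum
    omega

end

/-- Extend the period `vp` from `[vst, vst + vp)` to the right. -/
def hiCm : Cm :=
  (vhi ≔ vst + vp ;; vlim ≔ 2 * vL) ;; .loop vz vlim
    (.ite (.ltv vhi vm) (.ite (.eqv (.ld aP (vhi - vp)) (.ld aP vhi)) (vhi ≔ vhi + 1) .skip) .skip)

/-- After z rounds the extension has advanced z letters unless it met the end of the text or a
mismatch; in these two cases further rounds change nothing. -/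
theorem hiCm_spec {w : ℕ} {pm : Prog} (hw : 1 ≤ w) {σ : St} {c p m L : ℕ} {f : ℕ → ℕ}
    (hst : σ.var vst = c) (hp : σ.var vp = p) (hm : σ.var vm = m) (hL : σ.var vL = L)
    (hf : ∀ t < m, σ.arr aP t = f t) (hcp : c + p ≤ m) (hmw : m < 2 ^ w) (hLw : 2 * L + 10 < 2 ^ w) :
    Ht w pm hiCm σ (60 * L + 20) (fun τ => c + p ≤ τ.var vhi ∧ τ.var vhi ≤ m ∧
      (∀ y, c ≤ y → y + p < τ.var vhi → f y = f (y + p)) ∧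
      (τ.var vhi = m ∨ c + 2 * L ≤ τ.var vhi ∨ f (τ.var vhi - p) ≠ f (τ.var vhi))) := by
  refine Ht.seq_le 10 (2 * L * (20 + 4) + 3)
    (R := fun τ => τ = (σ.set vhi (c + p)).set vlim (2 * L))
    (Ht.of_wp hw (by decide) (by simp [Cm.wp, hst, hp, hL]; omega)) (by omega) ?_
  rintro τ - rfl
  refine (Ht.loop_le hw (fun z τ => c + p ≤ τ.var vhi ∧ τ.var vhi ≤ m ∧
      (∀ y, c ≤ y → y + p < τ.var vhi → f y = f (y + p)) ∧
      (τ.var vhi = m ∨ c + z + p ≤ τ.var vhi ∨ f (τ.var vhi - p) ≠ f (τ.var vhi))) 20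
    (n := 2 * L) (by simp) le_rfl (by decide) (by decide) (by decide) ?_ ?_).mono le_rfl
    fun τ _ ⟨h1, h2, h3, h4⟩ => ⟨h1, h2, h3, ?_⟩
  · simp; exact ⟨hcp, fun y h1 h2 => by omega⟩
  · intro z hz τ hF hvz ⟨h1, h2, h3, h4⟩
    have e1 : τ.var vp = p := (hF.1 vp (by decide)).trans (by simp [hp])
    have e2 : τ.var vm = m := (hF.1 vm (by decide)).trans (by simp [hm])
    have e3 : ∀ t < m, τ.arr aP t = f t := fun t ht => by
      rw [hF.2 aP (by decide)]; exact hf t ht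
    refine Ht.of_wp hw (by decide) ?_
    simp [Cm.wp, e1, e2]
    refine ⟨fun c1 => ?_, fun c1 => ?_⟩
    · rw [e3 _ c1, e3 _ (by omega)]
      refine ⟨⟨⟨by omega, by omega⟩, by omega⟩, fun c2 => ⟨by omega, by omega, by omega, ?_, ?_⟩, fun c2 => ⟨h1, h2, h3, ?_⟩⟩
      · intro y y1 y2
        rcases Nat.lt_or_eq_of_le y2 with y3 | y3
        · exact h3 y y1 y3
        · rw [y3, ← c2]; congr 1; omega
      · rcases h4 with h4 | h4 | h4
        · omega
        · right; left; omega
        · exact absurd c2 h4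
      · exact .inr (.inr c2)
    · exact ⟨h1, h2, h3, .inl (by omega)⟩
  · rcases h4 with h4 | h4 | h4
    · exact .inl h4
    · exact .inr (.inl (by omega))
    · exact .inr (.inr h4)

/-- Extend the period `vp` from `vst` to the left, as far as `vs`. -/
def loCm : Cm :=
  (vlo ≔ vst) ;; .loop vz vB
    (.ite (.ltv vs vlo) (.ite (.eqv (.ld aP (vlo - 1)) (.ld aP (vlo - 1 + vp))) (vlo ≔ vlo - 1) .skip) .skip)

theorem loCm_spec {w : ℕ} {pm : Prog} (hw : 1 ≤ w) {σ : St} {s B p m : ℕ} {f : ℕ → ℕ}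
    (hst : σ.var vst = s + B) (hs : σ.var vs = s) (hp : σ.var vp = p) (hB : σ.var vB = B)
    (hf : ∀ t < m, σ.arr aP t = f t) (hcp : s + B + p ≤ m) (hmw : m < 2 ^ w) :
    Ht w pm loCm σ (30 * B + 20) (fun τ => s ≤ τ.var vlo ∧ τ.var vlo ≤ s + B ∧
      (∀ y, τ.var vlo ≤ y → y < s + B → f y = f (y + p)) ∧
      (τ.var vlo = s ∨ f (τ.var vlo - 1) ≠ f (τ.var vlo - 1 + p))) := by
  have hone : 1 < 2 ^ w := Nat.one_lt_two_pow (by omega)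
  refine Ht.seq_le 10 (B * (25 + 4) + 3) (R := fun τ => τ = σ.set vlo (s + B))
    (Ht.of_wp hw (by decide) (by simp [Cm.wp, hst])) (by omega) ?_
  rintro τ - rfl
  refine (Ht.loop_le hw (fun z τ => s ≤ τ.var vlo ∧ τ.var vlo ≤ s + B ∧
      (∀ y, τ.var vlo ≤ y → y < s + B → f y = f (y + p)) ∧
      (τ.var vlo = s ∨ τ.var vlo + z = s + B ∨ f (τ.var vlo - 1) ≠ f (τ.var vlo - 1 + p))) 25
    (n := B) (by simp [hB]) le_rfl (by decide) (by decide) (by decide) ?_ ?_).mono le_rfl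
    fun τ _ ⟨h1, h2, h3, h4⟩ => ⟨h1, h2, h3, ?_⟩
  · simp; intro y h1 h2; omega
  · intro z hz τ hF hvz ⟨h1, h2, h3, h4⟩
    have e1 : τ.var vp = p := (hF.1 vp (by decide)).trans (by simp [hp])
    have e2 : τ.var vs = s := (hF.1 vs (by decide)).trans (by simp [hs])
    have e3 : ∀ t < m, τ.arr aP t = f t := fun t ht => by
      rw [hF.2 aP (by decide)]; exact hf t ht
    refine Ht.of_wp hw (by decide) ?_
    simp [Cm.wp, e1, e2]
    refine ⟨fun c1 => ?_, fun c1 => ?_⟩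
    · rw [e3 _ (by omega), e3 _ (by omega)]
      refine ⟨⟨⟨by omega, by omega⟩, by omega, by omega⟩, fun c2 => ⟨⟨by omega, by omega⟩, by omega, by omega, ?_, ?_⟩, fun c2 => ⟨h1, h2, h3, ?_⟩⟩
      · intro y y1 y2
        by_cases y3 : y = τ.var vlo - 1
        · rw [y3, c2]
        · exact h3 y (by omega) y2
      · rcases h4 with h4 | h4 | h4
        · omega
        · right; left; omega
        · exact absurd c2 h4
      · exact .inr (.inr c2)
    · exact ⟨h1, h2, h3, .inl (by omega)⟩
  · rcases h4 with h4 | h4 | h4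
    · exact .inl h4
    · exact .inl (by omega)
    · exact .inr h4

/-- Enter the block `vb`, with the root in `aW`, into the tables. -/
def enterCm : Cm :=
  trieCm ;; vsl ≔ vg * vZ + .ld aQ vg ;; .sto aBst vsl vs ;;
    .sto aBdel vsl ((vp - (vB + vi) % vp) % vp) ;; .sto aBlo vsl vlo ;; .sto aBhi vsl vhi ;;
    .sto aQ vg (.ld aQ vg + 1)

theorem enterCm_spec {w : ℕ} {pm : Prog} (hw : 1 ≤ w) {δ : St} {f : ℕ → ℕ} {m L B h X Z lo hi p : ℕ}
    (hhZ : h < Z) (hZ : δ.var vZ = Z) (hBL : B = L / 9 + 1) (ds : δ.var vs = h * B) (dB : δ.var vB = B)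
    (di : δ.var vi = blkStart f L h) (dp : δ.var vp = p) (hp : blkPer f L h = p) (hpos : 1 ≤ p)
    (dlo : δ.var vlo = lo) (dhi : δ.var vhi = hi)
    (dW : ∀ z < blkStart f L h + p, δ.arr aW z = window f L (h * (L / 9 + 1)) z)
    (dWw : ∀ z < blkStart f L h + p, δ.arr aW z < 2 ^ w) (hip : blkStart f L h + p + B ≤ Z)
    (hext : BlkExtent f m L h lo hi) (hc' : h * B + L ≤ hi)
    (hc : 3 * p ≤ L - B) (ht : TrieIs X δ) (hXZ : X + p < Z)
    (hZw : Z * Z + Z + Z + Z + 100 < 2 ^ w) (hI : BlkInv f m L h δ) :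
    Ht w pm enterCm δ (100 * p + 200) (fun τ => TrieIs (X + p) τ ∧ BlkInv f m L (h + 1) τ ∧
      TrieExt δ τ) := by
  have hcl := ht.cl
  have hcn := ht.cn
  have hrt : rword (δ.arr aW) (blkStart f L h) p =
      rword (window f L (h * (L / 9 + 1))) (blkStart f L h) p :=
    rword_congr fun t ht => dW t (by omega)
  refine Ht.seq_le _ 100 (trieCm_spec hw di dp hZ ht.ok
    (fun t ht => dWw _ (by omega))
    (by omega) (by omega) (by omega) (by omega)) (by omega) ?_
  rw [hrt]
  intro ε fε ⟨e1, e2, e3, e4, e5⟩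
  have eZ : ε.var vZ = Z := e2.Z.trans hZ
  have es : ε.var vs = h * B := (fε.1 vs (by decide)).trans ds
  have eB : ε.var vB = B := (fε.1 vB (by decide)).trans dB
  have ep : ε.var vp = p := (fε.1 vp (by decide)).trans dp
  have ei : ε.var vi = blkStart f L h := (fε.1 vi (by decide)).trans di
  have elo : ε.var vlo = lo := (fε.1 vlo (by decide)).trans dlo
  have ehi : ε.var vhi = hi := (fε.1 vhi (by decide)).trans dhi
  have eQ : ε.arr aQ = δ.arr aQ := fε.2 aQ (by decide)
  have est' : ε.arr aBst = δ.arr aBst := fε.2 aBst (by decide)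
  have edel' : ε.arr aBdel = δ.arr aBdel := fε.2 aBdel (by decide)
  have elo' : ε.arr aBlo = δ.arr aBlo := fε.2 aBlo (by decide)
  have ehi' : ε.arr aBhi = δ.arr aBhi := fε.2 aBhi (by decide)
  have hg : ε.var vg < Z := by have := e3.le; omega
  have hq : δ.arr aQ (ε.var vg) < Z := (hI.le (by rwa [hZ])).trans_lt hhZ
  have hgZ : ε.var vg * Z ≤ Z * Z := Nat.mul_le_mul_right _ hg.le
  have hmod : (B + blkStart f L h) % p ≤ p := (Nat.mod_lt _ hpos).le
  refine Ht.of_wp hw (by decide) ?_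
  simp [Cm.wp, eZ, eQ, ei, ep, es, eB, elo, ehi]
  generalize hD : (((((ε.set vsl _).put aBst _ _).put aBdel _ _).put aBlo _ _).put aBhi _ _).put aQ _ _ = υ
  have u1 : TrieEq ε υ := by subst hD; constructor <;> simp [St.put_arr_fun]
  have u2 : TrieIs (X + p) υ := u1.is ⟨e1, by omega, by omega⟩
  refine ⟨by omega, by omega, by omega, by omega, by omega, by omega, u2, ?_, e2.trans u1.ext⟩
  refine hI.push (g := ε.var vg) (lo := lo) (hi := hi) (e2.trans u1.ext) (by omega) (by omega)
    (by rw [hp]; exact e3.ext u1.ext) hext (by rw [← hBL]; exact hc') (by rw [hp, ← hBL]; exact hc) ?_ ?_ ?_ ?_ ?_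
  · subst hD; simp [St.put_arr_fun, eQ]
  · subst hD; simp [St.put_arr_fun, est', hZ, hBL]
  · subst hD; simp [St.put_arr_fun, edel', hZ, phase, hp, hBL]
  · subst hD; simp [St.put_arr_fun, elo', hZ]
  · subst hD; simp [St.put_arr_fun, ehi', hZ]

/-- Enter the block `vb` into the tables, if it is relevant. -/
def blkCm : Cm :=
  (vs ≔ vb * vB ;; vst ≔ vs + vB ;; vn ≔ vL - vB) ;; rootCm aP ;; hiCm ;; loCm ;;
    .ite (.ltv vn (3 * vp)) .skip (.ite (.ltv vhi (vs + vL)) .skip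
      enterCm)

/-- The test 3p ≤ L - B precedes the insertion of the root. An entered root thus has at most 3B
letters, and all blocks together add at most 3m letters to the trie. -/
theorem blkCm_spec {w : ℕ} {pm : Prog} (hw : 1 ≤ w) {σ : St} {f : ℕ → ℕ} {m L B h X Z : ℕ}
    (hb : σ.var vb = h) (hhZ : h < Z) (hZ : σ.var vZ = Z) (hm : σ.var vm = m) (hL : σ.var vL = L)
    (hB : σ.var vB = B) (hBL : B = L / 9 + 1) (hL5 : 5 ≤ L) (hhm : h * B + L ≤ m)
    (hf : ∀ t < m, σ.arr aP t = f t) (hfw : ∀ t < m, f t < 2 ^ w)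
    (ht : TrieIs X σ) (hXZ : X + 3 * B < Z) (hmZ : m ≤ Z)
    (hZw : Z * Z + Z + Z + Z + 100 < 2 ^ w) (hI : BlkInv f m L h σ) :
    Ht w pm blkCm σ (1000 * L + 1000) (fun τ => TrieIs (X + 3 * B) τ ∧ BlkInv f m L (h + 1) τ ∧
      TrieExt σ τ) := by
  have hone : 1 < 2 ^ w := Nat.one_lt_two_pow (by omega)
  have hn1 : 1 ≤ L - B := by omega
  refine Ht.seq_le 15 (1000 * L + 980)
    (R := fun τ => τ.var vs = h * B ∧ τ.var vst = h * B + B ∧ τ.var vn = L - B ∧ TrieEq σ τ)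
    (Ht.of_wp hw (by decide) ?_) (by omega) ?_
  · simp [Cm.wp, hb, hB, hL]
    exact ⟨by omega, by omega, by omega, by constructor <;> simp⟩
  intro α fα ⟨a1, a2, a3, a4⟩
  have aP' : α.arr aP = σ.arr aP := fα.2 aP (by decide)
  have hWf : ∀ t < L - B, σ.arr aP (h * B + B + t) = window f L (h * (L / 9 + 1)) t := fun t ht => by
    rw [hf _ (by omega), window, hBL]
  refine Ht.seq_le _ (790 * L + 800) (rootCm_spec hw (by decide) a3 a2 hn1 (by omega) (by omega))
    (by omega) ?_
  rw [aP', rotStart_congr hn1 hWf, rotPer_congr hn1 hWf]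
  intro β fβ ⟨b1, b2, b3⟩
  rw [hBL, ← blkStart] at b1
  rw [hBL, ← blkPer] at b2
  have hle : blkStart f L h + blkPer f L h ≤ L - B := by
    rw [hBL]; exact rotStart_add_rotPer_le (by omega)
  have hpos : 1 ≤ blkPer f L h := by rw [blkPer]; exact rotPer_pos (by omega)
  generalize hp : blkPer f L h = p at *
  have b4 : TrieEq σ β := a4.trans ⟨fβ.1 vZ (by decide), fβ.1 vcl (by decide), fβ.1 vcn (by decide),
    fβ.2 aLA (by decide), fβ.2 aLL (by decide), fβ.2 aNA (by decide), fβ.2 aNL (by decide)⟩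
  have bs : β.var vs = h * B := (fβ.1 vs (by decide)).trans a1
  have bst : β.var vst = h * B + B := (fβ.1 vst (by decide)).trans a2
  have bn : β.var vn = L - B := (fβ.1 vn (by decide)).trans a3
  have bm : β.var vm = m := (fβ.1 vm (by decide)).trans ((fα.1 vm (by decide)).trans hm)
  have bL : β.var vL = L := (fβ.1 vL (by decide)).trans ((fα.1 vL (by decide)).trans hL)
  have bB : β.var vB = B := (fβ.1 vB (by decide)).trans ((fα.1 vB (by decide)).trans hB)
  have bP : β.arr aP = σ.arr aP := (fβ.2 aP (by decide)).trans aP'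
  refine Ht.seq_le _ (730 * L + 780) (hiCm_spec hw bst b2 bm bL (by rw [bP]; exact hf) (by omega)
    (by omega) (by omega)) (by omega) ?_
  intro γ fγ ⟨c1, c2, c3, c4⟩
  have cs : γ.var vs = h * B := (fγ.1 vs (by decide)).trans bs
  have cst : γ.var vst = h * B + B := (fγ.1 vst (by decide)).trans bst
  have cB : γ.var vB = B := (fγ.1 vB (by decide)).trans bB
  have cp : γ.var vp = p := (fγ.1 vp (by decide)).trans b2
  have cP : γ.arr aP = σ.arr aP := (fγ.2 aP (by decide)).trans bP
  refine Ht.seq_le _ (700 * L + 730) (loCm_spec hw cst cs cp cB (by rw [cP]; exact hf) (by omega)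
    (by omega)) (by omega) ?_
  intro δ fδ ⟨d1, d2, d3, d4⟩
  have dhi : δ.var vhi = γ.var vhi := fδ.1 vhi (by decide)
  generalize hhi : γ.var vhi = hi at *
  generalize hlo : δ.var vlo = lo at *
  have hext : BlkExtent f m L h lo hi := by
    unfold BlkExtent; rw [← hBL, hp]
    exact ⟨d1, d2, d3, d4, c1, c2, c3, c4⟩
  have d5 : TrieEq σ δ := b4.trans (TrieEq.trans (τ := γ)
    ⟨fγ.1 vZ (by decide), fγ.1 vcl (by decide), fγ.1 vcn (by decide),
      fγ.2 aLA (by decide), fγ.2 aLL (by decide), fγ.2 aNA (by decide), fγ.2 aNL (by decide)⟩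
    ⟨fδ.1 vZ (by decide), fδ.1 vcl (by decide), fδ.1 vcn (by decide),
      fδ.2 aLA (by decide), fδ.2 aLL (by decide), fδ.2 aNA (by decide), fδ.2 aNL (by decide)⟩)
  have ds : δ.var vs = h * B := (fδ.1 vs (by decide)).trans cs
  have dB : δ.var vB = B := (fδ.1 vB (by decide)).trans cB
  have dp : δ.var vp = p := (fδ.1 vp (by decide)).trans cp
  have dn : δ.var vn = L - B := (fδ.1 vn (by decide)).trans ((fγ.1 vn (by decide)).trans bn)
  have dL : δ.var vL = L := (fδ.1 vL (by decide)).trans ((fγ.1 vL (by decide)).trans bL)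
  have di : δ.var vi = blkStart f L h := (fδ.1 vi (by decide)).trans ((fγ.1 vi (by decide)).trans b1)
  have dQ : δ.arr aQ = σ.arr aQ := (fδ.2 aQ (by decide)).trans ((fγ.2 aQ (by decide)).trans
    ((fβ.2 aQ (by decide)).trans (fα.2 aQ (by decide))))
  have dst : δ.arr aBst = σ.arr aBst := (fδ.2 aBst (by decide)).trans ((fγ.2 aBst (by decide)).trans
    ((fβ.2 aBst (by decide)).trans (fα.2 aBst (by decide))))
  have ddel : δ.arr aBdel = σ.arr aBdel := (fδ.2 aBdel (by decide)).trans ((fγ.2 aBdel (by decide)).trans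
    ((fβ.2 aBdel (by decide)).trans (fα.2 aBdel (by decide))))
  have dlo : δ.arr aBlo = σ.arr aBlo := (fδ.2 aBlo (by decide)).trans ((fγ.2 aBlo (by decide)).trans
    ((fβ.2 aBlo (by decide)).trans (fα.2 aBlo (by decide))))
  have dhi' : δ.arr aBhi = σ.arr aBhi := (fδ.2 aBhi (by decide)).trans ((fγ.2 aBhi (by decide)).trans
    ((fβ.2 aBhi (by decide)).trans (fα.2 aBhi (by decide))))
  have dW : ∀ z < L - B, δ.arr aW z = window f L (h * (L / 9 + 1)) z := fun z hz => by
    rw [fδ.2 aW (by decide), fγ.2 aW (by decide), b3 z hz]; exact hWf z hz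
  -- Completeness concerns only blocks all of whose extents reach s + L; the extent just computed is
  -- enough to show that a rejected block is not one of them.
  have hfin : ¬ (3 * p ≤ L - B ∧ h * B + L ≤ hi) →
      TrieIs (X + 3 * B) δ ∧ BlkInv f m L (h + 1) δ ∧ TrieExt σ δ := fun hno =>
    ⟨⟨(d5.is ht).ok, (d5.is ht).cl.trans (by omega), (d5.is ht).cn.trans (by omega)⟩,
      (hI.ext d5.ext dQ dst ddel dlo dhi').pass (by
        rintro ⟨e1, e2⟩
        exact hno ⟨by rwa [hp, ← hBL] at e1, by have := e2 lo hi hext; rwa [← hBL] at this⟩), d5.ext⟩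
  refine Ht.ite_le hw 5 (700 * L + 722) (by decide) (by omega) ?_ ?_ ?_
  · simp [dp]; omega
  · intro hc
    simp [dn, dp] at hc
    exact (Ht.skip (hfin fun h => not_lt.2 h.1 hc)).mono (by omega) fun _ _ h => h
  intro hc
  simp [dn, dp] at hc
  refine Ht.ite_le hw 5 (700 * L + 710) (by decide) (by omega) ?_ ?_ ?_
  · simp [ds, dL]; omega
  · intro hc'
    simp [dhi, ds, dL] at hc'
    exact (Ht.skip (hfin fun h => not_lt.2 h.2 hc')).mono (by omega) fun _ _ h => h
  intro hc'
  simp [dhi, ds, dL] at hc'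
  have w1 : ∀ z < blkStart f L h + p, δ.arr aW z < 2 ^ w := fun z hz => by
    have h1 := hWf z (by omega)
    have h2 : h * B + B + z < m := by clear * - hhm hle hz hn1; omega
    rw [dW z (by omega), ← h1, hf _ h2]
    exact hfw _ h2
  have w2 : ∀ z < blkStart f L h + p, δ.arr aW z = window f L (h * (L / 9 + 1)) z :=
    fun z hz => dW z (by omega)
  have w3 : blkStart f L h + p + B ≤ Z := by clear * - hle hhm hmZ hBL hL5; omega
  have w4 : p ≤ 3 * B := by clear * - hc hBL; omega
  have w5 : X + p < Z := by clear * - w4 hXZ; omega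
  have w6 : 100 * p + 200 ≤ 700 * L + 710 := by clear * - w4 hBL hL5; omega
  exact (enterCm_spec hw hhZ (d5.Z.trans hZ) hBL ds dB di dp hp hpos hlo dhi w2 w1 w3
    hext hc' hc (d5.is ht) w5 hZw (hI.ext d5.ext dQ dst ddel dlo dhi')).mono w6
    fun τ _ ⟨h1, h2, h3⟩ => ⟨⟨h1.ok, h1.cl.trans (Nat.add_le_add_left w4 X),
      h1.cn.trans (Nat.add_le_add_left w4 X)⟩, h2, d5.ext.trans h3⟩

/-! ## Preprocessing -/

/-- The state holds the text `f` of length `m` and the strings `F h` of length `K h`, `h < n`, of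
total length `N` and minimal length `L`. -/
structure Input (w : ℕ) (f : ℕ → ℕ) (m : ℕ) (F : ℕ → ℕ → ℕ) (K : ℕ → ℕ) (n N L : ℕ) (σ : St) :
    Prop where
  vm : σ.var vm = m
  vnS : σ.var vnS = n
  vN : σ.var vN = N
  vL : σ.var vL = L
  sum : ∑ h ∈ Finset.range n, K h = N
  five : 5 ≤ L
  le : L ≤ m
  min : ∀ h < n, L ≤ K h
  len : ∀ h < n, σ.arr aLen h = K h
  off : ∀ h < n, σ.arr aOff h = ∑ i ∈ Finset.range h, K i
  text : ∀ t < m, σ.arr aP t = f t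
  text_lt : ∀ t < m, f t < 2 ^ w
  str : ∀ h < n, ∀ t < K h, σ.arr aS (σ.arr aOff h + t) = F h t
  str_lt : ∀ h < n, ∀ t < K h, F h t < 2 ^ w

section
variable {w : ℕ} {f : ℕ → ℕ} {m : ℕ} {F : ℕ → ℕ → ℕ} {K : ℕ → ℕ} {n N L : ℕ} {σ τ : St}

theorem Input.congr (h : Input w f m F K n N L σ) (h1 : τ.var .vm = σ.var .vm)
    (h2 : τ.var .vnS = σ.var .vnS) (h3 : τ.var .vN = σ.var .vN) (h4 : τ.var .vL = σ.var .vL)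
    (h5 : τ.arr aLen = σ.arr aLen) (h6 : τ.arr aOff = σ.arr aOff) (h7 : τ.arr aP = σ.arr aP)
    (h8 : τ.arr aS = σ.arr aS) : Input w f m F K n N L τ :=
  ⟨h1.trans h.vm, h2.trans h.vnS, h3.trans h.vN, h4.trans h.vL, h.sum, h.five, h.le, h.min,
    by rw [h5]; exact h.len, by rw [h6]; exact h.off, by rw [h7]; exact h.text, h.text_lt,
    by rw [h8, h6]; exact h.str, h.str_lt⟩

theorem Input.sum_le (h : Input w f m F K n N L σ) {i : ℕ} (hi : i < n) :
    ∑ j ∈ Finset.range i, K j + K i ≤ N := by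
  rw [← Finset.sum_range_succ, ← h.sum]
  exact Finset.sum_le_sum_of_subset (by simpa using hi)

theorem Input.card_le (h : Input w f m F K n N L σ) : n * L ≤ N := by
  rw [← h.sum]
  have := Finset.sum_le_sum (s := Finset.range n) (f := fun _ => L) (g := K)
    fun i hi => h.min i (Finset.mem_range.1 hi)
  simpa using this

end

/-- Initialize the parameters and the tables. -/
def initCm : Cm :=
  (vB ≔ vL / 9 + 1 ;; vZ ≔ 8 * (vm + vN + 2) ;; vcl ≔ 0 ;; vcn ≔ 0) ;;
    .loop vj vZ (.sto aQ vj 0 ;; .sto aNS vj 0)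

/-- Enter all strings. -/
def stringsCm : Cm := .loop vh vnS strCm

/-- Enter all blocks. -/
def blocksCm : Cm := (vnb ≔ (vm - vL) / vB + 1) ;; .loop vb vnb blkCm

/-- The number of blocks. -/
def blkNum (m L : ℕ) : ℕ := (m - L) / (L / 9 + 1) + 1

/-- The extra block fits because B ≤ L. This inequality bounds the sum of B · q over all groups by
m. -/
theorem blkNum_mul {m L : ℕ} (h : L ≤ m) (hL : 5 ≤ L) : blkNum m L * (L / 9 + 1) ≤ m := by
  have := Nat.div_mul_le_self (m - L) (L / 9 + 1)
  rw [blkNum, Nat.add_mul]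
  omega

theorem blkNum_spec {m L b : ℕ} (h : L ≤ m) (hb : b < blkNum m L) : b * (L / 9 + 1) + L ≤ m := by
  have h1 := Nat.div_mul_le_self (m - L) (L / 9 + 1)
  have h2 : b * (L / 9 + 1) ≤ (m - L) / (L / 9 + 1) * (L / 9 + 1) :=
    Nat.mul_le_mul_right _ (by unfold blkNum at hb; omega)
  omega

section
variable {w : ℕ} {pm : Prog} {f : ℕ → ℕ} {m : ℕ} {F : ℕ → ℕ → ℕ} {K : ℕ → ℕ} {n N L Z : ℕ} {σ : St}

theorem initCm_spec (hw : 1 ≤ w) (hi : Input w f m F K n N L σ) (hZ : 8 * (m + N + 2) = Z)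
    (hZw : Z + 100 < 2 ^ w) :
    Ht w pm initCm σ (20 * Z + 30) (fun τ => Input w f m F K n N L τ ∧ τ.var vZ = Z ∧
      τ.var vB = L / 9 + 1 ∧ TrieIs 0 τ ∧ StrInv F K 0 τ ∧ BlkInv f m L 0 τ) := by
  have hle := hi.le
  refine Ht.seq_le 20 (Z * (6 + 4) + 3) (R := fun τ => Input w f m F K n N L τ ∧ τ.var vZ = Z ∧
      τ.var vB = L / 9 + 1 ∧ τ.var vcl = 0 ∧ τ.var vcn = 0) (Ht.of_wp hw (by decide) ?_) (by omega) ?_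
  · simp [Cm.wp, hi.vm, hi.vN, hi.vL, hZ]
    exact ⟨by omega, by omega, hi.congr (by simp) (by simp) (by simp) (by simp) (by simp) (by simp) (by simp) (by simp)⟩
  intro τ fτ ⟨t1, t2, t3, t4, t5⟩
  refine (Ht.loop_le hw (fun z τ => ∀ j < z, τ.arr aQ j = 0 ∧ τ.arr aNS j = 0) 6 t2 le_rfl (by decide)
    (by decide) (by decide) (by simp) ?_).mono le_rfl ?_
  · intro z hz τ hF hvz hI
    refine Ht.of_wp hw (by decide) ?_
    simp [Cm.wp, hvz]
    refine ⟨by omega, fun j hj => ⟨fun e => (hI j (by omega)).1, fun e => (hI j (by omega)).2⟩⟩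
  · intro υ fυ hI
    have uZ : υ.var vZ = Z := (fυ.1 vZ (by decide)).trans t2
    have ucl : υ.var vcl = 0 := (fυ.1 vcl (by decide)).trans t4
    have ucn : υ.var vcn = 0 := (fυ.1 vcn (by decide)).trans t5
    refine ⟨t1.congr (fυ.1 _ (by decide)) (fυ.1 _ (by decide)) (fυ.1 _ (by decide))
      (fυ.1 _ (by decide)) (fυ.2 _ (by decide)) (fυ.2 _ (by decide)) (fυ.2 _ (by decide))
      (fυ.2 _ (by decide)), uZ, (fυ.1 vB (by decide)).trans t3, ⟨⟨?_, ?_⟩, ucl.le, ucn.le⟩,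
      ⟨?_, fun i hi => absurd hi (Nat.not_lt_zero i), ?_⟩, ⟨?_, fun i hi => absurd hi (Nat.not_lt_zero i), ?_⟩⟩
    · rw [ucl]; exact fun i hi => absurd hi (Nat.not_lt_zero i)
    · rw [ucn]; exact fun i hi => absurd hi (Nat.not_lt_zero i)
    · intro g hg η hη; rw [(hI g (by omega)).2] at hη; omega
    · rw [uZ, Finset.sum_eq_zero fun g hg => (hI g (Finset.mem_range.1 hg)).2]
    · intro g hg η hη; rw [(hI g (by omega)).1] at hη; omega
    · rw [uZ, Finset.sum_eq_zero fun g hg => (hI g (Finset.mem_range.1 hg)).1]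

theorem stringsCm_spec (hw : 1 ≤ w) (hi : Input w f m F K n N L σ) (hZ : 8 * (m + N + 2) = Z)
    (hZw : Z * Z + Z + Z + 100 < 2 ^ w) (hvZ : σ.var vZ = Z) (ht : TrieIs 0 σ)
    (hs : StrInv F K 0 σ) :
    Ht w pm stringsCm σ (1000 * N + 10) (fun τ => TrieIs N τ ∧ StrInv F K n τ ∧ TrieExt σ τ) := by
  have hcard := hi.card_le
  have hn := hi.vnS
  have h5 := hi.five
  have hnN : 5 * n ≤ N := by nlinarith
  have hT : ∑ i ∈ Finset.range n, ((400 * K i + 400) + 4) + 3 ≤ 1000 * N + 10 := by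
    rw [Finset.sum_add_distrib, Finset.sum_add_distrib, ← Finset.mul_sum, hi.sum]
    simp
    omega
  rw [← hn] at hT
  refine (Ht.loop hw (fun z τ => TrieIs (∑ i ∈ Finset.range z, K i) τ ∧ StrInv F K z τ ∧ TrieExt σ τ)
    (fun i => 400 * K i + 400) (by decide) (by decide) (by decide) ?_ ?_).mono hT ?_
  · have e : TrieEq σ (σ.set vh 0) := by constructor <;> simp
    exact ⟨by simpa using e.is ht, hs.ext e.ext rfl rfl rfl rfl, e.ext⟩
  · intro h hh τ hF hvh ⟨h1, h2, h3⟩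
    rw [hn] at hh
    have e1 := hi.sum_le hh
    have hK := hi.min h hh
    have aoff : τ.arr aOff = σ.arr aOff := hF.2 aOff (by decide)
    have alen : τ.arr aLen = σ.arr aLen := hF.2 aLen (by decide)
    have aS' : τ.arr aS = σ.arr aS := hF.2 aS (by decide)
    refine (strCm_spec (Z := Z) hw hvh (by omega) ((hF.1 vZ (by decide)).trans hvZ)
      (by rw [alen]; exact hi.len h hh) (by omega) (by rw [aS', aoff]; exact hi.str h hh)
      (hi.str_lt h hh) h1 (by omega) (by rw [aoff, hi.off h hh]; omega) hZw h2).mono le_rfl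
      fun υ _ ⟨u1, u2, u3⟩ => ?_
    have e : TrieEq υ (υ.set vh (h + 1)) := by constructor <;> simp
    exact ⟨by rw [Finset.sum_range_succ]; exact e.is u1, u2.ext e.ext rfl rfl rfl rfl,
      h3.trans (u3.trans e.ext)⟩
  · intro τ _ ⟨h1, h2, h3⟩
    rw [hn, hi.sum] at h1
    rw [hn] at h2
    exact ⟨h1, h2, h3⟩

theorem blocksCm_spec (hw : 1 ≤ w) (hi : Input w f m F K n N L σ) (hZ : 8 * (m + N + 2) = Z)
    (hZw : Z * Z + Z + Z + Z + 100 < 2 ^ w) (hvZ : σ.var vZ = Z) (hvB : σ.var vB = L / 9 + 1)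
    (ht : TrieIs N σ) (hs : BlkInv f m L 0 σ) :
    Ht w pm blocksCm σ (20000 * m + 100) (fun τ => TrieOk τ ∧ BlkInv f m L (blkNum m L) τ ∧
      TrieExt σ τ) := by
  have h5 := hi.five
  have hle := hi.le
  have hmul := blkNum_mul hle h5
  have hnZ : blkNum m L ≤ m := (Nat.le_mul_of_pos_right _ (by omega)).trans hmul
  refine Ht.seq_le 15 (blkNum m L * ((1000 * L + 1000) + 4) + 3)
    (R := fun τ => τ.var vnb = blkNum m L ∧ TrieEq σ τ) (Ht.of_wp hw (by decide) ?_) ?_ ?_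
  · simp [Cm.wp, hi.vm, hi.vL, hvB]
    rw [← blkNum]
    have h1 : (m - L) / (L / 9 + 1) ≤ m - L := Nat.div_le_self _ _
    exact ⟨⟨hle, by omega, by omega⟩, rfl, by constructor <;> simp⟩
  -- L ≤ 9B, so a cost of O(L) per block adds up to O(m).
  · have h2 : blkNum m L * L ≤ blkNum m L * (9 * (L / 9 + 1)) := Nat.mul_le_mul_left _ (by omega)
    nlinarith
  intro τ fτ ⟨t1, t2⟩
  have tZ : τ.var vZ = Z := t2.Z.trans hvZ
  have hi' : Input w f m F K n N L τ := hi.congr (fτ.1 _ (by decide)) (fτ.1 _ (by decide))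
    (fτ.1 _ (by decide)) (fτ.1 _ (by decide)) (fτ.2 _ (by decide)) (fτ.2 _ (by decide))
    (fτ.2 _ (by decide)) (fτ.2 _ (by decide))
  have tB : τ.var vB = L / 9 + 1 := (fτ.1 vB (by decide)).trans hvB
  refine (Ht.loop_le hw (fun z υ => TrieIs (N + z * (3 * (L / 9 + 1))) υ ∧ BlkInv f m L z υ ∧ TrieExt σ υ)
    (1000 * L + 1000) t1 le_rfl (by decide) (by decide) (by decide) ?_ ?_).mono le_rfl
    fun υ _ ⟨u1, u2, u3⟩ => ⟨u1.ok, u2, u3⟩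
  · have e : TrieEq σ (τ.set vb 0) := t2.trans (by constructor <;> simp)
    exact ⟨by simpa using e.is ht, hs.ext e.ext (fτ.2 _ (by decide)) (fτ.2 _ (by decide))
      (fτ.2 _ (by decide)) (fτ.2 _ (by decide)) (fτ.2 _ (by decide)), e.ext⟩
  · intro h hh υ hF hvh ⟨h1, h2, h3⟩
    have h4 : (h + 1) * (L / 9 + 1) ≤ m := (Nat.mul_le_mul_right _ hh).trans hmul
    have h6 : N + h * (3 * (L / 9 + 1)) + 3 * (L / 9 + 1) = N + (h + 1) * (3 * (L / 9 + 1)) := by ring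
    have h7 : (h + 1) * (3 * (L / 9 + 1)) = 3 * ((h + 1) * (L / 9 + 1)) := by ring
    refine (blkCm_spec (Z := Z) hw hvh (by omega) ((hF.1 vZ (by decide)).trans tZ)
      ((hF.1 vm (by decide)).trans hi'.vm) ((hF.1 vL (by decide)).trans hi'.vL)
      ((hF.1 vB (by decide)).trans tB) rfl h5 (blkNum_spec hle hh)
      (by rw [hF.2 aP (by decide)]; exact hi'.text) hi.text_lt h1 (by omega) (by omega) hZw h2).mono
      le_rfl fun κ _ ⟨u1, u2, u3⟩ => ?_
    have e : TrieEq κ (κ.set vb (h + 1)) := by constructor <;> simp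
    rw [h6] at u1
    exact ⟨e.is u1, u2.ext e.ext rfl rfl rfl rfl rfl, h3.trans (u3.trans e.ext)⟩

/-- Compute the tables. -/
def prepCm : Cm := initCm ;; stringsCm ;; blocksCm

theorem prepCm_spec (hw : 1 ≤ w) (hi : Input w f m F K n N L σ) (hZ : 8 * (m + N + 2) = Z)
    (hZw : Z * Z + Z + Z + Z + 100 < 2 ^ w) :
    Ht w pm prepCm σ (3000 * Z + 200) (fun τ => Input w f m F K n N L τ ∧ τ.var vZ = Z ∧
      τ.var vB = L / 9 + 1 ∧ TrieOk τ ∧ StrInv F K n τ ∧ BlkInv f m L (blkNum m L) τ) := by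
  refine Ht.seq_le _ (2900 * Z + 150) (initCm_spec hw hi hZ (by omega)) (by omega) ?_
  intro α _ ⟨a1, a2, a3, a4, a5, a6⟩
  refine Ht.seq_le _ (20000 * m + 100) (stringsCm_spec hw a1 hZ (by omega) a2 a4 a5) (by omega) ?_
  intro β fβ ⟨b1, b2, b3⟩
  have bi : Input w f m F K n N L β := a1.congr (fβ.1 _ (by decide)) (fβ.1 _ (by decide))
    (fβ.1 _ (by decide)) (fβ.1 _ (by decide)) (fβ.2 _ (by decide)) (fβ.2 _ (by decide))
    (fβ.2 _ (by decide)) (fβ.2 _ (by decide))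
  have bB : β.var vB = L / 9 + 1 := (fβ.1 vB (by decide)).trans a3
  refine (blocksCm_spec hw bi hZ hZw (b3.Z.trans a2) bB b1
    (a6.ext b3 (fβ.2 _ (by decide)) (fβ.2 _ (by decide)) (fβ.2 _ (by decide)) (fβ.2 _ (by decide))
      (fβ.2 _ (by decide)))).mono le_rfl ?_
  intro γ fγ ⟨c1, c2, c3⟩
  exact ⟨bi.congr (fγ.1 _ (by decide)) (fγ.1 _ (by decide))
    (fγ.1 _ (by decide)) (fγ.1 _ (by decide)) (fγ.2 _ (by decide)) (fγ.2 _ (by decide))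
    (fγ.2 _ (by decide)) (fγ.2 _ (by decide)), c3.Z.trans (b3.Z.trans a2),
    (fγ.1 vB (by decide)).trans bB, c1, b2.ext c3 (fγ.2 _ (by decide)) (fγ.2 _ (by decide))
      (fγ.2 _ (by decide)) (fγ.2 _ (by decide)), c2⟩

end

/-! ## Hits -/

/-- The slots `β` and `η` of the group `g` have a common occurrence at `a`, in the block. -/
def HitAt (B : ℕ) (σ : St) (g β η a : ℕ) : Prop :=
  σ.arr aBst (g * σ.var vZ + β) ≤ a ∧ a < σ.arr aBst (g * σ.var vZ + β) + B ∧
  σ.arr aBlo (g * σ.var vZ + β) ≤ a ∧ 1 ≤ a ∧ σ.arr aU (a - 1) ≠ 0 ∧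
  (σ.arr aBdel (g * σ.var vZ + β) + (a - σ.arr aBst (g * σ.var vZ + β))) % σ.arr aGp g =
    σ.arr aSal (g * σ.var vZ + η) ∧
  a + σ.arr aSlen (g * σ.var vZ + η) ≤ σ.arr aBhi (g * σ.var vZ + β)

/-- The group `g` has a hit that ends at `j`. -/
def Hit (B : ℕ) (σ : St) (g j : ℕ) : Prop :=
  ∃ β < σ.arr aQ g, ∃ η < σ.arr aNS g, ∃ a, HitAt B σ g β η a ∧
    j + 1 = a + σ.arr aSlen (g * σ.var vZ + η)

/-- The tables of a group that has blocks and strings. -/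
structure GroupOk (m L : ℕ) (σ : St) (g : ℕ) : Prop where
  pos : 1 ≤ σ.arr aGp g
  small : 9 * σ.arr aGp g ≤ 2 * L
  five : 5 ≤ L
  st : ∀ β < σ.arr aQ g, σ.arr aBst (g * σ.var vZ + β) + L ≤ m
  del : ∀ β < σ.arr aQ g, σ.arr aBdel (g * σ.var vZ + β) < σ.arr aGp g
  lo : ∀ β < σ.arr aQ g, σ.arr aBst (g * σ.var vZ + β) ≤ σ.arr aBlo (g * σ.var vZ + β)
  hi : ∀ β < σ.arr aQ g, σ.arr aBhi (g * σ.var vZ + β) ≤ m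
  al : ∀ η < σ.arr aNS g, σ.arr aSal (g * σ.var vZ + η) < σ.arr aGp g
  len : ∀ η < σ.arr aNS g, L ≤ σ.arr aSlen (g * σ.var vZ + η)
  lt : ∀ η < σ.arr aNS g, 9 * σ.arr aSlen (g * σ.var vZ + η) < 10 * L

section
variable {f : ℕ → ℕ} {m : ℕ} {F : ℕ → ℕ → ℕ} {K : ℕ → ℕ} {n L : ℕ} {σ : St}

theorem slots_agree (ht : TrieOk σ) {g β η b i : ℕ} (hb : BlkSlot f m L σ g β b)
    (hs : StrSlot F K σ g η i) : blkPer f L b = rotPer (F i) (K i) ∧ ∀ t < blkPer f L b,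
      window f L (b * (L / 9 + 1)) (blkStart f L b + t) = F i (rotStart (F i) (K i) + t) :=
  rword_inj.1 ((hb.path.inj ht hs.path).1 rfl)

/-- The smallness of the period comes from a string of the group, and the bound on the phases of the
blocks from the equality of their roots with that of the string. Hence both kinds of slots must be
present. -/
theorem groupOk (ht : TrieOk σ) (hs : StrInv F K n σ) (hb : BlkInv f m L (blkNum m L) σ)
    (hok : ∀ i < n, ∃ p, StrOk L (F i) (K i) p) (hLm : L ≤ m) {g : ℕ} (hg : g < σ.var vZ)
    (hQ : 0 < σ.arr aQ g) (hN : 0 < σ.arr aNS g) : GroupOk m L σ g := by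
  obtain ⟨b0, -, hb0⟩ := hb.sound g hg 0 hQ
  obtain ⟨i0, hi0, hs0⟩ := hs.sound g hg 0 hN
  obtain ⟨p0, hp0⟩ := hok i0 hi0
  have hpos : 1 ≤ rotPer (F i0) (K i0) := by rw [hp0.rot.1]; exact hp0.pos
  refine ⟨by rw [hs0.per]; exact hpos, ?_, hp0.five, fun β hβ => ?_, fun β hβ => ?_, fun β hβ => ?_,
    fun β hβ => ?_, fun η hη => ?_, fun η hη => ?_, fun η hη => ?_⟩
  · rw [hs0.per, hp0.rot.1]; exact hp0.small
  · obtain ⟨b, h1, h2⟩ := hb.sound g hg β hβ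
    rw [h2.st]; exact blkNum_spec hLm h1
  · obtain ⟨b, h1, h2⟩ := hb.sound g hg β hβ
    rw [h2.del, hs0.per, (slots_agree ht h2 hs0).1]
    exact phase_lt hpos _
  · obtain ⟨b, h1, h2⟩ := hb.sound g hg β hβ
    rw [h2.st]; exact h2.ext.lo_ge
  · obtain ⟨b, h1, h2⟩ := hb.sound g hg β hβ
    exact h2.ext.hi_le
  · obtain ⟨i, h1, h2⟩ := hs.sound g hg η hη
    rw [h2.al, h2.per]
    exact phase_lt (by rw [← h2.per, hs0.per]; exact hpos) _
  · obtain ⟨i, h1, h2⟩ := hs.sound g hg η hη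
    obtain ⟨p, hp⟩ := hok i h1
    rw [h2.len]; exact hp.le
  · obtain ⟨i, h1, h2⟩ := hs.sound g hg η hη
    obtain ⟨p, hp⟩ := hok i h1
    rw [h2.len]; exact hp.lt

/-- A hit is an occurrence by `occurs_of_phase`. Conversely, an occurrence at a belongs to the block
number a / B; `phase_of_occurs` shows that this block was entered with the root of the string, so
that both have the same node as their group. -/
theorem hit_iff (ht : TrieOk σ) (hs : StrInv F K n σ) (hb : BlkInv f m L (blkNum m L) σ)
    (hok : ∀ i < n, ∃ p, StrOk L (F i) (K i) p) (j : ℕ) :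
    (∃ g < σ.var vZ, Hit (L / 9 + 1) σ g j) ↔ ∃ i < n, ∃ a, 1 ≤ a ∧ σ.arr aU (a - 1) ≠ 0 ∧
      Occurs f m (F i) (K i) a ∧ j + 1 = a + K i := by
  constructor
  · rintro ⟨g, hg, β, hβ, η, hη, a, ⟨a1, a2, a3, a4, a5, a6, a7⟩, a8⟩
    obtain ⟨b, h1, h2⟩ := hb.sound g hg β hβ
    obtain ⟨i, h3, h4⟩ := hs.sound g hg η hη
    obtain ⟨p, hp⟩ := hok i h3
    obtain ⟨e1, e2⟩ := slots_agree ht h2 h4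
    rw [h2.st] at a1 a2 a6
    rw [h2.del, h4.per, h4.al, ← e1] at a6
    rw [h4.len] at a7 a8
    refine ⟨i, h3, a, a4, a5, ?_, a8⟩
    exact occurs_of_phase (s := b * (L / 9 + 1)) hp (e1.trans hp.rot.1)
      (fun t ht => by have := e2 t ht; rwa [window, ← add_assoc] at this)
      rfl h2.ext h2.hi a3 a7 a6
  · rintro ⟨i, hi, a, a1, a2, a3, a4⟩
    obtain ⟨p, hp⟩ := hok i hi
    have hB : 0 < L / 9 + 1 := by omega
    have h1 : a / (L / 9 + 1) * (L / 9 + 1) ≤ a := Nat.div_mul_le_self _ _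
    have h2 : a < a / (L / 9 + 1) * (L / 9 + 1) + (L / 9 + 1) := by
      have := Nat.lt_div_mul_add hB (a := a); omega
    have hbn : a / (L / 9 + 1) < blkNum m L := by
      have := a3.1; have := hp.le
      unfold blkNum
      exact Nat.lt_succ_of_le (Nat.div_le_div_right (by omega))
    generalize a / (L / 9 + 1) = b at h1 h2 hbn
    obtain ⟨k1, k2, k3, k4, k5⟩ := phase_of_occurs hp a3 h1 h2 (q := blkPer f L b) rfl
    obtain ⟨g, hg, β, hβ, hbs⟩ := hb.complete b hbn k2 fun lo hi he => (k5 lo hi he).1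
    obtain ⟨g', hg', η, hη, hss⟩ := hs.complete i hi
    have hr : rword (window f L (b * (L / 9 + 1))) (blkStart f L b) (blkPer f L b) =
        rword (F i) (rotStart (F i) (K i)) (rotPer (F i) (K i)) :=
      rword_inj.2 ⟨k1.trans hp.rot.1.symm, fun t ht => by
        rw [window, ← add_assoc]; exact k3 t ht⟩
    obtain rfl : g = g' := (hbs.path.inj ht hss.path).2 hr
    refine ⟨g, hg, β, hβ, η, hη, a, ⟨?_, ?_, ?_, a1, a2, ?_, ?_⟩, ?_⟩
    · rw [hbs.st]; exact h1
    · rw [hbs.st]; exact h2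
    · exact (k5 _ _ hbs.ext).2.1
    · rw [hbs.st, hbs.del, hss.al, hss.per, hp.rot.1, ← k1]; exact k4
    · rw [hss.len]; exact (k5 _ _ hbs.ext).2.2
    · rw [hss.len]; exact a4

end

/-! ## Small groups -/

/-- From `σ` to `τ`, the cells `j` of `A` with `P j` become `1`. -/
def Marked (A : Arr) (σ τ : St) (P : ℕ → Prop) : Prop :=
  ∀ j, (P j → τ.arr A j = 1) ∧ (¬ P j → τ.arr A j = σ.arr A j)

theorem Marked.trans {A : Arr} {σ τ υ : St} {P Q R : ℕ → Prop} (h : Marked A σ τ P) (h' : Marked A τ υ Q)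
    (hR : ∀ j, R j ↔ P j ∨ Q j) : Marked A σ υ R := by
  intro j
  rw [hR]
  have h1 := h j
  have h2 := h' j
  by_cases hp : P j <;> by_cases hq : Q j <;> simp_all

theorem Marked.congr {A : Arr} {σ τ : St} {P Q : ℕ → Prop} (h : Marked A σ τ P) (hQ : ∀ j, Q j ↔ P j) :
    Marked A σ τ Q := by
  intro j; rw [hQ]; exact h j

theorem Marked.of_eq {A : Arr} {σ τ : St} {P : ℕ → Prop} (h : τ.arr A = σ.arr A) (hP : ∀ j, ¬ P j) :
    Marked A σ τ P := fun j => ⟨fun h' => absurd h' (hP j), fun _ => by rw [h]⟩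

theorem exists_lt_succ_iff {P : ℕ → Prop} {n : ℕ} : (∃ i < n + 1, P i) ↔ (∃ i < n, P i) ∨ P n := by
  constructor
  · rintro ⟨i, h1, h2⟩
    rcases Nat.lt_succ_iff_lt_or_eq.1 h1 with h | rfl
    · exact .inl ⟨i, h, h2⟩
    · exact .inr h2
  · rintro (⟨i, h1, h2⟩ | h)
    · exact ⟨i, by omega, h2⟩
    · exact ⟨n, by omega, h⟩

/-- The rule for a loop that marks cells. -/
theorem Ht.loop_marked {w : ℕ} {pm : Prog} {σ : St} (hw : 1 ≤ w) {A : Arr} {x y : Var} {c : Cm} {n T' : ℕ}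
    (R : ℕ → ℕ → Prop) (T : ℕ) (hn : σ.var y = n) (hT : n * (T + 4) + 3 ≤ T')
    (hxy : y ≠ x) (hx : x ∉ c.wv) (hy : y ∉ c.wv)
    (step : ∀ i < n, ∀ τ, Fr (.loop x y c) σ τ → τ.var x = i → Ht w pm c τ T (fun υ => Marked A τ υ (R i))) :
    Ht w pm (.loop x y c) σ T' (fun τ => Marked A σ τ (fun j => ∃ i < n, R i j)) := by
  refine Ht.loop_le hw (fun z τ => Marked A σ τ (fun j => ∃ i < z, R i j)) T hn hT hxy hx hy
    (Marked.of_eq rfl (by simp)) ?_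
  intro i hi τ hF hv hI
  refine (step i hi τ hF hv).mono le_rfl fun υ _ hυ => ?_
  exact Marked.trans (τ := τ) hI hυ fun j => exists_lt_succ_iff

/-- Mark the hit at the position `vs + (vy - vdel)`, if there is one. -/
def markCm : Cm :=
  .ite (.ltv vy vdel) .skip (va ≔ vs + (vy - vdel) ;;
    .ite (.ltv va (vs + vB)) (.ite (.ltv va vlo) .skip (.ite va
      (.ite (.ltv vhi (va + vlen)) .skip (.ite (.ld aU (va - 1)) (.sto aV (va + vlen - 1) 1) .skip)) .skip)) .skip)

theorem markCm_spec {w : ℕ} {pm : Prog} (hw : 1 ≤ w) {σ : St} {y δ s B lo hi k : ℕ}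
    (h1 : σ.var vy = y) (h2 : σ.var vdel = δ) (h3 : σ.var vs = s) (h4 : σ.var vB = B)
    (h5 : σ.var vlo = lo) (h6 : σ.var vhi = hi) (h7 : σ.var vlen = k)
    (hsz : s + y + B + k < 2 ^ w) :
    Ht w pm markCm σ 60 (fun τ => Marked aV σ τ fun j => δ ≤ y ∧ s + (y - δ) < s + B ∧
      lo ≤ s + (y - δ) ∧ 1 ≤ s + (y - δ) ∧ σ.arr aU (s + (y - δ) - 1) ≠ 0 ∧ s + (y - δ) + k ≤ hi ∧
      j + 1 = s + (y - δ) + k) := by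
  have hone : 1 < 2 ^ w := Nat.one_lt_two_pow (by omega)
  refine Ht.of_wp hw (by decide) ?_
  simp only [Cm.wp, markCm]
  simp [h1, h2, h3, h4, h5, h6, h7]
  generalize hW : 2 ^ w = W at *
  have hset : ∀ {a : ℕ} {P : ℕ → Prop}, (∀ j, ¬ P j) → Marked aV σ (σ.set va a) P := fun h =>
    Marked.of_eq rfl h
  refine ⟨fun c => Marked.of_eq rfl fun j h => by omega, fun c1 => ⟨by omega, by omega, fun c2 =>
    ⟨fun c => hset fun j h => by omega, fun c3 => ⟨fun c4 => ⟨by omega, fun c => hset fun j h => by omega,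
      fun c5 => ⟨⟨by omega, by omega⟩, fun c6 => ⟨⟨by omega, by omega⟩, by omega, by omega, ?_⟩, fun c => hset fun j h => h.2.2.2.2.1 c⟩⟩, fun c c' => hset fun j h => by omega⟩⟩, fun c => hset fun j h => by omega⟩⟩
  intro j
  constructor
  · rintro ⟨-, -, -, -, -, -, h⟩
    simp; omega
  · intro h
    simp
    intro h'
    exact absurd ⟨c1, by omega, c3, by omega, c6, by omega, by omega⟩ h

/-- Mark the hits of two slots, for each row. -/
def rowsCm : Cm := .loop vt vD ((vy ≔ vp * vt + vw1) ;; markCm)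

theorem rowsCm_spec {w : ℕ} {pm : Prog} (hw : 1 ≤ w) {σ : St} {D p α δ s B lo hi k W : ℕ}
    (h0 : σ.var vD = D) (h1 : σ.var vp = p) (h1' : σ.var vw1 = α) (h2 : σ.var vdel = δ)
    (h3 : σ.var vs = s) (h4 : σ.var vB = B)
    (h5 : σ.var vlo = lo) (h6 : σ.var vhi = hi) (h7 : σ.var vlen = k)
    (hD : ∀ t < D, p * t ≤ W) (hsz : s + W + α + B + k < 2 ^ w) :
    Ht w pm rowsCm σ (D * 80 + 3) (fun τ => Marked aV σ τ fun j => ∃ t < D, δ ≤ p * t + α ∧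
      s + (p * t + α - δ) < s + B ∧ lo ≤ s + (p * t + α - δ) ∧ 1 ≤ s + (p * t + α - δ) ∧
      σ.arr aU (s + (p * t + α - δ) - 1) ≠ 0 ∧ s + (p * t + α - δ) + k ≤ hi ∧
      j + 1 = s + (p * t + α - δ) + k) := by
  refine Ht.loop_marked hw (fun t j => δ ≤ p * t + α ∧
      s + (p * t + α - δ) < s + B ∧ lo ≤ s + (p * t + α - δ) ∧ 1 ≤ s + (p * t + α - δ) ∧
      σ.arr aU (s + (p * t + α - δ) - 1) ≠ 0 ∧ s + (p * t + α - δ) + k ≤ hi ∧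
      j + 1 = s + (p * t + α - δ) + k) 76 h0 le_rfl (by decide) (by decide) (by decide) ?_
  intro t ht e he hvt
  have e1 : e.var vp = p := (he.1 vp (by decide)).trans h1
  have e2 : e.var vw1 = α := (he.1 vw1 (by decide)).trans h1'
  have hpt := hD t ht
  refine Ht.seq_le 8 60 (R := fun τ => τ = e.set vy (p * t + α))
    (Ht.of_wp hw (by decide) (by simp [Cm.wp, e1, e2, hvt]; omega)) (by omega) ?_
  rintro _ - rfl
  have := markCm_spec (pm := pm) hw (σ := e.set vy (p * t + α)) (y := p * t + α) (by simp)
    (he.1 vdel (by decide) |>.trans h2) (he.1 vs (by decide) |>.trans h3) (he.1 vB (by decide) |>.trans h4)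
    (he.1 vlo (by decide) |>.trans h5) (he.1 vhi (by decide) |>.trans h6) (he.1 vlen (by decide) |>.trans h7)
    (by omega)
  rw [show (e.set vy (p * t + α)).arr aU = σ.arr aU from he.2 aU (by decide)] at this
  exact this

/-- Mark the hits of the group `vg`, for each block, each string and each row. -/
def naiveCm : Cm :=
  (vD ≔ vB / vp + 3) ;; .loop vbeta vq
    ((vsl ≔ vg * vZ + vbeta ;; vs ≔ .ld aBst vsl ;; vdel ≔ .ld aBdel vsl ;; vlo ≔ .ld aBlo vsl ;;
      vhi ≔ .ld aBhi vsl) ;;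
      .loop veta vng ((vsk ≔ vg * vZ + veta ;; vw1 ≔ .ld aSal vsk ;; vlen ≔ .ld aSlen vsk) ;;
        rowsCm))

/-- The row of a hit. -/
theorem hitAt_iff {B : ℕ} {σ : St} {m L g β η j : ℕ} (hok : GroupOk m L σ g) (hβ : β < σ.arr aQ g)
    (hη : η < σ.arr aNS g) :
    (∃ a, HitAt B σ g β η a ∧ j + 1 = a + σ.arr aSlen (g * σ.var vZ + η)) ↔
    ∃ t < B / σ.arr aGp g + 3,
      σ.arr aBdel (g * σ.var vZ + β) ≤ σ.arr aGp g * t + σ.arr aSal (g * σ.var vZ + η) ∧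
      σ.arr aBst (g * σ.var vZ + β) + (σ.arr aGp g * t + σ.arr aSal (g * σ.var vZ + η) -
        σ.arr aBdel (g * σ.var vZ + β)) < σ.arr aBst (g * σ.var vZ + β) + B ∧
      σ.arr aBlo (g * σ.var vZ + β) ≤ σ.arr aBst (g * σ.var vZ + β) +
        (σ.arr aGp g * t + σ.arr aSal (g * σ.var vZ + η) - σ.arr aBdel (g * σ.var vZ + β)) ∧
      1 ≤ σ.arr aBst (g * σ.var vZ + β) +
        (σ.arr aGp g * t + σ.arr aSal (g * σ.var vZ + η) - σ.arr aBdel (g * σ.var vZ + β)) ∧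
      σ.arr aU (σ.arr aBst (g * σ.var vZ + β) +
        (σ.arr aGp g * t + σ.arr aSal (g * σ.var vZ + η) - σ.arr aBdel (g * σ.var vZ + β)) - 1) ≠ 0 ∧
      σ.arr aBst (g * σ.var vZ + β) +
        (σ.arr aGp g * t + σ.arr aSal (g * σ.var vZ + η) - σ.arr aBdel (g * σ.var vZ + β)) +
          σ.arr aSlen (g * σ.var vZ + η) ≤ σ.arr aBhi (g * σ.var vZ + β) ∧
      j + 1 = σ.arr aBst (g * σ.var vZ + β) +
        (σ.arr aGp g * t + σ.arr aSal (g * σ.var vZ + η) - σ.arr aBdel (g * σ.var vZ + β)) +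
          σ.arr aSlen (g * σ.var vZ + η) := by
  have hp := hok.pos
  have hα := hok.al η hη
  have hδ := hok.del β hβ
  unfold HitAt
  generalize σ.arr aGp g = p at *
  generalize σ.arr aSal (g * σ.var vZ + η) = α at *
  generalize σ.arr aBdel (g * σ.var vZ + β) = δ at *
  generalize σ.arr aBst (g * σ.var vZ + β) = s at *
  generalize σ.arr aSlen (g * σ.var vZ + η) = k at *
  generalize σ.arr aBlo (g * σ.var vZ + β) = lo at *
  generalize σ.arr aBhi (g * σ.var vZ + β) = hi at *
  constructor
  · rintro ⟨a, ⟨h1, h2, h3, h4, h5, h6, h7⟩, h8⟩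
    have h9 := Nat.div_add_mod (δ + (a - s)) p
    rw [h6] at h9
    have h10 : (δ + (a - s)) / p < B / p + 3 := by
      have e1 : (δ + (a - s)) / p ≤ (B + p) / p := Nat.div_le_div_right (by omega)
      rw [Nat.add_div_right _ hp] at e1
      omega
    have h11 : s + (p * ((δ + (a - s)) / p) + α - δ) = a := by omega
    refine ⟨(δ + (a - s)) / p, h10, by omega, ?_⟩
    rw [h11]
    exact ⟨h2, h3, h4, h5, h7, h8⟩
  · rintro ⟨t, -, h1, h2, h3, h4, h5, h6, h7⟩
    refine ⟨_, ⟨by omega, h2, h3, h4, h5, ?_, h6⟩, h7⟩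
    have : δ + (s + (p * t + α - δ) - s) = p * t + α := by omega
    rw [this, Nat.mul_add_mod, Nat.mod_eq_of_lt hα]

/-- This exhaustive search is used for q ≤ p only, where q (B/p + 3) = O(B) and the total is O(nB)
plus lower terms. -/
theorem naiveCm_spec {w : ℕ} {pm : Prog} (hw : 1 ≤ w) {σ : St} {B m L g p q n Z : ℕ}
    (hok : GroupOk m L σ g) (hg : σ.var vg = g) (hgZ : g < Z) (hZ : σ.var vZ = Z) (hB : σ.var vB = B)
    (hp : σ.var vp = σ.arr aGp g) (hpp : σ.arr aGp g = p)
    (hq : σ.var vq = σ.arr aQ g) (hqq : σ.arr aQ g = q) (hn : σ.var vng = σ.arr aNS g)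
    (hnn : σ.arr aNS g = n) (hqZ : q < Z) (hnZ : n < Z) (hBm : B ≤ m) (hLm : L ≤ m) (hmZ : 8 * m ≤ Z)
    (hZw : Z * Z + Z + Z + Z + 100 < 2 ^ w) :
    Ht w pm naiveCm σ (q * (n * ((B / p + 3) * 100 + 100) + 100) + 100) (fun τ => Marked aV σ τ (Hit B σ g)) := by
  have hpos := hok.pos
  have hsmall := hok.small
  rw [hpp] at hpos hsmall
  have hBp : B / p ≤ B := Nat.div_le_self _ _
  have hgZ' : g * Z ≤ Z * Z := Nat.mul_le_mul_right _ hgZ.le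
  refine Ht.seq_le 10 (q * ((n * ((B / p + 3) * 80 + 50) + 50) + 4) + 3)
    (R := fun τ => τ = σ.set vD (B / p + 3))
    (Ht.of_wp hw (by decide) (by simp [Cm.wp, hB, hp, hpp]; omega)) ?_ ?_
  · have h1 : n * ((B / p + 3) * 80 + 50) ≤ n * ((B / p + 3) * 100 + 100) :=
      Nat.mul_le_mul_left _ (by omega)
    have h2 : q * ((n * ((B / p + 3) * 80 + 50) + 50) + 4) ≤ q * (n * ((B / p + 3) * 100 + 100) + 100) :=
      Nat.mul_le_mul_left _ (by omega)
    omega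
  rintro τ - rfl
  refine (Ht.loop_marked hw (n := q) (fun β j => ∃ η < n, ∃ a, HitAt B σ g β η a ∧
    j + 1 = a + σ.arr aSlen (g * σ.var vZ + η)) (n * ((B / p + 3) * 80 + 50) + 50) (by simp [hq, hqq]) le_rfl (by decide)
    (by decide) (by decide) ?_).mono le_rfl fun υ _ h => (by
      refine Marked.congr (show Marked aV σ υ _ from h) fun j => ?_
      simp only [Hit, hqq, hnn])
  intro β hβ α hα hvb
  have a1 : α.var vg = g := (hα.1 vg (by decide)).trans (by simp [hg])
  have a2 : α.var vZ = Z := (hα.1 vZ (by decide)).trans (by simp [hZ])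
  have a3 : α.arr aBst = σ.arr aBst := (hα.2 aBst (by decide))
  have a4 : α.arr aBdel = σ.arr aBdel := (hα.2 aBdel (by decide))
  have a5 : α.arr aBlo = σ.arr aBlo := (hα.2 aBlo (by decide))
  have a6 : α.arr aBhi = σ.arr aBhi := (hα.2 aBhi (by decide))
  have s1 := hok.st β (by omega)
  have s2 := hok.del β (by omega)
  have s3 := hok.hi β (by omega)
  rw [hpp] at s2
  rw [hZ] at s1 s2 s3
  refine Ht.seq_le 20 (n * ((B / p + 3) * 80 + 50) + 3) (R := fun τ => τ.var vs = σ.arr aBst (g * Z + β) ∧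
    τ.var vdel = σ.arr aBdel (g * Z + β) ∧ τ.var vlo = σ.arr aBlo (g * Z + β) ∧
    τ.var vhi = σ.arr aBhi (g * Z + β) ∧ τ.arr aV = α.arr aV)
    (Ht.of_wp hw (by decide) (by simp [Cm.wp, a1, a2, a3, a4, a5, a6, hvb]; omega)) (by omega) ?_
  intro b fb ⟨b1, b2, b3, b4, b5⟩
  have b6 : b.var vng = n := (fb.1 vng (by decide)).trans ((hα.1 vng (by decide)).trans (by simp [hn, hnn]))
  refine (Ht.loop_marked hw (n := n) (fun η j => ∃ a, HitAt B σ g β η a ∧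
    j + 1 = a + σ.arr aSlen (g * σ.var vZ + η)) ((B / p + 3) * 80 + 46) b6 le_rfl (by decide)
    (by decide) (by decide) ?_).mono le_rfl fun υ _ h => Marked.trans (Marked.of_eq b5 (P := fun _ => False) (by simp)) h (by simp)
  intro η hη c hc hvη
  have c1 : c.var vg = g := (hc.1 vg (by decide)).trans ((fb.1 vg (by decide)).trans a1)
  have c2 : c.var vZ = Z := (hc.1 vZ (by decide)).trans ((fb.1 vZ (by decide)).trans a2)
  have c3 : c.arr aSal = σ.arr aSal := (hc.2 aSal (by decide)).trans ((fb.2 aSal (by decide)).trans (hα.2 aSal (by decide)))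
  have c4 : c.arr aSlen = σ.arr aSlen := (hc.2 aSlen (by decide)).trans ((fb.2 aSlen (by decide)).trans (hα.2 aSlen (by decide)))
  have s4 := hok.al η (by omega)
  have s5 := hok.lt η (by omega)
  rw [hpp] at s4
  rw [hZ] at s4 s5
  refine Ht.seq_le 15 ((B / p + 3) * 80 + 3) (R := fun τ => τ.var vw1 = σ.arr aSal (g * Z + η) ∧
    τ.var vlen = σ.arr aSlen (g * Z + η) ∧ τ.arr aV = c.arr aV)
    (Ht.of_wp hw (by decide) (by simp [Cm.wp, c1, c2, c3, c4, hvη]; omega)) (by omega) ?_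
  intro d fd ⟨d1, d2, d3⟩
  have d4 : d.var vD = B / p + 3 := (fd.1 vD (by decide)).trans ((hc.1 vD (by decide)).trans
    ((fb.1 vD (by decide)).trans ((hα.1 vD (by decide)).trans (by simp))))
  have hD : ∀ t < B / p + 3, p * t ≤ B + 2 * p := fun t ht => by
    have := Nat.div_mul_le_self B p
    have h2 : p * t ≤ p * (B / p + 2) := Nat.mul_le_mul_left _ (by clear * - ht; omega)
    have h3 : p * (B / p + 2) = B / p * p + 2 * p := by ring
    rw [h3] at h2
    exact h2.trans (Nat.add_le_add_right this _)
  have eU : d.arr aU = σ.arr aU := (fd.2 aU (by decide)).trans ((hc.2 aU (by decide)).trans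
    ((fb.2 aU (by decide)).trans (hα.2 aU (by decide))))
  have e1 : d.var vp = p := (fd.1 vp (by decide)).trans ((hc.1 vp (by decide)).trans
    ((fb.1 vp (by decide)).trans ((hα.1 vp (by decide)).trans (by simp [hp, hpp]))))
  have e2 : d.var vB = B := (fd.1 vB (by decide)).trans ((hc.1 vB (by decide)).trans
    ((fb.1 vB (by decide)).trans ((hα.1 vB (by decide)).trans (by simp [hB]))))
  have hsz : σ.arr aBst (g * Z + β) + (B + 2 * p) + σ.arr aSal (g * Z + η) + B +
      σ.arr aSlen (g * Z + η) < 2 ^ w := by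
    clear * - hsmall s1 s4 s5 hBm hLm hmZ hZw
    omega
  refine (rowsCm_spec hw d4 e1 d1
    ((fd.1 vdel (by decide)).trans ((hc.1 vdel (by decide)).trans b2))
    ((fd.1 vs (by decide)).trans ((hc.1 vs (by decide)).trans b1)) e2
    ((fd.1 vlo (by decide)).trans ((hc.1 vlo (by decide)).trans b3))
    ((fd.1 vhi (by decide)).trans ((hc.1 vhi (by decide)).trans b4)) d2 hD hsz).mono le_rfl fun υ _ h => ?_
  refine Marked.trans (Marked.of_eq d3 (P := fun _ => False) (by simp)) h fun j => ?_
  rw [hitAt_iff hok (by rwa [hqq]) (by rwa [hnn]), hpp, hZ, false_or, eU]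

/-! ## Roots of unity modulo prime powers -/

section
variable {ρ : ℕ} [Fact ρ.Prime] {e k : ℕ}

/-- Each ρ-th power gains a factor ρ in the difference, so a ≡ b modulo ρ gives a^(ρ^k) ≡ b^(ρ^k)
modulo ρ^(k+1). The power depends on the residue modulo ρ only: it is the Teichmüller lift. -/
theorem pow_eq_of_modEq (hk : e ≤ k + 1) {a b : ℕ} (h : (a : ZMod ρ) = b) :
    (a : ZMod (ρ ^ e)) ^ ρ ^ k = (b : ZMod (ρ ^ e)) ^ ρ ^ k := by
  have h1 : (ρ : ℤ) ∣ (a : ℤ) - b := by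
    rw [← ZMod.intCast_zmod_eq_zero_iff_dvd]
    push_cast
    rw [h, sub_self]
  have h2 := dvd_sub_pow_of_dvd_sub h1 k
  have h3 : ((ρ ^ e : ℕ) : ℤ) ∣ (a : ℤ) ^ ρ ^ k - (b : ℤ) ^ ρ ^ k := by
    push_cast
    exact (pow_dvd_pow _ hk).trans h2
  rw [← ZMod.intCast_zmod_eq_zero_iff_dvd] at h3
  push_cast at h3
  exact sub_eq_zero.1 h3

/-- Fermat's theorem modulo ρ, lifted to ρ^e. -/
theorem pow_prime_pow_sub_one (hk : e ≤ k + 1) {a : ℕ} (ha : (a : ZMod ρ) ≠ 0) :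
    ((a : ZMod (ρ ^ e)) ^ ρ ^ k) ^ (ρ - 1) = 1 := by
  have h1 : ((a ^ (ρ - 1) : ℕ) : ZMod ρ) = ((1 : ℕ) : ZMod ρ) := by
    push_cast
    exact ZMod.pow_card_sub_one_eq_one ha
  have h2 := pow_eq_of_modEq hk h1
  push_cast at h2
  rw [one_pow] at h2
  rw [← pow_mul, mul_comm, pow_mul]
  exact h2

/-- Multiplying the summation variable by a generator g permutes the terms and scales the sum by the
lift of g^j. If ρ - 1 does not divide j, then g^j ≠ 1 modulo ρ, so the scale minus one is a unit
modulo ρ^e, not merely non-zero, and the sum vanishes. -/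
theorem sum_pow_units (hk : e ≤ k + 1) (j : ℕ) :
    ∑ u : (ZMod ρ)ˣ, (((u : ZMod ρ).val : ZMod (ρ ^ e)) ^ ρ ^ k) ^ j =
      if (ρ - 1) ∣ j then ((ρ - 1 : ℕ) : ZMod (ρ ^ e)) else 0 := by
  have hcard : Fintype.card (ZMod ρ)ˣ = ρ - 1 := by
    rw [ZMod.card_units_eq_totient, Nat.totient_prime Fact.out]
  split_ifs with hj
  · obtain ⟨i, rfl⟩ := hj
    have : ∀ u : (ZMod ρ)ˣ, (((u : ZMod ρ).val : ZMod (ρ ^ e)) ^ ρ ^ k) ^ ((ρ - 1) * i) = 1 := by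
      intro u
      rw [pow_mul, pow_prime_pow_sub_one hk, one_pow]
      rw [ZMod.natCast_zmod_val]
      exact u.ne_zero
    rw [Finset.sum_congr rfl fun u _ => this u]
    simp [hcard]
  · obtain ⟨g, hg⟩ := IsCyclic.exists_ofOrder_eq_natCard (α := (ZMod ρ)ˣ)
    rw [Nat.card_eq_fintype_card, hcard] at hg
    set S := ∑ u : (ZMod ρ)ˣ, (((u : ZMod ρ).val : ZMod (ρ ^ e)) ^ ρ ^ k) ^ j with hS
    set G : ℕ := (g : ZMod ρ).val with hG
    have hmul : ∀ u : (ZMod ρ)ˣ, ((((g * u : (ZMod ρ)ˣ) : ZMod ρ).val : ZMod (ρ ^ e)) ^ ρ ^ k) =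
        (G : ZMod (ρ ^ e)) ^ ρ ^ k * (((u : ZMod ρ).val : ZMod (ρ ^ e)) ^ ρ ^ k) := by
      intro u
      rw [← mul_pow, ← Nat.cast_mul]
      apply pow_eq_of_modEq hk
      push_cast
      simp [hG]
    have h1 : S = ((G : ZMod (ρ ^ e)) ^ ρ ^ k) ^ j * S := by
      conv_lhs => rw [hS, ← Equiv.sum_comp (Equiv.mulLeft g)]
      rw [hS, Finset.mul_sum]
      refine Finset.sum_congr rfl fun u _ => ?_
      simp only [Equiv.coe_mulLeft]
      rw [hmul, mul_pow]
    have h2 : IsUnit (((G : ZMod (ρ ^ e)) ^ ρ ^ k) ^ j - 1) := by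
      have h3 : (((G : ZMod (ρ ^ e)) ^ ρ ^ k) ^ j - 1) = (((G : ℤ) ^ (ρ ^ k * j) - 1 : ℤ) : ZMod (ρ ^ e)) := by
        push_cast; rw [pow_mul]
      rw [h3, ZMod.coe_int_isUnit_iff_isCoprime]
      push_cast
      apply IsCoprime.pow_left
      rw [(Nat.prime_iff_prime_int.1 (Fact.out : ρ.Prime)).coprime_iff_not_dvd,
        ← ZMod.intCast_zmod_eq_zero_iff_dvd]
      push_cast
      rw [hG, ZMod.natCast_zmod_val, pow_mul, ZMod.pow_card_pow, sub_eq_zero]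
      intro h4
      apply hj
      rw [← hg]
      apply orderOf_dvd_of_pow_eq_one
      ext
      push_cast
      exact h4
    have h5 : (((G : ZMod (ρ ^ e)) ^ ρ ^ k) ^ j - 1) * S = 0 := by
      rw [sub_mul, ← h1, one_mul, sub_self]
    exact (h2.mul_right_eq_zero).1 h5

theorem sum_pow_range (hk : e ≤ k + 1) (j : ℕ) :
    ∑ y ∈ Finset.range (ρ - 1), (((y + 1 : ℕ) : ZMod (ρ ^ e)) ^ ρ ^ k) ^ j =
      if (ρ - 1) ∣ j then ((ρ - 1 : ℕ) : ZMod (ρ ^ e)) else 0 := by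
  rw [← sum_pow_units hk]
  have hval : ∀ y < ρ - 1, (((y + 1 : ℕ) : ZMod ρ)).val = y + 1 := fun y hy =>
    ZMod.val_cast_of_lt (by omega)
  have hne : ∀ y < ρ - 1, ((y + 1 : ℕ) : ZMod ρ) ≠ 0 := fun y hy h => by
    have := hval y hy
    rw [h, ZMod.val_zero] at this
    omega
  refine Finset.sum_bij (fun y hy => Units.mk0 ((y + 1 : ℕ) : ZMod ρ) (hne y (Finset.mem_range.1 hy)))
    (fun _ _ => Finset.mem_univ _) ?_ ?_ ?_
  · intro y hy z hz h
    have h' := congrArg (fun u : (ZMod ρ)ˣ => (u : ZMod ρ).val) h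
    simp only [Units.val_mk0] at h'
    rw [hval y (Finset.mem_range.1 hy), hval z (Finset.mem_range.1 hz)] at h'
    omega
  · intro u _
    have h1 : (u : ZMod ρ).val < ρ := ZMod.val_lt _
    have h2 : (u : ZMod ρ).val ≠ 0 := by rw [Ne, ZMod.val_eq_zero]; exact u.ne_zero
    refine ⟨(u : ZMod ρ).val - 1, Finset.mem_range.2 (by omega), ?_⟩
    ext
    simp only [Units.val_mk0]
    rw [Nat.sub_add_cancel (by omega), ZMod.natCast_zmod_val]
  · intro y hy
    simp only [Units.val_mk0]
    rw [hval y (Finset.mem_range.1 hy)]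

end

/-! ## The bilinear algorithm -/

section
variable {R : Type*} [CommRing R] {r : ℕ} {pt : ℕ → R}

/-- After the sums are exchanged, each coefficient is multiplied by two power sums, one in each
variable, and orthogonality makes each of them r or 0. -/
theorem convolution_term (hS : ∀ j, ∑ y ∈ Finset.range r, pt y ^ j = if r ∣ j then (r : R) else 0)
    (w1 w2 u1 u2 : ℕ) (x : ℕ → ℕ → R) :
    ∑ y2 ∈ Finset.range r, pt y2 ^ w2 * ∑ y1 ∈ Finset.range r, pt y1 ^ w1 *
      (pt y1 ^ u1 * pt y2 ^ u2 * ∑ t2 ∈ Finset.range r, pt y2 ^ t2 * ∑ t1 ∈ Finset.range r, pt y1 ^ t1 * x t1 t2) =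
    r * r * ∑ t2 ∈ Finset.range r, ∑ t1 ∈ Finset.range r,
      if r ∣ w1 + u1 + t1 ∧ r ∣ w2 + u2 + t2 then x t1 t2 else 0 := by
  have h1 : ∀ t1 t2, (r : R) * r * (if r ∣ w1 + u1 + t1 ∧ r ∣ w2 + u2 + t2 then x t1 t2 else 0) =
      ∑ y2 ∈ Finset.range r, ∑ y1 ∈ Finset.range r, pt y1 ^ (w1 + u1 + t1) * pt y2 ^ (w2 + u2 + t2) * x t1 t2 := by
    intro t1 t2
    have : ∑ y2 ∈ Finset.range r, ∑ y1 ∈ Finset.range r, pt y1 ^ (w1 + u1 + t1) * pt y2 ^ (w2 + u2 + t2) * x t1 t2 =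
        (∑ y1 ∈ Finset.range r, pt y1 ^ (w1 + u1 + t1)) * (∑ y2 ∈ Finset.range r, pt y2 ^ (w2 + u2 + t2)) * x t1 t2 := by
      rw [Finset.sum_mul_sum, Finset.sum_comm, Finset.sum_mul]
      refine Finset.sum_congr rfl fun y _ => ?_
      rw [Finset.sum_mul]
    rw [this, hS, hS]
    by_cases a : r ∣ w1 + u1 + t1 <;> by_cases b : r ∣ w2 + u2 + t2 <;> simp [a, b]
  rw [Finset.mul_sum]
  simp only [Finset.mul_sum, h1]
  have h2 : ∀ y2 y1 t2 t1 : ℕ, pt y2 ^ w2 * (pt y1 ^ w1 * (pt y1 ^ u1 * pt y2 ^ u2 * (pt y2 ^ t2 * (pt y1 ^ t1 * x t1 t2)))) =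
      pt y1 ^ (w1 + u1 + t1) * pt y2 ^ (w2 + u2 + t2) * x t1 t2 := by
    intro y2 y1 t2 t1; ring
  simp only [h2]
  calc _ = ∑ y2 ∈ Finset.range r, ∑ t2 ∈ Finset.range r, ∑ y1 ∈ Finset.range r, ∑ t1 ∈ Finset.range r,
        pt y1 ^ (w1 + u1 + t1) * pt y2 ^ (w2 + u2 + t2) * x t1 t2 :=
        Finset.sum_congr rfl fun y2 _ => Finset.sum_comm
    _ = ∑ t2 ∈ Finset.range r, ∑ y2 ∈ Finset.range r, ∑ y1 ∈ Finset.range r, ∑ t1 ∈ Finset.range r,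
        pt y1 ^ (w1 + u1 + t1) * pt y2 ^ (w2 + u2 + t2) * x t1 t2 := Finset.sum_comm
    _ = _ := by
      refine Finset.sum_congr rfl fun t2 _ => ?_
      rw [Finset.sum_congr rfl fun y2 _ => Finset.sum_comm]
      exact Finset.sum_comm

/-- Evaluation, products of matrices at the points, and the transposed evaluation. -/
theorem convolution_eq (hS : ∀ j, ∑ y ∈ Finset.range r, pt y ^ j = if r ∣ j then (r : R) else 0)
    (w1 w2 p n e : ℕ) (al en u1 u2 : ℕ → ℕ) (hal : ∀ η < n, al η < p) (x : ℕ → ℕ → ℕ → R) :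
    ∑ y2 ∈ Finset.range r, pt y2 ^ w2 * ∑ y1 ∈ Finset.range r, pt y1 ^ w1 *
      ∑ a ∈ Finset.range p, (∑ η ∈ Finset.range n, if en η = e ∧ al η = a then
          pt y1 ^ u1 η * pt y2 ^ u2 η else 0) *
        ∑ t2 ∈ Finset.range r, pt y2 ^ t2 * ∑ t1 ∈ Finset.range r, pt y1 ^ t1 * x t1 t2 a =
    r * r * ∑ η ∈ Finset.range n, if en η = e then ∑ t2 ∈ Finset.range r, ∑ t1 ∈ Finset.range r,
      if r ∣ w1 + u1 η + t1 ∧ r ∣ w2 + u2 η + t2 then x t1 t2 (al η) else 0 else 0 := by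
  have h1 : ∀ y1 y2, ∑ a ∈ Finset.range p, (∑ η ∈ Finset.range n, if en η = e ∧ al η = a then
          pt y1 ^ u1 η * pt y2 ^ u2 η else 0) *
        ∑ t2 ∈ Finset.range r, pt y2 ^ t2 * ∑ t1 ∈ Finset.range r, pt y1 ^ t1 * x t1 t2 a =
      ∑ η ∈ Finset.range n, if en η = e then pt y1 ^ u1 η * pt y2 ^ u2 η *
        ∑ t2 ∈ Finset.range r, pt y2 ^ t2 * ∑ t1 ∈ Finset.range r, pt y1 ^ t1 * x t1 t2 (al η) else 0 := by
    intro y1 y2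
    simp only [Finset.sum_mul]
    rw [Finset.sum_comm]
    refine Finset.sum_congr rfl fun η hη => ?_
    rw [Finset.sum_eq_single (al η)]
    · by_cases c : en η = e <;> simp [c]
    · intro a _ ha; simp [ha.symm]
    · intro h; exact absurd (Finset.mem_range.2 (hal η (Finset.mem_range.1 hη))) h
  simp only [h1]
  rw [Finset.mul_sum]
  have h2 : ∀ η, (r : R) * r * (if en η = e then ∑ t2 ∈ Finset.range r, ∑ t1 ∈ Finset.range r,
      if r ∣ w1 + u1 η + t1 ∧ r ∣ w2 + u2 η + t2 then x t1 t2 (al η) else 0 else 0) =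
      ∑ y2 ∈ Finset.range r, ∑ y1 ∈ Finset.range r, (if en η = e then pt y2 ^ w2 * (pt y1 ^ w1 *
      (pt y1 ^ u1 η * pt y2 ^ u2 η * ∑ t2 ∈ Finset.range r, pt y2 ^ t2 * ∑ t1 ∈ Finset.range r, pt y1 ^ t1 * x t1 t2 (al η))) else 0) := by
    intro η
    by_cases c : en η = e
    · simp only [c, if_true]
      rw [← convolution_term hS]
      refine Finset.sum_congr rfl fun y _ => ?_
      rw [Finset.mul_sum]
    · simp [c]
  simp only [h2]
  rw [Finset.sum_comm]
  refine Finset.sum_congr rfl fun y2 _ => ?_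
  rw [Finset.sum_comm, Finset.mul_sum]
  refine Finset.sum_congr rfl fun y1 _ => ?_
  rw [Finset.mul_sum, Finset.mul_sum]
  refine Finset.sum_congr rfl fun η _ => ?_
  by_cases c : en η = e <;> simp [c]

end

/-- The sum w + u + t is below 2r, so only 0 and r are possible. As u + t < 2d ≤ r, the cyclic
convolution is an ordinary one. Evaluation and transposed evaluation both use positive powers, which
is why index w holds the coefficient of -w modulo r. -/
theorem dvd_digit_iff {r d w u t : ℕ} (hw : w < r) (hu : u < d) (ht : t < d) (hd : 2 * d ≤ r) :
    r ∣ w + u + t ↔ u + t = (r - w) % r := by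
  constructor
  · rintro ⟨c, hc⟩
    have hc2 : c < 2 := by
      by_contra h
      have : r * 2 ≤ r * c := Nat.mul_le_mul_left _ (by omega)
      omega
    interval_cases c
    · have : w = 0 := by omega
      subst this; simp; omega
    · rcases Nat.eq_zero_or_pos w with rfl | h
      · omega
      · rw [Nat.mod_eq_of_lt (by omega)]; omega
  · intro h
    rcases Nat.eq_zero_or_pos w with rfl | h0
    · simp at h
      have : u = 0 ∧ t = 0 := h
      simp [this]
    · rw [Nat.mod_eq_of_lt (by omega)] at h
      exact ⟨1, by omega⟩

/-- The number of the pairs of digits, scaled, vanishes modulo `M` only if there are none. -/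
theorem scaled_count_ne_zero {M r d w1 w2 n e : ℕ} {W : ℕ} {en u1 u2 : ℕ → ℕ} {x : ℕ → ℕ → ℕ → ℕ}
    {al : ℕ → ℕ} (hco : Nat.Coprime r M) (hnM : n < M) (hW : W < M) (hw1 : w1 < r) (hw2 : w2 < r)
    (hd : 2 * d ≤ r) (hu : ∀ η < n, u1 η < d ∧ u2 η < d)
    (hx : ∀ η < n, ∀ t1 t2, x t1 t2 (al η) ≤ 1) (hx' : ∀ η < n, ∀ t1 t2, x t1 t2 (al η) ≠ 0 → t1 < d ∧ t2 < d)
    (h : (W : ZMod M) = r * r * ∑ η ∈ Finset.range n, if en η = e then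
      ∑ t2 ∈ Finset.range r, ∑ t1 ∈ Finset.range r,
      if r ∣ w1 + u1 η + t1 ∧ r ∣ w2 + u2 η + t2 then (x t1 t2 (al η) : ZMod M) else 0 else 0) :
    W ≠ 0 ↔ ∃ η < n, en η = e ∧ ∃ t1 t2, x t1 t2 (al η) ≠ 0 ∧ u1 η + t1 = (r - w1) % r ∧
      u2 η + t2 = (r - w2) % r := by
  set c : ℕ := ∑ η ∈ Finset.range n, if en η = e then
      ∑ t2 ∈ Finset.range r, ∑ t1 ∈ Finset.range r,
      if r ∣ w1 + u1 η + t1 ∧ r ∣ w2 + u2 η + t2 then x t1 t2 (al η) else 0 else 0 with hc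
  have h1 : (W : ZMod M) = ((r * r * c : ℕ) : ZMod M) := by
    rw [h, hc]
    push_cast
    rfl
  -- Given the digits of a string, at most one pair (t1, t2) completes them to the wanted cell, so
  -- each string is counted at most once.
  have hcn : c ≤ n := by
    have : c ≤ ∑ η ∈ Finset.range n, 1 := by
      refine Finset.sum_le_sum fun η hη => ?_
      have hη' := Finset.mem_range.1 hη
      split_ifs with c1
      · have key : ∀ t2 ∈ Finset.range r, ∀ t1 ∈ Finset.range r,
            (if r ∣ w1 + u1 η + t1 ∧ r ∣ w2 + u2 η + t2 then x t1 t2 (al η) else 0) ≤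
            (if t2 = (r - w2) % r - u2 η then (if t1 = (r - w1) % r - u1 η then 1 else 0) else 0) := by
          intro t2 _ t1 _
          by_cases c2 : x t1 t2 (al η) = 0
          · simp [c2]
          · obtain ⟨k1, k2⟩ := hx' η hη' t1 t2 c2
            by_cases c3 : r ∣ w1 + u1 η + t1 ∧ r ∣ w2 + u2 η + t2
            · have e1 := (dvd_digit_iff hw1 (hu η hη').1 k1 hd).1 c3.1
              have e2 := (dvd_digit_iff hw2 (hu η hη').2 k2 hd).1 c3.2
              rw [if_pos c3, if_pos (by omega), if_pos (by omega)]
              exact hx η hη' t1 t2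
            · simp [c3]
        refine (Finset.sum_le_sum fun t2 h2 => Finset.sum_le_sum (key t2 h2)).trans ?_
        simp only [Finset.sum_ite_irrel, Finset.sum_const_zero, Finset.sum_ite_eq', Finset.mem_range]
        split_ifs <;> simp
      · simp
    simpa using this
  -- The factor r² is prime to M, and c ≤ n < M, so no non-zero count is lost modulo M.
  have h2 : W ≠ 0 ↔ c ≠ 0 := by
    rw [not_iff_not]
    constructor
    · rintro rfl
      rw [Nat.cast_zero, eq_comm, ZMod.natCast_eq_zero_iff] at h1
      have h3 : M ∣ c := (Nat.Coprime.mul_left hco hco).symm.dvd_of_dvd_mul_left h1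
      exact Nat.eq_zero_of_dvd_of_lt h3 (by omega)
    · intro h3
      rw [h3, Nat.mul_zero, Nat.cast_zero, ZMod.natCast_eq_zero_iff] at h1
      exact Nat.eq_zero_of_dvd_of_lt h1 hW
  rw [h2, hc, Ne, Finset.sum_eq_zero_iff]
  push Not
  constructor
  · rintro ⟨η, hη, h3⟩
    have hη' := Finset.mem_range.1 hη
    by_cases c1 : en η = e
    · rw [if_pos c1] at h3
      obtain ⟨t2, -, h4⟩ := Finset.exists_ne_zero_of_sum_ne_zero h3
      obtain ⟨t1, -, h5⟩ := Finset.exists_ne_zero_of_sum_ne_zero h4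
      by_cases c3 : r ∣ w1 + u1 η + t1 ∧ r ∣ w2 + u2 η + t2
      · rw [if_pos c3] at h5
        obtain ⟨k1, k2⟩ := hx' η hη' t1 t2 h5
        exact ⟨η, hη', c1, t1, t2, h5, (dvd_digit_iff hw1 (hu η hη').1 k1 hd).1 c3.1,
          (dvd_digit_iff hw2 (hu η hη').2 k2 hd).1 c3.2⟩
      · simp [c3] at h5
    · simp [c1] at h3
  · rintro ⟨η, hη, c1, t1, t2, h5, e1, e2⟩
    obtain ⟨k1, k2⟩ := hx' η hη t1 t2 h5
    have c3 : r ∣ w1 + u1 η + t1 ∧ r ∣ w2 + u2 η + t2 :=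
      ⟨(dvd_digit_iff hw1 (hu η hη).1 k1 hd).2 e1, (dvd_digit_iff hw2 (hu η hη).2 k2 hd).2 e2⟩
    refine ⟨η, Finset.mem_range.2 hη, ?_⟩
    rw [if_pos c1]
    intro h6
    rw [Finset.sum_eq_zero_iff] at h6
    have h7 := h6 t2 (Finset.mem_range.2 (by omega))
    rw [Finset.sum_eq_zero_iff] at h7
    have h8 := h7 t1 (Finset.mem_range.2 (by omega))
    rw [if_pos c3] at h8
    exact h5 h8

/-! ## Batches of matrix products -/

/-- The matrix `vo` of the batch `A` becomes the first factor. -/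
def loadMatCm (A : Arr) : Cm := .loop va vpp (.sto mA va (.ld A (vo * vpp + va)))

/-- The columns of the chunk `vch` of `X` become the second factor. -/
def loadColsCm (X : Arr) : Cm :=
  .loop vx1 vrr (.loop vcc vrr (vcol ≔ vch * vrr + vcc ;;
    .ite (.ltv vcol vC) (.sto mB (vx1 * vrr + vcc) (.ld X (vo * vio + vx1 * vix + vcol * vic)))
      (.sto mB (vx1 * vrr + vcc) 0)))

/-- Store the product, reduced modulo `vM`. -/
def storeColsCm (Y : Arr) : Cm :=
  .loop vx1 vrr (.loop vcc vrr (vcol ≔ vch * vrr + vcc ;;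
    .ite (.ltv vcol vC) (.sto Y (vo * voo + vx1 * voy + vcol * voc) (.ld mC (vx1 * vrr + vcc) % vM))
      .skip))

/-- Multiply each matrix of the batch `A` with the corresponding columns of `X`, modulo `vM`. -/
def batchCm (A X Y : Arr) : Cm :=
  (vpp ≔ vrr * vrr ;; vnc ≔ vC / vrr + 1) ;;
  .loop vo vO (.loop vch vnc (loadMatCm A ;; loadColsCm X ;; .mm vrr ;; storeColsCm Y))

/-- The arrays that are not used by the multiplication. -/
def Arr.Free (A : Arr) : Prop := A ≠ mA ∧ A ≠ mB ∧ A ≠ mC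

section
variable {w : ℕ} {pm : Prog} {σ : St}

theorem loadMatCm_spec (hw : 1 ≤ w) {A : Arr} (hA : A.Free) {s o : ℕ} (h1 : σ.var vpp = s * s)
    (h2 : σ.var vo = o) (hsz : o * (s * s) + s * s < 2 ^ w) :
    Ht w pm (loadMatCm A) σ (20 * (s * s) + 3) (fun τ => ∀ i < s * s, τ.arr mA i = σ.arr A (o * (s * s) + i)) := by
  refine Ht.loop_le hw (fun z τ => ∀ i < z, τ.arr mA i = σ.arr A (o * (s * s) + i)) 10 h1 (by omega) (by decide)
    (by simp [Cm.wv]) (by simp [Cm.wv]) (by simp) ?_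
  intro z hz τ hF hv hI
  have e1 : τ.var vpp = s * s := (hF.1 _ (by simp [Cm.wv])).trans h1
  have e2 : τ.var vo = o := (hF.1 _ (by simp [Cm.wv])).trans h2
  have e3 : τ.arr A = σ.arr A := hF.2 _ (by simp [Cm.wa]; exact hA.1)
  refine Ht.of_wp hw (Nat.le_of_ble_eq_true rfl) ?_
  simp [Cm.wp, e1, e2, e3, hv]
  refine ⟨by omega, by omega, fun i hi => ?_⟩
  split_ifs with c
  · rw [c]
  · exact hI i (by omega)

theorem loadColsCm_spec (hw : 1 ≤ w) {X : Arr} (hX : X.Free) {s o ch C io ix ic W : ℕ} (h1 : σ.var vrr = s)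
    (h2 : σ.var vo = o) (h3 : σ.var vch = ch) (h4 : σ.var vC = C) (h5 : σ.var vio = io)
    (h6 : σ.var vix = ix) (h7 : σ.var vic = ic)
    (hsz : s * s + C + s + ch * s + W < 2 ^ w) (hidx : ∀ x < s, ∀ c < C, o * io + x * ix + c * ic ≤ W) :
    Ht w pm (loadColsCm X) σ (60 * (s * s) + 10 * s + 3) (fun τ => ∀ x < s, ∀ cc < s,
      τ.arr mB (x * s + cc) = if ch * s + cc < C then σ.arr X (o * io + x * ix + (ch * s + cc) * ic) else 0) := by
  refine (Ht.loop_le hw (fun z τ => ∀ x < z, ∀ cc < s,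
      τ.arr mB (x * s + cc) = if ch * s + cc < C then σ.arr X (o * io + x * ix + (ch * s + cc) * ic) else 0)
      (s * (40 + 4) + 3) h1 (by ring_nf; omega) (by decide)
    (by simp [Cm.wv]) (by simp [Cm.wv]) (by simp) ?_)
  intro x hx τ hF hv hI
  have e1 : τ.var vrr = s := (hF.1 _ (by simp [Cm.wv])).trans h1
  have hxs : (x + 1) * s ≤ s * s := Nat.mul_le_mul_right _ hx
  rw [Nat.succ_mul] at hxs
  refine (Ht.loop_le hw (fun z τ => (∀ x' < x, ∀ cc < s,
      τ.arr mB (x' * s + cc) = if ch * s + cc < C then σ.arr X (o * io + x' * ix + (ch * s + cc) * ic) else 0) ∧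
      ∀ cc < z, τ.arr mB (x * s + cc) = if ch * s + cc < C then σ.arr X (o * io + x * ix + (ch * s + cc) * ic) else 0)
      40 e1 le_rfl (by decide) (by simp [Cm.wv]) (by simp [Cm.wv]) ?_ ?_).mono le_rfl ?_
  · exact ⟨by simpa using hI, by simp⟩
  · intro cc hcc υ hG hvc ⟨hI1, hI2⟩
    have f1 : υ.var vrr = s := (hG.1 _ (by simp [Cm.wv])).trans e1
    have f2 : υ.var vo = o := (hG.1 _ (by simp [Cm.wv])).trans ((hF.1 _ (by simp [Cm.wv])).trans h2)
    have f3 : υ.var vch = ch := (hG.1 _ (by simp [Cm.wv])).trans ((hF.1 _ (by simp [Cm.wv])).trans h3)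
    have f4 : υ.var vC = C := (hG.1 _ (by simp [Cm.wv])).trans ((hF.1 _ (by simp [Cm.wv])).trans h4)
    have f5 : υ.var vio = io := (hG.1 _ (by simp [Cm.wv])).trans ((hF.1 _ (by simp [Cm.wv])).trans h5)
    have f6 : υ.var vix = ix := (hG.1 _ (by simp [Cm.wv])).trans ((hF.1 _ (by simp [Cm.wv])).trans h6)
    have f7 : υ.var vic = ic := (hG.1 _ (by simp [Cm.wv])).trans ((hF.1 _ (by simp [Cm.wv])).trans h7)
    have f8 : υ.var vx1 = x := (hG.1 _ (by simp [Cm.wv])).trans hv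
    have f9 : υ.arr X = σ.arr X := (hG.2 _ (by simp [Cm.wa]; exact hX.2.1)).trans
      (hF.2 _ (by simp [Cm.wa]; exact hX.2.1))
    have hne : ∀ x' < x, ∀ c' < s, x' * s + c' ≠ x * s + cc := fun x' hx' c' hc' h => by
      have := mul_add_inj hc' hcc h; omega
    refine Ht.of_wp hw (Nat.le_of_ble_eq_true rfl) ?_
    simp [Cm.wp, f1, f2, f3, f4, f5, f6, f7, f8, f9, hvc]
    have hfin : ∀ v, (v = if ch * s + cc < C then σ.arr X (o * io + x * ix + (ch * s + cc) * ic) else 0) →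
        (∀ x' < x, ∀ c' < s, (if x' * s + c' = x * s + cc then v else υ.arr mB (x' * s + c')) =
          if ch * s + c' < C then σ.arr X (o * io + x' * ix + (ch * s + c') * ic) else 0) ∧
        ∀ c' ≤ cc, (if c' = cc then v else υ.arr mB (x * s + c')) =
          if ch * s + c' < C then σ.arr X (o * io + x * ix + (ch * s + c') * ic) else 0 := by
      intro v hv
      refine ⟨fun x' hx' c' hc' => ?_, fun c' hc' => ?_⟩
      · rw [if_neg (hne x' hx' c' hc')]; exact hI1 x' hx' c' hc'
      · split_ifs with c1 c2 c2
        · subst c1; rw [hv, if_pos c2]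
        · subst c1; rw [hv, if_neg c2]
        · rw [hI2 c' (by omega), if_pos c2]
        · rw [hI2 c' (by omega), if_neg c2]
    refine ⟨by omega, fun c1 => ?_, fun c1 => ?_⟩
    · have := hidx x hx _ c1
      exact ⟨by omega, by omega, by omega, hfin _ (by rw [if_pos c1])⟩
    · exact ⟨by omega, by omega, hfin _ (by rw [if_neg (by omega)])⟩
  · intro υ _ ⟨k1, k2⟩ x' hx' cc hcc
    simp only [St.set_arr]
    rcases Nat.lt_succ_iff_lt_or_eq.1 hx' with h | rfl
    · exact k1 x' h cc hcc
    · exact k2 cc hcc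

/-- The triples `(o, y, c)` satisfying `D` have been stored in `Y`. -/
def Stored (Y : Arr) (O s C oo oy oc : ℕ) (val : ℕ → ℕ → ℕ → ℕ) (D : ℕ → ℕ → ℕ → Prop) (τ : St) : Prop :=
  ∀ o < O, ∀ y < s, ∀ c < C, D o y c → τ.arr Y (o * oo + y * oy + c * oc) = val o y c

theorem Stored.imp {Y : Arr} {O s C oo oy oc : ℕ} {val : ℕ → ℕ → ℕ → ℕ} {D D' : ℕ → ℕ → ℕ → Prop} {τ υ : St}
    (h : Stored Y O s C oo oy oc val D τ) (hY : υ.arr Y = τ.arr Y)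
    (hD : ∀ o < O, ∀ y < s, ∀ c < C, D' o y c → D o y c) : Stored Y O s C oo oy oc val D' υ :=
  fun o ho y hy c hc h' => by rw [hY]; exact h o ho y hy c hc (hD o ho y hy c hc h')

/-- Different triples are stored in different cells. -/
def Separated (O s C oo oy oc : ℕ) : Prop :=
  ∀ o < O, ∀ y < s, ∀ c < C, ∀ o' < O, ∀ y' < s, ∀ c' < C,
    o * oo + y * oy + c * oc = o' * oo + y' * oy + c' * oc → o = o' ∧ y = y' ∧ c = c'

theorem Stored.put {Y : Arr} {O s C oo oy oc : ℕ} {val : ℕ → ℕ → ℕ → ℕ} {D D' : ℕ → ℕ → ℕ → Prop} {τ υ : St}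
    (h : Stored Y O s C oo oy oc val D τ) (hs : Separated O s C oo oy oc) {o y c : ℕ} (ho : o < O) (hy : y < s)
    (hc : c < C)
    (hY : υ.arr Y = fun j => if j = o * oo + y * oy + c * oc then val o y c else τ.arr Y j)
    (hD : ∀ o' < O, ∀ y' < s, ∀ c' < C, D' o' y' c' → D o' y' c' ∨ (o' = o ∧ y' = y ∧ c' = c)) :
    Stored Y O s C oo oy oc val D' υ := by
  intro o' ho' y' hy' c' hc' h'
  rw [hY]
  by_cases e : o' = o ∧ y' = y ∧ c' = c
  · obtain ⟨rfl, rfl, rfl⟩ := e; simp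
  · have hne : o' * oo + y' * oy + c' * oc ≠ o * oo + y * oy + c * oc := fun h2 =>
      e (hs o' ho' y' hy' c' hc' o ho y hy c hc h2)
    simp only [hne, if_false]
    exact h o' ho' y' hy' c' hc' ((hD o' ho' y' hy' c' hc' h').resolve_right e)

theorem storeColsCm_spec (hw : 1 ≤ w) {Y : Arr} (hYf : Y.Free) {O s o ch C oo oy oc W M : ℕ}
    {val : ℕ → ℕ → ℕ → ℕ} (h1 : σ.var vrr = s)
    (h2 : σ.var vo = o) (h3 : σ.var vch = ch) (h4 : σ.var vC = C) (h5 : σ.var voo = oo)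
    (h6 : σ.var voy = oy) (h7 : σ.var voc = oc) (h8 : σ.var vM = M) (ho : o < O)
    (hsz : s * s + C + s + ch * s + W < 2 ^ w) (hidx : ∀ y < s, ∀ c < C, o * oo + y * oy + c * oc ≤ W)
    (hs : Separated O s C oo oy oc)
    (hval : ∀ y < s, ∀ cc < s, ch * s + cc < C → σ.arr mC (y * s + cc) % M = val o y (ch * s + cc))
    (hI : Stored Y O s C oo oy oc val (fun o' _ c => o' < o ∨ o' = o ∧ c < ch * s) σ) :
    Ht w pm (storeColsCm Y) σ (60 * (s * s) + 10 * s + 3)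
      (Stored Y O s C oo oy oc val (fun o' _ c => o' < o ∨ o' = o ∧ c < ch * s + s)) := by
  refine (Ht.loop_le hw (fun z => Stored Y O s C oo oy oc val (fun o' y c => o' < o ∨ o' = o ∧ c < ch * s ∨
      o' = o ∧ c < ch * s + s ∧ y < z))
      (s * (40 + 4) + 3) h1 (by ring_nf; omega) (by decide)
    (by simp [Cm.wv]) (by simp [Cm.wv]) (hI.imp rfl ?_) ?_).mono le_rfl fun τ _ h => h.imp rfl ?_
  · intro o' _ y _ c _; omega
  swap
  · intro o' _ y _ c _; omega
  intro x hx τ hF hv hI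
  have e1 : τ.var vrr = s := (hF.1 _ (by simp [Cm.wv])).trans h1
  have hxs : (x + 1) * s ≤ s * s := Nat.mul_le_mul_right _ hx
  rw [Nat.succ_mul] at hxs
  refine (Ht.loop_le hw (fun z => Stored Y O s C oo oy oc val (fun o' y c => o' < o ∨ o' = o ∧ c < ch * s ∨
      o' = o ∧ c < ch * s + s ∧ y < x ∨ o' = o ∧ c < ch * s + z ∧ y = x))
      40 e1 le_rfl (by decide) (by simp [Cm.wv]) (by simp [Cm.wv]) (hI.imp rfl ?_) ?_).mono le_rfl
      fun τ _ h => h.imp rfl ?_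
  · intro o' _ y _ c _; omega
  swap
  · intro o' _ y _ c _; omega
  · intro cc hcc υ hG hvc hI
    have f1 : υ.var vrr = s := (hG.1 _ (by simp [Cm.wv])).trans e1
    have f2 : υ.var vo = o := (hG.1 _ (by simp [Cm.wv])).trans ((hF.1 _ (by simp [Cm.wv])).trans h2)
    have f3 : υ.var vch = ch := (hG.1 _ (by simp [Cm.wv])).trans ((hF.1 _ (by simp [Cm.wv])).trans h3)
    have f4 : υ.var vC = C := (hG.1 _ (by simp [Cm.wv])).trans ((hF.1 _ (by simp [Cm.wv])).trans h4)
    have f5 : υ.var voo = oo := (hG.1 _ (by simp [Cm.wv])).trans ((hF.1 _ (by simp [Cm.wv])).trans h5)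
    have f6 : υ.var voy = oy := (hG.1 _ (by simp [Cm.wv])).trans ((hF.1 _ (by simp [Cm.wv])).trans h6)
    have f7 : υ.var voc = oc := (hG.1 _ (by simp [Cm.wv])).trans ((hF.1 _ (by simp [Cm.wv])).trans h7)
    have f8 : υ.var vx1 = x := (hG.1 _ (by simp [Cm.wv])).trans hv
    have f9 : υ.var vM = M := (hG.1 _ (by simp [Cm.wv])).trans ((hF.1 _ (by simp [Cm.wv])).trans h8)
    have f10 : υ.arr mC = σ.arr mC := (hG.2 _ (by simp [Cm.wa]; exact hYf.2.2.symm)).trans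
      (hF.2 _ (by simp [Cm.wa]; exact hYf.2.2.symm))
    refine Ht.of_wp hw (Nat.le_of_ble_eq_true rfl) ?_
    simp [Cm.wp, f1, f2, f3, f4, f5, f6, f7, f8, f9, f10, hvc]
    refine ⟨by omega, fun c1 => ?_, fun c1 => hI.imp rfl ?_⟩
    · have := hidx x hx _ c1
      refine ⟨by omega, by omega, by omega, hI.put hs ho hx c1 ?_ ?_⟩
      · simp [St.put_arr_fun, hval x hx cc hcc c1]
      · intro o' _ y _ c _; omega
    · intro o' _ y _ c _; omega

/-- The entry `y`, `c` of the product number `o`. -/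
def batchVal (σ : St) (A X : Arr) (s io ix ic M o y c : ℕ) : ℕ :=
  (∑ x ∈ Finset.range s, σ.arr A (o * (s * s) + (y * s + x)) * σ.arr X (o * io + x * ix + c * ic)) % M

/-- The columns are cut into C/s + 1 chunks of s columns, the last one padded with zeros, and each
chunk is one square product of order s. Strides describe the layouts of source and target, so that
no separate transposition is needed between stages. -/
theorem batchCm_spec (hw : 1 ≤ w) {Φ smax Mx : ℕ} (hpm : Multiplies w pm Φ smax Mx) {A X Y : Arr}
    (hA : A.Free) (hX : X.Free) (hY : Y.Free) (hAY : A ≠ Y) (hXY : X ≠ Y)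
    {O s C io ix ic oo oy oc M W : ℕ} (h1 : σ.var vrr = s) (h2 : σ.var vO = O) (h3 : σ.var vC = C)
    (h4 : σ.var vio = io) (h5 : σ.var vix = ix) (h6 : σ.var vic = ic) (h7 : σ.var voo = oo)
    (h8 : σ.var voy = oy) (h9 : σ.var voc = oc) (h10 : σ.var vM = M) (hs1 : 1 ≤ s) (hs2 : s ≤ smax)
    (hin : ∀ o < O, ∀ x < s, ∀ c < C, o * io + x * ix + c * ic ≤ W)
    (hout : ∀ o < O, ∀ y < s, ∀ c < C, o * oo + y * oy + c * oc ≤ W)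
    (hsep : Separated O s C oo oy oc) (hsz : O * (s * s) + s * s + C + C + s + s + W < 2 ^ w)
    (hMx : s * (Mx * Mx) < 2 ^ w)
    (hmat : ∀ i < O * (s * s), σ.arr A i ≤ Mx)
    (hsrc : ∀ o < O, ∀ x < s, ∀ c < C, σ.arr X (o * io + x * ix + c * ic) ≤ Mx) :
    Ht w pm (batchCm A X Y) σ (O * ((C / s + 1) * (s * s * (Φ + 230))) + 20) (fun τ =>
      ∀ o < O, ∀ y < s, ∀ c < C, τ.arr Y (o * oo + y * oy + c * oc) = batchVal σ A X s io ix ic M o y c) := by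
  have hone : 1 < 2 ^ w := Nat.one_lt_two_pow (by omega)
  have hss : 1 ≤ s * s := Nat.mul_pos hs1 hs1
  have hnc : C / s * s ≤ C := Nat.div_mul_le_self C s
  have hCs : C / s ≤ C := Nat.div_le_self C s
  have hss' : s ≤ s * s := Nat.le_mul_of_pos_left s hs1
  have hClt : C < (C / s + 1) * s := by
    have := Nat.lt_div_mul_add hs1 (a := C); rw [Nat.succ_mul]; omega
  refine Ht.seq_le 12 (O * (((C / s + 1) * ((s * s * Φ + 190 * (s * s)) + 4) + 3) + 4) + 3)
    (R := fun τ => τ = (σ.set vpp (s * s)).set vnc (C / s + 1))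
    (Ht.of_wp hw (Nat.le_of_ble_eq_true rfl) (by simp [Cm.wp, h1, h3]; generalize C / s = nc at *; omega)) ?_ ?_
  · have e1 : (C / s + 1) * ((s * s * Φ + 190 * (s * s)) + 4) + 3 + 4 ≤ (C / s + 1) * (s * s * (Φ + 230)) := by
      have : (C / s + 1) * (s * s * (Φ + 230)) =
        (C / s + 1) * ((s * s * Φ + 190 * (s * s)) + 4) + (C / s + 1) * (40 * (s * s) - 4) := by
        rw [← Nat.mul_add]; congr 1
        have : s * s * (Φ + 230) = s * s * Φ + 230 * (s * s) := by ring
        omega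
      have h7 : 1 * 7 ≤ (C / s + 1) * (40 * (s * s) - 4) := Nat.mul_le_mul (Nat.le_add_left 1 _) (by omega)
      omega
    have := Nat.mul_le_mul_left O e1
    omega
  rintro τ - rfl
  refine (Ht.loop_le hw (fun z => Stored Y O s C oo oy oc (batchVal σ A X s io ix ic M) (fun o _ _ => o < z))
    ((C / s + 1) * ((s * s * Φ + 190 * (s * s)) + 4) + 3) (n := O) (by simp [h2]) le_rfl (by decide)
    (by simp [Cm.wv, loadMatCm, loadColsCm, storeColsCm]) (by simp [Cm.wv, loadMatCm, loadColsCm, storeColsCm])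
    (fun o _ y _ c _ h => absurd h (Nat.not_lt_zero o)) ?_).mono le_rfl fun τ _ h o ho y hy c hc => h o ho y hy c hc ho
  intro o ho α hα hvo hI
  have fr1 : ∀ x : Var, x ∉ [vo, vch, va, vx1, vcc, vcol] → x ≠ vpp → x ≠ vnc → α.var x = σ.var x := fun x hx k1 k2 => by
    rw [hα.1 x (by simp [Cm.wv, loadMatCm, loadColsCm, storeColsCm]; simp at hx; tauto)]; simp [k1, k2]
  have fr2 : ∀ B : Arr, B.Free → B ≠ Y → α.arr B = σ.arr B := fun B hB k => by
    rw [hα.2 B (by simp [Cm.wa, loadMatCm, loadColsCm, storeColsCm, k]; unfold Arr.Free at hB; tauto)]; rfl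
  have a1 : α.var vpp = s * s := (hα.1 _ (by simp [Cm.wv, loadMatCm, loadColsCm, storeColsCm])).trans (by simp)
  have a2 : α.var vnc = C / s + 1 := (hα.1 _ (by simp [Cm.wv, loadMatCm, loadColsCm, storeColsCm])).trans (by simp)
  have hos : o * (s * s) + s * s ≤ O * (s * s) := by
    rw [← Nat.succ_mul]; exact Nat.mul_le_mul_right _ ho
  refine (Ht.loop_le hw (fun z => Stored Y O s C oo oy oc (batchVal σ A X s io ix ic M)
    (fun o' _ c => o' < o ∨ o' = o ∧ c < z * s))
    (s * s * Φ + 190 * (s * s)) a2 le_rfl (by decide)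
    (by simp [Cm.wv, loadMatCm, loadColsCm, storeColsCm]) (by simp [Cm.wv, loadMatCm, loadColsCm, storeColsCm])
    (hI.imp rfl fun o' _ y _ c _ => by omega) ?_).mono le_rfl fun τ _ h => h.imp rfl fun o' _ y _ c hc => ?_
  swap
  · omega
  intro ch hch β hβ hvch hI
  have fr3 : ∀ x : Var, x ∉ [vch, va, vx1, vcc, vcol] → β.var x = α.var x := fun x hx =>
    hβ.1 x (by simp [Cm.wv, loadMatCm, loadColsCm, storeColsCm]; simp at hx; tauto)
  have fr4 : ∀ B : Arr, B.Free → B ≠ Y → β.arr B = σ.arr B := fun B hB k => by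
    rw [hβ.2 B (by simp [Cm.wa, loadMatCm, loadColsCm, storeColsCm, k]; unfold Arr.Free at hB; tauto), fr2 B hB k]
  have hchs : ch * s ≤ C / s * s := Nat.mul_le_mul_right _ (by omega)
  have bo : β.var vo = o := (fr3 _ (by simp)).trans hvo
  refine Ht.seq_le _ (s * s * Φ + 160 * (s * s)) (loadMatCm_spec hw hA ((fr3 _ (by simp)).trans a1) bo
    (by omega)) (by omega) ?_
  intro γ fγ g1
  rw [fr4 A hA hAY] at g1
  have fr5 : ∀ x : Var, x ∉ [vch, va, vx1, vcc, vcol] → γ.var x = α.var x := fun x hx =>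
    (fγ.1 x (by simp [Cm.wv, loadMatCm] ; simp at hx; tauto)).trans (fr3 x hx)
  have fr6 : ∀ x : Var, x ∉ [vo, vch, va, vx1, vcc, vcol, vpp, vnc] → γ.var x = σ.var x := fun x hx =>
    (fr5 x (by simp at hx ⊢; tauto)).trans (fr1 x (by simp at hx ⊢; tauto) (by simp at hx; tauto) (by simp at hx; tauto))
  have gch : γ.var vch = ch := (fγ.1 _ (by simp [Cm.wv, loadMatCm])).trans hvch
  have gX : γ.arr X = σ.arr X := (fγ.2 _ (by simp [Cm.wa, loadMatCm]; exact hX.1)).trans (fr4 X hX hXY)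
  have go : γ.var vo = o := (fr5 _ (by simp)).trans hvo
  refine Ht.seq_le _ (s * s * Φ + 80 * (s * s)) (loadColsCm_spec hw hX (W := W) ((fr6 _ (by simp)).trans h1)
    go gch ((fr6 _ (by simp)).trans h3) ((fr6 _ (by simp)).trans h4)
    ((fr6 _ (by simp)).trans h5) ((fr6 _ (by simp)).trans h6) (by omega) (hin o ho)) (by omega) ?_
  intro δ fδ d1
  rw [gX] at d1
  have fr7 : ∀ x : Var, x ∉ [vo, vch, va, vx1, vcc, vcol, vpp, vnc] → δ.var x = σ.var x := fun x hx =>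
    (fδ.1 x (by simp [Cm.wv, loadColsCm] ; simp at hx; tauto)).trans (fr6 x hx)
  have dch : δ.var vch = ch := (fδ.1 _ (by simp [Cm.wv, loadColsCm])).trans gch
  have do' : δ.var vo = o := (fδ.1 _ (by simp [Cm.wv, loadColsCm])).trans go
  have dA : ∀ i < s * s, δ.arr mA i = σ.arr A (o * (s * s) + i) := by
    rw [fδ.2 mA (by simp [Cm.wa, loadColsCm])]; exact g1
  have dY : δ.arr Y = β.arr Y := (fδ.2 _ (by simp [Cm.wa, loadColsCm]; exact hY.2.1)).trans
    (fγ.2 _ (by simp [Cm.wa, loadMatCm]; exact hY.1))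
  refine Ht.seq_le _ (75 * (s * s)) (Ht.mm hpm ((fr7 _ (by simp)).trans h1) hs1 hs2 ?_ ?_ (by omega) hMx)
    (by rw [sq]; omega) ?_
  · intro i hi
    rw [dA i hi]
    exact hmat _ (by omega)
  · intro i hi
    have e1 := Nat.div_add_mod i s
    have e2 : i / s < s := by rw [Nat.div_lt_iff_lt_mul hs1]; exact hi
    have e3 := d1 (i / s) e2 (i % s) (Nat.mod_lt _ hs1)
    rw [mul_comm, e1] at e3
    rw [e3]
    split_ifs with c
    · exact hsrc o ho _ e2 _ c
    · exact Nat.zero_le _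
  intro ε fε e1
  have fr8 : ∀ x : Var, x ∉ [vo, vch, va, vx1, vcc, vcol, vpp, vnc] → ε.var x = σ.var x := fun x hx =>
    (fε.1 x (by simp [Cm.wv])).trans (fr7 x hx)
  have eY : ε.arr Y = β.arr Y := (fε.2 _ (by simp [Cm.wa]; exact hY)).trans dY
  refine (storeColsCm_spec hw hY (W := W) (val := batchVal σ A X s io ix ic M) ((fr8 _ (by simp)).trans h1)
    ((fε.1 _ (by simp [Cm.wv])).trans do') ((fε.1 _ (by simp [Cm.wv])).trans dch) ((fr8 _ (by simp)).trans h3)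
    ((fr8 _ (by simp)).trans h7) ((fr8 _ (by simp)).trans h8) ((fr8 _ (by simp)).trans h9)
    ((fr8 _ (by simp)).trans h10) ho (by omega) (hout o ho) hsep ?_ (hI.imp eY fun _ _ _ _ _ _ h => h)).mono
    (by omega) fun τ _ h => h.imp rfl fun o' _ y _ c _ h => by rw [Nat.succ_mul] at h; exact h
  intro y hy cc hcc hC
  rw [e1 y hy cc hcc, batchVal]
  congr 1
  refine Finset.sum_congr rfl fun x hx => ?_
  have hx' := Finset.mem_range.1 hx
  have hyx : y * s + x < s * s := by
    have : (y + 1) * s ≤ s * s := Nat.mul_le_mul_right _ hy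
    rw [Nat.succ_mul] at this; omega
  rw [dA _ hyx, d1 x hx' cc hcc, if_pos hC]

end

/-! ## Parameters and evaluation points -/

/-- Choose the order, the prime and the modulus of the transforms. -/
def setupCm : Cm :=
  (vD ≔ vB / vp + 3) ;; sqrtCm ;; (vd ≔ vR + 1 ;; vR ≔ 2 * vd) ;; primeCm ;;
  (vr ≔ vrho - 1 ;; vM ≔ 1 ;; vI ≔ vq * vp) ;;
  .loop vt vLam (.ite (.ltv vZ vM) .skip (vM ≔ vM * vrho))

/-- The parameters of the transforms. -/
structure Params (D Z Λ d r ρ M : ℕ) : Prop where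
  prime : ρ.Prime
  rho : ρ = r + 1
  pow : ∃ e, 1 ≤ e ∧ e ≤ Λ ∧ M = ρ ^ e
  lt : Z < M
  le : M ≤ ρ * Z
  d_ge : D ≤ d * d
  d_le : d * d ≤ 4 * D
  r_ge : 2 * d ≤ r
  r_le : r ≤ 4 * d

/-- The parameters are in their variables. -/
structure HasParams (d r ρ M I : ℕ) (σ : St) : Prop where
  vd : σ.var vd = d
  vr : σ.var vr = r
  vrho : σ.var vrho = ρ
  vM : σ.var vM = M
  vI : σ.var vI = I

section
variable {w : ℕ} {pm : Prog} {σ : St}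

/-- With d one more than the integer square root of D, D ≤ d² ≤ 4D, and the search for a prime in
(2d, 4d] costs O(d²) = O(D). The modulus is multiplied by ρ only while it is at most Z, so it ends
at most ρZ; Λ rounds suffice because ρ ≥ 2 and 2^Λ > Z. -/
theorem setupCm_spec (hw : 1 ≤ w) {B p q Z Λ : ℕ} (h1 : σ.var vB = B) (h2 : σ.var vp = p)
    (h3 : σ.var vq = q) (h4 : σ.var vZ = Z) (h5 : σ.var vLam = Λ) (hZ : 1 ≤ Z) (hΛ : Z < 2 ^ Λ)
    (hBZ : B + 3 ≤ Z) (hqp : q * p < 2 ^ w) (hZw : 16 * (Z * Z) + 100 < 2 ^ w) :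
    Ht w pm setupCm σ (8000 * (B / p + 3) + 30 * Λ + 200) (fun τ =>
      ∃ d r ρ M, Params (B / p + 3) Z Λ d r ρ M ∧ HasParams d r ρ M (q * p) τ) := by
  have hBp : B / p ≤ B := Nat.div_le_self _ _
  generalize hD : B / p + 3 = D
  have hD3 : 3 ≤ D := hD ▸ Nat.le_add_left 3 _
  have hDZ : D ≤ Z := hD ▸ (Nat.add_le_add_right hBp 3).trans hBZ
  have hDD : D * D ≤ Z * Z := Nat.mul_le_mul hDZ hDZ
  have hZZ : Z ≤ Z * Z := Nat.le_mul_of_pos_left Z hZ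
  refine Ht.seq_le 10 (7970 * D + 30 * Λ + 190) (R := fun τ => τ = σ.set vD D)
    (Ht.of_wp hw (by decide) (by simp [Cm.wp, h1, h2, hD]; omega)) (by omega) ?_
  rintro τ fτ rfl
  refine Ht.seq_le _ (7900 * D + 30 * Λ + 160) (sqrtCm_spec hw (D := D) (by simp) (by omega) (by omega)) (by omega) ?_
  intro a fa ⟨a1, a2⟩
  generalize hs : a.var vR = s at a1 a2
  have hs1 : 1 ≤ s := by
    by_contra h
    obtain rfl : s = 0 := by omega
    omega
  have hsD : s ≤ D := by nlinarith only [a1, hs1]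
  have hdd : (s + 1) * (s + 1) ≤ 4 * D := by nlinarith only [a1, hs1]
  refine Ht.seq_le 10 (7900 * D + 30 * Λ + 150) (R := fun τ => τ.var vd = s + 1 ∧ τ.var vR = 2 * (s + 1))
    (Ht.of_wp hw (by decide) (by simp [Cm.wp, hs]; omega)) (by omega) ?_
  intro b fb ⟨b1, b2⟩
  refine Ht.seq_le _ (30 * Λ + 50) (primeCm_spec hw b2 (by omega) (by omega))
    (by nlinarith only [hdd]) ?_
  intro c fc ⟨c1, c2, c3⟩
  generalize hρ : c.var vrho = ρ at c1 c2 c3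
  have k : ∀ x : Var, x ∉ (vD :: (sqrtCm.wv ++ [vd, vR] ++ primeCm.wv)) → c.var x = σ.var x := by
    intro x hx
    simp only [List.mem_cons, List.mem_append, not_or] at hx
    rw [fc.1 x (by tauto), fb.1 x (by simp [Cm.wv]; tauto), fa.1 x (by tauto)]
    simp [hx.1]
  have e1 : c.var vB = B := (k _ (by decide)).trans h1
  have e2 : c.var vp = p := (k _ (by decide)).trans h2
  have e3 : c.var vq = q := (k _ (by decide)).trans h3
  have e4 : c.var vZ = Z := (k _ (by decide)).trans h4
  have e5 : c.var vLam = Λ := (k _ (by decide)).trans h5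
  have e6 : c.var vd = s + 1 := (fc.1 _ (by decide)).trans b1
  refine Ht.seq_le 20 (Λ * (16 + 4) + 3) (R := fun τ => τ.var vr = ρ - 1 ∧ τ.var vM = 1 ∧ τ.var vI = q * p)
    (Ht.of_wp hw (by decide) (by simp [Cm.wp, hρ, e2, e3]; omega)) (by omega) ?_
  intro g fg ⟨g1, g2, g3⟩
  have g4 : g.var vZ = Z := (fg.1 _ (by decide)).trans e4
  have g5 : g.var vrho = ρ := (fg.1 _ (by decide)).trans hρ
  have g6 : g.var vd = s + 1 := (fg.1 _ (by decide)).trans e6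
  have hρ2 := c3.two_le
  have hρZ : ρ * Z < 2 ^ w := by
    have : ρ * Z ≤ (4 * (2 * D)) * Z := Nat.mul_le_mul_right _ (by omega)
    have h' : D * Z ≤ Z * Z := Nat.mul_le_mul_right _ hDZ
    rw [show 4 * (2 * D) * Z = 8 * (D * Z) by ring] at this
    omega
  refine (Ht.loop_le hw (fun z τ => ∃ e ≤ z, τ.var vM = ρ ^ e ∧ ρ ^ e ≤ ρ * Z ∧ (Z < ρ ^ e ∨ e = z)) 16
    ((fg.1 _ (by decide)).trans e5) le_rfl (by decide) (by decide) (by decide)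
    ⟨0, le_rfl, by simp [g2], by simp; nlinarith only [hρ2, hZ], .inr rfl⟩ ?_).mono le_rfl ?_
  · intro z hz τ hF hv ⟨e, k1, k2, k3, k4⟩
    have q1 : τ.var vZ = Z := (hF.1 _ (by decide)).trans g4
    have q2 : τ.var vrho = ρ := (hF.1 _ (by decide)).trans g5
    refine Ht.of_wp hw (by decide) ?_
    simp only [Cm.wp]
    simp [q1, q2, k2]
    refine ⟨fun c => ⟨e, by omega, rfl, k3, .inl c⟩, fun c => ?_⟩
    have : ρ ^ e * ρ ≤ ρ * Z := by rw [mul_comm]; exact Nat.mul_le_mul_left _ c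
    exact ⟨by omega, e + 1, by omega, by rw [pow_succ], by rw [pow_succ]; exact this, .inr (by omega)⟩
  · intro τ hF ⟨e, k1, k2, k3, k4⟩
    have hlt : Z < ρ ^ e := by
      rcases k4 with h | rfl
      · exact h
      · exact hΛ.trans_le (Nat.pow_le_pow_left hρ2 _)
    have he : 1 ≤ e := by
      by_contra h
      obtain rfl : e = 0 := by omega
      simp at hlt; omega
    refine ⟨s + 1, ρ - 1, ρ, ρ ^ e, ⟨c3, by omega, ⟨e, he, k1, rfl⟩, hlt, k3, by omega, hdd, by omega, by omega⟩, ?_⟩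
    exact ⟨(hF.1 _ (by decide)).trans g6, (hF.1 _ (by decide)).trans g1, (hF.1 _ (by decide)).trans g5, k2,
      (hF.1 _ (by decide)).trans g3⟩

/-- `val` becomes the power of `val` with exponent `vrho`, modulo `vM`. -/
def powRhoCm : Cm := (vx ≔ val ;; val ≔ 1) ;; .loop vz vrho (val ≔ val * vx % vM)

theorem powRhoCm_spec (hw : 1 ≤ w) {ρ M v : ℕ} (h1 : σ.var vrho = ρ) (h2 : σ.var vM = M) (h3 : σ.var val = v)
    (hM : 1 < M) (hMw : M * M < 2 ^ w) (hv : v < M) :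
    Ht w pm powRhoCm σ (12 * ρ + 10) (fun τ => τ.var val < M ∧ ((τ.var val : ℕ) : ZMod M) = (v : ZMod M) ^ ρ) := by
  have hone : 1 < 2 ^ w := Nat.one_lt_two_pow (by omega)
  refine Ht.seq_le 6 (ρ * (8 + 4) + 3) (R := fun τ => τ.var vx = v ∧ τ.var val = 1)
    (Ht.of_wp hw (by decide) (by simp [Cm.wp, h3]; omega)) (by omega) ?_
  intro a fa ⟨a1, a2⟩
  refine Ht.loop_le hw (fun z τ => τ.var val < M ∧ ((τ.var val : ℕ) : ZMod M) = (v : ZMod M) ^ z) 8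
    ((fa.1 _ (by decide)).trans h1) le_rfl (by decide) (by decide) (by decide) (by simp [a2, hM]) ?_
  intro z hz τ hF hvz ⟨k1, k2⟩
  have e1 : τ.var vx = v := (hF.1 _ (by decide)).trans a1
  have e2 : τ.var vM = M := (hF.1 _ (by decide)).trans ((fa.1 _ (by decide)).trans h2)
  have : τ.var val * v ≤ M * M := Nat.mul_le_mul k1.le hv.le
  refine Ht.of_wp hw (by decide) ?_
  simp only [Cm.wp]
  simp [e1, e2]
  exact ⟨by omega, Nat.mod_lt _ (by omega), by rw [k2, pow_succ]⟩

/-- The powers of the point `vy`. -/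
def pointCm : Cm :=
  (val ≔ vy + 1) ;; .loop vt vLam powRhoCm ;; (vx ≔ 1) ;;
  .loop vu vr (.sto aVd (vy * vr + vu) vx ;; .sto aG (vu * vr + vy) vx ;; vx ≔ vx * val % vM)

/-- The matrices of the powers of the points. -/
def pointsCm : Cm := .loop vy vr pointCm

/-- The cell is reduced and represents `v`. -/
def Reduced (M : ℕ) (c : ℕ) (v : ZMod M) : Prop := c < M ∧ (c : ZMod M) = v

/-- The point is obtained by raising y + 1 to the power ρ, Λ times. No generator of the units is
needed, because the power sums do not depend on the order of the points. -/
theorem pointCm_spec (hw : 1 ≤ w) {ρ M r Λ y : ℕ} (h1 : σ.var vrho = ρ) (h2 : σ.var vM = M) (h3 : σ.var vr = r)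
    (h4 : σ.var vLam = Λ) (h5 : σ.var vy = y) (hM : 1 < M) (hMw : M * M < 2 ^ w) (hrM : r < M) (hy : y < r)
    (hρr : ρ = r + 1) :
    Ht w pm pointCm σ (100 * (r * (Λ + 1))) (fun τ => 
      (∀ u < r, Reduced M (τ.arr aVd (y * r + u)) ((((y + 1 : ℕ) : ZMod M) ^ ρ ^ Λ) ^ u)) ∧
      (∀ u < r, Reduced M (τ.arr aG (u * r + y)) ((((y + 1 : ℕ) : ZMod M) ^ ρ ^ Λ) ^ u)) ∧
      (∀ j, (∀ u < r, j ≠ y * r + u) → τ.arr aVd j = σ.arr aVd j) ∧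
      (∀ j, (∀ u < r, j ≠ u * r + y) → τ.arr aG j = σ.arr aG j)) := by
  have hone : 1 < 2 ^ w := Nat.one_lt_two_pow (by omega)
  have hMM : M ≤ M * M := Nat.le_mul_of_pos_left M (by omega)
  have hrr : r * r ≤ M * M := Nat.mul_le_mul hrM.le hrM.le
  have hrΛ : 1 * Λ ≤ r * Λ := Nat.mul_le_mul_right _ (by omega)
  refine Ht.seq_le 10 (Λ * ((12 * ρ + 10) + 4) + 60 * r + 10) (R := fun τ => τ = σ.set val (y + 1))
    (Ht.of_wp hw (by decide) (by simp [Cm.wp, h5]; omega)) (by subst hρr; ring_nf at hrΛ ⊢; omega) ?_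
  rintro τ - rfl
  refine Ht.seq_le _ (60 * r + 7) (Ht.loop_le hw (fun z τ => Reduced M (τ.var val) (((y + 1 : ℕ) : ZMod M) ^ ρ ^ z))
    (12 * ρ + 10) (n := Λ) (by simp [h4]) le_rfl (by decide) (by decide) (by decide)
    (by simp [Reduced]; omega) ?_) (by omega) ?_
  · intro z hz τ hF hvz ⟨k1, k2⟩
    refine (powRhoCm_spec hw ((hF.1 _ (by decide)).trans (by simp [h1])) ((hF.1 _ (by decide)).trans (by simp [h2]))
      rfl hM hMw k1).mono le_rfl fun υ _ ⟨q1, q2⟩ => ⟨by simpa using q1, ?_⟩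
    simp only [St.set_var, reduceCtorEq, if_false]
    rw [q2, k2, pow_succ, pow_mul]
  intro a fa ⟨a1, a2⟩
  refine Ht.seq_le 4 (r * (30 + 4) + 3) (R := fun τ => τ = a.set vx 1)
    (Ht.of_wp hw (by decide) (by simp [Cm.wp]; omega)) (by omega) ?_
  rintro τ - rfl
  refine Ht.mono (Ht.loop_le hw (fun z τ =>
      Reduced M (τ.var vx) ((((y + 1 : ℕ) : ZMod M) ^ ρ ^ Λ) ^ z) ∧
      (∀ u < z, Reduced M (τ.arr aVd (y * r + u)) ((((y + 1 : ℕ) : ZMod M) ^ ρ ^ Λ) ^ u)) ∧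
      (∀ u < z, Reduced M (τ.arr aG (u * r + y)) ((((y + 1 : ℕ) : ZMod M) ^ ρ ^ Λ) ^ u)) ∧
      (∀ j, (∀ u < r, j ≠ y * r + u) → τ.arr aVd j = σ.arr aVd j) ∧
      (∀ j, (∀ u < r, j ≠ u * r + y) → τ.arr aG j = σ.arr aG j)) 30 (n := r)
    ((fa.1 _ (by decide)).trans (by simp [h3])) le_rfl (by decide) (by decide) (by decide) ?_ ?_) le_rfl
      fun τ _ h => h.2
  · refine ⟨by simp [Reduced, hM], by simp, by simp, fun j _ => ?_, fun j _ => ?_⟩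
    · rw [St.set_arr, St.set_arr, fa.2 aVd (by decide)]; rfl
    · rw [St.set_arr, St.set_arr, fa.2 aG (by decide)]; rfl
  · intro z hz τ hF hvz ⟨k1, k2, k3, k4, k5⟩
    have e1 : τ.var val = a.var val := (hF.1 _ (by decide)).trans (by simp)
    have e2 : τ.var vM = M := (hF.1 _ (by decide)).trans ((fa.1 _ (by decide)).trans (by simp [h2]))
    have e3 : τ.var vr = r := (hF.1 _ (by decide)).trans ((fa.1 _ (by decide)).trans (by simp [h3]))
    have e4 : τ.var vy = y := (hF.1 _ (by decide)).trans ((fa.1 _ (by decide)).trans (by simp [h5]))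
    have hm : τ.var vx * a.var val ≤ M * M := Nat.mul_le_mul k1.1.le a1.le
    have hyr : (y + 1) * r ≤ r * r := Nat.mul_le_mul_right _ hy
    have hzr : (z + 1) * r ≤ r * r := Nat.mul_le_mul_right _ hz
    rw [Nat.succ_mul] at hyr hzr
    refine Ht.of_wp hw (by decide) ?_
    simp only [Cm.wp]
    simp [e1, e2, e3, e4, hvz]
    refine ⟨by omega, by omega, by omega, by omega, by omega, ?_, ?_, ?_, ?_, ?_⟩
    · refine ⟨Nat.mod_lt _ (by omega), ?_⟩
      rw [pow_succ (n := z), ZMod.natCast_mod, Nat.cast_mul, k1.2, a2]; simp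
    · intro u hu
      split_ifs with c
      · subst c; simpa using k1
      · simpa using k2 u (by omega)
    · intro u hu
      split_ifs with c
      · have : u = z := by
          rcases c with c | c
          · exact c
          · omega
        subst this; simpa using k1
      · simpa using k3 u (by omega)
    · intro j hj
      rw [if_neg (hj z hz)]; exact k4 j hj
    · intro j hj
      rw [if_neg (hj z hz)]; exact k5 j hj

theorem pointsCm_spec (hw : 1 ≤ w) {ρ M r Λ : ℕ} (h1 : σ.var vrho = ρ) (h2 : σ.var vM = M) (h3 : σ.var vr = r)
    (h4 : σ.var vLam = Λ) (hM : 1 < M) (hMw : M * M < 2 ^ w) (hrM : r < M) (hρr : ρ = r + 1) :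
    Ht w pm pointsCm σ (104 * (r * r * (Λ + 1)) + 3) (fun τ => ∀ y < r, ∀ u < r,
      Reduced M (τ.arr aVd (y * r + u)) ((((y + 1 : ℕ) : ZMod M) ^ ρ ^ Λ) ^ u) ∧
      Reduced M (τ.arr aG (u * r + y)) ((((y + 1 : ℕ) : ZMod M) ^ ρ ^ Λ) ^ u)) := by
  refine Ht.loop_le hw (fun z τ => ∀ y < z, ∀ u < r,
      Reduced M (τ.arr aVd (y * r + u)) ((((y + 1 : ℕ) : ZMod M) ^ ρ ^ Λ) ^ u) ∧
      Reduced M (τ.arr aG (u * r + y)) ((((y + 1 : ℕ) : ZMod M) ^ ρ ^ Λ) ^ u)) (100 * (r * (Λ + 1))) h3 ?_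
    (by decide) (by decide) (by decide) (by simp) ?_
  · rcases Nat.eq_zero_or_pos r with rfl | hr
    · simp
    · have : r ≤ r * r := Nat.le_mul_of_pos_left r hr
      have h5 : 0 ≤ r * r * Λ := Nat.zero_le _
      ring_nf at this h5 ⊢; omega
  intro y hy τ hF hvy hI
  refine (pointCm_spec hw ((hF.1 _ (by decide)).trans h1) ((hF.1 _ (by decide)).trans h2)
    ((hF.1 _ (by decide)).trans h3) ((hF.1 _ (by decide)).trans h4) hvy hM hMw hrM hy hρr).mono le_rfl ?_
  intro υ _ ⟨k1, k2, k3, k4⟩ y' hy' u hu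
  simp only [St.set_arr]
  rcases Nat.lt_succ_iff_lt_or_eq.1 hy' with h | rfl
  · rw [k3 _ fun u' hu' e => by have := mul_add_inj hu hu' e; omega,
      k4 _ fun u' hu' e => by have := mul_add_inj (h.trans hy) hy e; omega]
    exact hI y' h u hu
  · exact ⟨k1 u hu, k2 u hu⟩

end

/-! ## Large groups: the tables -/

/-- The sizes in the treatment of a large group. -/
structure FastNum (w B m L g p q n Z Λ d r ρ M : ℕ) : Prop where
  hw : 1 ≤ w
  par : Params (B / p + 3) Z Λ d r ρ M
  p_pos : 1 ≤ p
  small : 9 * p ≤ 2 * L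
  p_lt : p < q
  mul : B * q ≤ m
  mZ : 8 * m ≤ Z
  qZ : q < Z
  nZ : n < Z
  gZ : g < Z
  five : 5 ≤ L
  Lm : L ≤ m
  hB : B = L / 9 + 1
  word : Z ^ 6 ≤ 2 ^ w

namespace FastNum
variable {w B m L g p q n Z Λ d r ρ M : ℕ}

theorem p_le (h : FastNum w B m L g p q n Z Λ d r ρ M) : p ≤ 2 * B := by have := h.small; have := h.hB; omega
theorem B_pos (h : FastNum w B m L g p q n Z Λ d r ρ M) : 1 ≤ B := by have := h.hB; omega
theorem B_le (h : FastNum w B m L g p q n Z Λ d r ρ M) : B ≤ m := (Nat.le_mul_of_pos_right B (by have := h.p_lt; omega)).trans h.mul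
theorem q_le (h : FastNum w B m L g p q n Z Λ d r ρ M) : q ≤ m := (Nat.le_mul_of_pos_left q h.B_pos).trans h.mul
theorem Z_ge (h : FastNum w B m L g p q n Z Λ d r ρ M) : 40 ≤ Z := by have := h.mZ; have := h.five; have := h.Lm; omega
theorem word_sq (h : FastNum w B m L g p q n Z Λ d r ρ M) : 1000 * (Z * Z) + 1000 * Z + 1000 < 2 ^ w := by
  have h1 := h.Z_ge
  have h2 : 40 ^ 4 * (Z * Z) ≤ Z ^ 6 := by
    rw [show Z ^ 6 = Z ^ 4 * (Z * Z) by ring]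
    exact Nat.mul_le_mul_right _ (Nat.pow_le_pow_left h1 _)
  have h3 : 40 * Z ≤ Z * Z := Nat.mul_le_mul_right _ h1
  have := h.word
  omega
-- p ≤ 2B turns the three spare rows into at most 6B cells. The size bounds O(B) for r² p and O(Bq)
-- for r² pq rest on this.
theorem D_mul (h : FastNum w B m L g p q n Z Λ d r ρ M) : (B / p + 3) * p ≤ 7 * B := by
  have h1 := Nat.div_mul_le_self B p
  have h2 := h.p_le
  rw [Nat.add_mul]; omega
theorem d_pos (h : FastNum w B m L g p q n Z Λ d r ρ M) : 1 ≤ d := by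
  have h1 := h.par.d_ge
  by_contra h2
  obtain rfl : d = 0 := by omega
  simp at h1
theorem d_le (h : FastNum w B m L g p q n Z Λ d r ρ M) : d ≤ B / p + 3 := by
  have h1 := h.par.d_le
  have h2 := Nat.le_add_left 3 (B / p)
  generalize B / p + 3 = D at *
  by_contra h3
  have : (D + 1) * (D + 1) ≤ d * d := Nat.mul_le_mul (by omega) (by omega)
  nlinarith only [this, h1, h2]
theorem B_lt (h : FastNum w B m L g p q n Z Λ d r ρ M) : 2 * B ≤ m := by
  have h1 : B * 2 ≤ B * q := Nat.mul_le_mul_left _ (by have := h.p_lt; have := h.p_pos; omega)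
  have := h.mul; omega
theorem rho_le (h : FastNum w B m L g p q n Z Λ d r ρ M) : ρ ≤ 8 * m := by
  have h1 := h.d_le
  have h2 : B / p + 3 ≤ B + 3 := Nat.add_le_add_right (Nat.div_le_self _ _) 3
  have h3 := h.par.r_le
  have h4 := h.par.rho
  have := h.B_lt; have := h.five; have := h.Lm
  omega
theorem r_le (h : FastNum w B m L g p q n Z Λ d r ρ M) : r ≤ 8 * m := by have := h.rho_le; have := h.par.rho; omega
theorem r_pos (h : FastNum w B m L g p q n Z Λ d r ρ M) : 2 ≤ r := by have := h.d_pos; have := h.par.r_ge; omega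
theorem rr_le (h : FastNum w B m L g p q n Z Λ d r ρ M) : r * r ≤ 64 * (B / p + 3) := by
  have h1 := h.par.r_le
  have h2 := h.par.d_le
  have : r * r ≤ (4 * d) * (4 * d) := Nat.mul_le_mul h1 h1
  rw [show 4 * d * (4 * d) = 16 * (d * d) by ring] at this
  omega
theorem rrp_le (h : FastNum w B m L g p q n Z Λ d r ρ M) : r * r * p ≤ 448 * B := by
  have h1 := Nat.mul_le_mul_right p h.rr_le
  have h2 := h.D_mul
  rw [mul_assoc 64] at h1
  omega
theorem rrI_le (h : FastNum w B m L g p q n Z Λ d r ρ M) : r * r * (q * p) ≤ 448 * (B * q) := by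
  have := Nat.mul_le_mul_right q h.rrp_le
  calc r * r * (q * p) = r * r * p * q := by ring
    _ ≤ _ := this
    _ = _ := by ring
-- This is where p < q matters: the matrices of the strings at all r² pairs of points fit into space
-- O(Bq).
theorem rrpp_le (h : FastNum w B m L g p q n Z Λ d r ρ M) : r * r * (p * p) ≤ 448 * (B * q) := by
  have h1 := Nat.mul_le_mul h.rrp_le h.p_lt.le
  calc r * r * (p * p) = r * r * p * p := by ring
    _ ≤ _ := h1
    _ = _ := by ring
theorem M_gt (h : FastNum w B m L g p q n Z Λ d r ρ M) : 1 < M := by have := h.par.lt; have := h.Z_ge; omega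
theorem M_le (h : FastNum w B m L g p q n Z Λ d r ρ M) : M ≤ Z * Z :=
  h.par.le.trans (Nat.mul_le_mul_right _ (h.rho_le.trans h.mZ))
theorem r_lt (h : FastNum w B m L g p q n Z Λ d r ρ M) : r < M := by have := h.par.lt; have := h.r_le; have := h.mZ; omega
-- Of the six factors Z in the word bound, one pays for the order of a matrix, two for each entry (M
-- ≤ Z²), and one is spare.
theorem MM_lt (h : FastNum w B m L g p q n Z Λ d r ρ M) : 2 * (M * M) < 2 ^ w ∧
    r * ((Z * Z) * (Z * Z)) < 2 ^ w ∧ p * ((Z * Z) * (Z * Z)) < 2 ^ w := by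
  have h1 : M * M ≤ (Z * Z) * (Z * Z) := Nat.mul_le_mul h.M_le h.M_le
  have key : ∀ x < Z, x * ((Z * Z) * (Z * Z)) < 2 ^ w := by
    intro x hx
    have h2 : x * ((Z * Z) * (Z * Z)) ≤ Z * ((Z * Z) * (Z * Z)) := Nat.mul_le_mul_right _ hx.le
    have h3 : Z * ((Z * Z) * (Z * Z)) * 2 ≤ Z * ((Z * Z) * (Z * Z)) * Z := Nat.mul_le_mul_left _ (by have := h.Z_ge; omega)
    have h4 : Z * ((Z * Z) * (Z * Z)) * Z = Z ^ 6 := by ring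
    have h5 : 0 < Z * ((Z * Z) * (Z * Z)) := by have := h.Z_ge; positivity
    have := h.word
    omega
  have h6 := h.Z_ge; have h7 := h.qZ; have h8 := h.p_lt
  have hrZ : r < Z := by have := h.rho_le; have := h.mZ; have := h.par.rho; omega
  exact ⟨(Nat.mul_le_mul_left 2 h1).trans_lt (key _ (by omega)), key _ hrZ, key _ (by omega)⟩
-- r = ρ - 1 is prime to every power of ρ, so the scale r² of the transforms is invertible modulo M.
theorem coprime (h : FastNum w B m L g p q n Z Λ d r ρ M) : Nat.Coprime r M := by
  obtain ⟨e, -, -, he⟩ := h.par.pow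
  rw [he]
  refine Nat.Coprime.pow_right _ ?_
  rw [h.par.rho]
  simp

end FastNum

/-- The variables of the context of a large group. -/
def fastVars : List Var := [vB, vL, vg, vp, vq, vng, vZ, vLam, vd, vr, vrho, vM, vI]
/-- The arrays of the context of a large group. -/
def fastArrs : List Arr := [aU, aGp, aQ, aNS, aBst, aBdel, aBlo, aBhi, aSal, aSlen]

/-- The context of a large group: the tables are those of `σ`. -/
structure FastCtx (σ : St) (B L g p q n Z Λ d r ρ M : ℕ) (τ : St) : Prop where
  vB : τ.var vB = B
  vL : τ.var vL = L
  vg : τ.var vg = g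
  vp : τ.var vp = p
  vq : τ.var vq = q
  vng : τ.var vng = n
  vZ : τ.var vZ = Z
  vLam : τ.var vLam = Λ
  vd : τ.var vd = d
  vr : τ.var vr = r
  vrho : τ.var vrho = ρ
  vM : τ.var vM = M
  vI : τ.var vI = q * p
  arr : ∀ A ∈ fastArrs, τ.arr A = σ.arr A
  z : σ.var Var.vZ = Z
  q_eq : σ.arr aQ g = q
  n_eq : σ.arr aNS g = n
  p_eq : σ.arr aGp g = p

theorem FastCtx.keep {σ : St} {B L g p q n Z Λ d r ρ M : ℕ} {τ υ : St}
    (h : FastCtx σ B L g p q n Z Λ d r ρ M τ) {c : Cm} (f : Fr c τ υ) (hv : ∀ x ∈ fastVars, x ∉ c.wv)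
    (ha : ∀ A ∈ fastArrs, A ∉ c.wa) : FastCtx σ B L g p q n Z Λ d r ρ M υ := by
  have k : ∀ x ∈ fastVars, υ.var x = τ.var x := fun x hx => f.1 x (hv x hx)
  exact ⟨(k _ (by decide)).trans h.vB, (k _ (by decide)).trans h.vL, (k _ (by decide)).trans h.vg,
    (k _ (by decide)).trans h.vp, (k _ (by decide)).trans h.vq, (k _ (by decide)).trans h.vng,
    (k _ (by decide)).trans h.vZ, (k _ (by decide)).trans h.vLam, (k _ (by decide)).trans h.vd,
    (k _ (by decide)).trans h.vr, (k _ (by decide)).trans h.vrho, (k _ (by decide)).trans h.vM,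
    (k _ (by decide)).trans h.vI, fun A hA => (f.2 A (ha A hA)).trans (h.arr A hA), h.z, h.q_eq, h.n_eq, h.p_eq⟩

/-- The row of the slot `β` contains an active prefix at `y`. -/
def Row (B : ℕ) (σ : St) (g β y : ℕ) : Prop :=
  σ.arr aBdel (g * σ.var vZ + β) ≤ y ∧ y - σ.arr aBdel (g * σ.var vZ + β) < B ∧
  σ.arr aBlo (g * σ.var vZ + β) ≤ σ.arr aBst (g * σ.var vZ + β) + (y - σ.arr aBdel (g * σ.var vZ + β)) ∧
  1 ≤ σ.arr aBst (g * σ.var vZ + β) + (y - σ.arr aBdel (g * σ.var vZ + β)) ∧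
  σ.arr aU (σ.arr aBst (g * σ.var vZ + β) + (y - σ.arr aBdel (g * σ.var vZ + β)) - 1) ≠ 0

/-- Set the first `vlim` cells of `A` to zero. -/
def zeroCm (A : Arr) : Cm := .loop vt vlim (.sto A vt 0)

theorem zeroCm_spec {w : ℕ} {pm : Prog} (hw : 1 ≤ w) {σ : St} (A : Arr) {n : ℕ} (hn : σ.var vlim = n)
    (hnw : n < 2 ^ w) : Ht w pm (zeroCm A) σ (7 * n + 3) (fun τ => ∀ j < n, τ.arr A j = 0) := by
  refine Ht.loop_le hw (fun z τ => ∀ j < z, τ.arr A j = 0) 3 hn (by omega) (by decide) (by simp [Cm.wv])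
    (by simp [Cm.wv]) (by simp) ?_
  intro z hz τ hF hv hI
  refine Ht.of_wp hw (Nat.le_of_ble_eq_true rfl) ?_
  simp [Cm.wp, hv]
  refine ⟨by omega, fun j hj => ?_⟩
  by_cases c : j = z
  · simp [c]
  · simpa [c] using hI j (by omega)

/-- Enter the cell of the row of the slot `vbeta` that belongs to the position `vs + vb`. -/
def rowCellCm : Cm :=
  va ≔ vs + vb ;; .ite (.ltv va vlo) .skip (.ite va (.ite (.ld aU (va - 1))
    (vy ≔ vdel + vb ;; vt ≔ vy / vp ;;
      .sto aX (((vt % vd) * vr + vt / vd) * vI + (vbeta * vp + vy % vp)) 1) .skip) .skip)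

/-- Enter the rows of all slots. -/
def fillRowsCm : Cm :=
  (vlim ≔ vr * vr * vI) ;; zeroCm aX ;; .loop vbeta vq
    ((vsl ≔ vg * vZ + vbeta ;; vs ≔ .ld aBst vsl ;; vdel ≔ .ld aBdel vsl ;; vlo ≔ .ld aBlo vsl) ;;
      .loop vb vB rowCellCm)

section
variable {w : ℕ} {pm : Prog} {σ τ : St} {B m L g p q n Z Λ d r ρ M : ℕ}

theorem digits_lt (h : FastNum w B m L g p q n Z Λ d r ρ M) {t : ℕ} (ht : t < B / p + 3) :
    t % d < d ∧ t / d < d :=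
  ⟨Nat.mod_lt _ h.d_pos, by rw [Nat.div_lt_iff_lt_mul h.d_pos]; exact ht.trans_le h.par.d_ge⟩

theorem row_div_lt (h : FastNum w B m L g p q n Z Λ d r ρ M) {y δ : ℕ} (hδ : δ < p) (hy : y < δ + B) :
    y / p < B / p + 3 := by
  have h1 : y / p ≤ (B + p) / p := Nat.div_le_div_right (by omega)
  rw [Nat.add_div_right _ h.p_pos] at h1
  omega

theorem cell_lt {r I t1 t2 x : ℕ} (h1 : t1 < r) (h2 : t2 < r) (hx : x < I) :
    (t1 * r + t2) * I + x < r * r * I := by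
  have : (t1 * r + t2 + 1) * I ≤ r * r * I := Nat.mul_le_mul_right _ (by
    have : (t1 + 1) * r ≤ r * r := Nat.mul_le_mul_right _ h1
    rw [Nat.succ_mul] at this; omega)
  rw [Nat.succ_mul] at this
  omega

theorem pair_lt {p q β a : ℕ} (hβ : β < q) (ha : a < p) : β * p + a < q * p := by
  have : (β + 1) * p ≤ q * p := Nat.mul_le_mul_right _ hβ
  rw [Nat.succ_mul] at this; omega

theorem rowCellCm_spec (h : FastNum w B m L g p q n Z Λ d r ρ M) (hc : FastCtx σ B L g p q n Z Λ d r ρ M τ)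
    {β b s δ lo : ℕ} (h1 : τ.var vbeta = β) (h2 : τ.var vb = b) (h3 : τ.var vs = s) (h4 : τ.var vdel = δ)
    (h5 : τ.var vlo = lo) (hβ : β < q) (hb : b < B) (hs : s ≤ m) (hδ : δ < p) :
    Ht w pm rowCellCm τ 60 (fun υ => Marked aX τ υ fun j => lo ≤ s + b ∧ 1 ≤ s + b ∧ σ.arr aU (s + b - 1) ≠ 0 ∧
      j = ((δ + b) / p % d * r + (δ + b) / p / d) * (q * p) + (β * p + (δ + b) % p)) := by
  have hU := hc.arr aU (by decide)
  have hset : ∀ {a : ℕ} {P : ℕ → Prop}, (∀ j, ¬ P j) → Marked aX τ (τ.set va a) P := fun h =>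
    Marked.of_eq rfl h
  have hW := h.word_sq
  have := h.B_le; have := h.mZ; have := h.q_le; have := h.p_lt
  have hp := h.p_pos
  have hy : (δ + b) % p < p := Nat.mod_lt _ hp
  obtain ⟨e1, e2⟩ := digits_lt h (row_div_lt h hδ (y := δ + b) (by omega))
  have hr := h.par.r_ge
  have hdp := h.d_pos
  have c1 := cell_lt (r := r) (I := q * p) (t1 := (δ + b) / p % d) (t2 := (δ + b) / p / d) (by omega) (by omega) (pair_lt hβ hy)
  have c2 := h.rrI_le
  have c3 := h.mul
  have c4 : (δ + b) / p % d * r ≤ ((δ + b) / p % d * r + (δ + b) / p / d) * (q * p) :=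
    (Nat.le_add_right _ _).trans (Nat.le_mul_of_pos_right _ (Nat.mul_pos (by omega) hp))
  have c5 : (δ + b) / p / d ≤ ((δ + b) / p % d * r + (δ + b) / p / d) * (q * p) :=
    (Nat.le_add_left _ _).trans (Nat.le_mul_of_pos_right _ (Nat.mul_pos (by omega) hp))
  have c7 : (δ + b) / p % d * r + (δ + b) / p / d ≤ ((δ + b) / p % d * r + (δ + b) / p / d) * (q * p) :=
    Nat.le_mul_of_pos_right _ (Nat.mul_pos (by omega) hp)
  have c6 : β * p ≤ q * p := Nat.mul_le_mul_right _ hβ.le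
  have hone : 1 < 2 ^ w := by omega
  refine Ht.of_wp h.hw (by decide) ?_
  simp only [Cm.wp, rowCellCm]
  simp [h1, h2, h3, h4, h5, hU, hc.vp, hc.vd, hc.vr, hc.vI]
  generalize (δ + b) / p % d = t1 at *
  generalize (δ + b) / p / d = t2 at *
  generalize (δ + b) % p = y at *
  generalize hx : (t1 * r + t2) * (q * p) = X at *
  refine ⟨by omega, fun c => hset fun j hj => by omega, fun k1 => ⟨fun k2 => ?_, fun _ _ => hset fun j hj => by omega⟩⟩
  have hw0 := h.hw
  have k2' : 1 ≤ s + b := Nat.pos_of_ne_zero fun hh => k2 (by omega) (by omega)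
  refine ⟨⟨by omega, by omega⟩, fun k3 => ⟨by omega, by omega, by omega, by omega, ?_⟩, fun k3 => hset fun j hj => hj.2.2.1 k3⟩
  intro j
  constructor
  · rintro ⟨-, -, -, h⟩; simp [h]
  · intro h
    simp
    rintro rfl
    exact absurd ⟨k1, by omega, k3, rfl⟩ h

/-- An address decodes uniquely into both digits of the row, the block and the column, so marks of
different positions cannot be confused. Digits in [d, r) stay zero; this padding is what keeps the
convolution from wrapping around. -/
theorem fillRowsCm_spec (h : FastNum w B m L g p q n Z Λ d r ρ M) (hc : FastCtx σ B L g p q n Z Λ d r ρ M τ)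
    (hok : GroupOk m L σ g) :
    Ht w pm fillRowsCm τ (8000 * (B * q)) (fun υ => ∀ t1 < r, ∀ t2 < r, ∀ β < q, ∀ a < p,
      υ.arr aX ((t1 * r + t2) * (q * p) + (β * p + a)) =
        truth (t1 < d ∧ t2 < d ∧ Row B σ g β (p * (t1 + d * t2) + a))) := by
  have hw := h.hw
  have hW := h.word_sq
  have hsz := h.rrI_le
  have hmul := h.mul
  have hmZ := h.mZ
  have hBq : 1 * q ≤ B * q := Nat.mul_le_mul_right _ h.B_pos
  have hq1 := h.p_lt
  have hp := h.p_pos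
  have hZZ : Z ≤ Z * Z := Nat.le_mul_of_pos_left Z (by have := h.Z_ge; omega)
  have hrr : r * r ≤ r * r * (q * p) := Nat.le_mul_of_pos_right _ (Nat.mul_pos (by omega) hp)
  refine Ht.seq_le 6 (4000 * (B * q)) (R := fun υ => υ = τ.set vlim (r * r * (q * p)))
    (Ht.of_wp hw (by decide) (by simp [Cm.wp, hc.vr, hc.vI]; clear * - hW hsz hmul hmZ hrr hZZ; omega))
    (by clear * - hBq hq1; omega) ?_
  rintro α fα hα
  have ca := hc.keep fα (by decide) (by decide)
  refine Ht.seq_le _ (q * ((B * 64 + 30) + 4) + 3) (zeroCm_spec hw aX (n := r * r * (q * p)) (by simp [hα])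
    (by clear * - hW hsz hmul hmZ hZZ; omega)) (by ring_nf at hsz hBq ⊢; omega) ?_
  intro β fβ hβ
  have cb := ca.keep fβ (by decide) (by decide)
  refine Ht.mono (Ht.loop_marked (A := aX) hw (fun β j => ∃ b < B,
    σ.arr aBlo (g * Z + β) ≤ σ.arr aBst (g * Z + β) + b ∧ 1 ≤ σ.arr aBst (g * Z + β) + b ∧
      σ.arr aU (σ.arr aBst (g * Z + β) + b - 1) ≠ 0 ∧
      j = ((σ.arr aBdel (g * Z + β) + b) / p % d * r + (σ.arr aBdel (g * Z + β) + b) / p / d) * (q * p) +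
        (β * p + (σ.arr aBdel (g * Z + β) + b) % p)) (B * 64 + 30) cb.vq le_rfl (by decide) (by decide) (by decide) ?_)
    le_rfl ?_
  · intro b hb γ fγ hvb
    have cg := cb.keep fγ (by decide) (by decide)
    have hgZ : g * Z ≤ Z * Z := Nat.mul_le_mul_right _ h.gZ.le
    have hqZ := h.qZ
    have k1 := hok.st b (by rw [hc.q_eq]; exact hb)
    have k2 := hok.del b (by rw [hc.q_eq]; exact hb)
    rw [hc.z] at k1 k2
    rw [hc.p_eq] at k2
    refine Ht.seq_le 20 (B * 64 + 3) (R := fun υ => υ.var vs = σ.arr aBst (g * Z + b) ∧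
      υ.var vdel = σ.arr aBdel (g * Z + b) ∧ υ.var vlo = σ.arr aBlo (g * Z + b) ∧ υ.arr aX = γ.arr aX)
      (Ht.of_wp hw (by decide) (by
        simp [Cm.wp, cg.vg, cg.vZ, hvb, cg.arr aBst (by decide), cg.arr aBdel (by decide), cg.arr aBlo (by decide)]
        clear * - hW hgZ hqZ hb hZZ; omega)) (by clear * -; omega) ?_
    intro δ fδ ⟨d1, d2, d3, d4⟩
    have cd := cg.keep fδ (by decide) (by decide)
    have d5 : δ.var vbeta = b := (fδ.1 _ (by decide)).trans hvb
    refine Ht.mono (Ht.loop_marked (A := aX) hw (fun x j => 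
      σ.arr aBlo (g * Z + b) ≤ σ.arr aBst (g * Z + b) + x ∧ 1 ≤ σ.arr aBst (g * Z + b) + x ∧
      σ.arr aU (σ.arr aBst (g * Z + b) + x - 1) ≠ 0 ∧
      j = ((σ.arr aBdel (g * Z + b) + x) / p % d * r + (σ.arr aBdel (g * Z + b) + x) / p / d) * (q * p) +
        (b * p + (σ.arr aBdel (g * Z + b) + x) % p)) 60 cd.vB le_rfl (by decide) (by decide) (by decide) ?_) le_rfl
      fun υ _ h => Marked.trans (Marked.of_eq d4 (P := fun _ => False) (by simp)) h (by simp)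
    intro x hx ε fε hvx
    have ce := cd.keep fε (by decide) (by decide)
    exact rowCellCm_spec h ce ((fε.1 _ (by decide)).trans d5) hvx ((fε.1 _ (by decide)).trans d1)
      ((fε.1 _ (by decide)).trans d2) ((fε.1 _ (by decide)).trans d3) hb hx (by omega) k2
  · intro υ _ hυ t1 ht1 t2 ht2 b hb a ha
    have k2 := hok.del b (by rw [hc.q_eq]; exact hb)
    rw [hc.z, hc.p_eq] at k2
    obtain ⟨m1, m2⟩ := hυ ((t1 * r + t2) * (q * p) + (b * p + a))
    have key : (t1 < d ∧ t2 < d ∧ Row B σ g b (p * (t1 + d * t2) + a)) ↔ ∃ β < q, ∃ b' < B,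
      σ.arr aBlo (g * Z + β) ≤ σ.arr aBst (g * Z + β) + b' ∧ 1 ≤ σ.arr aBst (g * Z + β) + b' ∧
      σ.arr aU (σ.arr aBst (g * Z + β) + b' - 1) ≠ 0 ∧
      (t1 * r + t2) * (q * p) + (b * p + a) =
      ((σ.arr aBdel (g * Z + β) + b') / p % d * r + (σ.arr aBdel (g * Z + β) + b') / p / d) * (q * p) +
        (β * p + (σ.arr aBdel (g * Z + β) + b') % p) := by
      unfold Row
      rw [hc.z]
      constructor
      · rintro ⟨l1, l2, l3, l4, l5, l6, l7⟩
        refine ⟨b, hb, p * (t1 + d * t2) + a - σ.arr aBdel (g * Z + b), l4, l5, l6, l7, ?_⟩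
        rw [Nat.add_sub_cancel' l3, Nat.mul_add_div hp, Nat.div_eq_of_lt ha, Nat.mul_add_mod, Nat.mod_eq_of_lt ha,
          Nat.add_zero, Nat.add_mul_mod_self_left, Nat.mod_eq_of_lt l1, Nat.add_mul_div_left _ _ h.d_pos,
          Nat.div_eq_of_lt l1, Nat.zero_add]
      · rintro ⟨β', hβ', b', hb', l4, l5, l6, l7⟩
        have k3 := hok.del β' (by rw [hc.q_eq]; exact hβ')
        rw [hc.z, hc.p_eq] at k3
        obtain ⟨e1, e2⟩ := digits_lt h (row_div_lt h k3 (y := σ.arr aBdel (g * Z + β') + b') (by omega))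
        have hm := Nat.mod_lt (σ.arr aBdel (g * Z + β') + b') hp
        have hr := h.par.r_ge
        obtain ⟨i1, i2⟩ := mul_add_inj (pair_lt hb ha) (pair_lt hβ' hm) l7
        obtain ⟨rfl, i3⟩ := mul_add_inj ha hm i2
        obtain ⟨i4, i5⟩ := mul_add_inj ht2 (by omega) i1
        have hdiv : p * (t1 + d * t2) + a = σ.arr aBdel (g * Z + b) + b' := by
          rw [i3, i4, i5, Nat.mod_add_div, Nat.div_add_mod]
        rw [hdiv, Nat.add_sub_cancel_left]
        exact ⟨by omega, by omega, by omega, hb', l4, l5, l6⟩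
    unfold truth
    split_ifs with hP
    · exact m1 (key.1 hP)
    · rw [m2 fun h => hP (key.2 h)]
      exact hβ _ (cell_lt ht1 ht2 (pair_lt hb ha))

end

/-! ## Large groups: the matrices of the strings -/

/-- The number of the row of the end of the slot `η`, relative to the row of `L`. -/
def endRow (σ : St) (p L g η : ℕ) : ℕ :=
  (σ.arr aSal (g * σ.var vZ + η) + σ.arr aSlen (g * σ.var vZ + η)) / p - L / p

/-- The column of the end of the slot `η`. -/
def endCol (σ : St) (p g η : ℕ) : ℕ :=
  (σ.arr aSal (g * σ.var vZ + η) + σ.arr aSlen (g * σ.var vZ + η)) % p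

/-- The entry of the matrix of the first `n` strings, evaluated at two points. -/
noncomputable def strEntry {M : ℕ} (pt : ℕ → ZMod M) (σ : St) (p L g d n y1 y2 e a : ℕ) : ZMod M :=
  ∑ η ∈ Finset.range n, if endCol σ p g η = e ∧ σ.arr aSal (g * σ.var vZ + η) = a then
    pt y1 ^ (endRow σ p L g η % d) * pt y2 ^ (endRow σ p L g η / d) else 0

/-- Add the monomial of one string to the matrices. -/
def addStrCm : Cm :=
  .loop vx1 vr (.loop vx2 vr (vt ≔ (vx1 * vr + vx2) * vpp + (ve * vp + va) ;;
    .sto aK vt ((.ld aK vt + .ld aVd (vx1 * vr + vu1) * .ld aVd (vx2 * vr + vu2)) % vM)))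

/-- The matrices of the strings, evaluated at all pairs of points. -/
def fillStrCm : Cm :=
  (vpp ≔ vp * vp ;; vlim ≔ vr * vr * vpp) ;; zeroCm aK ;; .loop veta vng
    ((vsk ≔ vg * vZ + veta ;; va ≔ .ld aSal vsk ;; vlen ≔ .ld aSlen vsk ;; vt ≔ va + vlen ;;
      ve ≔ vt % vp ;; vu ≔ vt / vp - vL / vp ;; vu1 ≔ vu % vd ;; vu2 ≔ vu / vd) ;; addStrCm)

section
variable {w : ℕ} {pm : Prog} {σ τ : St} {B m L g p q n Z Λ d r ρ M : ℕ}

/-- A string is a single monomial in one entry (e, a). Adding its values at all pairs of points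
takes O(r²) = O(B) time, which amounts to O(nB) for the group. -/
theorem addStrCm_spec (h : FastNum w B m L g p q n Z Λ d r ρ M) (hc : FastCtx σ B L g p q n Z Λ d r ρ M τ)
    {pt : ℕ → ZMod M} {f : ℕ → ℕ → ℕ → ℕ → ZMod M} {e0 a0 u1 u2 : ℕ}
    (hV : ∀ y < r, ∀ u < r, Reduced M (τ.arr aVd (y * r + u)) (pt y ^ u))
    (hpp : τ.var vpp = p * p) (h1 : τ.var ve = e0) (h2 : τ.var va = a0) (h3 : τ.var vu1 = u1)
    (h4 : τ.var vu2 = u2) (he : e0 < p) (ha : a0 < p) (hu1 : u1 < r) (hu2 : u2 < r)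
    (hf : ∀ y1 < r, ∀ y2 < r, ∀ e < p, ∀ a < p,
      Reduced M (τ.arr aK ((y1 * r + y2) * (p * p) + (e * p + a))) (f y1 y2 e a)) :
    Ht w pm addStrCm τ (70 * (r * r)) (fun υ => ∀ y1 < r, ∀ y2 < r, ∀ e < p, ∀ a < p,
      Reduced M (υ.arr aK ((y1 * r + y2) * (p * p) + (e * p + a)))
        (f y1 y2 e a + if e0 = e ∧ a0 = a then pt y1 ^ u1 * pt y2 ^ u2 else 0)) := by
  have hw := h.hw
  have hW := h.word_sq
  have hMM := h.MM_lt.1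
  have hr2 := h.r_pos
  have hMle := h.M_le
  have hM1 := h.M_gt
  have hsz := h.rrpp_le
  have hmul := h.mul
  have hmZ := h.mZ
  have hM0 : 0 < M := by omega
  have hpp1 : 1 ≤ p * p := Nat.mul_pos h.p_pos h.p_pos
  have hp2 : 2 * r ≤ r * r := Nat.mul_le_mul_right _ hr2
  let t : ℕ → ℕ → ℕ → ℕ → ZMod M := fun y1 y2 e a => if e0 = e ∧ a0 = a then pt y1 ^ u1 * pt y2 ^ u2 else 0
  let I : (ℕ → ℕ → Prop) → St → Prop := fun P υ => ∀ y1 < r, ∀ y2 < r, ∀ e < p, ∀ a < p,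
    (P y1 y2 → Reduced M (υ.arr aK ((y1 * r + y2) * (p * p) + (e * p + a))) (f y1 y2 e a + t y1 y2 e a)) ∧
    (¬ P y1 y2 → Reduced M (υ.arr aK ((y1 * r + y2) * (p * p) + (e * p + a))) (f y1 y2 e a))
  have hcongr : ∀ {P Q : ℕ → ℕ → Prop} {υ κ : St}, I P υ → κ.arr aK = υ.arr aK →
      (∀ y1 < r, ∀ y2 < r, Q y1 y2 ↔ P y1 y2) → I Q κ := by
    intro P Q υ κ hI hK hPQ y1 l1 y2 l2 e l3 a l4
    rw [hK, hPQ y1 l1 y2 l2]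
    exact hI y1 l1 y2 l2 e l3 a l4
  refine Ht.mono (Ht.loop_le hw (fun z υ => I (fun y1 _ => y1 < z) υ) (r * (50 + 4) + 3) hc.vr
    (by ring_nf at hp2 ⊢; omega) (by decide) (by decide) (by decide) ?_ ?_) le_rfl ?_
  · intro y1 l1 y2 l2 e l3 a l4
    exact ⟨fun h => absurd h (Nat.not_lt_zero _), fun _ => hf y1 l1 y2 l2 e l3 a l4⟩
  · intro x1 hx1 α fα hv1 hI
    have ca := hc.keep fα (by decide) (by decide)
    refine Ht.mono (Ht.loop_le hw (fun z υ => I (fun y1 y2 => y1 < x1 ∨ y1 = x1 ∧ y2 < z) υ) 50 ca.vr le_rfl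
      (by decide) (by decide) (by decide) (hcongr hI rfl fun _ _ _ _ => by omega) ?_) le_rfl
      fun υ _ hυ => hcongr hυ rfl fun _ _ _ _ => by omega
    intro x2 hx2 β fβ hv2 hI
    have cb := ca.keep fβ (by decide) (by decide)
    have k1 : β.var vx1 = x1 := (fβ.1 _ (by decide)).trans hv1
    have k2 : β.var vpp = p * p := (fβ.1 _ (by decide)).trans ((fα.1 _ (by decide)).trans hpp)
    have k3 : β.var ve = e0 := (fβ.1 _ (by decide)).trans ((fα.1 _ (by decide)).trans h1)
    have k4 : β.var va = a0 := (fβ.1 _ (by decide)).trans ((fα.1 _ (by decide)).trans h2)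
    have k5 : β.var vu1 = u1 := (fβ.1 _ (by decide)).trans ((fα.1 _ (by decide)).trans h3)
    have k6 : β.var vu2 = u2 := (fβ.1 _ (by decide)).trans ((fα.1 _ (by decide)).trans h4)
    have k7 : β.arr aVd = τ.arr aVd := (fβ.2 _ (by decide)).trans (fα.2 _ (by decide))
    have v1 := hV x1 hx1 u1 hu1
    have v2 := hV x2 hx2 u2 hu2
    have v3 := (hI x1 hx1 x2 hx2 e0 he a0 ha).2 (by omega)
    have hea := pair_lt he ha
    have b1 := cell_lt hx1 hx2 hea
    have b2 : x1 * r + x2 ≤ (x1 * r + x2) * (p * p) := Nat.le_mul_of_pos_right _ hpp1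
    have b3 : τ.arr aVd (x1 * r + u1) * τ.arr aVd (x2 * r + u2) ≤ (M - 1) * (M - 1) :=
      Nat.mul_le_mul (by have := v1.1; omega) (by have := v2.1; omega)
    have b4 : (M - 1) * (M - 1) + (M - 1) < M * M := by
      -- A reduced entry plus a product of two reduced entries stays below M², so a single reduction
      -- afterwards is enough.
      have e1 : (M - 1) * (M - 1) + (M - 1) = (M - 1) * M := by
        rw [← Nat.mul_succ]; congr 1; omega
      rw [e1]
      exact Nat.mul_lt_mul_of_pos_right (by omega) hM0
    have b5 : (x1 + 1) * r ≤ r * r := Nat.mul_le_mul_right _ hx1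
    have b6 : (x2 + 1) * r ≤ r * r := Nat.mul_le_mul_right _ hx2
    have b7 : r * r ≤ r * r * (p * p) := Nat.le_mul_of_pos_right _ hpp1
    rw [Nat.succ_mul] at b5 b6
    have hcell : I (fun y1 y2 => y1 < x1 ∨ y1 = x1 ∧ y2 < x2 + 1)
        ((β.set vt ((x1 * r + x2) * (p * p) + (e0 * p + a0))).put aK ((x1 * r + x2) * (p * p) + (e0 * p + a0))
          ((β.arr aK ((x1 * r + x2) * (p * p) + (e0 * p + a0)) + τ.arr aVd (x1 * r + u1) * τ.arr aVd (x2 * r + u2)) % M)) := by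
      intro y1 l1 y2 l2 e l3 a l4
      obtain ⟨m1, m2⟩ := hI y1 l1 y2 l2 e l3 a l4
      simp only [St.put_arr, St.set_arr, true_and]
      by_cases c : (y1 * r + y2) * (p * p) + (e * p + a) = (x1 * r + x2) * (p * p) + (e0 * p + a0)
      · obtain ⟨c1, c2⟩ := mul_add_inj (pair_lt l3 l4) hea c
        obtain ⟨rfl, rfl⟩ := mul_add_inj l2 hx2 c1
        obtain ⟨rfl, rfl⟩ := mul_add_inj l4 ha c2
        rw [if_pos rfl]
        refine ⟨fun _ => ⟨Nat.mod_lt _ hM0, ?_⟩, fun hn => absurd (.inr ⟨rfl, Nat.lt_succ_self _⟩) hn⟩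
        rw [ZMod.natCast_mod, Nat.cast_add, Nat.cast_mul, v1.2, v2.2, v3.2]
        simp [t]
      · rw [if_neg c]
        refine ⟨fun hP => ?_, fun hn => m2 fun hP => hn (hP.imp id fun ⟨a1, a2⟩ => ⟨a1, by omega⟩)⟩
        by_cases hP' : y1 < x1 ∨ y1 = x1 ∧ y2 < x2
        · exact m1 hP'
        · have e1 : y1 = x1 := by omega
          have e2 : y2 = x2 := by omega
          subst e1 e2
          have : t y1 y2 e a = 0 := if_neg fun ⟨a1, a2⟩ => c (by rw [a1, a2])
          rw [this, add_zero]
          exact m2 hP'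
    refine Ht.of_wp hw (by decide) ?_
    simp only [Cm.wp]
    simp [cb.vr, cb.vp, cb.vM, k1, k2, k3, k4, k5, k6, k7, hv2]
    have v3' := v3.1
    clear v1 v2 v3 hI hf hV
    generalize τ.arr aVd (x1 * r + u1) * τ.arr aVd (x2 * r + u2) = X at *
    generalize hY : (x1 * r + x2) * (p * p) = Y at *
    generalize hYK : β.arr aK (Y + (e0 * p + a0)) = K at *
    clear * - hcongr hcell b1 b2 b3 b4 b5 b6 b7 hMM v3' hW hsz hmul hmZ hMle hu1 hu2 hx1 hx2 hr2
    generalize (M - 1) * (M - 1) = M2 at *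
    refine ⟨by omega, by omega, by omega, ?_⟩
    exact hcongr hcell rfl fun _ _ _ _ => by omega
  · intro υ _ hυ y1 l1 y2 l2 e l3 a l4
    exact (hυ y1 l1 y2 l2 e l3 a l4).1 l1

/-- Since k ≤ L + B, counting rows from row L/p leaves B/p, plus one for α < p and one for rounding.
So the same D, and the same base d, serves for the ends and for the rows of the blocks. -/
theorem endRow_lt (h : FastNum w B m L g p q n Z Λ d r ρ M) {α k : ℕ} (hα : α < p)
    (hk : 9 * k < 10 * L) : (α + k) / p - L / p < B / p + 3 := by
  have hB := h.hB
  have e1 : α + k ≤ L + B + p := by omega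
  have e2 : (α + k) / p ≤ (L + B + p) / p := Nat.div_le_div_right e1
  rw [Nat.add_div_right _ h.p_pos] at e2
  have e3 := Nat.add_div h.p_pos (a := L) (b := B)
  generalize B / p = x at *
  generalize L / p = y at *
  split_ifs at e3 <;> omega

theorem fillStrCm_spec (h : FastNum w B m L g p q n Z Λ d r ρ M) (hc : FastCtx σ B L g p q n Z Λ d r ρ M τ)
    (hok : GroupOk m L σ g) {pt : ℕ → ZMod M}
    (hV : ∀ y < r, ∀ u < r, Reduced M (τ.arr aVd (y * r + u)) (pt y ^ u)) :
    Ht w pm fillStrCm τ (4000 * (B * q) + 20000 * (n * B) + 100) (fun υ => ∀ y1 < r, ∀ y2 < r, ∀ e < p, ∀ a < p,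
      Reduced M (υ.arr aK ((y1 * r + y2) * (p * p) + (e * p + a))) (strEntry pt σ p L g d n y1 y2 e a)) := by
  have hw := h.hw
  have hW := h.word_sq
  have hsz := h.rrpp_le
  have hmul := h.mul
  have hmZ := h.mZ
  have hp := h.p_pos
  have hZZ : Z ≤ Z * Z := Nat.le_mul_of_pos_left Z (by have := h.Z_ge; omega)
  have hpp1 : 1 ≤ p * p := Nat.mul_pos h.p_pos h.p_pos
  have hr2 := h.r_pos
  have hrr : r * r ≤ r * r * (p * p) := Nat.le_mul_of_pos_right _ hpp1
  have hrr' : p * p ≤ r * r * (p * p) := Nat.le_mul_of_pos_left _ (Nat.mul_pos (by omega) (by omega))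
  refine Ht.seq_le 10 (3990 * (B * q) + 20000 * (n * B) + 80)
    (R := fun υ => υ = (τ.set vpp (p * p)).set vlim (r * r * (p * p)))
    (Ht.of_wp hw (by decide) (by simp [Cm.wp, hc.vr, hc.vp]; clear * - hW hsz hmul hmZ hrr hrr' hZZ; omega))
    (by omega) ?_
  rintro α fα hα
  have ca := hc.keep fα (by decide) (by decide)
  have hrB : r * r ≤ 256 * B := by
    have h1 := h.rr_le
    have h2 : B / p ≤ B := Nat.div_le_self _ _
    have h3 := h.B_pos
    generalize B / p = x at *
    omega
  refine Ht.seq_le _ (n * ((70 * (r * r) + 60) + 4) + 3) (zeroCm_spec hw aK (n := r * r * (p * p)) (by simp [hα])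
    (by clear * - hW hsz hmul hmZ hZZ; omega)) ?_ ?_
  · have h1 := h.B_pos
    have h2 : n * ((70 * (r * r) + 60) + 4) ≤ n * (20000 * B) := Nat.mul_le_mul_left _ (by omega)
    rw [show n * (20000 * B) = 20000 * (n * B) by ring] at h2
    clear * - hsz h2
    omega
  intro β fβ hβ
  have cb := ca.keep fβ (by decide) (by decide)
  have bpp : β.var vpp = p * p := (fβ.1 _ (by decide)).trans (by simp [hα])
  have bV : β.arr aVd = τ.arr aVd := (fβ.2 _ (by decide)).trans (fα.2 _ (by decide))
  refine Ht.loop_le hw (fun z υ => ∀ y1 < r, ∀ y2 < r, ∀ e < p, ∀ a < p,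
      Reduced M (υ.arr aK ((y1 * r + y2) * (p * p) + (e * p + a))) (strEntry pt σ p L g d z y1 y2 e a))
    (70 * (r * r) + 60) cb.vng le_rfl (by decide) (by decide) (by decide) ?_ ?_
  · intro y1 l1 y2 l2 e l3 a l4
    rw [St.set_arr, hβ _ (cell_lt l1 l2 (pair_lt l3 l4))]
    exact ⟨by have := h.M_gt; omega, by simp [strEntry]⟩
  intro z hz γ fγ hvz hI
  have cg := cb.keep fγ (by decide) (by decide)
  have hgZ : g * Z ≤ Z * Z := Nat.mul_le_mul_right _ h.gZ.le
  have hnZ := h.nZ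
  have k1 := hok.al z (by rw [hc.n_eq]; exact hz)
  have k2 := hok.len z (by rw [hc.n_eq]; exact hz)
  have k3 := hok.lt z (by rw [hc.n_eq]; exact hz)
  rw [hc.p_eq, hc.z] at k1
  rw [hc.z] at k2 k3
  have hpq := h.p_lt
  have hqZ := h.qZ
  have hLm := h.Lm
  have hlow : L / p ≤ (σ.arr aSal (g * Z + z) + σ.arr aSlen (g * Z + z)) / p := Nat.div_le_div_right (by omega)
  have hU := endRow_lt h k1 k3
  obtain ⟨d1, d2⟩ := digits_lt h hU
  have hdr := h.par.r_ge
  have hsub : ∀ x, x / p ≤ x := fun x => Nat.div_le_self x p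
  refine Ht.seq_le 50 (70 * (r * r)) (R := fun υ =>
    υ.var va = σ.arr aSal (g * Z + z) ∧ υ.var ve = endCol σ p g z ∧ υ.var vu1 = endRow σ p L g z % d ∧
    υ.var vu2 = endRow σ p L g z / d)
    (Ht.of_wp hw (by decide) (by
      simp [Cm.wp, cg.vg, cg.vZ, cg.vp, cg.vL, cg.vd, hvz, cg.arr aSal (by decide), cg.arr aSlen (by decide),
        endCol, endRow, hc.z]
      clear * - hW hgZ hnZ hz hZZ hlow k1 k2 k3 hpq hqZ hLm hmZ
      omega)) (by omega) ?_
  intro δ fδ ⟨q1, q2, q3, q4⟩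
  have cd := cg.keep fδ (by decide) (by decide)
  have dV : δ.arr aVd = τ.arr aVd := (fδ.2 _ (by decide)).trans ((fγ.2 _ (by decide)).trans bV)
  have dK : δ.arr aK = γ.arr aK := fδ.2 _ (by decide)
  have dpp : δ.var vpp = p * p := (fδ.1 _ (by decide)).trans ((fγ.1 _ (by decide)).trans bpp)
  refine Ht.mono (addStrCm_spec h cd (pt := pt) (by rw [dV]; exact hV) dpp q2 q1 q3 q4 (Nat.mod_lt _ hp) k1
    (by rw [endRow, hc.z]; omega) (by rw [endRow, hc.z]; omega) (by rw [dK]; exact hI)) le_rfl ?_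
  intro υ _ hυ y1 l1 y2 l2 e l3 a l4
  have := hυ y1 l1 y2 l2 e l3 a l4
  rw [St.set_arr, strEntry, Finset.sum_range_succ, hc.z]
  rw [strEntry, hc.z] at this
  exact this

end

/-! ## Large groups: the transforms -/

/-- Multiply the first index of `X` by the matrix `A`, and put the new index last. -/
def transCm (A X Y : Arr) : Cm :=
  (vrr ≔ vr ;; vO ≔ 1 ;; vC ≔ vr * vI ;; vio ≔ 0 ;; vix ≔ vC ;; vic ≔ 1 ;; voo ≔ 0 ;; voy ≔ 1 ;; voc ≔ vr) ;;
  batchCm A X Y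

/-- Multiply the matrices of the strings with the columns of the blocks, point by point. -/
def pointwiseCm : Cm :=
  (vrr ≔ vp ;; vO ≔ vr * vr ;; vC ≔ vq ;; vio ≔ 1 ;; vix ≔ vr * vr ;; vic ≔ vp * vO ;; voo ≔ vI ;; voy ≔ 1 ;;
    voc ≔ vp) ;; batchCm aK aX aY

section
variable {w : ℕ} {pm : Prog} {σ τ : St} {B m L g p q n Z Λ d r ρ M : ℕ}

theorem batchVal_reduced {A X : Arr} {s io ix ic o y c : ℕ} {ζ xv : ℕ → ZMod M} (hM : 0 < M)
    (hA : ∀ x < s, Reduced M (σ.arr A (o * (s * s) + (y * s + x))) (ζ x))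
    (hX : ∀ x < s, Reduced M (σ.arr X (o * io + x * ix + c * ic)) (xv x)) :
    Reduced M (batchVal σ A X s io ix ic M o y c) (∑ x ∈ Finset.range s, ζ x * xv x) := by
  refine ⟨Nat.mod_lt _ hM, ?_⟩
  rw [batchVal, ZMod.natCast_mod, Nat.cast_sum]
  refine Finset.sum_congr rfl fun x hx => ?_
  have hx' := Finset.mem_range.1 hx
  rw [Nat.cast_mul, (hA x hx').2, (hX x hx').2]

/-- Transforming the leading index and storing the new one last rotates the indices, so that two
calls treat both digits. The r · pq columns form about pq chunks of cost r² Φ each, hence O(B q Φ).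
-/
theorem transCm_spec (h : FastNum w B m L g p q n Z Λ d r ρ M) (hc : FastCtx σ B L g p q n Z Λ d r ρ M τ)
    {Φ smax : ℕ} (hpm : Multiplies w pm Φ smax (Z * Z)) (hs : 8 * m ≤ smax) {A X Y : Arr}
    (hA : A.Free) (hX : X.Free) (hY : Y.Free) (hAY : A ≠ Y) (hXY : X ≠ Y) {ζ xv : ℕ → ℕ → ZMod M}
    (h1 : ∀ y < r, ∀ u < r, Reduced M (τ.arr A (y * r + u)) (ζ y u))
    (h2 : ∀ x < r, ∀ c < r * (q * p), Reduced M (τ.arr X (x * (r * (q * p)) + c)) (xv x c)) :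
    Ht w pm (transCm A X Y) τ (1000 * (B * q * (Φ + 300))) (fun υ => ∀ y < r, ∀ c < r * (q * p),
      Reduced M (υ.arr Y (c * r + y)) (∑ x ∈ Finset.range r, ζ y x * xv x c)) := by
  have hw := h.hw
  have hW := h.word_sq
  have hsz := h.rrI_le
  have hmul := h.mul
  have hmZ := h.mZ
  have hp := h.p_pos
  have hq := h.p_lt
  have hB := h.B_pos
  have hr2 := h.r_pos
  have hMle := h.M_le
  have hI : 1 ≤ q * p := Nat.mul_pos (by omega) hp
  have hrr : r * r ≤ r * r * (q * p) := Nat.le_mul_of_pos_right _ hI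
  have hr1 : r ≤ r * r := Nat.le_mul_of_pos_left r (by omega)
  have hC : r * (q * p) ≤ r * (r * (q * p)) := Nat.le_mul_of_pos_left _ (by omega)
  rw [← mul_assoc r r] at hC
  have hBq : 1 ≤ B * q := Nat.mul_pos hB (by omega)
  refine Ht.seq_le 40 (1 * ((r * (q * p) / r + 1) * (r * r * (Φ + 230))) + 20) (R := fun υ =>
    υ.var vrr = r ∧ υ.var vO = 1 ∧ υ.var vC = r * (q * p) ∧ υ.var vio = 0 ∧ υ.var vix = r * (q * p) ∧ υ.var vic = 1 ∧
    υ.var voo = 0 ∧ υ.var voy = 1 ∧ υ.var voc = r ∧ υ.arr A = τ.arr A ∧ υ.arr X = τ.arr X ∧ υ.var vM = M)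
    (Ht.of_wp hw (by decide) (by
      simp [Cm.wp, hc.vr, hc.vI, hc.vM]
      clear * - hw hW hsz hmul hmZ hC; omega)) ?_ ?_
  · rw [Nat.mul_div_cancel_left _ (by omega)]
    have e1 : (q * p + 1) * (r * r * (Φ + 230)) ≤ (2 * (q * p)) * (r * r * (Φ + 230)) :=
      Nat.mul_le_mul_right _ (by omega)
    have e2 : (2 * (q * p)) * (r * r * (Φ + 230)) ≤ 2 * ((448 * (B * q)) * (Φ + 230)) := by
      calc (2 * (q * p)) * (r * r * (Φ + 230)) = 2 * ((r * r * (q * p)) * (Φ + 230)) := by ring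
        _ ≤ _ := Nat.mul_le_mul_left _ (Nat.mul_le_mul_right _ hsz)
    have e3 : 1 * (B * q * (Φ + 300)) = B * q * Φ + 300 * (B * q) := by ring
    have e4 : 2 * (448 * (B * q) * (Φ + 230)) = 896 * (B * q * Φ) + 206080 * (B * q) := by ring
    omega
  intro α fα ⟨a1, a2, a3, a4, a5, a6, a7, a8, a9, a10, a11, a12⟩
  refine Ht.mono (batchCm_spec hw hpm hA hX hY hAY hXY (W := r * r * (q * p)) a1 a2 a3 a4 a5 a6 a7 a8 a9 a12 (by omega)
    (h.r_le.trans hs) ?_ ?_ ?_ ?_ h.MM_lt.2.1 ?_ ?_) le_rfl ?_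
  · intro o ho x hx c hc
    have : (x + 1) * (r * (q * p)) ≤ r * (r * (q * p)) := Nat.mul_le_mul_right _ hx
    rw [Nat.succ_mul] at this
    rw [mul_assoc r r]; omega
  · intro o ho y hy c hc
    have : (c + 1) * r ≤ (r * (q * p)) * r := Nat.mul_le_mul_right _ hc
    rw [Nat.succ_mul] at this
    rw [mul_right_comm]; omega
  · intro o ho y hy c hc o' ho' y' hy' c' hc' e
    obtain ⟨e1, e2⟩ := mul_add_inj hy hy' (show c * r + y = c' * r + y' by omega)
    exact ⟨by omega, e2, e1⟩
  · clear * - hW hsz hmul hmZ hC hr1 hrr; omega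
  · intro i hi
    rw [one_mul] at hi
    have e1 : i / r < r := by rw [Nat.div_lt_iff_lt_mul (by omega)]; exact hi
    have e2 := (h1 (i / r) e1 (i % r) (Nat.mod_lt _ (by omega))).1
    rw [Nat.div_add_mod' i r] at e2
    rw [a10]; omega
  · intro o ho x hx c hc
    obtain rfl : o = 0 := by omega
    have := (h2 x hx c hc).1
    rw [a11, Nat.zero_mul, Nat.zero_add, Nat.mul_one]
    omega
  · intro υ _ hυ y hy c hc
    have := hυ 0 (by omega) y hy c hc
    rw [Nat.zero_mul, Nat.zero_add, Nat.mul_one, add_comm] at this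
    rw [this]
    refine batchVal_reduced (by have := h.M_gt; omega) (fun x hx => ?_) (fun x hx => ?_)
    · rw [a10, Nat.zero_mul, Nat.zero_add]; exact h1 y hy x hx
    · rw [a11, Nat.zero_mul, Nat.zero_add, Nat.mul_one]; exact h2 x hx c hc

/-- At each of the r² pairs of points a p × p matrix meets q columns. As p < q, there are at most
2q/p chunks, and the total is of order r² pq Φ = O(B q Φ). -/
theorem pointwiseCm_spec (h : FastNum w B m L g p q n Z Λ d r ρ M) (hc : FastCtx σ B L g p q n Z Λ d r ρ M τ)
    {Φ smax : ℕ} (hpm : Multiplies w pm Φ smax (Z * Z)) (hs : 8 * m ≤ smax) {ζ : ℕ → ℕ → ℕ → ZMod M}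
    {xv : ℕ → ℕ → ℕ → ZMod M}
    (h1 : ∀ o < r * r, ∀ e < p, ∀ a < p, Reduced M (τ.arr aK (o * (p * p) + (e * p + a))) (ζ o e a))
    (h2 : ∀ o < r * r, ∀ a < p, ∀ β < q, Reduced M (τ.arr aX ((β * p + a) * (r * r) + o)) (xv o a β)) :
    Ht w pm pointwiseCm τ (1000 * (B * q * (Φ + 300))) (fun υ => ∀ o < r * r, ∀ e < p, ∀ β < q,
      Reduced M (υ.arr aY (o * (q * p) + (β * p + e))) (∑ a ∈ Finset.range p, ζ o e a * xv o a β)) := by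
  have hw := h.hw
  have hW := h.word_sq
  have hsz := h.rrI_le
  have hsz' := h.rrpp_le
  have hmul := h.mul
  have hmZ := h.mZ
  have hp := h.p_pos
  have hq := h.p_lt
  have hB := h.B_pos
  have hr2 := h.r_pos
  have hMle := h.M_le
  have hI : 1 ≤ q * p := Nat.mul_pos (by omega) hp
  have hrr : r * r ≤ r * r * (q * p) := Nat.le_mul_of_pos_right _ hI
  have hrr1 : 1 ≤ r * r := Nat.mul_pos (by omega) (by omega)
  have hC : p * (r * r) ≤ r * r * (q * p) := by
    rw [mul_comm]; exact Nat.mul_le_mul_left _ (Nat.le_mul_of_pos_left _ (by omega))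
  have hpp : p * p ≤ r * r * (p * p) := Nat.le_mul_of_pos_left _ hrr1
  have hBq : 1 ≤ B * q := Nat.mul_pos hB (by omega)
  have hqB : q ≤ B * q := Nat.le_mul_of_pos_left _ hB
  refine Ht.seq_le 40 ((r * r) * ((q / p + 1) * (p * p * (Φ + 230))) + 20) (R := fun υ =>
    υ.var vrr = p ∧ υ.var vO = r * r ∧ υ.var vC = q ∧ υ.var vio = 1 ∧ υ.var vix = r * r ∧
    υ.var vic = p * (r * r) ∧
    υ.var voo = q * p ∧ υ.var voy = 1 ∧ υ.var voc = p ∧ υ.arr aK = τ.arr aK ∧ υ.arr aX = τ.arr aX ∧ υ.var vM = M)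
    (Ht.of_wp hw (by decide) (by
      simp [Cm.wp, hc.vr, hc.vI, hc.vM, hc.vp, hc.vq]
      clear * - hw hW hsz hmul hmZ hC hrr; omega)) ?_ ?_
  · have e0 : q / p * p ≤ q := Nat.div_mul_le_self q p
    have e1 : (q / p + 1) * p ≤ 2 * q := by rw [Nat.succ_mul]; omega
    have e2 : (r * r) * ((q / p + 1) * (p * p * (Φ + 230))) ≤ 2 * ((448 * (B * q)) * (Φ + 230)) := by
      calc (r * r) * ((q / p + 1) * (p * p * (Φ + 230))) = ((q / p + 1) * p) * ((r * r) * p * (Φ + 230)) := by ring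
        _ ≤ (2 * q) * ((r * r) * p * (Φ + 230)) := Nat.mul_le_mul_right _ e1
        _ = 2 * ((r * r * (q * p)) * (Φ + 230)) := by ring
        _ ≤ _ := Nat.mul_le_mul_left _ (Nat.mul_le_mul_right _ hsz)
    have e3 : 1 * (B * q * (Φ + 300)) = B * q * Φ + 300 * (B * q) := by ring
    have e4 : 2 * (448 * (B * q) * (Φ + 230)) = 896 * (B * q * Φ) + 206080 * (B * q) := by ring
    omega
  intro α fα ⟨a1, a2, a3, a4, a5, a6, a7, a8, a9, a10, a11, a12⟩
  have hin : ∀ o a β : ℕ, o * 1 + a * (r * r) + β * (p * (r * r)) = (β * p + a) * (r * r) + o := fun o a β => by ring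
  have hout : ∀ o e β : ℕ, o * (q * p) + e * 1 + β * p = o * (q * p) + (β * p + e) := fun o e β => by ring
  refine Ht.mono (batchCm_spec hw hpm (A := aK) (X := aX) (Y := aY) (by unfold Arr.Free; decide) (by unfold Arr.Free; decide)
    (by unfold Arr.Free; decide) (by decide) (by decide) (W := r * r * (q * p)) a1 a2 a3 a4 a5 a6 a7 a8 a9 a12 hp
    (by have := h.q_le; omega) ?_ ?_ ?_ ?_ h.MM_lt.2.2 ?_ ?_) le_rfl ?_
  · intro o ho a ha β hβ
    rw [hin]
    have := pair_lt (pair_lt hβ ha) ho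
    rw [mul_comm (q * p)] at this
    omega
  · intro o ho e he β hβ
    rw [hout]
    exact (pair_lt ho (pair_lt hβ he)).le
  · intro o ho y hy c hc o' ho' y' hy' c' hc' e
    rw [hout, hout] at e
    obtain ⟨e1, e2⟩ := mul_add_inj (pair_lt hc hy) (pair_lt hc' hy') e
    obtain ⟨e3, e4⟩ := mul_add_inj hy hy' e2
    exact ⟨e1, e4, e3⟩
  · have := h.B_le; clear * - hW hsz hsz' hmul hmZ hC hrr hpp hqB hq this; omega
  · intro i hi
    have hpp0 : 0 < p * p := Nat.mul_pos hp hp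
    have e1 : i / (p * p) < r * r := by rw [Nat.div_lt_iff_lt_mul hpp0]; exact hi
    have e3 : i % (p * p) < p * p := Nat.mod_lt _ hpp0
    have e4 : i % (p * p) / p < p := by rw [Nat.div_lt_iff_lt_mul hp]; exact e3
    have e2 := (h1 _ e1 _ e4 (i % (p * p) % p) (Nat.mod_lt _ hp)).1
    rw [Nat.div_add_mod' (i % (p * p)) p, Nat.div_add_mod' i (p * p)] at e2
    rw [a10]; omega
  · intro o ho a ha β hβ
    have := (h2 o ho a ha β hβ).1
    rw [a11, hin]
    omega
  · intro υ _ hυ o ho e he β hβ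
    have := hυ o ho e he β hβ
    rw [hout] at this
    rw [this]
    refine batchVal_reduced (by have := h.M_gt; omega) (fun a ha => ?_) (fun a ha => ?_)
    · rw [a10]; exact h1 o ho e he a ha
    · rw [a11, hin]; exact h2 o ho a ha β hβ

end

/-! ## Large groups: the hits -/

/-- The end of the hit that belongs to a cell of the product. -/
def cellEnd (σ : St) (p L g d r β e w1 w2 : ℕ) : ℕ :=
  σ.arr aBst (g * σ.var vZ + β) + (((r - w1) % r + d * ((r - w2) % r) + L / p) * p + e) -
    σ.arr aBdel (g * σ.var vZ + β)

/-- A cell of the product marks the hit that ends at `j`. -/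
def CellHit (y : ℕ → ℕ) (σ : St) (p L g d r β e w1 w2 j : ℕ) : Prop :=
  y (((β * p + e) * r + w1) * r + w2) ≠ 0 ∧ cellEnd σ p L g d r β e w1 w2 ≤ σ.arr aBhi (g * σ.var vZ + β) ∧
    j + 1 = cellEnd σ p L g d r β e w1 w2

/-- Mark the hit of one cell of the product. -/
def cellHitCm : Cm :=
  .ite (.ld aY (((vbeta * vp + ve) * vr + vx1) * vr + vx2))
    (va ≔ vs + ((((vr - vx1) % vr + vd * ((vr - vx2) % vr)) + vL / vp) * vp + ve) - vdel ;;
      .ite (.ltv vhi va) .skip (.sto aV (va - 1) 1)) .skip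

/-- Mark the hits of all cells of the product. -/
def cellHitsCm : Cm :=
  .loop vbeta vq
    ((vsl ≔ vg * vZ + vbeta ;; vs ≔ .ld aBst vsl ;; vdel ≔ .ld aBdel vsl ;; vhi ≔ .ld aBhi vsl) ;;
      .loop ve vp (.loop vx1 vr (.loop vx2 vr cellHitCm)))

section
variable {w : ℕ} {pm : Prog} {σ τ : St} {B m L g p q n Z Λ d r ρ M : ℕ}

/-- The subtraction of the phase in the position of the end must not be truncated. This is required
of non-zero cells only, since nothing is computed for the others. -/
theorem cellHitCm_spec (h : FastNum w B m L g p q n Z Λ d r ρ M) (hc : FastCtx σ B L g p q n Z Λ d r ρ M τ)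
    {β e w1 w2 : ℕ} (h1 : τ.var vs = σ.arr aBst (g * Z + β)) (h2 : τ.var vdel = σ.arr aBdel (g * Z + β))
    (h3 : τ.var vhi = σ.arr aBhi (g * Z + β)) (h4 : τ.var vbeta = β) (h5 : τ.var ve = e) (h6 : τ.var vx1 = w1)
    (h7 : τ.var vx2 = w2) (hβ : β < q) (he : e < p) (hw1 : w1 < r) (hw2 : w2 < r)
    (hs : σ.arr aBst (g * Z + β) ≤ m)
    (hle : τ.arr aY (((β * p + e) * r + w1) * r + w2) ≠ 0 → σ.arr aBdel (g * Z + β) + 1 ≤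
      ((r - w1) % r + d * ((r - w2) % r) + L / p) * p + e) :
    Ht w pm cellHitCm τ 60 (fun υ => Marked aV τ υ (CellHit (τ.arr aY) σ p L g d r β e w1 w2)) := by
  have hw := h.hw
  have hW := h.word_sq
  have hsz := h.rrI_le
  have hrrp := h.rrp_le
  have hmul := h.mul
  have hmZ := h.mZ
  have hBm := h.B_le
  have hLm := h.Lm
  have hp := h.p_pos
  have hr2 := h.r_pos
  have hqm := h.q_le
  have hpq := h.p_lt
  have hdr := h.par.r_ge
  have hrm := h.r_le
  have i0 := pair_lt (pair_lt (pair_lt hβ he) hw1) hw2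
  have i1 : β * p ≤ (β * p + e) * r := (Nat.le_add_right _ _).trans (Nat.le_mul_of_pos_right _ (by omega))
  have i2 : (β * p + e) ≤ (β * p + e) * r := Nat.le_mul_of_pos_right _ (by omega)
  have i3 : (β * p + e) * r + w1 ≤ ((β * p + e) * r + w1) * r := Nat.le_mul_of_pos_right _ (by omega)
  have i4 : q * p * r * r = r * r * (q * p) := by ring
  rw [i4] at i0
  have i5 := Nat.le_add_right (((β * p + e) * r + w1) * r) w2
  have v1 : (r - w1) % r < r := Nat.mod_lt _ (by omega)
  have v2 : (r - w2) % r < r := Nat.mod_lt _ (by omega)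
  have v3 : d * ((r - w2) % r) ≤ r * r := Nat.mul_le_mul (by omega) v2.le
  have v4 : L / p * p ≤ L := Nat.div_mul_le_self L p
  have v5 : L / p ≤ L := Nat.div_le_self L p
  have v6 : (r - w1) % r * p ≤ r * r * p := Nat.mul_le_mul_right _ (by nlinarith only [v1, hr2])
  have v7 : d * ((r - w2) % r) * p ≤ r * r * p := Nat.mul_le_mul_right _ v3
  have v8 : r * r ≤ r * r * p := Nat.le_mul_of_pos_right _ hp
  have hdec : ((r - w1) % r + d * ((r - w2) % r) + L / p) * p = (r - w1) % r * p + d * ((r - w2) % r) * p + L / p * p := by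
    ring
  refine Ht.of_wp hw (by decide) ?_
  simp only [Cm.wp, cellHitCm]
  simp [hc.vp, hc.vr, hc.vd, hc.vL, h1, h2, h3, h4, h5, h6, h7]
  unfold CellHit cellEnd
  rw [hc.z]
  generalize (r - w1) % r = a1 at *
  generalize (r - w2) % r = a2 at *
  generalize L / p = l0 at *
  generalize d * a2 = da at *
  generalize hX : (a1 + da + l0) * p = X at *
  generalize ((β * p + e) * r + w1) * r + w2 = c at *
  generalize σ.arr aBst (g * Z + β) = s at *
  generalize σ.arr aBdel (g * Z + β) = δ at *
  generalize σ.arr aBhi (g * Z + β) = hi at *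
  clear h1 h2 h3 h4 h5 h6 h7
  refine ⟨by omega, fun k1 => ?_, fun k1 => Marked.of_eq rfl fun j hj => hj.1 k1⟩
  have k2 := hle k1
  refine ⟨by omega, fun k3 => Marked.of_eq rfl fun j hj => by omega, fun k3 => ⟨by omega, by omega, by omega, ?_⟩⟩
  intro j
  constructor
  · rintro ⟨-, -, h⟩
    simp; omega
  · intro h
    simp
    rintro rfl
    exact absurd ⟨k1, by omega, by omega⟩ h

theorem cellHitsCm_spec (h : FastNum w B m L g p q n Z Λ d r ρ M) (hc : FastCtx σ B L g p q n Z Λ d r ρ M τ)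
    (hok : GroupOk m L σ g)
    (hle : ∀ β < q, ∀ e < p, ∀ w1 < r, ∀ w2 < r, τ.arr aY (((β * p + e) * r + w1) * r + w2) ≠ 0 →
      σ.arr aBdel (g * Z + β) + 1 ≤ ((r - w1) % r + d * ((r - w2) % r) + L / p) * p + e) :
    Ht w pm cellHitsCm τ (50000 * (B * q)) (fun υ => Marked aV τ υ fun j =>
      ∃ β < q, ∃ e < p, ∃ w1 < r, ∃ w2 < r, CellHit (τ.arr aY) σ p L g d r β e w1 w2 j) := by
  have hw := h.hw
  have hW := h.word_sq
  have hp := h.p_pos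
  have hr2 := h.r_pos
  have hrr : 2 * r ≤ r * r := Nat.mul_le_mul_right _ hr2
  have hZZ : Z ≤ Z * Z := Nat.le_mul_of_pos_left Z (by have := h.Z_ge; omega)
  have e1 : r * ((r * (60 + 4) + 3) + 4) + 3 ≤ 71 * (r * r) := by ring_nf at hrr ⊢; omega
  have e2 : p * (71 * (r * r) + 4) + 3 ≤ 73 * (r * r * p) := by
    have a1 : p * (71 * (r * r) + 4) ≤ p * (72 * (r * r)) := Nat.mul_le_mul_left _ (by omega)
    have a2 : p * (72 * (r * r)) = 72 * (r * r * p) := by ring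
    have a3 : r * r ≤ r * r * p := Nat.le_mul_of_pos_right _ hp
    omega
  have e3 : q * ((73 * (r * r * p) + 20) + 4) + 3 ≤ 50000 * (B * q) := by
    have a1 := h.rrI_le
    have a2 : q * ((73 * (r * r * p) + 20) + 4) = 73 * (r * r * (q * p)) + 24 * q := by ring
    have a3 : 1 * q ≤ B * q := Nat.mul_le_mul_right _ h.B_pos
    have := h.p_lt
    omega
  refine Ht.loop_marked hw (fun β j => ∃ e < p, ∃ w1 < r, ∃ w2 < r, CellHit (τ.arr aY) σ p L g d r β e w1 w2 j)
    (73 * (r * r * p) + 20) hc.vq e3 (by decide) (by decide) (by decide) ?_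
  intro β hβ α fα hvb
  have ca := hc.keep fα (by decide) (by decide)
  have aYe : α.arr aY = τ.arr aY := fα.2 _ (by decide)
  have hgZ : g * Z ≤ Z * Z := Nat.mul_le_mul_right _ h.gZ.le
  have hqZ := h.qZ
  have k1 := hok.st β (by rw [hc.q_eq]; exact hβ)
  rw [hc.z] at k1
  refine Ht.seq_le 20 (73 * (r * r * p)) (R := fun υ => υ.var vs = σ.arr aBst (g * Z + β) ∧
    υ.var vdel = σ.arr aBdel (g * Z + β) ∧ υ.var vhi = σ.arr aBhi (g * Z + β) ∧ υ.arr aV = α.arr aV)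
    (Ht.of_wp hw (by decide) (by
      simp [Cm.wp, ca.vg, ca.vZ, hvb, ca.arr aBst (by decide), ca.arr aBdel (by decide), ca.arr aBhi (by decide)]
      clear * - hW hgZ hqZ hβ hZZ; omega)) (by clear * -; omega) ?_
  intro b fb ⟨b1, b2, b3, b4⟩
  have cb := ca.keep fb (by decide) (by decide)
  have bY : b.arr aY = τ.arr aY := (fb.2 _ (by decide)).trans aYe
  have bb : b.var vbeta = β := (fb.1 _ (by decide)).trans hvb
  refine Ht.mono (Ht.loop_marked (A := aV) hw (fun e j => ∃ w1 < r, ∃ w2 < r, CellHit (τ.arr aY) σ p L g d r β e w1 w2 j)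
    (71 * (r * r)) cb.vp e2 (by decide) (by decide) (by decide) ?_) le_rfl
    fun υ _ h => Marked.trans (Marked.of_eq b4 (P := fun _ => False) (by simp)) h (by simp)
  intro e he c fc hve
  have cc := cb.keep fc (by decide) (by decide)
  refine Ht.loop_marked hw (fun w1 j => ∃ w2 < r, CellHit (τ.arr aY) σ p L g d r β e w1 w2 j)
    (r * (60 + 4) + 3) cc.vr e1 (by decide) (by decide) (by decide) ?_
  intro w1 hw1 a fa hv1
  have cd := cc.keep fa (by decide) (by decide)
  refine Ht.loop_marked hw (fun w2 j => CellHit (τ.arr aY) σ p L g d r β e w1 w2 j)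
    60 cd.vr le_rfl (by decide) (by decide) (by decide) ?_
  intro w2 hw2 f ff hv2
  have cf := cd.keep ff (by decide) (by decide)
  have fr : ∀ x : Var, x ∉ [ve, vx1, vx2, va] → f.var x = b.var x := fun x hx =>
    (ff.1 x (by simp at hx; simp [Cm.wv, cellHitCm]; tauto)).trans
      ((fa.1 x (by simp at hx; simp [Cm.wv, cellHitCm]; tauto)).trans (fc.1 x (by simp at hx; simp [Cm.wv, cellHitCm]; tauto)))
  have fY : f.arr aY = τ.arr aY := (ff.2 _ (by decide)).trans ((fa.2 _ (by decide)).trans ((fc.2 _ (by decide)).trans bY))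
  have := cellHitCm_spec (pm := pm) h cf (β := β) (e := e) (w1 := w1) (w2 := w2) ((fr _ (by decide)).trans b1)
    ((fr _ (by decide)).trans b2) ((fr _ (by decide)).trans b3) ((fr _ (by decide)).trans bb)
    ((ff.1 _ (by decide)).trans ((fa.1 _ (by decide)).trans hve)) ((ff.1 _ (by decide)).trans hv1) hv2 hβ he hw1 hw2
    (by omega) (by rw [fY]; exact hle β hβ e he w1 hw1 w2 hw2)
  rw [fY] at this
  exact this

/-- The position of the end, from the digits. -/
theorem end_eq {p L d r α k t1 t2 w1 w2 : ℕ} (hL : L / p ≤ (α + k) / p)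
    (h1 : ((α + k) / p - L / p) % d + t1 = (r - w1) % r)
    (h2 : ((α + k) / p - L / p) / d + t2 = (r - w2) % r) :
    ((r - w1) % r + d * ((r - w2) % r) + L / p) * p + (α + k) % p = p * (t1 + d * t2) + α + k := by
  rw [← h1, ← h2]
  have e1 := Nat.mod_add_div ((α + k) / p - L / p) d
  have e2 := Nat.div_add_mod (α + k) p
  -- Digits are added without carry. Weighing the sums by 1 and d gives the row of the end,
  -- whichever pairs of digits produced them.
  have e3 : ((α + k) / p - L / p) % d + t1 + d * (((α + k) / p - L / p) / d + t2) + L / p =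
      (α + k) / p + (t1 + d * t2) := by
    rw [Nat.mul_add]; omega
  rw [e3, Nat.add_mul, mul_comm ((α + k) / p), mul_comm (t1 + d * t2)]
  omega

/-- The cells of the product with hits are the hits of the group. -/
theorem cellHit_iff (h : FastNum w B m L g p q n Z Λ d r ρ M) (hc : FastCtx σ B L g p q n Z Λ d r ρ M τ)
    (hok : GroupOk m L σ g) {y : ℕ → ℕ}
    (hy : ∀ β < q, ∀ e < p, ∀ w1 < r, ∀ w2 < r, y (((β * p + e) * r + w1) * r + w2) ≠ 0 ↔
      ∃ η < n, endCol σ p g η = e ∧ ∃ t1 t2, (t1 < d ∧ t2 < d ∧ Row B σ g β (p * (t1 + d * t2) + σ.arr aSal (g * Z + η))) ∧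
        endRow σ p L g η % d + t1 = (r - w1) % r ∧ endRow σ p L g η / d + t2 = (r - w2) % r) :
    (∀ β < q, ∀ e < p, ∀ w1 < r, ∀ w2 < r, y (((β * p + e) * r + w1) * r + w2) ≠ 0 →
      σ.arr aBdel (g * Z + β) + 1 ≤ ((r - w1) % r + d * ((r - w2) % r) + L / p) * p + e) ∧
    ∀ j, (∃ β < q, ∃ e < p, ∃ w1 < r, ∃ w2 < r, CellHit y σ p L g d r β e w1 w2 j) ↔ Hit B σ g j := by
  have hp := h.p_pos
  have hlow : ∀ η < n, L / p ≤ (σ.arr aSal (g * Z + η) + σ.arr aSlen (g * Z + η)) / p := fun η hη =>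
    Nat.div_le_div_right (by
      have := hok.len η (by rw [hc.n_eq]; exact hη)
      rw [hc.z] at this; omega)
  constructor
  · intro β hβ e he w1 hw1 w2 hw2 hne
    obtain ⟨η, hη, rfl, t1, t2, ⟨-, -, h3⟩, h4, h5⟩ := (hy β hβ e he w1 hw1 w2 hw2).1 hne
    unfold endRow at h4 h5
    unfold endCol
    rw [hc.z] at h4 h5 ⊢
    rw [end_eq (hlow η hη) h4 h5]
    have h6 := h3.1
    have h7 := hok.len η (by rw [hc.n_eq]; exact hη)
    rw [hc.z] at h6 h7
    have := h.five
    omega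
  intro j
  unfold Hit
  rw [hc.q_eq, hc.n_eq]
  constructor
  · rintro ⟨β, hβ, e, he, w1, hw1, w2, hw2, h1, h2, h3⟩
    obtain ⟨η, hη, rfl, t1, t2, ⟨-, -, h6⟩, h4, h5⟩ := (hy β hβ e he w1 hw1 w2 hw2).1 h1
    have hal := hok.al η (by rw [hc.n_eq]; exact hη)
    unfold endRow at h4 h5
    unfold cellEnd endCol at h2 h3
    unfold Row at h6
    rw [hc.z] at h2 h3 h4 h5 h6 hal
    rw [hc.p_eq] at hal
    rw [end_eq (hlow η hη) h4 h5] at h2 h3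
    obtain ⟨k1, k2, k3, k4, k5⟩ := h6
    refine ⟨β, hβ, η, hη, σ.arr aBst (g * Z + β) + (p * (t1 + d * t2) + σ.arr aSal (g * Z + η) - σ.arr aBdel (g * Z + β)), ?_⟩
    unfold HitAt
    rw [hc.z, hc.p_eq]
    refine ⟨⟨by omega, by omega, k3, k4, k5, ?_, by omega⟩, by omega⟩
    rw [Nat.add_sub_cancel_left, Nat.add_sub_cancel' k1, Nat.mul_add_mod, Nat.mod_eq_of_lt hal]
  · rintro ⟨β, hβ, η, hη, a, hat, hj⟩
    have hdel := hok.del β (by rw [hc.q_eq]; exact hβ)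
    have hal := hok.al η (by rw [hc.n_eq]; exact hη)
    have hlt := hok.lt η (by rw [hc.n_eq]; exact hη)
    unfold HitAt at hat
    rw [hc.z, hc.p_eq] at hat hdel hal
    rw [hc.z] at hj hlt
    obtain ⟨k1, k2, k3, k4, k5, k6, k7⟩ := hat
    obtain ⟨d1, d2⟩ := digits_lt h (row_div_lt h hdel (y := σ.arr aBdel (g * Z + β) + (a - σ.arr aBst (g * Z + β))) (by omega))
    obtain ⟨d3, d4⟩ := digits_lt h (endRow_lt h hal hlt)
    have hdr := h.par.r_ge
    have hY := Nat.div_add_mod (σ.arr aBdel (g * Z + β) + (a - σ.arr aBst (g * Z + β))) p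
    rw [k6] at hY
    generalize hT : (σ.arr aBdel (g * Z + β) + (a - σ.arr aBst (g * Z + β))) / p = T at *
    have hTd : T % d + d * (T / d) = T := Nat.mod_add_div T d
    -- Negation modulo r is an involution, so the cell of a given pair of digit sums is found by
    -- negating both.
    have hrv : ∀ v < r, (r - v) % r < r ∧ (r - (r - v) % r) % r = v := by
      intro v hv
      refine ⟨Nat.mod_lt _ (by omega), ?_⟩
      rcases Nat.eq_zero_or_pos v with rfl | hv0
      · simp
      · rw [Nat.mod_eq_of_lt (by omega : r - v < r), Nat.mod_eq_of_lt (by omega)]; omega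
    have hE : endRow σ p L g η = (σ.arr aSal (g * Z + η) + σ.arr aSlen (g * Z + η)) / p - L / p := by
      rw [endRow, hc.z]
    obtain ⟨r1, r2⟩ := hrv (endRow σ p L g η % d + T % d) (by rw [hE]; omega)
    obtain ⟨r3, r4⟩ := hrv (endRow σ p L g η / d + T / d) (by rw [hE]; omega)
    have hend := end_eq (r := r) (d := d) (t1 := T % d) (t2 := T / d)
      (w1 := (r - (endRow σ p L g η % d + T % d)) % r) (w2 := (r - (endRow σ p L g η / d + T / d)) % r) (hlow η hη)
      (by rw [← hE]; exact r2.symm) (by rw [← hE]; exact r4.symm)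
    have hrow : Row B σ g β (p * (T % d + d * (T / d)) + σ.arr aSal (g * Z + η)) := by
      unfold Row
      rw [hc.z, hTd, hY, Nat.add_sub_cancel_left, Nat.add_sub_cancel' k1]
      exact ⟨by omega, by omega, k3, k4, k5⟩
    have hce : cellEnd σ p L g d r β (endCol σ p g η) ((r - (endRow σ p L g η % d + T % d)) % r)
        ((r - (endRow σ p L g η / d + T / d)) % r) = a + σ.arr aSlen (g * Z + η) := by
      unfold cellEnd
      rw [hc.z, endCol, hc.z, hend, hTd]
      omega
    refine ⟨β, hβ, endCol σ p g η, Nat.mod_lt _ hp, _, r1, _, r3, ?_⟩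
    refine ⟨(hy β hβ _ (Nat.mod_lt _ hp) _ r1 _ r3).2 ⟨η, hη, rfl, T % d, T / d, ⟨d1, d2, hrow⟩, r2.symm, r4.symm⟩, ?_, ?_⟩
    · rw [hce, hc.z]; exact k7
    · rw [hce]; exact hj

end

/-! ## Large groups: the algorithm -/

/-- The products of the matrices of the strings with the rows of the blocks. -/
def convCm : Cm :=
  transCm aVd aX aY ;; transCm aVd aY aX ;; pointwiseCm ;; transCm aG aY aX ;; transCm aG aX aY

/-- Mark the hits of the group `vg` by fast convolution. -/
def fastCm : Cm := setupCm ;; pointsCm ;; fillRowsCm ;; fillStrCm ;; convCm ;; cellHitsCm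

section
variable {w : ℕ} {pm : Prog} {σ τ : St} {B m L g p q n Z Λ d r ρ M : ℕ}

/-- The five stages arrange the indices as (t1, t2, β, a), (t2, β, a, y1), (β, a, y1, y2), (y1, y2,
β, e), (y2, β, e, w1), (β, e, w1, w2). The reindexing by quotients and remainders only translates
between these layouts. -/
theorem convCm_spec (h : FastNum w B m L g p q n Z Λ d r ρ M) (hc : FastCtx σ B L g p q n Z Λ d r ρ M τ)
    {Φ smax : ℕ} (hpm : Multiplies w pm Φ smax (Z * Z)) (hs : 8 * m ≤ smax) {pt : ℕ → ZMod M}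
    {k : ℕ → ℕ → ℕ → ℕ → ZMod M} {x : ℕ → ℕ → ℕ → ℕ → ZMod M}
    (h1 : ∀ y < r, ∀ u < r, Reduced M (τ.arr aVd (y * r + u)) (pt y ^ u))
    (h2 : ∀ y < r, ∀ u < r, Reduced M (τ.arr aG (u * r + y)) (pt y ^ u))
    (h3 : ∀ y1 < r, ∀ y2 < r, ∀ e < p, ∀ a < p,
      Reduced M (τ.arr aK ((y1 * r + y2) * (p * p) + (e * p + a))) (k y1 y2 e a))
    (h4 : ∀ t1 < r, ∀ t2 < r, ∀ β < q, ∀ a < p,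
      Reduced M (τ.arr aX ((t1 * r + t2) * (q * p) + (β * p + a))) (x β t1 t2 a)) :
    Ht w pm convCm τ (5000 * (B * q * (Φ + 300))) (fun υ => ∀ β < q, ∀ e < p, ∀ w1 < r, ∀ w2 < r,
      Reduced M (υ.arr aY (((β * p + e) * r + w1) * r + w2))
        (∑ y2 ∈ Finset.range r, pt y2 ^ w2 * ∑ y1 ∈ Finset.range r, pt y1 ^ w1 *
          ∑ a ∈ Finset.range p, k y1 y2 e a *
            ∑ t2 ∈ Finset.range r, pt y2 ^ t2 * ∑ t1 ∈ Finset.range r, pt y1 ^ t1 * x β t1 t2 a)) := by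
  have hp := h.p_pos
  have hr0 : 0 < r := by have := h.r_pos; omega
  have hI : 0 < q * p := Nat.mul_pos (by have := h.p_lt; omega) hp
  refine Ht.seq_le _ (4000 * (B * q * (Φ + 300))) (transCm_spec h hc hpm hs (A := aVd) (X := aX) (Y := aY)
    (by unfold Arr.Free; decide) (by unfold Arr.Free; decide) (by unfold Arr.Free; decide) (by decide) (by decide)
    (ζ := fun y u => pt y ^ u) (xv := fun t1 c => x (c % (q * p) / p) t1 (c / (q * p)) (c % (q * p) % p)) h1 ?_)
    (by omega) ?_
  · intro t1 ht1 c hc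
    have e1 : c / (q * p) < r := by rw [Nat.div_lt_iff_lt_mul hI]; exact hc
    have e2 : c % (q * p) < q * p := Nat.mod_lt _ hI
    have e3 : c % (q * p) / p < q := by rw [Nat.div_lt_iff_lt_mul hp]; exact e2
    have := h4 t1 ht1 _ e1 _ e3 (c % (q * p) % p) (Nat.mod_lt _ hp)
    rwa [Nat.div_add_mod', Nat.add_mul, add_assoc, Nat.div_add_mod', mul_assoc] at this
  intro a fa ha
  have ca := hc.keep fa (by decide) (by decide)
  replace ha : ∀ y1 < r, ∀ t2 < r, ∀ β < q, ∀ a' < p, Reduced M (a.arr aY ((t2 * (q * p) + (β * p + a')) * r + y1))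
      (∑ t1 ∈ Finset.range r, pt y1 ^ t1 * x β t1 t2 a') := by
    intro y1 hy1 t2 ht2 β hβ a' ha'
    have hlt := pair_lt hβ ha'
    have := ha y1 hy1 (t2 * (q * p) + (β * p + a')) (pair_lt ht2 hlt)
    rwa [show (t2 * (q * p) + (β * p + a')) / (q * p) = t2 by
        rw [add_comm, Nat.add_mul_div_right _ _ hI, Nat.div_eq_of_lt hlt, Nat.zero_add],
      show (t2 * (q * p) + (β * p + a')) % (q * p) = β * p + a' by
        rw [add_comm, Nat.add_mul_mod_self_right, Nat.mod_eq_of_lt hlt],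
      show (β * p + a') / p = β by rw [add_comm, Nat.add_mul_div_right _ _ hp, Nat.div_eq_of_lt ha', Nat.zero_add],
      show (β * p + a') % p = a' by rw [add_comm, Nat.add_mul_mod_self_right, Nat.mod_eq_of_lt ha']] at this
  refine Ht.seq_le _ (3000 * (B * q * (Φ + 300))) (transCm_spec h ca hpm hs (A := aVd) (X := aY) (Y := aX)
    (by unfold Arr.Free; decide) (by unfold Arr.Free; decide) (by unfold Arr.Free; decide) (by decide) (by decide)
    (ζ := fun y u => pt y ^ u) (xv := fun t2 c => ∑ t1 ∈ Finset.range r, pt (c % r) ^ t1 * x (c / r / p) t1 t2 (c / r % p))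
      (by rw [fa.2 aVd (by decide)]; exact h1) ?_) (by omega) ?_
  · intro t2 ht2 c hc
    have e0 : c % r < r := Nat.mod_lt _ hr0
    have e1 : c / r < q * p := by rw [Nat.div_lt_iff_lt_mul hr0, mul_comm]; exact hc
    have e3 : c / r / p < q := by rw [Nat.div_lt_iff_lt_mul hp]; exact e1
    have := ha _ e0 t2 ht2 _ e3 (c / r % p) (Nat.mod_lt _ hp)
    rwa [Nat.div_add_mod', Nat.add_mul, add_assoc, Nat.div_add_mod', mul_assoc, mul_comm (q * p) r] at this
  intro b fb hb
  have cb := ca.keep fb (by decide) (by decide)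
  replace hb : ∀ y2 < r, ∀ y1 < r, ∀ β < q, ∀ a' < p, Reduced M (b.arr aX (((β * p + a') * r + y1) * r + y2))
      (∑ t2 ∈ Finset.range r, pt y2 ^ t2 * ∑ t1 ∈ Finset.range r, pt y1 ^ t1 * x β t1 t2 a') := by
    intro y2 hy2 y1 hy1 β hβ a' ha'
    have hlt := pair_lt hβ ha'
    have := hb y2 hy2 ((β * p + a') * r + y1) (by rw [mul_comm r]; exact pair_lt hlt hy1)
    rwa [show ((β * p + a') * r + y1) / r = β * p + a' by
        rw [add_comm, Nat.add_mul_div_right _ _ hr0, Nat.div_eq_of_lt hy1, Nat.zero_add],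
      show ((β * p + a') * r + y1) % r = y1 by
        rw [add_comm, Nat.add_mul_mod_self_right, Nat.mod_eq_of_lt hy1],
      show (β * p + a') / p = β by rw [add_comm, Nat.add_mul_div_right _ _ hp, Nat.div_eq_of_lt ha', Nat.zero_add],
      show (β * p + a') % p = a' by rw [add_comm, Nat.add_mul_mod_self_right, Nat.mod_eq_of_lt ha']] at this
  have bK : b.arr aK = τ.arr aK := (fb.2 aK (by decide)).trans (fa.2 aK (by decide))
  refine Ht.seq_le _ (2000 * (B * q * (Φ + 300))) (pointwiseCm_spec h cb hpm hs
    (ζ := fun o e a' => k (o / r) (o % r) e a')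
    (xv := fun o a' β => ∑ t2 ∈ Finset.range r, pt (o % r) ^ t2 * ∑ t1 ∈ Finset.range r, pt (o / r) ^ t1 * x β t1 t2 a')
    ?_ ?_) (by omega) ?_
  · intro o ho e he a' ha'
    have e1 : o / r < r := by rw [Nat.div_lt_iff_lt_mul hr0]; exact ho
    have := h3 _ e1 (o % r) (Nat.mod_lt _ hr0) e he a' ha'
    rwa [Nat.div_add_mod', ← bK] at this
  · intro o ho a' ha' β hβ
    have e1 : o / r < r := by rw [Nat.div_lt_iff_lt_mul hr0]; exact ho
    have := hb (o % r) (Nat.mod_lt _ hr0) _ e1 β hβ a' ha'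
    rwa [Nat.add_mul, add_assoc, Nat.div_add_mod', mul_assoc] at this
  intro c fc hcc
  have cc := cb.keep fc (by decide) (by decide)
  have cG : c.arr aG = τ.arr aG := (fc.2 aG (by decide)).trans ((fb.2 aG (by decide)).trans (fa.2 aG (by decide)))
  let f : ℕ → ℕ → ℕ → ℕ → ZMod M := fun y1 y2 β e => ∑ a ∈ Finset.range p, k y1 y2 e a *
            ∑ t2 ∈ Finset.range r, pt y2 ^ t2 * ∑ t1 ∈ Finset.range r, pt y1 ^ t1 * x β t1 t2 a
  replace hcc : ∀ y1 < r, ∀ y2 < r, ∀ e < p, ∀ β < q,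
      Reduced M (c.arr aY ((y1 * r + y2) * (q * p) + (β * p + e))) (f y1 y2 β e) := by
    intro y1 hy1 y2 hy2 e he β hβ
    have := hcc (y1 * r + y2) (pair_lt hy1 hy2) e he β hβ
    rwa [show (y1 * r + y2) / r = y1 by
        rw [add_comm, Nat.add_mul_div_right _ _ hr0, Nat.div_eq_of_lt hy2, Nat.zero_add],
      show (y1 * r + y2) % r = y2 by
        rw [add_comm, Nat.add_mul_mod_self_right, Nat.mod_eq_of_lt hy2]] at this
  refine Ht.seq_le _ (1000 * (B * q * (Φ + 300))) (transCm_spec h cc hpm hs (A := aG) (X := aY) (Y := aX)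
    (by unfold Arr.Free; decide) (by unfold Arr.Free; decide) (by unfold Arr.Free; decide) (by decide) (by decide)
    (ζ := fun u y => pt y ^ u) (xv := fun y1 c => f y1 (c / (q * p)) (c % (q * p) / p) (c % (q * p) % p))
    (by rw [cG]; exact fun u hu y hy => h2 y hy u hu) ?_)
    (by omega) ?_
  · intro t1 ht1 c hc
    have e1 : c / (q * p) < r := by rw [Nat.div_lt_iff_lt_mul hI]; exact hc
    have e2 : c % (q * p) < q * p := Nat.mod_lt _ hI
    have e3 : c % (q * p) / p < q := by rw [Nat.div_lt_iff_lt_mul hp]; exact e2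
    have := hcc t1 ht1 _ e1 (c % (q * p) % p) (Nat.mod_lt _ hp) _ e3
    rwa [Nat.div_add_mod', Nat.add_mul, add_assoc, Nat.div_add_mod', mul_assoc] at this
  intro a' fa' ha
  have ca' := cc.keep fa' (by decide) (by decide)
  replace ha : ∀ w1 < r, ∀ y2 < r, ∀ β < q, ∀ e < p, Reduced M (a'.arr aX ((y2 * (q * p) + (β * p + e)) * r + w1))
      (∑ y1 ∈ Finset.range r, pt y1 ^ w1 * f y1 y2 β e) := by
    intro y1 hy1 t2 ht2 β hβ a' ha'
    have hlt := pair_lt hβ ha'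
    have := ha y1 hy1 (t2 * (q * p) + (β * p + a')) (pair_lt ht2 hlt)
    rwa [show (t2 * (q * p) + (β * p + a')) / (q * p) = t2 by
        rw [add_comm, Nat.add_mul_div_right _ _ hI, Nat.div_eq_of_lt hlt, Nat.zero_add],
      show (t2 * (q * p) + (β * p + a')) % (q * p) = β * p + a' by
        rw [add_comm, Nat.add_mul_mod_self_right, Nat.mod_eq_of_lt hlt],
      show (β * p + a') / p = β by rw [add_comm, Nat.add_mul_div_right _ _ hp, Nat.div_eq_of_lt ha', Nat.zero_add],
      show (β * p + a') % p = a' by rw [add_comm, Nat.add_mul_mod_self_right, Nat.mod_eq_of_lt ha']] at this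
  refine Ht.mono (transCm_spec h ca' hpm hs (A := aG) (X := aX) (Y := aY)
    (by unfold Arr.Free; decide) (by unfold Arr.Free; decide) (by unfold Arr.Free; decide) (by decide) (by decide)
    (ζ := fun u y => pt y ^ u)
    (xv := fun y2 c => ∑ y1 ∈ Finset.range r, pt y1 ^ (c % r) * f y1 y2 (c / r / p) (c / r % p))
      (by rw [fa'.2 aG (by decide), cG]; exact fun u hu y hy => h2 y hy u hu) ?_) le_rfl ?_
  · intro t2 ht2 c hc
    have e0 : c % r < r := Nat.mod_lt _ hr0
    have e1 : c / r < q * p := by rw [Nat.div_lt_iff_lt_mul hr0, mul_comm]; exact hc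
    have e3 : c / r / p < q := by rw [Nat.div_lt_iff_lt_mul hp]; exact e1
    have := ha _ e0 t2 ht2 _ e3 (c / r % p) (Nat.mod_lt _ hp)
    rwa [Nat.div_add_mod', Nat.add_mul, add_assoc, Nat.div_add_mod', mul_assoc, mul_comm (q * p) r] at this
  intro υ _ hυ β hβ e he w1 hw1 w2 hw2
  have hlt := pair_lt hβ he
  have := hυ w2 hw2 ((β * p + e) * r + w1) (by rw [mul_comm r]; exact pair_lt hlt hw1)
  rwa [show ((β * p + e) * r + w1) / r = β * p + e by
      rw [add_comm, Nat.add_mul_div_right _ _ hr0, Nat.div_eq_of_lt hw1, Nat.zero_add],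
    show ((β * p + e) * r + w1) % r = w1 by
      rw [add_comm, Nat.add_mul_mod_self_right, Nat.mod_eq_of_lt hw1],
    show (β * p + e) / p = β by rw [add_comm, Nat.add_mul_div_right _ _ hp, Nat.div_eq_of_lt he, Nat.zero_add],
    show (β * p + e) % p = e by rw [add_comm, Nat.add_mul_mod_self_right, Nat.mod_eq_of_lt he]] at this

theorem fastCm_spec (hw : 1 ≤ w) (hok : GroupOk m L σ g) {Φ smax : ℕ} (hpm : Multiplies w pm Φ smax (Z * Z))
    (hs : 8 * m ≤ smax) (hB : σ.var vB = B) (hBL : B = L / 9 + 1) (hL : σ.var vL = L) (hLm : L ≤ m) (hg : σ.var vg = g)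
    (hgZ : g < Z) (hZ : σ.var vZ = Z)
    (hp : σ.var vp = σ.arr aGp g) (hpp : σ.arr aGp g = p)
    (hq : σ.var vq = σ.arr aQ g) (hqq : σ.arr aQ g = q) (hn : σ.var vng = σ.arr aNS g)
    (hnn : σ.arr aNS g = n) (hΛ : σ.var vLam = Λ) (hZΛ : Z < 2 ^ Λ) (hpq : p < q) (hmul : B * q ≤ m)
    (hmZ : 8 * m ≤ Z) (hqZ : q < Z) (hnZ : n < Z) (hword : Z ^ 6 ≤ 2 ^ w) :
    Ht w pm fastCm σ (2000000 * (B * q * (Φ + Λ + 1) + n * B)) (fun τ => Marked aV σ τ (Hit B σ g)) := by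
  have hpos := hok.pos
  have hsmall := hok.small
  have hfive := hok.five
  rw [hpp] at hpos hsmall
  have hB1 : 1 ≤ B := by omega
  have hBp : B / p + 3 ≤ B + 3 := Nat.add_le_add_right (Nat.div_le_self _ _) 3
  have hBm : B ≤ m := by omega
  have hZ40 : 40 ≤ Z := by omega
  have hZZ : 16 * (Z * Z) + 100 < 2 ^ w := by
    have h2 : 40 ^ 4 * (Z * Z) ≤ Z ^ 6 := by
      rw [show Z ^ 6 = Z ^ 4 * (Z * Z) by ring]
      exact Nat.mul_le_mul_right _ (Nat.pow_le_pow_left hZ40 _)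
    have h3 : 40 * 40 ≤ Z * Z := Nat.mul_le_mul hZ40 hZ40
    omega
  have hqp : q * p < 2 ^ w := by
    have : q * p ≤ Z * Z := Nat.mul_le_mul hqZ.le (by omega)
    omega
  have hBq : B * 2 ≤ B * q := Nat.mul_le_mul_left _ (by omega)
  have hBqΦ : B * q * (Φ + Λ + 1) = B * q * Φ + B * q * Λ + B * q := by ring
  have hBqΛ : 2 * (B * Λ) ≤ B * q * Λ := by
    calc 2 * (B * Λ) = B * 2 * Λ := by ring
      _ ≤ _ := Nat.mul_le_mul_right _ hBq
  have hΛB : 1 * Λ ≤ B * Λ := Nat.mul_le_mul_right _ hB1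
  refine Ht.seq_le _ (1900000 * (B * q * Φ + B * q * Λ + B * q) + 20000 * (n * B)) (setupCm_spec hw hB (hp.trans hpp) (hq.trans hqq) hZ hΛ
    (by omega) hZΛ (by omega) hqp hZZ) (by clear * - hBp hBqΦ hBqΛ hΛB hBq hB1; omega) ?_
  rintro α fα ⟨d, r, ρ, M, hpar, hhas⟩
  have h : FastNum w B m L g p q n Z Λ d r ρ M :=
    ⟨hw, hpar, hpos, hsmall, hpq, hmul, hmZ, hqZ, hnZ, hgZ, hfive, hLm, hBL, hword⟩
  have fr : ∀ x : Var, x ∉ setupCm.wv → α.var x = σ.var x := fα.1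
  have ca : FastCtx σ B L g p q n Z Λ d r ρ M α :=
    ⟨(fr _ (by decide)).trans hB, (fr _ (by decide)).trans hL, (fr _ (by decide)).trans hg,
      (fr _ (by decide)).trans (hp.trans hpp), (fr _ (by decide)).trans (hq.trans hqq),
      (fr _ (by decide)).trans (hn.trans hnn), (fr _ (by decide)).trans hZ, (fr _ (by decide)).trans hΛ,
      hhas.vd, hhas.vr, hhas.vrho, hhas.vM, hhas.vI, fun A _ => fα.2 A (by simp [Cm.wa, setupCm, sqrtCm, primeCm,
        primeStepCm, divisorCm]), hZ, hqq, hnn, hpp⟩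
  have hrr : r * r ≤ 256 * B := by have := h.rr_le; clear * - this hBp hB1; omega
  have hpts : 104 * (r * r * (Λ + 1)) ≤ 14000 * (B * q * Λ) + 14000 * (B * q) := by
    have e1 : r * r * (Λ + 1) ≤ 256 * B * (Λ + 1) := Nat.mul_le_mul_right _ hrr
    have e2 : 256 * B * (Λ + 1) = 256 * (B * Λ) + 256 * B := by ring
    clear * - e1 e2 hBqΛ hBq; omega
  have hM1 := h.M_gt
  refine Ht.seq_le _ (1800000 * (B * q * Φ + B * q * Λ + B * q) + 20000 * (n * B)) (pointsCm_spec hw hhas.vrho hhas.vM hhas.vr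
    ca.vLam hM1 (by have := h.MM_lt.1; omega) h.r_lt hpar.rho) (by clear * - hpts hBq hB1; omega) ?_
  intro β fβ hβ
  have cb := ca.keep fβ (by decide) (by decide)
  refine Ht.seq_le _ (1700000 * (B * q * Φ + B * q * Λ + B * q) + 20000 * (n * B)) (fillRowsCm_spec h cb hok)
    (by clear * -; omega) ?_
  intro γ fγ hγ
  have cg := cb.keep fγ (by decide) (by decide)
  have gV : γ.arr aVd = β.arr aVd := fγ.2 _ (by decide)
  have gG : γ.arr aG = β.arr aG := fγ.2 _ (by decide)
  refine Ht.seq_le _ (1600000 * (B * q * Φ + B * q * Λ + B * q)) (fillStrCm_spec h cg hok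
    (pt := fun y => ((y + 1 : ℕ) : ZMod M) ^ ρ ^ Λ) (by rw [gV]; exact fun y hy u hu => (hβ y hy u hu).1))
    (by clear * - hBq hB1; omega) ?_
  intro δ fδ hδ
  have cd := cg.keep fδ (by decide) (by decide)
  have dV : δ.arr aVd = β.arr aVd := (fδ.2 _ (by decide)).trans gV
  have dG : δ.arr aG = β.arr aG := (fδ.2 _ (by decide)).trans gG
  have dX : δ.arr aX = γ.arr aX := fδ.2 _ (by decide)
  refine Ht.seq_le _ (50000 * (B * q)) (convCm_spec h cd hpm hs
    (pt := fun y => ((y + 1 : ℕ) : ZMod M) ^ ρ ^ Λ) (x := fun β t1 t2 a =>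
      ((truth (t1 < d ∧ t2 < d ∧ Row B σ g β (p * (t1 + d * t2) + a)) : ℕ) : ZMod M))
    (by rw [dV]; exact fun y hy u hu => (hβ y hy u hu).1) (by rw [dG]; exact fun y hy u hu => (hβ y hy u hu).2)
    hδ ?_) ?_ ?_
  · intro t1 ht1 t2 ht2 b hb a ha
    rw [dX, hγ t1 ht1 t2 ht2 b hb a ha]
    exact ⟨by unfold truth; split_ifs <;> omega, rfl⟩
  · have : 5000 * (B * q * (Φ + 300)) = 5000 * (B * q * Φ) + 1500000 * (B * q) := by ring
    clear * - this; omega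
  intro ε fε hε
  have ce := cd.keep fε (by decide) (by decide)
  -- A cell is a residue of r² times a number of strings that is at most n < Z < M, so it is
  -- non-zero exactly if some string and some active row produce its digits.
  have key : ∀ β < q, ∀ e < p, ∀ w1 < r, ∀ w2 < r, ε.arr aY (((β * p + e) * r + w1) * r + w2) ≠ 0 ↔
      ∃ η < n, endCol σ p g η = e ∧ ∃ t1 t2, (t1 < d ∧ t2 < d ∧ Row B σ g β (p * (t1 + d * t2) + σ.arr aSal (g * Z + η))) ∧
        endRow σ p L g η % d + t1 = (r - w1) % r ∧ endRow σ p L g η / d + t2 = (r - w2) % r := by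
    intro b hb e he w1 hw1 w2 hw2
    obtain ⟨k1, k2⟩ := hε b hb e he w1 hw1 w2 hw2
    have hal : ∀ η < n, σ.arr aSal (g * σ.var vZ + η) < p := fun η hη => by
      rw [← hpp]; exact hok.al η (by rw [hnn]; exact hη)
    -- Orthogonality applies because e ≤ Λ makes the exponent ρ^Λ large enough for the modulus ρ^e.
    have hS : ∀ j, ∑ y ∈ Finset.range r, (((y + 1 : ℕ) : ZMod M) ^ ρ ^ Λ) ^ j = if r ∣ j then (r : ZMod M) else 0 := by
      obtain ⟨e', e1, e2, e3⟩ := hpar.pow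
      have hr : r = ρ - 1 := by have := hpar.rho; omega
      have : Fact ρ.Prime := ⟨hpar.prime⟩
      subst hr e3
      exact fun j => sum_pow_range (by omega) j
    have hconv := convolution_eq hS w1 w2 p n e (fun η => σ.arr aSal (g * σ.var vZ + η)) (endCol σ p g)
      (fun η => endRow σ p L g η % d) (fun η => endRow σ p L g η / d) hal
      (fun t1 t2 a => ((truth (t1 < d ∧ t2 < d ∧ Row B σ g b (p * (t1 + d * t2) + a)) : ℕ) : ZMod M))
    have hdig : ∀ η < n, endRow σ p L g η % d < d ∧ endRow σ p L g η / d < d := fun η hη =>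
      digits_lt h (endRow_lt h (hal η hη) (hok.lt η (by rw [hnn]; exact hη)))
    have := scaled_count_ne_zero (en := endCol σ p g) (u1 := fun η => endRow σ p L g η % d)
      (u2 := fun η => endRow σ p L g η / d) (x := fun t1 t2 a => truth (t1 < d ∧ t2 < d ∧ Row B σ g b (p * (t1 + d * t2) + a)))
      (al := fun η => σ.arr aSal (g * σ.var vZ + η)) (n := n) (e := e) h.coprime
      (hnZ.trans hpar.lt) k1 hw1 hw2 hpar.r_ge hdig
      (fun η _ t1 t2 => by show truth _ ≤ 1; unfold truth; split_ifs <;> omega)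
      (fun η _ t1 t2 h => by
        simp only [ne_eq, truth_eq_zero, not_not] at h
        exact ⟨h.1, h.2.1⟩)
      (k2.trans hconv)
    rw [this]
    simp only [ne_eq, truth_eq_zero, not_not, hZ]
  obtain ⟨q1, q2⟩ := cellHit_iff h ce hok key
  refine Ht.mono (cellHitsCm_spec h ce hok q1) le_rfl fun υ _ hυ => ?_
  have eV : ε.arr aV = σ.arr aV := (fε.2 _ (by decide)).trans ((fδ.2 _ (by decide)).trans ((fγ.2 _ (by decide)).trans
    ((fβ.2 _ (by decide)).trans (fα.2 _ (by decide)))))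
  exact Marked.trans (Marked.of_eq eV (P := fun _ => False) (by simp)) hυ fun j => by rw [q2]; simp

end

/-! ## All groups -/

/-- Mark the hits of the group `vg`. -/
def groupCm : Cm :=
  (vq ≔ .ld aQ vg ;; vng ≔ .ld aNS vg ;; vp ≔ .ld aGp vg) ;;
    .ite vq (.ite vng (.ite (.ltv vp vq) fastCm naiveCm) .skip) .skip

/-- Mark the hits of all groups. -/
def groupsCm : Cm := .loop vg vZ groupCm

/-- `vLam` becomes an integer with `vZ < 2 ^ vLam`. -/
def lamCm : Cm :=
  (vLam ≔ 0 ;; vx ≔ 1) ;; .loop vt vZ (.ite (.ltv vZ vx) .skip (vx ≔ vx * 2 ;; vLam ≔ vLam + 1))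

theorem hit_congr {B g : ℕ} {σ τ : St} (h : ∀ A ∈ fastArrs, τ.arr A = σ.arr A) (hZ : τ.var vZ = σ.var vZ) :
    Hit B τ g = Hit B σ g := by
  funext j
  unfold Hit HitAt
  rw [hZ, h aQ (by decide), h aNS (by decide), h aBst (by decide), h aBlo (by decide), h aU (by decide),
    h aBdel (by decide), h aGp (by decide), h aSal (by decide), h aSlen (by decide), h aBhi (by decide)]

theorem GroupOk.congr {m L g : ℕ} {σ τ : St} (hok : GroupOk m L σ g) (h : ∀ A ∈ fastArrs, τ.arr A = σ.arr A)
    (hZ : τ.var vZ = σ.var vZ) : GroupOk m L τ g := by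
  obtain ⟨h1, h2, h3, h4, h5, h6, h7, h8, h9, h10⟩ := hok
  constructor <;> (try rw [hZ]) <;> (try rw [h aQ (by decide)]) <;> (try rw [h aNS (by decide)]) <;>
    (try rw [h aGp (by decide)]) <;> (try rw [h aBst (by decide)]) <;> (try rw [h aBdel (by decide)]) <;>
    (try rw [h aBlo (by decide)]) <;> (try rw [h aBhi (by decide)]) <;> (try rw [h aSal (by decide)]) <;>
    (try rw [h aSlen (by decide)]) <;> assumption

section
variable {w : ℕ} {pm : Prog} {σ τ : St} {f : ℕ → ℕ} {m : ℕ} {F : ℕ → ℕ → ℕ} {K : ℕ → ℕ} {n N L Z Λ g : ℕ}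

theorem lamCm_spec (hw : 1 ≤ w) (hZ : σ.var vZ = Z) (h1 : 1 ≤ Z) (hZw : 4 * Z + 10 < 2 ^ w) :
    Ht w pm lamCm σ (30 * Z + 20) (fun τ => Z < 2 ^ τ.var vLam ∧ 2 ^ τ.var vLam ≤ 2 * Z) := by
  refine Ht.seq_le 6 (Z * (20 + 4) + 3) (R := fun τ => τ.var vLam = 0 ∧ τ.var vx = 1 ∧ τ.var vZ = Z)
    (Ht.of_wp hw (by decide) (by simp [Cm.wp, hZ]; omega)) (by omega) ?_
  intro a fa ⟨a1, a2, a3⟩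
  refine Ht.mono (Ht.loop_le hw (fun z τ => τ.var vx = 2 ^ τ.var vLam ∧ τ.var vx ≤ 2 * Z ∧
    (Z < τ.var vx ∨ τ.var vLam = z) ∧ τ.var vLam ≤ z) 20 a3 le_rfl (by decide) (by decide) (by decide)
    (by simp [a1, a2]; omega) ?_) le_rfl ?_
  · intro z hz τ hF hv ⟨k1, k2, k3, k4⟩
    have e1 : τ.var vZ = Z := (hF.1 _ (by decide)).trans a3
    refine Ht.of_wp hw (by decide) ?_
    simp only [Cm.wp]
    simp [e1]
    refine ⟨fun c => ⟨k1, k2, .inl c, by omega⟩, fun c => ⟨⟨by omega, by omega⟩, ⟨by omega, by omega⟩, ?_, by omega,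
      .inr (by omega), by omega⟩⟩
    rw [pow_succ, k1]
  · intro τ _ ⟨k1, k2, k3, k4⟩
    rw [← k1]
    refine ⟨?_, k2⟩
    rcases k3 with h | h
    · exact h
    · rw [k1, h]; exact Nat.lt_two_pow_self

theorem groupCm_spec (hw : 1 ≤ w) {Φ smax : ℕ} (hpm : Multiplies w pm Φ smax (Z * Z)) (hs : 8 * m ≤ smax)
    (hZ : 8 * (m + N + 2) = Z) (hword : Z ^ 6 ≤ 2 ^ w) (hi : Input w f m F K n N L σ) (hσZ : σ.var vZ = Z)
    (hσB : σ.var vB = L / 9 + 1) (ht : TrieOk σ) (hst : StrInv F K n σ) (hbl : BlkInv f m L (blkNum m L) σ)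
    (hok : ∀ i < n, ∃ p, StrOk L (F i) (K i) p) (hσΛ : σ.var vLam = Λ) (hΛ : Z < 2 ^ Λ) (hg : g < Z)
    (hv : ∀ x ∈ [vm, vL, vB, vZ, vLam], τ.var x = σ.var x) (ha : ∀ A ∈ fastArrs, τ.arr A = σ.arr A)
    (hτg : τ.var vg = g) :
    Ht w pm groupCm τ (2000000 * ((L / 9 + 1) * σ.arr aQ g * (Φ + Λ + 1) + σ.arr aNS g * (L / 9 + 1)) + 200)
      (fun υ => Marked aV τ υ (Hit (L / 9 + 1) σ g)) := by
  have hZ40 : 16 ≤ Z := by omega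
  have hZZ : Z * Z + Z + Z + Z + 100 < 2 ^ w := by
    have h2 : 16 ^ 4 * (Z * Z) ≤ Z ^ 6 := by
      rw [show Z ^ 6 = Z ^ 4 * (Z * Z) by ring]
      exact Nat.mul_le_mul_right _ (Nat.pow_le_pow_left hZ40 _)
    have h3 : 16 * Z ≤ Z * Z := Nat.mul_le_mul_right _ hZ40
    omega
  have hH := hit_congr (B := L / 9 + 1) (g := g) ha (hv vZ (by decide))
  generalize hB : L / 9 + 1 = B at *
  generalize hq : σ.arr aQ g = q
  generalize hn : σ.arr aNS g = ns
  have hqτ : τ.arr aQ g = q := by rw [ha aQ (by decide), hq]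
  have hnτ : τ.arr aNS g = ns := by rw [ha aNS (by decide), hn]
  refine Ht.seq_le 20 (2000000 * (B * q * (Φ + Λ + 1) + ns * B) + 150) (R := fun υ => υ.var vq = q ∧ υ.var vng = ns ∧
    υ.var vp = τ.arr aGp g ∧ υ.arr = τ.arr)
    (Ht.of_wp hw (by decide) (by simp [Cm.wp, hτg, hqτ, hnτ]; omega)) (by omega) ?_
  intro α fα ⟨a1, a2, a3, a4⟩
  have aa : ∀ A ∈ fastArrs, α.arr A = σ.arr A := fun A hA => by rw [a4]; exact ha A hA
  -- Without a block or without a string there is no hit. The cell for the period may then hold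
  -- garbage, so this case is settled before the period is used.
  have hnone : (q = 0 ∨ ns = 0) → Ht w pm .skip α 1 (fun υ => Marked aV τ υ (Hit B σ g)) := fun h => by
    refine Ht.skip (Marked.of_eq (by rw [a4]) fun j => ?_)
    rintro ⟨β, hβ, η, hη, -⟩
    omega
  refine Ht.ite_le hw 1 (2000000 * (B * q * (Φ + Λ + 1) + ns * B) + 120) (by decide) (by omega) trivial
    (fun c => ?_) (fun c => (hnone (.inl (by simpa [a1] using c))).mono (by omega) fun _ _ h => h)
  refine Ht.ite_le hw 1 (2000000 * (B * q * (Φ + Λ + 1) + ns * B) + 110) (by decide) (by omega) trivial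
    (fun c' => ?_) (fun c' => (hnone (.inr (by simpa [a2] using c'))).mono (by omega) fun _ _ h => h)
  simp only [Ex.eval_v, a1, a2, ne_eq] at c c'
  have hgok := groupOk ht hst hbl hok hi.le (g := g) (by omega) (by omega) (by omega)
  have av : ∀ x ∈ [vm, vL, vB, vZ, vLam, vg], α.var x = τ.var x := fun x hx => fα.1 x (by revert x; decide)
  have aZ : α.var vZ = Z := (av _ (by decide)).trans ((hv _ (by decide)).trans hσZ)
  have aok : GroupOk m L α g := hgok.congr aa (aZ.trans hσZ.symm)
  have hHα : Hit B α g = Hit B σ g := hit_congr aa (aZ.trans hσZ.symm)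
  have ag : α.var vg = g := (av _ (by decide)).trans hτg
  have aB : α.var vB = B := (av _ (by decide)).trans ((hv _ (by decide)).trans hσB)
  have aL : α.var vL = L := (av _ (by decide)).trans ((hv _ (by decide)).trans hi.vL)
  have aΛ : α.var vLam = Λ := (av _ (by decide)).trans ((hv _ (by decide)).trans hσΛ)
  have hqle : q ≤ blkNum m L := by
    rw [← hq]
    exact (Finset.single_le_sum (f := fun g => σ.arr aQ g) (fun _ _ => Nat.zero_le _)
      (Finset.mem_range.2 (by omega))).trans hbl.sum
  have hnle : ns ≤ n := by
    rw [← hn]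
    exact (Finset.single_le_sum (f := fun g => σ.arr aNS g) (fun _ _ => Nat.zero_le _)
      (Finset.mem_range.2 (by omega))).trans hst.sum
  have hmul : B * q ≤ m := by
    rw [mul_comm]
    refine (Nat.mul_le_mul_right _ hqle).trans ?_
    rw [← hB]; exact blkNum_mul hi.le hi.five
  have hB1 : 1 ≤ B := by omega
  have hqm : q ≤ m := (Nat.le_mul_of_pos_left _ hB1).trans hmul
  have hnN : n ≤ N := (Nat.le_mul_of_pos_right _ (by have := hi.five; omega)).trans hi.card_le
  have hfive := hi.five
  have hle := hi.le
  have hpe : α.var vp = α.arr aGp g := by rw [a3, a4]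
  have hqe : α.var vq = α.arr aQ g := by rw [a1, a4, hqτ]
  have hne : α.var vng = α.arr aNS g := by rw [a2, a4, hnτ]
  have fin : ∀ {c : Cm} {T : ℕ}, Ht w pm c α T (fun υ => Marked aV α υ (Hit B α g)) →
      Ht w pm c α T (fun υ => Marked aV τ υ (Hit B σ g)) := fun h => h.mono le_rfl fun υ _ hυ => by
    rw [hHα] at hυ
    exact Marked.trans (Marked.of_eq (by rw [a4]) (P := fun _ => False) (by simp)) hυ (by simp)
  refine Ht.ite_le hw 3 (2000000 * (B * q * (Φ + Λ + 1) + ns * B) + 100) (by decide) (by omega)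
    (by simp) (fun c2 => ?_) (fun c2 => ?_)
  · have hpq : α.arr aGp g < q := by simpa [a1, hpe] using c2
    exact fin ((fastCm_spec hw aok hpm hs aB hB.symm aL hle ag hg aZ hpe rfl hqe (by rw [a4, hqτ]) hne (by rw [a4, hnτ]) aΛ hΛ
      hpq hmul (by omega) (by omega) (by omega) hword).mono (by omega) fun _ _ h => h)
  · have hpq : q ≤ α.arr aGp g := by simpa [a1, hpe] using c2
    refine fin ((naiveCm_spec hw aok ag hg aZ aB hpe rfl hqe (by rw [a4, hqτ]) hne (by rw [a4, hnτ]) (by omega) (by omega)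
      (by omega) hle (by omega) hZZ).mono ?_ fun _ _ h => h)
    have hsm := aok.small
    have hpos := aok.pos
    generalize α.arr aGp g = p at *
    -- Here q ≤ p, and p (B/p + 3) ≤ B + 3p ≤ 7B.
    have e1 : q * (B / p + 3) ≤ 7 * B := by
      have k1 := Nat.div_mul_le_self B p
      have k2 : q * (B / p + 3) ≤ p * (B / p + 3) := Nat.mul_le_mul_right _ hpq
      have k3 : p * (B / p + 3) = B / p * p + 3 * p := by ring
      omega
    have e2 : q * (ns * ((B / p + 3) * 100 + 100) + 100) = 100 * (ns * (q * (B / p + 3))) + 100 * (ns * q) + 100 * q := by ring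
    have e3 : ns * (q * (B / p + 3)) ≤ ns * (7 * B) := Nat.mul_le_mul_left _ e1
    have e4 : ns * q ≤ ns * (2 * B) := Nat.mul_le_mul_left _ (by omega)
    have e5 : 1 * q ≤ B * q := Nat.mul_le_mul_right _ hB1
    have e6 : B * q * 1 ≤ B * q * (Φ + Λ + 1) := Nat.mul_le_mul_left _ (by omega)
    have e7 : ns * (7 * B) = 7 * (ns * B) := by ring
    have e8 : ns * (2 * B) = 2 * (ns * B) := by ring
    rw [e2]
    clear * - e3 e4 e5 e6 e7 e8
    omega

/-- The sum of q over the groups is at most the number of blocks, and B times that is at most m. The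
sum of the numbers of slots for strings is at most n, and nB ≤ nL ≤ N. -/
theorem groupsCm_spec (hw : 1 ≤ w) {Φ smax : ℕ} (hpm : Multiplies w pm Φ smax (Z * Z)) (hs : 8 * m ≤ smax)
    (hZ : 8 * (m + N + 2) = Z) (hword : Z ^ 6 ≤ 2 ^ w) (hi : Input w f m F K n N L σ) (hσZ : σ.var vZ = Z)
    (hσB : σ.var vB = L / 9 + 1) (ht : TrieOk σ) (hst : StrInv F K n σ) (hbl : BlkInv f m L (blkNum m L) σ)
    (hok : ∀ i < n, ∃ p, StrOk L (F i) (K i) p) (hσΛ : σ.var vLam = Λ) (hΛ : Z < 2 ^ Λ) :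
    Ht w pm groupsCm σ (2000000 * (m * (Φ + Λ + 1) + N) + 204 * Z + 3)
      (fun υ => Marked aV σ υ (fun j => ∃ g < Z, Hit (L / 9 + 1) σ g j)) := by
  have := Ht.loop (pm := pm) (σ := σ) hw (x := vg) (y := vZ) (c := groupCm)
    (fun z υ => Marked aV σ υ (fun j => ∃ g < z, Hit (L / 9 + 1) σ g j))
    (fun g => 2000000 * ((L / 9 + 1) * σ.arr aQ g * (Φ + Λ + 1) + σ.arr aNS g * (L / 9 + 1)) + 200)
    (by decide) (by decide) (by decide) (Marked.of_eq rfl (by simp)) (by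
      intro g hg τ hF hv hI
      rw [hσZ] at hg
      refine (groupCm_spec hw hpm hs hZ hword hi hσZ hσB ht hst hbl hok hσΛ hΛ hg
        (fun x hx => hF.1 x (by revert x; decide)) (fun A hA => hF.2 A (by revert A; decide)) hv).mono le_rfl ?_
      exact fun υ _ hυ => Marked.trans (τ := τ) hI hυ fun j => exists_lt_succ_iff)
  rw [hσZ] at this
  refine this.mono ?_ fun _ _ h => h
  have e1 : ∑ g ∈ Finset.range Z, (2000000 * ((L / 9 + 1) * σ.arr aQ g * (Φ + Λ + 1) + σ.arr aNS g * (L / 9 + 1)) + 200 + 4) =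
      2000000 * ((∑ g ∈ Finset.range Z, σ.arr aQ g) * (L / 9 + 1) * (Φ + Λ + 1) +
        (∑ g ∈ Finset.range Z, σ.arr aNS g) * (L / 9 + 1)) + Z * 204 := by
    simp only [add_assoc, Finset.sum_add_distrib, ← Finset.mul_sum, ← Finset.sum_mul, Finset.sum_const,
      Finset.card_range, smul_eq_mul]
    ring
  rw [e1]
  have hq := hbl.sum
  have hn := hst.sum
  rw [hσZ] at hq hn
  have k1 : (∑ g ∈ Finset.range Z, σ.arr aQ g) * (L / 9 + 1) * (Φ + Λ + 1) ≤ m * (Φ + Λ + 1) :=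
    Nat.mul_le_mul_right _ ((Nat.mul_le_mul_right _ hq).trans (blkNum_mul hi.le hi.five))
  have k2 : (∑ g ∈ Finset.range Z, σ.arr aNS g) * (L / 9 + 1) ≤ N :=
    (Nat.mul_le_mul hn (by have := hi.five; omega : L / 9 + 1 ≤ L)).trans hi.card_le
  omega

end

/-! ## The program -/

/-- The program, with the lengths in their places. -/
def apCm : Cm :=
  lengthsCm ;; (vlim ≔ vm) ;; zeroCm aV ;; .ite (.ltv vm vL) .skip (prepCm ;; lamCm ;; groupsCm)

theorem apCm_spec {w : ℕ} {pm : Prog} {σ : St} {f : ℕ → ℕ} {m : ℕ} {F : ℕ → ℕ → ℕ} {K : ℕ → ℕ} {n N Φ smax Z : ℕ}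
    (hw : 1 ≤ w) (hpm : Multiplies w pm Φ smax (Z * Z)) (hs : 8 * m ≤ smax) (hZ : 8 * (m + N + 2) = Z)
    (hword : Z ^ 6 ≤ 2 ^ w) (hm1 : 1 ≤ m) (hm : σ.var vm = m) (hn : σ.var vnS = n) (hnN : n ≤ N)
    (hN : ∑ h ∈ Finset.range n, K h = N) (hlen : ∀ h < n, σ.arr aLen h = K h)
    (htext : ∀ t < m, σ.arr aP t = f t) (htext' : ∀ t < m, f t < 2 ^ w)
    (hstr : ∀ h < n, ∀ t < K h, σ.arr aS (∑ i ∈ Finset.range h, K i + t) = F h t)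
    (hstr' : ∀ h < n, ∀ t < K h, F h t < 2 ^ w)
    (hok : ∀ L, (∀ i < n, L ≤ K i) → (∃ i < n, L = K i) → ∀ i < n, ∃ p, StrOk L (F i) (K i) p) :
    Ht w pm apCm σ (3000000 * (m * (Φ + Nat.log 2 Z + 3) + N)) (fun τ => ∀ j < m, τ.arr aV j =
      truth (∃ i < n, ∃ a, 1 ≤ a ∧ σ.arr aU (a - 1) ≠ 0 ∧ Occurs f m (F i) (K i) a ∧ j + 1 = a + K i)) := by
  have hZ16 : 16 ≤ Z := by omega
  have hZZ : Z * Z + Z + Z + Z + 100 < 2 ^ w := by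
    have h2 : 16 ^ 4 * (Z * Z) ≤ Z ^ 6 := by
      rw [show Z ^ 6 = Z ^ 4 * (Z * Z) by ring]
      exact Nat.mul_le_mul_right _ (Nat.pow_le_pow_left hZ16 _)
    have h3 : 16 * Z ≤ Z * Z := Nat.mul_le_mul_right _ hZ16
    omega
  have hbig : 16 * Z ≤ Z * Z := Nat.mul_le_mul_right _ hZ16
  have hsumK : ∀ h < n, ∑ i ∈ Finset.range h, K i = ∑ i ∈ Finset.range h, σ.arr aLen i := fun h hh =>
    Finset.sum_congr rfl fun i hi => (hlen i (by have := Finset.mem_range.1 hi; omega)).symm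
  have hNlen : ∑ h ∈ Finset.range n, σ.arr aLen h = N := by
    rw [← hN]; exact Finset.sum_congr rfl fun i hi => hlen i (Finset.mem_range.1 hi)
  have hmΦ : m * (Φ + Nat.log 2 Z + 3) = m * Φ + m * Nat.log 2 Z + 3 * m := by ring
  rw [hmΦ]
  refine Ht.seq_le _ (3000000 * (m * Φ + m * Nat.log 2 Z) + 8990000 * m + 2990000 * N) (lengthsCm_spec hw hm hn hNlen
    (by omega) (by omega) (by omega)) (by omega) ?_
  intro α fα ⟨a1, a2, a3, a4, a5⟩
  have am : α.var vm = m := (fα.1 _ (by decide)).trans hm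
  have an : α.var vnS = n := (fα.1 _ (by decide)).trans hn
  refine Ht.seq_le 4 (3000000 * (m * Φ + m * Nat.log 2 Z) + 8980000 * m + 2990000 * N) (R := fun υ => υ = α.set vlim m)
    (Ht.of_wp hw (by decide) (by simp [Cm.wp, am])) (by omega) ?_
  rintro α' - rfl
  refine Ht.seq_le _ (3000000 * (m * Φ + m * Nat.log 2 Z) + 8970000 * m + 2990000 * N) (zeroCm_spec hw aV (n := m) (by simp)
    (by omega)) (by omega) ?_
  intro β fβ hβ
  have bm : β.var vm = m := (fβ.1 _ (by decide)).trans am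
  have bn : β.var vnS = n := (fβ.1 _ (by decide)).trans an
  have bN : β.var vN = N := (fβ.1 _ (by decide)).trans a1
  have bL : β.var vL = α.var vL := fβ.1 _ (by decide)
  have bA : ∀ A ∈ [aP, aU, aS, aLen], β.arr A = σ.arr A := fun A hA =>
    (fβ.2 A (by revert A; decide)).trans (fα.2 A (by revert A; decide))
  have boff : β.arr aOff = α.arr aOff := fβ.2 _ (by decide)
  generalize hL : α.var vL = L at *
  refine Ht.ite_le hw 3 (3000000 * (m * Φ + m * Nat.log 2 Z) + 8960000 * m + 2990000 * N) (by decide) (by omega) (by simp)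
    (fun c => ?_) (fun c => ?_)
  -- No string fits into the text. An instance without strings also ends here, since the initial
  -- value m + 1 of L is then never lowered.
  · have hmL : m < L := by simpa [bm, bL] using c
    refine (Ht.skip ?_).mono (by omega) fun _ _ h => h
    intro j hj
    rw [hβ j hj, eq_comm, truth_eq_zero]
    rintro ⟨i, hi, a, -, -, h, -⟩
    have := a3 i hi
    rw [hlen i hi] at this
    have := h.1
    omega
  · have hLm : L ≤ m := by simpa [bm, bL] using c
    have hmin : ∀ i < n, L ≤ K i := fun i hi => by rw [← hlen i hi]; exact a3 i hi
    obtain ⟨i0, hi0, hL0⟩ := a5 hLm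
    have hok' := hok L hmin ⟨i0, hi0, by rw [← hlen i0 hi0]; exact hL0⟩
    obtain ⟨p0, hp0⟩ := hok' i0 hi0
    have hin : Input w f m F K n N L β := by
      refine ⟨bm, bn, bN, bL, hN, hp0.five, hLm, hmin, fun h hh => ?_, fun h hh => ?_, fun t ht => ?_, htext',
        fun h hh t ht => ?_, hstr'⟩
      · rw [bA aLen (by decide)]; exact hlen h hh
      · rw [boff, a2 h hh, hsumK h hh]
      · rw [bA aP (by decide)]; exact htext t ht
      · rw [boff, a2 h hh, bA aS (by decide), ← hsumK h hh]; exact hstr h hh t ht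
    refine Ht.seq_le _ (3000000 * (m * Φ + m * Nat.log 2 Z) + 8800000 * m + 2900000 * N) (prepCm_spec hw hin hZ hZZ) (by omega) ?_
    intro γ fγ ⟨g1, g2, g3, g4, g5, g6⟩
    refine Ht.seq_le _ (3000000 * (m * Φ + m * Nat.log 2 Z) + 8700000 * m + 2800000 * N) (lamCm_spec hw g2 (by omega) (by omega))
      (by omega) ?_
    intro δ fδ ⟨d1, d2⟩
    have hΛ : δ.var vLam ≤ Nat.log 2 Z + 1 := by
      have h1 : Nat.log 2 (2 * Z) = Nat.log 2 Z + 1 := by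
        rw [mul_comm]; exact Nat.log_mul_base (by omega) (by omega)
      rw [← h1]
      exact Nat.le_log_of_pow_le (by omega) d2
    have dA : ∀ A, δ.arr A = γ.arr A := fun A => fδ.2 A (by simp [Cm.wa, lamCm])
    have dv : ∀ x : Var, x ∉ lamCm.wv → δ.var x = γ.var x := fδ.1
    have dZ : δ.var vZ = Z := (dv _ (by decide)).trans g2
    have dst : δ.arr = γ.arr := funext dA
    have hin' : Input w f m F K n N L δ := g1.congr (dv _ (by decide)) (dv _ (by decide)) (dv _ (by decide))
      (dv _ (by decide)) (dA _) (dA _) (dA _) (dA _)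
    have he : TrieExt γ δ := ⟨dv _ (by decide), (dv _ (by decide)).ge, (dv _ (by decide)).ge,
      fun i _ => by rw [dst], fun i _ => by rw [dst]⟩
    have ht : TrieOk δ := by
      refine ⟨?_, ?_⟩
      · rw [dst, dv _ (by decide)]; exact g4.letters
      · rw [dst, dv _ (by decide)]; exact g4.nodes
    have hst : StrInv F K n δ := g5.ext he (dA _) (dA _) (dA _) (dA _)
    have hbl : BlkInv f m L (blkNum m L) δ := g6.ext he (dA _) (dA _) (dA _) (dA _) (dA _)
    have hcost : m * (Φ + δ.var vLam + 1) ≤ m * Φ + m * Nat.log 2 Z + 2 * m := by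
      calc m * (Φ + δ.var vLam + 1) ≤ m * (Φ + (Nat.log 2 Z + 1) + 1) := Nat.mul_le_mul_left _ (by omega)
        _ = _ := by ring
    refine (groupsCm_spec hw hpm hs hZ hword hin' dZ ((dv _ (by decide)).trans g3) ht hst hbl hok' rfl d1).mono
      (by omega) ?_
    intro υ _ hυ j hj
    have hU : δ.arr aU = σ.arr aU := by
      rw [dst, fγ.2 _ (by decide), bA _ (by decide)]
    have hV : δ.arr aV j = 0 := by
      rw [dst, fγ.2 _ (by decide), hβ j hj]
    have hiff := hit_iff ht hst hbl hok' j
    rw [hU, dZ] at hiff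
    unfold truth
    split_ifs with h
    · exact (hυ j).1 (hiff.2 h)
    · exact ((hυ j).2 fun h' => h (hiff.1 h')).trans hV

/-! ## Instances as lists -/

theorem sum_length_getD {α : Type*} (S : List (List α)) :
    ∑ i ∈ Finset.range S.length, (S.getD i []).length = S.flatten.length := by
  induction S with
  | nil => rfl
  | cons X S ih =>
    rw [List.length_cons, Finset.sum_range_succ', List.flatten_cons, List.length_append, ← ih, add_comm]
    simp

theorem getElem?_flatten_add {α : Type*} (S : List (List α)) (h t : ℕ) (ht : t < (S.getD h []).length) :
    S.flatten[∑ i ∈ Finset.range h, (S.getD i []).length + t]? = (S.getD h [])[t]? := by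
  induction S generalizing h with
  | nil => simp at ht
  | cons X S ih =>
    cases h with
    | zero =>
      simp only [List.getD_cons_zero] at ht
      simp [List.getElem?_append_left ht]
    | succ h =>
      simp only [List.getD_cons_succ] at ht
      rw [Finset.sum_range_succ', List.flatten_cons, List.getElem?_append_right (by simp; omega),
        List.getD_cons_succ, ← ih h ht]
      congr 1
      simp
      omega

theorem take_append_eq_iff {w : ℕ} {P X : List (BitVec w)} {a : ℕ} (h : a + X.length ≤ P.length) :
    P.take a ++ X = P.take (a + X.length) ↔ ∀ t < X.length, letters P (a + t) = letters X t := by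
  rw [List.take_add, List.append_cancel_left_eq]
  constructor
  · intro e t ht
    rw [letters_eq_iff (by omega) ht]
    conv_rhs => rw [e]
    rw [List.getElem?_take_of_lt ht, List.getElem?_drop]
  · intro e
    apply List.ext_getElem?
    intro t
    by_cases ht : t < X.length
    · rw [List.getElem?_take_of_lt ht, List.getElem?_drop, (letters_eq_iff (by omega) ht).1 (e t ht)]
    · rw [List.getElem?_eq_none (by omega), List.getElem?_eq_none (by simp; omega)]

theorem activePrefixes_eq_true_iff {w : ℕ} {P : List (BitVec w)} {U : Fin P.length → Bool}
    {S : List (List (BitVec w))} {u : ℕ → ℕ} (hu : ∀ t (ht : t < P.length), u t ≠ 0 ↔ U ⟨t, ht⟩ = true)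
    (j : Fin P.length) : activePrefixes P U S j = true ↔ ∃ i < S.length, ∃ a, 1 ≤ a ∧ u (a - 1) ≠ 0 ∧
      Occurs (letters P) P.length (letters (S.getD i [])) (S.getD i []).length a ∧
      (j : ℕ) + 1 = a + (S.getD i []).length := by
  have hj := j.2
  simp only [activePrefixes, decide_eq_true_eq]
  constructor
  · rintro ⟨X, hX, i, h1, h2, h3⟩
    obtain ⟨k, hk, rfl⟩ := List.getElem_of_mem hX
    rw [← List.getD_eq_getElem S [] hk] at h2 h3
    exact ⟨k, hk, i + 1, by omega, (hu i i.2).2 h1, ⟨by omega, (take_append_eq_iff (by omega)).1 h2⟩, h3⟩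
  · rintro ⟨k, hk, a, h1, h2, ⟨h3, h4⟩, h5⟩
    have e : a - 1 + 1 = a := by omega
    by_cases ha : a - 1 < P.length
    · refine ⟨S.getD k [], ?_, ⟨a - 1, ha⟩, (hu _ ha).1 h2, ?_, ?_⟩
      · rw [List.getD_eq_getElem S [] hk]; exact List.getElem_mem hk
      · simp only [e]; exact (take_append_eq_iff h3).2 h4
      · simp only [e]; exact h5
    · omega

/-! ## The running time -/

/-- r^ω = r² · r^(ω-2), and ω ≥ 2 makes the second factor monotone in r. One constant Φ therefore
serves all orders up to `smax`, which is the form in which times of products can be summed. -/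
theorem multiplies_of_time {pm : Prog} {C ω : ℝ} {c w smax Mx : ℕ} (hC : 0 ≤ C) (hω : 2 ≤ ω)
    (h : ∀ (r M w : ℕ) (A B : Matrix (Fin r) (Fin r) ℤ),
      1 ≤ r → (∀ i j, |A i j| ≤ (M : ℤ)) → (∀ i j, |B i j| ≤ (M : ℤ)) →
      (r + M + 2) ^ c ≤ 2 ^ w →
      ∀ s : RAMState w, s.var 0 = BitVec.ofNat w r → s.HoldsMatrix 0 A → s.HoldsMatrix 1 B →
        pm.RunsWithin s (C * (r : ℝ) ^ ω) (fun s' => s'.HoldsMatrix 2 (A * B)))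
    (hw : (smax + Mx + 2) ^ c ≤ 2 ^ w) : Multiplies w pm ⌈C * (smax : ℝ) ^ (ω - 2)⌉₊ smax Mx := by
  intro r A B hr hrs hA hB s h0 h1 h2
  obtain ⟨t, s', he, ht, hp⟩ := h r Mx w A B hr hA hB
    ((Nat.pow_le_pow_left (by omega) c).trans hw) s h0 h1 h2
  refine ⟨t, s', he, ?_, hp⟩
  have hr0 : (0 : ℝ) < r := by exact_mod_cast hr
  have e : (r : ℝ) ^ ω = (r : ℝ) ^ 2 * (r : ℝ) ^ (ω - 2) := by
    rw [← Real.rpow_natCast, ← Real.rpow_add hr0]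
    congr 1
    push_cast
    ring
  have h3 : (r : ℝ) ^ (ω - 2) ≤ (smax : ℝ) ^ (ω - 2) :=
    Real.rpow_le_rpow hr0.le (by exact_mod_cast hrs) (by linarith)
  have : (t : ℝ) ≤ ((r ^ 2 * ⌈C * (smax : ℝ) ^ (ω - 2)⌉₊ : ℕ) : ℝ) := by
    push_cast
    calc (t : ℝ) ≤ C * (r : ℝ) ^ ω := ht
      _ = (r : ℝ) ^ 2 * (C * (r : ℝ) ^ (ω - 2)) := by rw [e]; ring
      _ ≤ (r : ℝ) ^ 2 * (C * (smax : ℝ) ^ (ω - 2)) := by gcongr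
      _ ≤ _ := by gcongr; exact Nat.le_ceil _
  exact_mod_cast this

/-- m · (8m)^(ω-2) is a constant times m^(ω-1), and the latter also dominates m. The remaining
logarithm is absorbed by one factor of the polylogarithm, whose exponent is at least 1. -/
theorem time_le {C ω : ℝ} (hC : 0 ≤ C) (hω : 2 ≤ ω) {m N c : ℕ} (hm : 1 ≤ m) (hc : 1 ≤ c) :
    ((1 + 3000000 * (m * (⌈C * ((8 * m : ℕ) : ℝ) ^ (ω - 2)⌉₊ + Nat.log 2 (8 * (m + N + 2)) + 3) + N) : ℕ) : ℝ) ≤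
      (3000000 * (C * 8 ^ (ω - 2) + 9) + 1) * ((m : ℝ) ^ (ω - 1) + N) * (1 + Real.log (m + N)) ^ c := by
  have hm' : (1 : ℝ) ≤ m := by exact_mod_cast hm
  have hN : (0 : ℝ) ≤ N := Nat.cast_nonneg N
  set D := C * (8 : ℝ) ^ (ω - 2) with hD
  have hD0 : 0 ≤ D := by positivity
  set Y := (m : ℝ) ^ (ω - 1) with hY
  set l := Real.log (m + N) with hl
  have hl0 : 0 ≤ l := Real.log_nonneg (by linarith)
  have hY1 : (m : ℝ) ≤ Y := by
    calc (m : ℝ) = (m : ℝ) ^ (1 : ℝ) := (Real.rpow_one _).symm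
      _ ≤ Y := Real.rpow_le_rpow_of_exponent_le hm' (by linarith)
  have hΦ : (m : ℝ) * ⌈C * ((8 * m : ℕ) : ℝ) ^ (ω - 2)⌉₊ ≤ (D + 1) * Y := by
    have h1 := (Nat.ceil_lt_add_one (show 0 ≤ C * ((8 * m : ℕ) : ℝ) ^ (ω - 2) by positivity)).le
    have h2 : C * ((8 * m : ℕ) : ℝ) ^ (ω - 2) = D * (m : ℝ) ^ (ω - 2) := by
      push_cast
      rw [Real.mul_rpow (by norm_num) (by linarith), hD]
      ring
    have h3 : (m : ℝ) * (m : ℝ) ^ (ω - 2) = Y := by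
      rw [hY, show ω - 1 = 1 + (ω - 2) by ring, Real.rpow_add (by linarith), Real.rpow_one]
    calc (m : ℝ) * ⌈C * ((8 * m : ℕ) : ℝ) ^ (ω - 2)⌉₊ ≤ m * (D * (m : ℝ) ^ (ω - 2) + 1) := by
          rw [← h2]; gcongr
      _ = D * (m * (m : ℝ) ^ (ω - 2)) + m := by ring
      _ ≤ (D + 1) * Y := by rw [h3]; linarith
  -- 8(m + N + 2) ≤ 2^5 (m + N) because m ≥ 1; division by log 2 > 1/2 then costs a factor of at
  -- most 2.
  have hlog : (Nat.log 2 (8 * (m + N + 2)) : ℝ) ≤ 5 * (1 + l) := by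
    have h1 : (2 : ℝ) ^ Nat.log 2 (8 * (m + N + 2)) ≤ 2 ^ 5 * (m + N) := by
      have h2 : 2 ^ Nat.log 2 (8 * (m + N + 2)) ≤ 8 * (m + N + 2) := Nat.pow_log_le_self 2 (by omega)
      have h3 : ((2 ^ Nat.log 2 (8 * (m + N + 2)) : ℕ) : ℝ) ≤ ((2 ^ 5 * (m + N) : ℕ) : ℝ) := by
        exact_mod_cast h2.trans (by omega)
      norm_num at h3 ⊢
      exact h3
    have h2 := Real.log_le_log (by positivity) h1
    rw [Real.log_pow, Real.log_mul (by norm_num) (by positivity), Real.log_pow, ← hl] at h2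
    have h3 : (1 : ℝ) / 2 < Real.log 2 := by linarith [Real.log_two_gt_d9]
    push_cast at h2
    by_contra! h4
    nlinarith
  have hp : 1 + l ≤ (1 + l) ^ c := le_self_pow₀ (by linarith) (by omega)
  have key : (((1 + 3000000 * (m * (⌈C * ((8 * m : ℕ) : ℝ) ^ (ω - 2)⌉₊ + Nat.log 2 (8 * (m + N + 2)) + 3) + N) : ℕ)) : ℝ) ≤
      (3000000 * (D + 9) + 1) * (Y + N) * (1 + l) := by
    rw [Nat.cast_add, Nat.cast_mul, Nat.cast_add, Nat.cast_mul, Nat.cast_add, Nat.cast_add]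
    generalize (⌈C * ((8 * m : ℕ) : ℝ) ^ (ω - 2)⌉₊ : ℝ) = Φ at *
    have h1 : (m : ℝ) * (Nat.log 2 (8 * (m + N + 2)) : ℝ) ≤ Y * (5 * (1 + l)) := by gcongr
    have h2 : Y + N ≤ (Y + N) * (1 + l) := by nlinarith
    have h3 : (D + 4) * Y ≤ (D + 4) * ((Y + N) * (1 + l)) := by gcongr; linarith
    have h4 : Y * (5 * (1 + l)) ≤ 5 * ((Y + N) * (1 + l)) := by nlinarith
    push_cast
    nlinarith
  refine key.trans ?_
  gcongr

/-- With y = m + N + 2 ≥ 3, 8y ≤ y³. So Z^6 ≤ y^18, while the order plus the bound Z² on the entries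
is at most y^7, whose c-th power the multiplication program requires. -/
theorem word_bounds {m N c w : ℕ} (h : (m + N + 2) ^ (7 * c + 18) ≤ 2 ^ w) (hm : 1 ≤ m) :
    1 ≤ w ∧ m + N + 2 ≤ 2 ^ w ∧ (8 * (m + N + 2)) ^ 6 ≤ 2 ^ w ∧
      (8 * m + 8 * (m + N + 2) * (8 * (m + N + 2)) + 2) ^ c ≤ 2 ^ w := by
  have hy : 3 ≤ m + N + 2 := by omega
  have hmy : m + 2 ≤ m + N + 2 := by omega
  generalize m + N + 2 = y at *
  have h3 : 8 * y ≤ y ^ 3 := by nlinarith [Nat.mul_le_mul hy hy]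
  have hle : ∀ k, k ≤ 7 * c + 18 → y ^ k ≤ 2 ^ w := fun k hk =>
    (Nat.pow_le_pow_right (by omega) hk).trans h
  have h1 : y ≤ 2 ^ w := by simpa using hle 1 (by omega)
  refine ⟨?_, h1, ?_, ?_⟩
  · by_contra! hw
    obtain rfl : w = 0 := by omega
    simp at h1
    omega
  · calc (8 * y) ^ 6 ≤ (y ^ 3) ^ 6 := Nat.pow_le_pow_left h3 6
      _ = y ^ 18 := by rw [← pow_mul]
      _ ≤ 2 ^ w := hle 18 (by omega)
  · have h4 : 8 * y * (8 * y) ≤ y ^ 6 := by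
      calc 8 * y * (8 * y) ≤ y ^ 3 * y ^ 3 := Nat.mul_le_mul h3 h3
        _ = y ^ 6 := by ring
    have h5 : y ^ 3 ≤ y ^ 6 := Nat.pow_le_pow_right (by omega) (by omega)
    calc (8 * m + 8 * y * (8 * y) + 2) ^ c ≤ (y ^ 7) ^ c := by
          refine Nat.pow_le_pow_left ?_ c
          calc 8 * m + 8 * y * (8 * y) + 2 ≤ 3 * y ^ 6 := by omega
            _ ≤ y * y ^ 6 := Nat.mul_le_mul_right _ hy
            _ = y ^ 7 := by ring
      _ = y ^ (7 * c) := by rw [← pow_mul]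
      _ ≤ 2 ^ w := hle _ (by omega)

theorem mainTheorem7 (ω : ℝ) (hω : MatrixMultiplicationInTime ω) :
    ∃ (p : Prog) (C : ℝ) (c : ℕ),
      ∀ (w ℓ : ℕ) (P : List (BitVec w)) (U : Fin P.length → Bool) (S : List (List (BitVec w))),
        P ≠ [] → ℓ ≤ P.length → S.Nodup →
        (∀ X ∈ S, 9 * ℓ ≤ 8 * X.length ∧ 4 * X.length < 5 * ℓ ∧ IsType3 ℓ X) →
        (P.length + S.flatten.length + 2) ^ c ≤ 2 ^ w →
        ∀ s : RAMState w, s.HoldsInstance P U S →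
          p.RunsWithin s
            (C * ((P.length : ℝ) ^ (ω - 1) + S.flatten.length) *
              (1 + Real.log (P.length + S.flatten.length)) ^ c)
            (fun s' => s'.HoldsBits 4 (activePrefixes P U S)) := by
  obtain ⟨pm, C, c, h⟩ := hω
  have hsq := MatrixMultiplicationInTime.sq_le h
  have hω2 : 2 ≤ ω := two_le_of_sq_le hsq
  have hC : 0 ≤ C := by have := hsq 1 le_rfl; simp at this; linarith
  -- The number of strings arrives in machine variable 1, which is a temporary of the compiled code;
  -- its variable `vnS` is machine variable 3, so it is moved there.
  refine ⟨.seq (.op .bor 3 1 1) (apCm.compile pm), 3000000 * (C * 8 ^ (ω - 2) + 9) + 1, 7 * c + 18, ?_⟩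
  intro w ℓ P U S hP _ _ hS hword s ⟨i0, i1, iP, iU, iS, iL⟩
  have hm : 1 ≤ P.length := List.length_pos_iff.2 hP
  obtain ⟨hw, hsize, hword6, hwordm⟩ := word_bounds hword hm
  have h1w : 1 < 2 ^ w := Nat.one_lt_two_pow (by omega)
  have hmem : ∀ i < S.length, S.getD i [] ∈ S := fun i hi => by
    rw [List.getD_eq_getElem S [] hi]; exact List.getElem_mem hi
  have hN := sum_length_getD S
  have hle : ∀ i < S.length, (S.getD i []).length ≤ S.flatten.length := fun i hi => by
    rw [← hN]
    exact Finset.single_le_sum (f := fun i => (S.getD i []).length) (fun _ _ => Nat.zero_le _) (Finset.mem_range.2 hi)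
  -- Every string is non-empty: 4|X| < 5ℓ forces ℓ ≥ 1, and then 9ℓ ≤ 8|X| gives |X| ≥ 1.
  have hnN : S.length ≤ S.flatten.length := by
    rw [← hN]
    calc S.length = ∑ _i ∈ Finset.range S.length, 1 := by simp
      _ ≤ _ := Finset.sum_le_sum fun i hi => by
        have := hS _ (hmem i (Finset.mem_range.1 hi))
        omega
  set s₁ := s.setVar 3 (s.var 1)
  let σ : St := ⟨fun x => (s₁.var x.phys).toNat, fun a i => (s₁.arr a.ctorIdx (BitVec.ofNat w i)).toNat⟩
  have hU : ∀ t (ht : t < P.length), σ.arr aU t ≠ 0 ↔ U ⟨t, ht⟩ = true := fun t ht => by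
    have e : σ.arr aU t = (if U ⟨t, ht⟩ then 1#w else 0#w).toNat := congrArg BitVec.toNat (iU ⟨t, ht⟩)
    rw [e]
    split_ifs with hb <;> simp [hb]; omega
  have hap := apCm_spec (σ := σ) (f := letters P) (F := fun i => letters (S.getD i []))
    (K := fun i => (S.getD i []).length) hw (multiplies_of_time hC hω2 h hwordm) le_rfl rfl hword6 hm
    (by
      change (Function.update s.var 3 (s.var 1) 0).toNat = _
      rw [Function.update_of_ne (by decide), i0, BitVec.toNat_ofNat, Nat.mod_eq_of_lt (by omega)])
    (n := S.length)
    (by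
      change (Function.update s.var 3 (s.var 1) 3).toNat = _
      rw [Function.update_self, i1, BitVec.toNat_ofNat, Nat.mod_eq_of_lt (by omega)])
    hnN hN
    (fun i hi => by
      change (s.arr 3 (BitVec.ofNat w i)).toNat = _
      have hi' := hle i hi
      rw [iL i (by simpa using hi), List.getElem_map, ← List.getD_eq_getElem S [] hi, BitVec.toNat_ofNat,
        Nat.mod_eq_of_lt (by omega)])
    (fun t ht => by
      change (s.arr 0 (BitVec.ofNat w t)).toNat = _
      rw [iP t ht, letters, List.getD_eq_getElem _ _ ht])
    (fun t _ => BitVec.isLt _)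
    (fun i hi t ht => by
      change (s.arr 2 (BitVec.ofNat w _)).toNat = _
      have e := getElem?_flatten_add S i t ht
      rw [List.getElem?_eq_getElem ht] at e
      obtain ⟨hlt, e⟩ := List.getElem?_eq_some_iff.1 e
      rw [iS _ hlt, e, letters, List.getD_eq_getElem _ _ ht])
    (fun i _ t _ => BitVec.isLt _)
    -- The minimum L is the length of one of the strings, so 9ℓ ≤ 8L holds for it too.
    (fun L hmin ⟨k, hk, hL⟩ i hi =>
      (hS _ (hmem i hi)).2.2.strOk (hS _ (hmem i hi)).2.1 (hmin i hi) (by rw [hL]; exact (hS _ (hmem k hk)).1))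
  obtain ⟨t, s', τ, he, ht, hτ, -, hV⟩ := hap s₁ ⟨fun _ => rfl, fun _ _ _ => rfl⟩
  refine ⟨1 + t, s', Exec.seq ?_ he, ?_, fun j => ?_⟩
  · have := Exec.op s .bor 3 1 1
    simpa [WordOp.eval] using this
  · refine le_trans ?_ (time_le hC hω2 hm (by omega))
    exact_mod_cast Nat.add_le_add_left ht 1
  · have hj := j.2
    apply BitVec.eq_of_toNat_eq
    refine (hτ.arr aV j (by omega)).trans ?_
    rw [hV j hj]
    have hiff := activePrefixes_eq_true_iff (S := S) hU j
    unfold truth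
    by_cases hb : activePrefixes P U S j = true
    · rw [if_pos (hiff.1 hb), if_pos hb]
      simp [Nat.mod_eq_of_lt h1w]
    · rw [if_neg fun h => hb (hiff.2 h), if_neg hb]
      simp
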